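/- Let $\mathcal V$ be a complete and cocomplete cartesian closed category such that the category $\mathbf{Cat}(\mathcal V)$ of categories internal to $\mathcal V$ is cocomplete. Let $\mathcal O$ be an operad in $\mathbf{Cat}(\mathcal V)$ (symmetric, and reduced: $\mathcal O(0)=*$), with unit $1\in\mathcal O(1)$ and composition $\gamma$. Write $x\otimes y=\gamma(x;y,\dots,y)\in\mathcal O(jk)$ for $x\in\mathcal O(j)$, $y\in\mathcal O(k)$ (the intrinsic pairing), order $\{1,\dots,j\}\times\{1,\dots,k\}$ lexicographically, and let $\tau_{j,k}:\{1,\dots,jk\}\to\{1,\dots,kj\}$ be $(a,b)\mapsto(b,a)$. Formulas are read with generalized elements. *Pseudo-commutative operads.* A pseudo-commutative structure on $\mathcal O$ consists of invertible internal natural transformations $\alpha_{x,y}:(x\otimes y)\tau_{k,j}\to y\otimes x$ of functors $\mathcal O(j)\times\mathcal O(k)\to\mathcal O(kj)$, for all $j,k\ge0$, such that: (i) $\alpha_{1,y}$ is the identity; (ii) $\alpha_{y,x}\circ(\alpha_{x,y}\tau_{j,k})$ is the identity of $x\otimes y$; (iii) $\alpha_{x\rho_2,y\rho_1}=\alpha_{x,y}(\rho_1\otimes\rho_2)$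 for $\rho_1\in\Sigma_k$, $\rho_2\in\Sigma_j$, where $\rho_1\otimes\rho_2$ is the product permutation; (iv) for $x\in\mathcal O(j)$, $y_i\in\mathcal O(k_i)$ and $z\in\mathcal O(\ell)$, $\alpha_{\gamma(x;y_1,\dots,y_j),z}$ is the composite of $\gamma(\mathrm{id}_x;\alpha_{y_1,z},\dots,\alpha_{y_j,z})D$ followed by $\gamma(\alpha_{x,z};\mathrm{id},\dots,\mathrm{id})$, where the identities are those of $y_1,\dots,y_j$, this list being repeated $\ell$ times, and where $D$ is the distributivity permutation $(b,(i,a))\mapsto(i,(b,a))$ of $\ell\sum k_i=\sum\ell k_i$ elements. *The category of operators.* Let $\mathscr F$ be the category of the based sets $\mathbf n=\{0,1,\dots,n\}$ with basepoint $0$ and based functions. For $\phi:\mathbf m\to\mathbf n$ and $1\le j\le n$ put $\phi_j=|\phi^{-1}(j)|$, and let $\Pi\subset\mathscr F$ be the subcategory of the $\phi$ with all $\phi_j\le1$. The category of operators $\mathscr D=\mathscr D(\mathcal O)$ is the $\mathcal V$-2-category (category enriched in $\mathbf{Cat}(\mathcal V)$) with objects the $\mathbf n$, morphism categories $$\mathscr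 D(\mathbf m,\mathbf n)=\coprod_{\phi\in\mathscr F(\mathbf m,\mathbf n)}\ \prod_{1\le j\le n}\mathcal O(\phi_j)$$ and composition $$(\psi;d_1,\dots,d_p)\circ(\phi;c_1,\dots,c_n)=\Big(\psi\phi;\ \big(\gamma(d_k;(c_j)_{\psi(j)=k})\,\rho_k(\psi,\phi)\big)_{k}\Big),$$ where $\rho_k(\psi,\phi)$ converts the natural order of $(\psi\phi)^{-1}(k)$ to its order as the union of the blocks $\phi^{-1}(j)$, $j\in\psi^{-1}(k)$. It comes with $\mathcal V$-2-functors $\iota:\Pi\to\mathscr D$ (send $\phi$ to $(\phi;c)$ with each $c_j$ equal to $1$ or $*$) and $\xi:\mathscr D\to\mathscr F$ (send $(\phi;c)$ to $\phi$); both are the identity on objects, and $\xi\iota$ is the inclusion. The object $\mathbf 0$ is a zero object, and this makes $\mathscr D$ a $\mathcal V_*$-2-category, enriched in based internal categories. *Pseudo-commutative categories of operators.* A pseudo-commutative structure on $\mathscr D$ consists of the following. (a) A $\mathcal V_*$-pseudofunctor $\circledast:\mathscr D\wedge\mathscr D\rightsquigarrow\mathscr D$ with $\mathbf m\circledast\mathbf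 p=\mathbf{mp}$: functors $\mathscr D(\mathbf m,\mathbf n)\wedge\mathscr D(\mathbf p,\mathbf q)\to\mathscr D(\mathbf{mp},\mathbf{nq})$ that strictly preserve identities, and invertible based transformations $$\vartheta:(g_1\circledast g_2)\circ(f_1\circledast f_2)\Rightarrow(g_1f_1)\circledast(g_2f_2)$$ that are unital (the identity if $f_1,f_2$, or $g_1,g_2$, are both identities) and compatible with triple composition. The pseudofunctor is strictly associative and strictly unital with unit $\mathbf 1$; these are equalities of pseudofunctors, including the constraints $\vartheta$. (b) A symmetry: 1-cells $\tau_{\mathbf m,\mathbf p}:\mathbf{mp}\to\mathbf{pm}$ and invertible based transformations $$\hat\tau_{f,g}:(g\circledast f)\circ\tau_{\mathbf m,\mathbf p}\Rightarrow\tau_{\mathbf n,\mathbf q}\circ(f\circledast g)\qquad(f:\mathbf m\to\mathbf n,\ g:\mathbf p\to\mathbf q)$$ that form a $\mathcal V_*$-pseudotransformation (they are the identity at identities and are compatible with composition and $\vartheta$), whose pasting with its own interchange is the identity of $\circledast$ (symmetry axiom), and for which the constraint at $(f,g\circledast h)$ is the pasting of those at $(f,g)$ and $(f,h)$ (hexagon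 axiom, for 1-cells and for 2-cells). (c) These satisfy: (1) $\circledast$ restricts along $\iota$ to the smash product $\wedge$ on $\Pi$, and $\xi(f\circledast g)=\xi(f)\wedge\xi(g)$; (2) $\circledast$ is strict relative to $\Pi$, that is, $\vartheta$ is the identity whenever both morphisms $f_1,g_1$ of the first variable, or both morphisms $f_2,g_2$ of the second variable, or both of $f_1,f_2$, or both of $g_1,g_2$, come from $\Pi$; (3) $\tau_{\mathbf m,\mathbf p}$ is the image under $\iota$ of the permutation $\tau_{m,p}$, and $\hat\tau_{f,g}$ is the identity if both $f$ and $g$ come from $\Pi$. **Theorem.** Let $\alpha$ be a pseudo-commutative structure on $\mathcal O$. Then $\mathscr D(\mathcal O)$ is a pseudo-commutative category of operators. More precisely, it has a pseudo-commutative structure in which the product is given by the intrinsic pairing, $$(\phi;(c_j)_j)\circledast(\psi;(d_k)_k)=\big(\phi\wedge\psi;\ (c_j\otimes d_k)_{(j,k)}\big)$$ on objects and morphisms of the morphism categories, and in which the symmetry is given by $\alpha$: the component of $\hat\tau$ at $f=(\phi;(c_j)_j)$ and $g=(\psi;(d_k)_k)$ has, in the coordinate $(k,j)$, the entry $\alpha_{d_k,c_j}:(d_k\otimes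 c_j)\tau_{\phi_j,\psi_k}\to c_j\otimes d_k$. -/

import Mathlib

set_option linter.unusedSectionVars false
set_option linter.unreachableTactic false
set_option linter.unusedTactic false

open CategoryTheory Limits MonoidalCategory CartesianMonoidalCategory

universe w v u

/-- A category internal to `V`. -/
structure ICat (V : Type u) [Category.{v} V] [HasPullbacks V] where
  Ob : V
  Mor : V
  src : Mor ⟶ Ob
  tgt : Mor ⟶ Ob
  idm : Ob ⟶ Mor
  /-- composition; the first component of a composable pair is applied first -/
  cmp : pullback tgt src ⟶ Mor
  idm_src : idm ≫ src = 𝟙 Ob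
  idm_tgt : idm ≫ tgt = 𝟙 Ob
  cmp_src : cmp ≫ src = pullback.fst tgt src ≫ src
  cmp_tgt : cmp ≫ tgt = pullback.snd tgt src ≫ tgt
  id_cmp : pullback.lift (src ≫ idm) (𝟙 Mor) (by simp [idm_tgt]) ≫ cmp = 𝟙 Mor
  cmp_id : pullback.lift (𝟙 Mor) (tgt ≫ idm) (by simp [idm_src]) ≫ cmp = 𝟙 Mor
  assoc : ∀ {X : V} (f g h : X ⟶ Mor) (w : f ≫ tgt = g ≫ src) (w' : g ≫ tgt = h ≫ src),
    pullback.lift (pullback.lift f g w ≫ cmp) h (by rw [Category.assoc, cmp_tgt, pullback.lift_snd_assoc, w']) ≫ cmp =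
      pullback.lift f (pullback.lift g h w' ≫ cmp) (by rw [Category.assoc, cmp_src, pullback.lift_fst_assoc, w]) ≫ cmp

namespace ICat

section Basic

variable {V : Type u} [Category.{v} V] [HasPullbacks V]

attribute [simp] idm_src idm_tgt

/-- Composition of composable generalized morphisms (first `f`, then `g`). -/
noncomputable def comp (C : ICat V) {X : V} (f g : X ⟶ C.Mor) (w : f ≫ C.tgt = g ≫ C.src) :
    X ⟶ C.Mor :=
  pullback.lift f g w ≫ C.cmp

variable (C : ICat V)

@[simp]
theorem comp_src {X : V} (f g : X ⟶ C.Mor) (w : f ≫ C.tgt = g ≫ C.src) :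
    C.comp f g w ≫ C.src = f ≫ C.src := by
  rw [comp, Category.assoc, C.cmp_src, pullback.lift_fst_assoc]

@[simp]
theorem comp_tgt {X : V} (f g : X ⟶ C.Mor) (w : f ≫ C.tgt = g ≫ C.src) :
    C.comp f g w ≫ C.tgt = g ≫ C.tgt := by
  rw [comp, Category.assoc, C.cmp_tgt, pullback.lift_snd_assoc]

theorem precomp_comp {X Y : V} (k : Y ⟶ X) (f g : X ⟶ C.Mor) (w : f ≫ C.tgt = g ≫ C.src) :
    k ≫ C.comp f g w = C.comp (k ≫ f) (k ≫ g) (by simp [w]) := by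
  rw [comp, comp, ← Category.assoc]
  congr 1
  apply pullback.hom_ext
  · rw [Category.assoc, pullback.lift_fst, pullback.lift_fst]
  · rw [Category.assoc, pullback.lift_snd, pullback.lift_snd]

theorem comp_congr' {X : V} {f f' g g' : X ⟶ C.Mor} {w : f ≫ C.tgt = g ≫ C.src}
    {w' : f' ≫ C.tgt = g' ≫ C.src} (hf : f = f') (hg : g = g') :
    C.comp f g w = C.comp f' g' w' := by
  subst hf hg; rfl

@[simp]
theorem idm_comp {X : V} (a : X ⟶ C.Ob) (f : X ⟶ C.Mor) (w : (a ≫ C.idm) ≫ C.tgt = f ≫ C.src) :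
    C.comp (a ≫ C.idm) f w = f := by
  have h : a = f ≫ C.src := by simpa using w
  subst h
  refine Eq.trans ?_ ((f ≫= C.id_cmp).trans (Category.comp_id f))
  rw [comp, ← Category.assoc]; congr 1
  apply pullback.hom_ext
  · refine (pullback.lift_fst _ _ _).trans ?_
    simp only [Category.assoc, pullback.lift_fst]
  · refine (pullback.lift_snd _ _ _).trans ?_
    simp only [Category.assoc, pullback.lift_snd, Category.comp_id]

@[simp]
theorem comp_idm {X : V} (a : X ⟶ C.Ob) (f : X ⟶ C.Mor) (w : f ≫ C.tgt = (a ≫ C.idm) ≫ C.src) :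
    C.comp f (a ≫ C.idm) w = f := by
  have h : a = f ≫ C.tgt := by simpa using w.symm
  subst h
  refine Eq.trans ?_ ((f ≫= C.cmp_id).trans (Category.comp_id f))
  rw [comp, ← Category.assoc]; congr 1
  apply pullback.hom_ext
  · refine (pullback.lift_fst _ _ _).trans ?_
    simp only [Category.assoc, pullback.lift_fst, Category.comp_id]
  · refine (pullback.lift_snd _ _ _).trans ?_
    simp only [Category.assoc, pullback.lift_snd]

theorem comp_assoc {X : V} (f g h : X ⟶ C.Mor) (w : f ≫ C.tgt = g ≫ C.src)
    (w' : g ≫ C.tgt = h ≫ C.src) :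
    C.comp (C.comp f g w) h (by simp [w']) = C.comp f (C.comp g h w') (by simp [w]) :=
  C.assoc f g h w w'

/-- An internal category may be given by a composition of generalized morphisms, natural in the
stage of definition. -/
noncomputable abbrev ofPoints (Ob Mor : V) (src tgt : Mor ⟶ Ob) (idm : Ob ⟶ Mor)
    (cp : ∀ {X : V} (f g : X ⟶ Mor), f ≫ tgt = g ≫ src → (X ⟶ Mor))
    (nat : ∀ {X Y : V} (k : Y ⟶ X) (f g : X ⟶ Mor) (w : f ≫ tgt = g ≫ src),
      k ≫ cp f g w = cp (k ≫ f) (k ≫ g) (by simp [w]))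
    (idm_src : idm ≫ src = 𝟙 Ob) (idm_tgt : idm ≫ tgt = 𝟙 Ob)
    (cp_src : ∀ {X : V} (f g : X ⟶ Mor) (w : f ≫ tgt = g ≫ src), cp f g w ≫ src = f ≫ src)
    (cp_tgt : ∀ {X : V} (f g : X ⟶ Mor) (w : f ≫ tgt = g ≫ src), cp f g w ≫ tgt = g ≫ tgt)
    (id_cp : ∀ {X : V} (f : X ⟶ Mor), cp (f ≫ src ≫ idm) f (by simp [idm_tgt]) = f)
    (cp_id : ∀ {X : V} (f : X ⟶ Mor), cp f (f ≫ tgt ≫ idm) (by simp [idm_src]) = f)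
    (assoc : ∀ {X : V} (f g h : X ⟶ Mor) (w : f ≫ tgt = g ≫ src) (w' : g ≫ tgt = h ≫ src),
      cp (cp f g w) h (by simp [cp_tgt, w']) = cp f (cp g h w') (by simp [cp_src, w])) :
    ICat V where
  Ob := Ob
  Mor := Mor
  src := src
  tgt := tgt
  idm := idm
  cmp := cp (pullback.fst tgt src) (pullback.snd tgt src) pullback.condition
  idm_src := idm_src
  idm_tgt := idm_tgt
  cmp_src := cp_src _ _ _
  cmp_tgt := cp_tgt _ _ _
  id_cmp := by
    rw [nat]
    simp only [pullback.lift_fst, pullback.lift_snd]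
    simpa using id_cp (𝟙 Mor)
  cmp_id := by
    rw [nat]
    simp only [pullback.lift_fst, pullback.lift_snd]
    simpa using cp_id (𝟙 Mor)
  assoc f g h w w' := by
    simp only [nat, pullback.lift_fst, pullback.lift_snd]
    exact assoc f g h w w'

theorem ofPoints_comp {Ob Mor : V} {src tgt : Mor ⟶ Ob} {idm : Ob ⟶ Mor}
    {cp : ∀ {X : V} (f g : X ⟶ Mor), f ≫ tgt = g ≫ src → (X ⟶ Mor)}
    (nat h1 h2 h3 h4 h5 h6 h7) {X : V} (f g : X ⟶ Mor) (w : f ≫ tgt = g ≫ src) :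
    (ofPoints Ob Mor src tgt idm cp nat h1 h2 h3 h4 h5 h6 h7).comp f g w = cp f g w := by
  change pullback.lift f g w ≫ cp _ _ _ = _
  simp only [nat, pullback.lift_fst, pullback.lift_snd]

/-- A functor of internal categories. -/
@[ext]
structure IFun (C D : ICat V) where
  ob : C.Ob ⟶ D.Ob
  mor : C.Mor ⟶ D.Mor
  src : mor ≫ D.src = C.src ≫ ob
  tgt : mor ≫ D.tgt = C.tgt ≫ ob
  idm : C.idm ≫ mor = ob ≫ D.idm
  cmp : C.cmp ≫ mor = D.comp (pullback.fst C.tgt C.src ≫ mor) (pullback.snd C.tgt C.src ≫ mor)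
    (by simp only [Category.assoc, src, tgt]; rw [← Category.assoc, pullback.condition,
      Category.assoc])


theorem IFun.comp_mor {C D : ICat V} (F : IFun C D) {X : V} (f g : X ⟶ C.Mor)
    (w : f ≫ C.tgt = g ≫ C.src) :
    C.comp f g w ≫ F.mor = D.comp (f ≫ F.mor) (g ≫ F.mor)
      (by simp only [Category.assoc, F.src, F.tgt]; rw [← Category.assoc, w, Category.assoc]) := by
  rw [comp, Category.assoc, F.cmp, precomp_comp]
  simp only [pullback.lift_fst_assoc, pullback.lift_snd_assoc]

/-- A functor given by its effect on composites of generalized morphisms. -/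
def IFun.mk' {C D : ICat V} (ob : C.Ob ⟶ D.Ob) (mor : C.Mor ⟶ D.Mor)
    (src : mor ≫ D.src = C.src ≫ ob) (tgt : mor ≫ D.tgt = C.tgt ≫ ob)
    (idm : C.idm ≫ mor = ob ≫ D.idm)
    (cmp : ∀ {X : V} (f g : X ⟶ C.Mor) (w : f ≫ C.tgt = g ≫ C.src)
      (w' : (f ≫ mor) ≫ D.tgt = (g ≫ mor) ≫ D.src),
      C.comp f g w ≫ mor = D.comp (f ≫ mor) (g ≫ mor) w') : IFun C D where
  ob := ob
  mor := mor
  src := src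
  tgt := tgt
  idm := idm
  cmp := by
    rw [← cmp _ _ pullback.condition]
    congr 1
    rw [comp]
    simp [pullback.lift_fst_snd]

instance : Category.{v} (ICat V) where
  Hom := IFun
  id C := IFun.mk' (𝟙 _) (𝟙 _) (by simp) (by simp) (by simp) (by intros; simp)
  comp F G := IFun.mk' (F.ob ≫ G.ob) (F.mor ≫ G.mor)
    (by rw [Category.assoc, G.src, ← Category.assoc, F.src, Category.assoc])
    (by rw [Category.assoc, G.tgt, ← Category.assoc, F.tgt, Category.assoc])
    (by rw [← Category.assoc, F.idm, Category.assoc, G.idm, Category.assoc])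
    (by intros; rw [← Category.assoc, F.comp_mor, G.comp_mor]; simp)
  id_comp F := by apply IFun.ext <;> exact Category.id_comp _
  comp_id F := by apply IFun.ext <;> exact Category.comp_id _
  assoc F G H := by apply IFun.ext <;> exact Category.assoc _ _ _

/-- The map on objects. -/
def ob {C D : ICat V} (F : C ⟶ D) : C.Ob ⟶ D.Ob := IFun.ob F
/-- The map on morphisms. -/
def mor {C D : ICat V} (F : C ⟶ D) : C.Mor ⟶ D.Mor := IFun.mor F

variable {C D E : ICat V}

@[simp] theorem ob_id : ob (𝟙 C) = 𝟙 C.Ob := rfl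
@[simp] theorem mor_id : mor (𝟙 C) = 𝟙 C.Mor := rfl
@[simp] theorem ob_comp (F : C ⟶ D) (G : D ⟶ E) : ob (F ≫ G) = ob F ≫ ob G := rfl
@[simp] theorem mor_comp (F : C ⟶ D) (G : D ⟶ E) : mor (F ≫ G) = mor F ≫ mor G := rfl

theorem hom_ext {F G : C ⟶ D} (h : ob F = ob G) (h' : mor F = mor G) : F = G := IFun.ext h h'

theorem mor_src (F : C ⟶ D) : mor F ≫ D.src = C.src ≫ ob F := IFun.src F
theorem mor_tgt (F : C ⟶ D) : mor F ≫ D.tgt = C.tgt ≫ ob F := IFun.tgt F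
theorem idm_mor (F : C ⟶ D) : C.idm ≫ mor F = ob F ≫ D.idm := IFun.idm F

theorem w_mor (F : C ⟶ D) {X : V} {f g : X ⟶ C.Mor} (w : f ≫ C.tgt = g ≫ C.src) :
    (f ≫ mor F) ≫ D.tgt = (g ≫ mor F) ≫ D.src := by
  rw [Category.assoc, mor_tgt, ← Category.assoc, w, Category.assoc, ← mor_src, Category.assoc]

theorem comp_mor (F : C ⟶ D) {X : V} (f g : X ⟶ C.Mor) (w : f ≫ C.tgt = g ≫ C.src)
    (w' : (f ≫ mor F) ≫ D.tgt = (g ≫ mor F) ≫ D.src) :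
    C.comp f g w ≫ mor F = D.comp (f ≫ mor F) (g ≫ mor F) w' := IFun.comp_mor F f g w

theorem ob_eq_of_mor {F G : C ⟶ D} (h : mor F = mor G) : ob F = ob G := by
  have := idm_mor F
  rw [h, idm_mor] at this
  simpa using (congrArg (fun t => t ≫ D.src) this).symm

end Basic
end ICat

namespace ICat

section Disc

variable {V : Type u} [Category.{v} V] [HasPullbacks V]

/-- The discrete internal category on an object of `V`. -/
noncomputable abbrev disc (X : V) : ICat V :=
  ofPoints X X (𝟙 X) (𝟙 X) (𝟙 X) (fun f _ _ => f) (fun _ _ _ _ => rfl) (by simp) (by simp)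
    (fun _ _ _ => rfl) (fun _ _ w => w) (fun f => by simp) (fun f => rfl)
    (fun _ _ _ _ _ => rfl)

theorem disc_comp (X : V) {Y : V} (f g : Y ⟶ X) (w : f ≫ (disc X).tgt = g ≫ (disc X).src) :
    (disc X).comp f g w = f := ofPoints_comp _ _ _ _ _ _ _ _ f g w

/-- A map from an object of `V` to the object of objects of `C`, as a functor. -/
noncomputable def discHom {X : V} {C : ICat V} (a : X ⟶ C.Ob) : disc X ⟶ C :=
  IFun.mk' (C := disc X) a (a ≫ C.idm) (by simp [disc, ofPoints]) (by simp [disc, ofPoints])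
    (by simp [disc, ofPoints]) (fun f g w w' => by
      have e : f = g := ((Category.comp_id f).symm.trans w).trans (Category.comp_id g)
      subst e
      rw [disc_comp]
      refine Eq.symm ((C.comp_congr' (g' := (f ≫ a) ≫ C.idm) (w' := by simp) rfl (by simp)).trans
        (C.comp_idm _ _ (by simp))))

end Disc

section Products

variable {V : Type u} [Category.{v} V] [CartesianMonoidalCategory V] [HasPullbacks V]

/-- The product of two internal categories. -/
noncomputable abbrev prod (C D : ICat V) : ICat V :=
  ofPoints (C.Ob ⊗ D.Ob) (C.Mor ⊗ D.Mor) (C.src ⊗ₘ D.src) (C.tgt ⊗ₘ D.tgt) (C.idm ⊗ₘ D.idm)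
    (fun f g w => lift
      (C.comp (f ≫ fst _ _) (g ≫ fst _ _) (by simpa using congrArg (fun t => t ≫ fst _ _) w))
      (D.comp (f ≫ snd _ _) (g ≫ snd _ _) (by simpa using congrArg (fun t => t ≫ snd _ _) w)))
    (fun k f g w => by
      ext <;> simp only [Category.assoc, lift_fst, lift_snd, precomp_comp])
    (by ext <;> simp) (by ext <;> simp)
    (fun f g w => by ext <;> simp)
    (fun f g w => by ext <;> simp)
    (fun f => by
      ext
      · rw [lift_fst]
        refine (C.comp_congr' (f' := ((f ≫ fst _ _) ≫ C.src) ≫ C.idm) (by simp) rfl).trans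
          (C.idm_comp _ _ (by simp))
      · rw [lift_snd]
        refine (D.comp_congr' (f' := ((f ≫ snd _ _) ≫ D.src) ≫ D.idm) (by simp) rfl).trans
          (D.idm_comp _ _ (by simp)))
    (fun f => by
      ext
      · rw [lift_fst]
        refine (C.comp_congr' (g' := ((f ≫ fst _ _) ≫ C.tgt) ≫ C.idm) rfl (by simp)).trans
          (C.comp_idm _ _ (by simp))
      · rw [lift_snd]
        refine (D.comp_congr' (g' := ((f ≫ snd _ _) ≫ D.tgt) ≫ D.idm) rfl (by simp)).trans
          (D.comp_idm _ _ (by simp)))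
    (fun f g h w w' => by
      ext
      · simp only [lift_fst]
        exact C.comp_assoc _ _ _ _ (by simpa using congrArg (fun t => t ≫ fst _ _) w')
      · simp only [lift_snd]
        exact D.comp_assoc _ _ _ _ (by simpa using congrArg (fun t => t ≫ snd _ _) w'))

theorem prod_comp (C D : ICat V) {X : V} (f g : X ⟶ C.Mor ⊗ D.Mor)
    (w : f ≫ (C.prod D).tgt = g ≫ (C.prod D).src)
    (w1 : (f ≫ fst _ _) ≫ C.tgt = (g ≫ fst _ _) ≫ C.src)
    (w2 : (f ≫ snd _ _) ≫ D.tgt = (g ≫ snd _ _) ≫ D.src) :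
    (C.prod D).comp f g w = lift (C.comp (f ≫ fst _ _) (g ≫ fst _ _) w1)
      (D.comp (f ≫ snd _ _) (g ≫ snd _ _) w2) :=
  ofPoints_comp _ _ _ _ _ _ _ _ f g w

/-- The two projections and the pairing for `prod`. -/
noncomputable def prodFst (C D : ICat V) : C.prod D ⟶ C :=
  IFun.mk' (C := C.prod D) (fst _ _) (fst _ _) (by simp [prod, ofPoints]) (by simp [prod, ofPoints])
    (by simp [prod, ofPoints]) (fun f g w w' => by
      rw [prod_comp (w1 := w') (w2 := by
        simpa [prod, ofPoints] using congrArg (fun t => t ≫ snd _ _) w), lift_fst])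

noncomputable def prodSnd (C D : ICat V) : C.prod D ⟶ D :=
  IFun.mk' (C := C.prod D) (snd _ _) (snd _ _) (by simp [prod, ofPoints]) (by simp [prod, ofPoints])
    (by simp [prod, ofPoints]) (fun f g w w' => by
      rw [prod_comp (w2 := w') (w1 := by
        simpa [prod, ofPoints] using congrArg (fun t => t ≫ fst _ _) w), lift_snd])

noncomputable def prodLift {C D E : ICat V} (F : E ⟶ C) (G : E ⟶ D) : E ⟶ C.prod D :=
  IFun.mk' (D := C.prod D) (lift (ob F) (ob G)) (lift (mor F) (mor G))
    (by ext <;> simp [prod, ofPoints, mor_src]) (by ext <;> simp [prod, ofPoints, mor_tgt])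
    (by ext <;> simp [prod, ofPoints, idm_mor]) (fun f g w w' => by
      have h1 : (f ≫ mor F) ≫ C.tgt = (g ≫ mor F) ≫ C.src := by
        simp only [Category.assoc, mor_src, mor_tgt]; rw [← Category.assoc, w, Category.assoc]
      have h2 : (f ≫ mor G) ≫ D.tgt = (g ≫ mor G) ≫ D.src := by
        simp only [Category.assoc, mor_src, mor_tgt]; rw [← Category.assoc, w, Category.assoc]
      rw [prod_comp (w1 := by simpa using h1) (w2 := by simpa using h2)]
      ext
      · simp only [Category.assoc, lift_fst, comp_mor F f g w h1]
      · simp only [Category.assoc, lift_snd, comp_mor G f g w h2])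

noncomputable abbrev prodCone (C D : ICat V) : LimitCone (pair C D) where
  cone := BinaryFan.mk (prodFst C D) (prodSnd C D)
  isLimit := BinaryFan.IsLimit.mk _ (fun F G => prodLift F G)
    (fun F G => hom_ext (lift_fst _ _) (lift_fst _ _))
    (fun F G => hom_ext (lift_snd _ _) (lift_snd _ _))
    (fun F G m h1 h2 => by
      subst h1 h2
      refine hom_ext ?_ ?_
      · exact CartesianMonoidalCategory.hom_ext _ _ (lift_fst _ _).symm (lift_snd _ _).symm
      · exact CartesianMonoidalCategory.hom_ext _ _ (lift_fst _ _).symm (lift_snd _ _).symm)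

noncomputable abbrev unitCone : LimitCone (Functor.empty.{0} (ICat V)) where
  cone := asEmptyCone (disc (𝟙_ V))
  isLimit := IsTerminal.ofUniqueHom
    (fun _ => IFun.mk' (D := disc (𝟙_ V)) (toUnit _) (toUnit _) (toUnit_unique _ _)
      (toUnit_unique _ _) (toUnit_unique _ _) (fun _ _ _ _ => toUnit_unique _ _))
    (fun _ _ => hom_ext (toUnit_unique _ _) (toUnit_unique _ _))

noncomputable instance : CartesianMonoidalCategory (ICat V) :=
  .ofChosenFiniteProducts unitCone prodCone

theorem tensor_eq (C D : ICat V) : C ⊗ D = C.prod D := rfl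
theorem unit_eq : 𝟙_ (ICat V) = disc (𝟙_ V) := rfl
theorem ob_lift {C D E : ICat V} (F : E ⟶ C) (G : E ⟶ D) : ob (lift F G) = lift (ob F) (ob G) :=
  rfl
theorem mor_lift {C D E : ICat V} (F : E ⟶ C) (G : E ⟶ D) : mor (lift F G) = lift (mor F) (mor G) :=
  rfl
theorem ob_fst (C D : ICat V) : ob (fst C D) = fst C.Ob D.Ob := rfl
theorem ob_snd (C D : ICat V) : ob (snd C D) = snd C.Ob D.Ob := rfl
theorem mor_fst (C D : ICat V) : mor (fst C D) = fst C.Mor D.Mor := rfl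
theorem mor_snd (C D : ICat V) : mor (snd C D) = snd C.Mor D.Mor := rfl

end Products

end ICat

namespace ICat

section Trans

variable {V : Type u} [Category.{v} V] [HasPullbacks V]

/-- An internal natural transformation. -/
@[ext]
structure ITrans {C D : ICat V} (F G : C ⟶ D) where
  app : C.Ob ⟶ D.Mor
  src : app ≫ D.src = ob F
  tgt : app ≫ D.tgt = ob G
  nat : D.comp (mor F) (C.tgt ≫ app) (by rw [mor_tgt, Category.assoc, src]) =
    D.comp (C.src ≫ app) (mor G) (by rw [mor_src, Category.assoc, tgt])

theorem ITrans.nat' {C D : ICat V} {F G : C ⟶ D} (t : ITrans F G) {X : V} (f : X ⟶ C.Mor)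
    (w : (f ≫ mor F) ≫ D.tgt = ((f ≫ C.tgt) ≫ t.app) ≫ D.src)
    (w' : ((f ≫ C.src) ≫ t.app) ≫ D.tgt = (f ≫ mor G) ≫ D.src) :
    D.comp (f ≫ mor F) ((f ≫ C.tgt) ≫ t.app) w =
      D.comp ((f ≫ C.src) ≫ t.app) (f ≫ mor G) w' := by
  have := f ≫= t.nat
  rw [precomp_comp, precomp_comp] at this
  simpa only [Category.assoc] using this

/-- The object of commutative squares. -/
noncomputable abbrev Sq (C : ICat V) : V := pullback C.cmp C.cmp

/-- The square with top `f`, right `b`, left `a` and bottom `g`. -/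
noncomputable def sqMk (C : ICat V) {X : V} (f b a g : X ⟶ C.Mor) (w : f ≫ C.tgt = b ≫ C.src)
    (w' : a ≫ C.tgt = g ≫ C.src) (e : C.comp f b w = C.comp a g w') : X ⟶ C.Sq :=
  pullback.lift (pullback.lift f b w) (pullback.lift a g w') e

noncomputable def sqTop (C : ICat V) : C.Sq ⟶ C.Mor := pullback.fst _ _ ≫ pullback.fst _ _
noncomputable def sqRight (C : ICat V) : C.Sq ⟶ C.Mor := pullback.fst _ _ ≫ pullback.snd _ _
noncomputable def sqLeft (C : ICat V) : C.Sq ⟶ C.Mor := pullback.snd _ _ ≫ pullback.fst _ _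
noncomputable def sqBot (C : ICat V) : C.Sq ⟶ C.Mor := pullback.snd _ _ ≫ pullback.snd _ _

section
variable (C : ICat V) {X : V} (f b a g : X ⟶ C.Mor) (w : f ≫ C.tgt = b ≫ C.src)
    (w' : a ≫ C.tgt = g ≫ C.src) (e : C.comp f b w = C.comp a g w')

theorem sqMk_top : C.sqMk f b a g w w' e ≫ C.sqTop = f := by
  rw [sqMk, sqTop, ← Category.assoc]
  exact (congrArg (fun t => t ≫ _) (pullback.lift_fst _ _ _)).trans (pullback.lift_fst _ _ _)
theorem sqMk_right : C.sqMk f b a g w w' e ≫ C.sqRight = b := by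
  rw [sqMk, sqRight, ← Category.assoc]
  exact (congrArg (fun t => t ≫ _) (pullback.lift_fst _ _ _)).trans (pullback.lift_snd _ _ _)
theorem sqMk_left : C.sqMk f b a g w w' e ≫ C.sqLeft = a := by
  rw [sqMk, sqLeft, ← Category.assoc]
  exact (congrArg (fun t => t ≫ _) (pullback.lift_snd _ _ _)).trans (pullback.lift_fst _ _ _)
theorem sqMk_bot : C.sqMk f b a g w w' e ≫ C.sqBot = g := by
  rw [sqMk, sqBot, ← Category.assoc]
  exact (congrArg (fun t => t ≫ _) (pullback.lift_snd _ _ _)).trans (pullback.lift_snd _ _ _)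
end

section
variable (C : ICat V) {X : V} (k : X ⟶ C.Sq)

theorem sq_w : (k ≫ C.sqTop) ≫ C.tgt = (k ≫ C.sqRight) ≫ C.src := by
  simp only [sqTop, sqRight, Category.assoc, pullback.condition]
theorem sq_w' : (k ≫ C.sqLeft) ≫ C.tgt = (k ≫ C.sqBot) ≫ C.src := by
  simp only [sqLeft, sqBot, Category.assoc, pullback.condition]
theorem sq_e : C.comp (k ≫ C.sqTop) (k ≫ C.sqRight) (C.sq_w k) =
    C.comp (k ≫ C.sqLeft) (k ≫ C.sqBot) (C.sq_w' k) := by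
  have h1 : pullback.lift (k ≫ C.sqTop) (k ≫ C.sqRight) (C.sq_w k) =
      k ≫ pullback.fst C.cmp C.cmp := by
    apply pullback.hom_ext
    · rw [pullback.lift_fst, Category.assoc, sqTop]
    · rw [pullback.lift_snd, Category.assoc, sqRight]
  have h2 : pullback.lift (k ≫ C.sqLeft) (k ≫ C.sqBot) (C.sq_w' k) =
      k ≫ pullback.snd C.cmp C.cmp := by
    apply pullback.hom_ext
    · rw [pullback.lift_fst, Category.assoc, sqLeft]
    · rw [pullback.lift_snd, Category.assoc, sqBot]
  rw [comp, comp, h1, h2, Category.assoc, Category.assoc, pullback.condition]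
theorem sq_src : (k ≫ C.sqTop) ≫ C.src = (k ≫ C.sqLeft) ≫ C.src := by
  simpa using C.sq_e k =≫ C.src
theorem sq_tgt : (k ≫ C.sqRight) ≫ C.tgt = (k ≫ C.sqBot) ≫ C.tgt := by
  simpa using C.sq_e k =≫ C.tgt

variable {k} in
theorem sq_ext {k' : X ⟶ C.Sq} (h1 : k ≫ C.sqTop = k' ≫ C.sqTop)
    (h2 : k ≫ C.sqRight = k' ≫ C.sqRight) (h3 : k ≫ C.sqLeft = k' ≫ C.sqLeft)
    (h4 : k ≫ C.sqBot = k' ≫ C.sqBot) : k = k' := by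
  simp only [sqTop, sqRight, sqLeft, sqBot, ← Category.assoc] at h1 h2 h3 h4
  apply pullback.hom_ext <;> apply pullback.hom_ext <;> assumption
end

/-- Pasting two commutative squares along a common edge. -/
noncomputable def sqComp (C : ICat V) {X : V} (f g : X ⟶ C.Sq)
    (w : f ≫ C.sqRight = g ≫ C.sqLeft) : X ⟶ C.Sq :=
  C.sqMk (C.comp (f ≫ C.sqTop) (g ≫ C.sqTop) (by rw [sq_w, sq_src, w]))
    (g ≫ C.sqRight) (f ≫ C.sqLeft)
    (C.comp (f ≫ C.sqBot) (g ≫ C.sqBot) (by rw [← sq_w', ← sq_tgt, w]))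
    (by rw [comp_tgt, sq_w]) (by rw [comp_src, sq_w'])
    (by
      rw [C.comp_assoc _ _ _ _ (C.sq_w g), C.comp_congr' (w' := by
          rw [comp_src, sq_w, w]) rfl (C.sq_e g),
        ← C.comp_assoc _ _ _ (by rw [sq_w, w]) (C.sq_w' g),
        C.comp_congr' (w' := by rw [comp_tgt, w, sq_w']) (C.comp_congr' (w' := C.sq_w f) rfl w.symm)
          rfl,
        C.comp_congr' (w' := by rw [comp_tgt, ← sq_tgt, w, sq_w']) (C.sq_e f) rfl,
        C.comp_assoc _ _ _ (C.sq_w' f) (by rw [← sq_tgt, w, sq_w'])])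

/-- The internal category of arrows of `C` and commutative squares. -/
noncomputable abbrev arr (C : ICat V) : ICat V :=
  ofPoints C.Mor C.Sq C.sqLeft C.sqRight
    (C.sqMk (C.src ≫ C.idm) (𝟙 _) (𝟙 _) (C.tgt ≫ C.idm) (by simp) (by simp) (by simp))
    (fun f g w => C.sqComp f g w)
    (fun k f g w => by
      apply C.sq_ext <;>
      simp only [Category.assoc, sqComp, sqMk_top, sqMk_left, sqMk_right, sqMk_bot, precomp_comp])
    (C.sqMk_left _ _ _ _ _ _ _) (C.sqMk_right _ _ _ _ _ _ _)
    (fun f g w => C.sqMk_left _ _ _ _ _ _ _) (fun f g w => C.sqMk_right _ _ _ _ _ _ _)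
    (fun f => by
      apply C.sq_ext <;>
      simp only [sqComp, sqMk_top, sqMk_left, sqMk_right, sqMk_bot]
      · refine (C.comp_congr' (w' := ?_) (f' := ((f ≫ C.sqLeft) ≫ C.src) ≫ C.idm) (by
          simp only [Category.assoc, sqMk_top]) rfl).trans (C.idm_comp _ _ ?_) <;>
        simp only [Category.assoc, idm_tgt, Category.comp_id] <;> simpa using (C.sq_src f).symm
      · simp only [Category.assoc, sqMk_left, Category.comp_id]
      · refine (C.comp_congr' (w' := ?_) (f' := ((f ≫ C.sqLeft) ≫ C.tgt) ≫ C.idm) (by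
          simp only [Category.assoc, sqMk_bot]) rfl).trans (C.idm_comp _ _ ?_) <;>
        simp only [Category.assoc, idm_tgt, Category.comp_id] <;> simpa using C.sq_w' f)
    (fun f => by
      apply C.sq_ext <;>
      simp only [sqComp, sqMk_top, sqMk_left, sqMk_right, sqMk_bot]
      · refine (C.comp_congr' (w' := ?_) (g' := ((f ≫ C.sqRight) ≫ C.src) ≫ C.idm) rfl (by
          simp only [Category.assoc, sqMk_top])).trans (C.comp_idm _ _ ?_) <;>
        simp only [Category.assoc, idm_src, Category.comp_id] <;> simpa using C.sq_w f
      · simp only [Category.assoc, sqMk_right, Category.comp_id]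
      · refine (C.comp_congr' (w' := ?_) (g' := ((f ≫ C.sqRight) ≫ C.tgt) ≫ C.idm) rfl (by
          simp only [Category.assoc, sqMk_bot])).trans (C.comp_idm _ _ ?_) <;>
        simp only [Category.assoc, idm_src, Category.comp_id] <;> simpa using (C.sq_tgt f).symm)
    (fun f g h w w' => by
      apply C.sq_ext <;>
      simp only [sqComp, sqMk_top, sqMk_left, sqMk_right, sqMk_bot] <;>
      apply C.comp_assoc)

/-- A natural transformation, as a functor to the arrow category. -/
noncomputable def ITrans.toArr {C D : ICat V} {F G : C ⟶ D} (t : ITrans F G) : C ⟶ D.arr :=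
  IFun.mk' (D := D.arr) t.app
    (D.sqMk (mor F) (C.tgt ≫ t.app) (C.src ≫ t.app) (mor G)
      (by rw [mor_tgt, Category.assoc, t.src]) (by rw [mor_src, Category.assoc, t.tgt]) t.nat)
    (D.sqMk_left _ _ _ _ _ _ _) (D.sqMk_right _ _ _ _ _ _ _)
    (by
      apply D.sq_ext <;> simp only [Category.assoc, sqMk_top, sqMk_left, sqMk_right, sqMk_bot]
      · rw [idm_mor, ← t.src, Category.assoc]
      · rw [← Category.assoc, idm_tgt, Category.id_comp, Category.comp_id]
      · rw [← Category.assoc, idm_src, Category.id_comp, Category.comp_id]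
      · rw [idm_mor, ← t.tgt, Category.assoc])
    (fun f g w w' => by
      rw [ofPoints_comp]
      apply D.sq_ext <;>
        simp only [Category.assoc, sqComp, sqMk_top, sqMk_left, sqMk_right, sqMk_bot]
      · rw [comp_mor]
      · rw [← Category.assoc, comp_tgt, Category.assoc]
      · rw [← Category.assoc, comp_src, Category.assoc]
      · rw [comp_mor])

noncomputable def arrDom (D : ICat V) : D.arr ⟶ D :=
  IFun.mk' (C := D.arr) D.src D.sqTop (by simpa using D.sq_src (𝟙 _))
    (by simpa using D.sq_w (𝟙 _)) (D.sqMk_top _ _ _ _ _ _ _)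
    (fun f g w w' => by rw [ofPoints_comp, sqComp, sqMk_top])

noncomputable def arrCod (D : ICat V) : D.arr ⟶ D :=
  IFun.mk' (C := D.arr) D.tgt D.sqBot (by simpa using (D.sq_w' (𝟙 _)).symm)
    (by simpa using (D.sq_tgt (𝟙 _)).symm) (D.sqMk_bot _ _ _ _ _ _ _)
    (fun f g w w' => by rw [ofPoints_comp, sqComp, sqMk_bot])

/-- A functor to the arrow category, as a natural transformation. -/
noncomputable def ITrans.ofArr {C D : ICat V} (K : C ⟶ D.arr) :
    ITrans (K ≫ D.arrDom) (K ≫ D.arrCod) where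
  app := ob K
  src := rfl
  tgt := rfl
  nat := (D.comp_congr' (w' := D.sq_w (mor K)) rfl (mor_tgt K).symm).trans
    ((D.sq_e (mor K)).trans (D.comp_congr' (mor_src K) rfl))

end Trans
end ICat

namespace ICat

section Distrib

variable {V : Type u} [Category.{v} V] [CartesianMonoidalCategory V] [HasPullbacks V]

/-- The codiscrete (chaotic) internal category on an object of `V`. -/
noncomputable abbrev codisc (X : V) : ICat V :=
  ofPoints X (X ⊗ X) (fst _ _) (snd _ _) (lift (𝟙 _) (𝟙 _))
    (fun f g _ => lift (f ≫ fst _ _) (g ≫ snd _ _)) (by intros; ext <;> simp) (by simp) (by simp)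
    (by simp) (by simp) (by intros; ext <;> simp) (by intros; ext <;> simp)
    (by intros; ext <;> simp)

/-- A map on objects, as a functor to a codiscrete category. -/
noncomputable def toCodisc {C : ICat V} {X : V} (a : C.Ob ⟶ X) : C ⟶ codisc X :=
  IFun.mk' (D := codisc X) a (lift (C.src ≫ a) (C.tgt ≫ a)) (by simp) (by simp)
    (by ext <;> simp [← Category.assoc]) (by
      intro X f g w w'
      rw [ofPoints_comp]
      ext
      · simp only [lift_fst, Category.assoc]; rw [← Category.assoc, comp_src, Category.assoc]
      · simp only [lift_snd, Category.assoc]; rw [← Category.assoc, comp_tgt, Category.assoc])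

/-- The family `i` exhibits `S` as a coproduct. -/
def IsCoprod {J : Type w} {B : J → ICat V} {S : ICat V} (i : ∀ j, B j ⟶ S) : Prop :=
  ∀ (C : ICat V) (g : ∀ j, B j ⟶ C), ∃! h : S ⟶ C, ∀ j, i j ≫ h = g j

variable {J : Type w} {B : J → ICat V} {S : ICat V} {i : ∀ j, B j ⟶ S}

theorem IsCoprod.hom_ext (hS : IsCoprod i) {C : ICat V} {f g : S ⟶ C}
    (h : ∀ j, i j ≫ f = i j ≫ g) : f = g :=
  (hS C fun j => i j ≫ g).unique h fun _ => rfl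

theorem IsCoprod.ob_ext (hS : IsCoprod i) {Y : V} {f g : S.Ob ⟶ Y}
    (h : ∀ j, ob (i j) ≫ f = ob (i j) ≫ g) : f = g :=
  congrArg ob (hS.hom_ext (f := toCodisc f) (g := toCodisc g) fun j => by
    refine ICat.hom_ext (h j) ?_
    change mor (i j) ≫ lift _ _ = mor (i j) ≫ lift _ _
    ext
    · simp only [Category.assoc, lift_fst]
      rw [← Category.assoc, mor_src, Category.assoc, h, ← Category.assoc, ← mor_src, Category.assoc]
    · simp only [Category.assoc, lift_snd]
      rw [← Category.assoc, mor_tgt, Category.assoc, h, ← Category.assoc, ← mor_tgt, Category.assoc])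

/-- The product of an identity functor with a functor. -/
noncomputable abbrev prodMap (A : ICat V) {D E : ICat V} (F : D ⟶ E) : A.prod D ⟶ A.prod E :=
  prodLift (prodFst _ _) (prodSnd _ _ ≫ F)

theorem ob_prodMap (A : ICat V) {D E : ICat V} (F : D ⟶ E) : ob (prodMap A F) = A.Ob ◁ ob F := by
  change lift (fst _ _) (snd _ _ ≫ ob F) = _
  ext <;> simp

theorem mor_prodMap (A : ICat V) {D E : ICat V} (F : D ⟶ E) :
    mor (prodMap A F) = A.Mor ◁ mor F := by
  change lift (fst _ _) (snd _ _ ≫ mor F) = _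
  ext <;> simp

theorem disc_prod_comp (X : V) (C : ICat V) {Y : V} (f g : Y ⟶ C.Mor) (w : f ≫ C.tgt = g ≫ C.src)
    (w' : (X ◁ f) ≫ ((disc X).prod C).tgt = (X ◁ g) ≫ ((disc X).prod C).src) :
    ((disc X).prod C).comp (X ◁ f) (X ◁ g) w' = X ◁ (C.comp f g w) := by
  rw [prod_comp (w1 := by simp) (w2 := by simp [w])]
  ext
  · rw [lift_fst, disc_comp, whiskerLeft_fst, whiskerLeft_fst]
  · rw [lift_snd, whiskerLeft_snd X (C.comp f g w), precomp_comp]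
    exact C.comp_congr' (whiskerLeft_snd _ _) (whiskerLeft_snd _ _)

variable [MonoidalClosed V]

theorem IsCoprod.tensor_ob_ext (hS : IsCoprod i) {X Y : V} {f g : X ⊗ S.Ob ⟶ Y}
    (h : ∀ j, X ◁ ob (i j) ≫ f = X ◁ ob (i j) ≫ g) : f = g := by
  apply MonoidalClosed.curry_injective
  apply hS.ob_ext
  intro j
  rw [← MonoidalClosed.curry_natural_left, h, MonoidalClosed.curry_natural_left]

theorem IsCoprod.point_ext (hS : IsCoprod i) {X Y Z : V} {f g : X ⊗ S.Ob ⟶ Y}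
    (h : ∀ j, X ◁ ob (i j) ≫ f = X ◁ ob (i j) ≫ g) (z : Z ⟶ X ⊗ S.Ob) : z ≫ f = z ≫ g := by
  rw [hS.tensor_ob_ext h]

open MonoidalClosed in
/-- The power of an internal category by an object of `V`. -/
noncomputable abbrev pow (X : V) (C : ICat V) : ICat V :=
  ofPoints ((ihom X).obj C.Ob) ((ihom X).obj C.Mor) ((ihom X).map C.src) ((ihom X).map C.tgt)
    ((ihom X).map C.idm)
    (fun f g w => curry (C.comp (uncurry f) (uncurry g) (by
      rw [← uncurry_natural_right, ← uncurry_natural_right, w])))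
    (fun k f g w => by
      rw [← curry_natural_left, precomp_comp]
      congr 1
      exact C.comp_congr' (uncurry_natural_left _ _).symm (uncurry_natural_left _ _).symm)
    (by rw [← Functor.map_comp, idm_src, CategoryTheory.Functor.map_id])
    (by rw [← Functor.map_comp, idm_tgt, CategoryTheory.Functor.map_id])
    (fun f g w => by
      rw [← curry_natural_right, comp_src, curry_eq_iff, uncurry_natural_right])
    (fun f g w => by
      rw [← curry_natural_right, comp_tgt, curry_eq_iff, uncurry_natural_right])
    (fun f => by
      rw [curry_eq_iff]
      exact (C.comp_congr' (f' := (uncurry f ≫ C.src) ≫ C.idm) (w' := by simp)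
        (by simp only [← Category.assoc, uncurry_natural_right]) rfl).trans
        (C.idm_comp _ _ _))
    (fun f => by
      rw [curry_eq_iff]
      exact (C.comp_congr' (g' := (uncurry f ≫ C.tgt) ≫ C.idm) (w' := by simp)
        rfl (by simp only [← Category.assoc, uncurry_natural_right])).trans
        (C.comp_idm _ _ _))
    (fun f g h w w' => by
      congr 1
      have e1 : uncurry f ≫ C.tgt = uncurry g ≫ C.src := by
        rw [← uncurry_natural_right, ← uncurry_natural_right, w]
      have e2 : uncurry g ≫ C.tgt = uncurry h ≫ C.src := by
        rw [← uncurry_natural_right, ← uncurry_natural_right, w']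
      refine (C.comp_congr' (w' := ?_) (uncurry_curry _) rfl).trans
        ((C.comp_assoc _ _ _ e1 e2).trans (C.comp_congr' rfl (uncurry_curry _).symm))
      rw [comp_tgt, e2])

open MonoidalClosed in
/-- Currying a functor out of the product with a discrete category. -/
noncomputable def curryDisc {X : V} {D C : ICat V} (F : (disc X).prod D ⟶ C) : D ⟶ pow X C :=
  IFun.mk' (D := pow X C) (curry (ob F)) (curry (mor F))
    (by rw [← curry_natural_right, mor_src, ← curry_natural_left]; simp)
    (by rw [← curry_natural_right, mor_tgt, ← curry_natural_left]; simp)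
    (by
      rw [← curry_natural_right, ← idm_mor, ← curry_natural_left]; simp)
    (fun f g w w' => by
      rw [ofPoints_comp, ← curry_natural_left, ← disc_prod_comp (w := w) (w' := by simp [← MonoidalCategory.whiskerLeft_comp, w])]
      congr 1
      have e : ((X ◁ f) ≫ mor F) ≫ C.tgt = ((X ◁ g) ≫ mor F) ≫ C.src := by
        have w2 : (X ◁ f) ≫ ((disc X).prod D).tgt = (X ◁ g) ≫ ((disc X).prod D).src := by
          simp [← MonoidalCategory.whiskerLeft_comp, w]
        rw [Category.assoc, mor_tgt, ← Category.assoc, w2, Category.assoc, ← mor_src,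
          Category.assoc]
      rw [comp_mor F (w' := e)]
      apply C.comp_congr'
      · rw [uncurry_natural_left, uncurry_curry]
      · rw [uncurry_natural_left, uncurry_curry])

open MonoidalClosed in
/-- Uncurrying. -/
noncomputable def uncurryDisc {X : V} {D C : ICat V} (F : D ⟶ pow X C) : (disc X).prod D ⟶ C :=
  IFun.mk' (C := (disc X).prod D) (uncurry (ob F)) (uncurry (mor F))
    (by rw [← uncurry_natural_right, mor_src, uncurry_natural_left]; simp)
    (by rw [← uncurry_natural_right, mor_tgt, uncurry_natural_left]; simp)
    (by
      rw [← uncurry_natural_right, ← idm_mor, uncurry_natural_left]; simp)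
    (fun f g w w' => by
      have e1 : f ≫ fst _ _ = g ≫ fst _ _ := by simpa using w =≫ fst _ _
      have e2 : (f ≫ snd _ _) ≫ D.tgt = (g ≫ snd _ _) ≫ D.src := by simpa using w =≫ snd _ _
      have hf : f = lift (f ≫ fst _ _) (𝟙 _) ≫ X ◁ (f ≫ snd _ _) := by ext <;> simp
      have hg : g = lift (f ≫ fst _ _) (𝟙 _) ≫ X ◁ (g ≫ snd _ _) := by
        ext <;> simp [e1]
      have e3 : ((f ≫ snd _ _) ≫ mor F) ≫ (pow X C).tgt =
          ((g ≫ snd _ _) ≫ mor F) ≫ (pow X C).src := by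
        rw [Category.assoc, mor_tgt, ← Category.assoc, e2, Category.assoc, ← mor_src]
        simp only [Category.assoc]
      have key := comp_mor F _ _ e2 e3
      rw [ofPoints_comp, eq_curry_iff, uncurry_natural_left] at key
      have hc : ((disc X).prod D).comp f g w =
          lift (f ≫ fst _ _) (𝟙 _) ≫ X ◁ (D.comp (f ≫ snd _ _) (g ≫ snd _ _) e2) := by
        rw [prod_comp (w1 := by simpa using e1) (w2 := e2)]
        ext
        · rw [lift_fst, disc_comp]; simp
        · rw [lift_snd]; simp
      rw [hc, Category.assoc, key, precomp_comp]
      apply C.comp_congr'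
      · rw [uncurry_natural_left, ← Category.assoc, ← hf]
      · rw [uncurry_natural_left, ← Category.assoc, ← hg])

theorem uncurry_curryDisc {X : V} {D C : ICat V} (F : (disc X).prod D ⟶ C) :
    uncurryDisc (curryDisc F) = F :=
  ICat.hom_ext (MonoidalClosed.uncurry_curry _) (MonoidalClosed.uncurry_curry _)

theorem curryDisc_natural {X : V} {D E C : ICat V} (F : D ⟶ E) (G : (disc X).prod E ⟶ C) :
    curryDisc (prodMap _ F ≫ G) = F ≫ curryDisc G := by
  refine ICat.hom_ext ?_ ?_
  · change MonoidalClosed.curry (ob (prodMap _ F) ≫ ob G) = _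
    rw [ob_prodMap]
    exact MonoidalClosed.curry_natural_left _ _
  · change MonoidalClosed.curry (mor (prodMap _ F) ≫ mor G) = _
    rw [mor_prodMap]
    exact MonoidalClosed.curry_natural_left _ _

theorem curryDisc_injective {X : V} {D C : ICat V} {F G : (disc X).prod D ⟶ C}
    (h : curryDisc F = curryDisc G) : F = G := by
  rw [← uncurry_curryDisc F, h, uncurry_curryDisc]

theorem curry_uncurryDisc {X : V} {D C : ICat V} (F : D ⟶ pow X C) :
    curryDisc (uncurryDisc F) = F :=
  ICat.hom_ext (MonoidalClosed.curry_uncurry _) (MonoidalClosed.curry_uncurry _)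

theorem IsCoprod.disc (hS : IsCoprod i) (X : V) : IsCoprod fun j => prodMap (ICat.disc X) (i j) := by
  intro C g
  obtain ⟨h, hh, -⟩ := hS _ fun j => curryDisc (g j)
  refine ⟨uncurryDisc h, fun j => ?_, fun h' hh' => ?_⟩
  · apply curryDisc_injective
    rw [curryDisc_natural, curry_uncurryDisc, hh]
  · apply curryDisc_injective
    apply hS.hom_ext
    intro j
    rw [← curryDisc_natural, hh', curry_uncurryDisc, hh]

end Distrib
end ICat

namespace ICat

theorem comp_mid {V : Type u} [Category.{v} V] [HasPullbacks V] (C : ICat V) {X : V}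
    {p q q' r r' s : X ⟶ C.Mor} (h1 : p ≫ C.tgt = q ≫ C.src) (h2 : q ≫ C.tgt = r ≫ C.src)
    (h3 : r ≫ C.tgt = s ≫ C.src) (h1' : p ≫ C.tgt = q' ≫ C.src) (h2' : q' ≫ C.tgt = r' ≫ C.src)
    (h3' : r' ≫ C.tgt = s ≫ C.src) (e : C.comp q r h2 = C.comp q' r' h2') :
    C.comp (C.comp p q h1) (C.comp r s h3) (by simp [h2]) =
      C.comp (C.comp p q' h1') (C.comp r' s h3') (by simp [h2']) := by
  rw [C.comp_assoc _ _ _ h1 (by simp [h2]), C.comp_assoc _ _ _ h1' (by simp [h2'])]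
  refine C.comp_congr' rfl ?_
  rw [← C.comp_assoc _ _ _ h2 h3, ← C.comp_assoc _ _ _ h2' h3']
  exact C.comp_congr' e rfl

section Glue

variable {V : Type u} [Category.{v} V] [CartesianMonoidalCategory V] [HasPullbacks V]

/-- Reindexing along a map of discrete categories. -/
noncomputable abbrev reind {X Y : V} (a : X ⟶ Y) (S : ICat V) : (disc X).prod S ⟶ (disc Y).prod S :=
  prodLift (prodFst _ _ ≫ discHom (C := disc Y) a) (prodSnd _ _)

theorem ob_reind {X Y : V} (a : X ⟶ Y) (S : ICat V) : ob (reind a S) = a ▷ S.Ob := by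
  change lift (fst _ _ ≫ a) (snd _ _) = _
  ext <;> simp

theorem mor_reind {X Y : V} (a : X ⟶ Y) (S : ICat V) : mor (reind a S) = a ▷ S.Mor := by
  change lift (fst _ _ ≫ a ≫ 𝟙 _) (snd _ _) = _
  ext <;> simp

/-- The inclusion of the discrete category of objects. -/
noncomputable abbrev obIncl (A S : ICat V) : (disc A.Ob).prod S ⟶ A.prod S :=
  prodLift (prodFst _ _ ≫ discHom (𝟙 A.Ob)) (prodSnd _ _)

/-- A functor `A × S ⟶ C` restricted to the discrete category of objects of `A`. -/
noncomputable abbrev part0 {A S C : ICat V} (G : A.prod S ⟶ C) : (disc A.Ob).prod S ⟶ C :=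
  obIncl A S ≫ G

theorem ob_part0 {A S C : ICat V} (G : A.prod S ⟶ C) : ob (part0 G) = ob G := by
  change lift (fst _ _ ≫ 𝟙 _) (snd _ _) ≫ ob G = _
  rw [Category.comp_id, lift_fst_snd]; exact Category.id_comp _

theorem mor_part0 {A S C : ICat V} (G : A.prod S ⟶ C) : mor (part0 G) = A.idm ▷ S.Mor ≫ mor G := by
  change lift (fst _ _ ≫ 𝟙 _ ≫ A.idm) (snd _ _) ≫ mor G = _
  congr 1
  ext <;> simp

/-- The action of the morphisms of `A`, as a natural transformation. -/
noncomputable def part1 {A S C : ICat V} (G : A.prod S ⟶ C) :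
    ITrans (reind A.src S ≫ part0 G) (reind A.tgt S ≫ part0 G) where
  app := A.Mor ◁ S.idm ≫ mor G
  src := by
    rw [Category.assoc, mor_src, ob_comp, ob_reind, ob_part0, ← Category.assoc]
    congr 1
    ext <;> simp
  tgt := by
    rw [Category.assoc, mor_tgt, ob_comp, ob_reind, ob_part0, ← Category.assoc]
    congr 1
    ext <;> simp
  nat := by
    have e1 : ((A.src ≫ A.idm) ▷ S.Mor) ≫ (A.prod S).tgt =
        (A.Mor ◁ (S.tgt ≫ S.idm)) ≫ (A.prod S).src := by ext <;> simp
    have e2 : (A.Mor ◁ (S.src ≫ S.idm)) ≫ (A.prod S).tgt =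
        ((A.tgt ≫ A.idm) ▷ S.Mor) ≫ (A.prod S).src := by ext <;> simp
    have aux {f g f' g' : A.Mor ⊗ S.Mor ⟶ A.Mor ⊗ S.Mor} (w : f ≫ (A.prod S).tgt = g ≫ (A.prod S).src)
        (w' : f' ≫ (A.prod S).tgt = g' ≫ (A.prod S).src)
        (e : (A.prod S).comp f g w = (A.prod S).comp f' g' w') (h1 h2) :
        C.comp (f ≫ mor G) (g ≫ mor G) h1 = C.comp (f' ≫ mor G) (g' ≫ mor G) h2 := by
      rw [← comp_mor G f g w, ← comp_mor G f' g' w', e]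
    have e3 : (A.prod S).comp _ _ e1 = (A.prod S).comp _ _ e2 := by
      have a1 : ((A.src ≫ A.idm) ▷ S.Mor ≫ fst _ _) ≫ A.tgt =
        (A.Mor ◁ (S.tgt ≫ S.idm) ≫ fst _ _) ≫ A.src := by simp
      have a2 : ((A.src ≫ A.idm) ▷ S.Mor ≫ snd _ _) ≫ S.tgt =
        (A.Mor ◁ (S.tgt ≫ S.idm) ≫ snd _ _) ≫ S.src := by simp
      have a3 : (A.Mor ◁ (S.src ≫ S.idm) ≫ fst _ _) ≫ A.tgt =
        ((A.tgt ≫ A.idm) ▷ S.Mor ≫ fst _ _) ≫ A.src := by simp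
      have a4 : (A.Mor ◁ (S.src ≫ S.idm) ≫ snd _ _) ≫ S.tgt =
        ((A.tgt ≫ A.idm) ▷ S.Mor ≫ snd _ _) ≫ S.src := by simp
      rw [prod_comp (w1 := a1) (w2 := a2), prod_comp (w1 := a3) (w2 := a4)]
      ext
      · simp only [lift_fst]
        exact ((A.comp_congr' (f' := (fst A.Mor S.Mor ≫ A.src) ≫ A.idm) (g' := fst A.Mor S.Mor)
          (w' := by simp) (by simp) (by simp)).trans (A.idm_comp _ _ _)).trans
          (((A.comp_congr' (g' := (fst A.Mor S.Mor ≫ A.tgt) ≫ A.idm) (f' := fst A.Mor S.Mor)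
          (w' := by simp) (by simp) (by simp)).trans (A.comp_idm _ _ _)).symm)
      · simp only [lift_snd]
        exact ((S.comp_congr' (g' := (snd A.Mor S.Mor ≫ S.tgt) ≫ S.idm) (f' := snd A.Mor S.Mor)
          (w' := by simp) (by simp) (by simp)).trans (S.comp_idm _ _ _)).trans
          (((S.comp_congr' (f' := (snd A.Mor S.Mor ≫ S.src) ≫ S.idm) (g' := snd A.Mor S.Mor)
          (w' := by simp) (by simp) (by simp)).trans (S.idm_comp _ _ _)).symm)
    have q1 : mor (reind A.src S ≫ part0 G) = (A.src ≫ A.idm) ▷ S.Mor ≫ mor G := by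
      rw [mor_comp, mor_reind, mor_part0, comp_whiskerRight, Category.assoc]
    have q2 : mor (reind A.tgt S ≫ part0 G) = (A.tgt ≫ A.idm) ▷ S.Mor ≫ mor G := by
      rw [mor_comp, mor_reind, mor_part0, comp_whiskerRight, Category.assoc]
    have q3 : ((disc A.Mor).prod S).tgt ≫ A.Mor ◁ S.idm ≫ mor G =
        (A.Mor ◁ (S.tgt ≫ S.idm)) ≫ mor G := by
      rw [← Category.assoc]; congr 1; ext <;> simp
    have q4 : ((disc A.Mor).prod S).src ≫ A.Mor ◁ S.idm ≫ mor G =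
        (A.Mor ◁ (S.src ≫ S.idm)) ≫ mor G := by
      rw [← Category.assoc]; congr 1; ext <;> simp
    exact (C.comp_congr' (w' := w_mor G e1) q1 q3).trans
      ((aux e1 e2 e3 (w_mor G e1) (w_mor G e2)).trans (C.comp_congr' q4.symm q2.symm))

variable {A S C : ICat V} (H : (disc A.Ob).prod S ⟶ C) (K : (disc A.Mor).prod S ⟶ C.arr)

/-- Gluing a functor on the objects of `A` and an action of the morphisms of `A`. -/
noncomputable def glue (hs : K ≫ C.arrDom = reind A.src S ≫ H)
    (ht : K ≫ C.arrCod = reind A.tgt S ≫ H)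
    (hi : A.idm ▷ S.Ob ≫ ob K = ob H ≫ C.idm)
    (hc : ∀ {X : V} (a b : X ⟶ A.Mor) (w : a ≫ A.tgt = b ≫ A.src) (x : X ⟶ S.Ob)
      (w' : (lift a x ≫ ob K) ≫ C.tgt = (lift b x ≫ ob K) ≫ C.src),
      lift (A.comp a b w) x ≫ ob K = C.comp (lift a x ≫ ob K) (lift b x ≫ ob K) w') :
    A.prod S ⟶ C := by
  have os : ob K ≫ C.src = A.src ▷ S.Ob ≫ ob H := (congrArg ob hs).trans (by
    rw [ob_comp, ob_reind])
  have ot : ob K ≫ C.tgt = A.tgt ▷ S.Ob ≫ ob H := (congrArg ob ht).trans (by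
    rw [ob_comp, ob_reind])
  have ms : mor K ≫ C.sqTop = A.src ▷ S.Mor ≫ mor H := (congrArg mor hs).trans (by
    rw [mor_comp, mor_reind])
  have mt : mor K ≫ C.sqBot = A.tgt ▷ S.Mor ≫ mor H := (congrArg mor ht).trans (by
    rw [mor_comp, mor_reind])
  have ls {X : V} (a : X ⟶ A.Mor) (x : X ⟶ S.Ob) :
      (lift a x ≫ ob K) ≫ C.src = lift (a ≫ A.src) x ≫ ob H := by
    rw [Category.assoc, os, ← Category.assoc, lift_whiskerRight]
  have lt {X : V} (a : X ⟶ A.Mor) (x : X ⟶ S.Ob) :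
      (lift a x ≫ ob K) ≫ C.tgt = lift (a ≫ A.tgt) x ≫ ob H := by
    rw [Category.assoc, ot, ← Category.assoc, lift_whiskerRight]
  have hhs {X : V} (o : X ⟶ A.Ob) (m : X ⟶ S.Mor) :
      (lift o m ≫ mor H) ≫ C.src = lift o (m ≫ S.src) ≫ ob H := by
    rw [Category.assoc, mor_src, ← Category.assoc]; congr 1; ext <;> simp
  have hht {X : V} (o : X ⟶ A.Ob) (m : X ⟶ S.Mor) :
      (lift o m ≫ mor H) ≫ C.tgt = lift o (m ≫ S.tgt) ≫ ob H := by
    rw [Category.assoc, mor_tgt, ← Category.assoc]; congr 1; ext <;> simp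
  have w0 {X : V} (a : X ⟶ A.Mor) (m : X ⟶ S.Mor) :
      (lift a (m ≫ S.src) ≫ ob K) ≫ C.tgt = (lift (a ≫ A.tgt) m ≫ mor H) ≫ C.src := by
    rw [lt, hhs]
  have w1 {X : V} (a : X ⟶ A.Mor) (m : X ⟶ S.Mor) :
      (lift (a ≫ A.src) m ≫ mor H) ≫ C.tgt = (lift a (m ≫ S.tgt) ≫ ob K) ≫ C.src := by
    rw [ls, hht]
  have hn {X : V} (a : X ⟶ A.Mor) (m : X ⟶ S.Mor) :
      C.comp _ _ (w1 a m) = C.comp _ _ (w0 a m) := by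
    have z1 : (lift a m ≫ mor K) ≫ C.sqTop = lift (a ≫ A.src) m ≫ mor H := by
      rw [Category.assoc, ms, ← Category.assoc, lift_whiskerRight]
    have z2 : (lift a m ≫ mor K) ≫ C.sqBot = lift (a ≫ A.tgt) m ≫ mor H := by
      rw [Category.assoc, mt, ← Category.assoc, lift_whiskerRight]
    have z3 : (lift a m ≫ mor K) ≫ C.sqLeft = lift a (m ≫ S.src) ≫ ob K := by
      rw [Category.assoc]
      refine (congrArg (fun t => lift a m ≫ t) (mor_src K)).trans ?_
      rw [← Category.assoc]; congr 1; ext <;> simp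
    have z4 : (lift a m ≫ mor K) ≫ C.sqRight = lift a (m ≫ S.tgt) ≫ ob K := by
      rw [Category.assoc]
      refine (congrArg (fun t => lift a m ≫ t) (mor_tgt K)).trans ?_
      rw [← Category.assoc]; congr 1; ext <;> simp
    exact (C.comp_congr' z1.symm z4.symm).trans ((C.sq_e _).trans (C.comp_congr' z3 z2))
  have pm {X : V} (a : X ⟶ A.Mor) (m : X ⟶ S.Mor) :
      lift a m ≫ C.comp _ _ (w0 (fst A.Mor S.Mor) (snd A.Mor S.Mor)) = C.comp _ _ (w0 a m) := by
    rw [precomp_comp]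
    apply C.comp_congr' <;> (rw [← Category.assoc]; congr 1; ext <;> simp)
  refine IFun.mk' (C := A.prod S) (@ICat.ob V _ _ ((disc A.Ob).prod S) C H)
    (C.comp _ _ (w0 (fst A.Mor S.Mor) (snd A.Mor S.Mor))) ?_ ?_ ?_ ?_
  · rw [comp_src, ls, ← lift_map, lift_fst_snd, Category.id_comp]
  · rw [comp_tgt, hht, ← lift_map, lift_fst_snd, Category.id_comp]
  · have e : (A.prod S).idm = lift (fst _ _ ≫ A.idm) (snd _ _ ≫ S.idm) := by ext <;> simp
    have e1 : lift (fst A.Ob S.Ob ≫ A.idm) ((snd A.Ob S.Ob ≫ S.idm) ≫ S.src) ≫ ob K =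
        ob H ≫ C.idm := by
      rw [← hi]
      refine congrArg (fun t => t ≫ ob K) ?_
      ext <;> simp
    have e2 : lift ((fst A.Ob S.Ob ≫ A.idm) ≫ A.tgt) (snd A.Ob S.Ob ≫ S.idm) ≫ mor H =
        ob H ≫ C.idm := by
      rw [← idm_mor]
      refine congrArg (fun t => t ≫ mor H) ?_
      ext <;> simp
    have e3 : (@ICat.ob V _ _ ((disc A.Ob).prod S) C H ≫ C.idm) ≫ C.tgt =
        (ob H ≫ C.idm) ≫ C.src := by simp
    rw [e, pm]
    exact (C.comp_congr' (w' := e3) e1 e2).trans (C.comp_idm _ _ e3)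
  · intro X f g w w'
    obtain ⟨a, m, rfl⟩ : ∃ a m, f = lift a m := ⟨f ≫ fst _ _, f ≫ snd _ _, by ext <;> simp⟩
    obtain ⟨b, n, rfl⟩ : ∃ b n, g = lift b n := ⟨g ≫ fst _ _, g ≫ snd _ _, by ext <;> simp⟩
    have wa : a ≫ A.tgt = b ≫ A.src := by simpa using congrArg (fun t => t ≫ fst _ _) w
    have wm : m ≫ S.tgt = n ≫ S.src := by simpa using congrArg (fun t => t ≫ snd _ _) w
    have e0 : (A.prod S).comp (lift a m) (lift b n) w = lift (A.comp a b wa) (S.comp m n wm) := by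
      rw [prod_comp (w1 := by simpa using wa) (w2 := by simpa using wm)]
      ext
      · simp only [lift_fst]
      · simp only [lift_snd]
    have k1 : (lift a (m ≫ S.src) ≫ ob K) ≫ C.tgt = (lift b (m ≫ S.src) ≫ ob K) ≫ C.src := by
      rw [lt, ls, wa]
    have k2 : (lift (b ≫ A.tgt) m ≫ mor H) ≫ C.tgt = (lift (b ≫ A.tgt) n ≫ mor H) ≫ C.src := by
      rw [hht, hhs, wm]
    have k3 : lift (A.comp a b wa) (S.comp m n wm ≫ S.src) ≫ ob K = C.comp _ _ k1 := by
      rw [comp_src, hc a b wa _ k1]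
    have k4 : lift (A.comp a b wa ≫ A.tgt) (S.comp m n wm) ≫ mor H = C.comp _ _ k2 := by
      have k5 : lift (b ≫ A.tgt) m ≫ ((disc A.Ob).prod S).tgt =
          lift (b ≫ A.tgt) n ≫ ((disc A.Ob).prod S).src := by ext <;> simp [wm]
      rw [← comp_mor H _ _ k5 k2, comp_tgt]
      refine congrArg (fun t => t ≫ mor H) ?_
      rw [prod_comp (w1 := by simp) (w2 := by simpa using wm)]
      ext
      · simp only [lift_fst, disc_comp]
      · simp only [lift_snd]
    have k6 : C.comp _ _ (w0 b m) =
        C.comp (lift (a ≫ A.tgt) m ≫ mor H) (lift b (n ≫ S.src) ≫ ob K) (by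
          rw [hht, ls, wa, wm]) :=
      (hn b m).symm.trans (C.comp_congr' (by rw [wa]) (by rw [wm]))
    have k7 := C.comp_mid k1 (w0 b m) k2 (w0 a m) (by rw [hht, ls, wa, wm]) (w0 b n) k6
    exact (((congrArg (fun t => t ≫ _) e0).trans (pm _ _)).trans
      (C.comp_congr' k3 k4)).trans (k7.trans (C.comp_congr' (pm a m).symm (pm b n).symm))

end Glue
end ICat

namespace ICat

section Distrib2

variable {V : Type u} [Category.{v} V] [CartesianMonoidalCategory V] [HasPullbacks V]

theorem part_ext {A S C : ICat V} {F G : A.prod S ⟶ C} (h0 : part0 F = part0 G)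
    (h1 : A.Mor ◁ S.idm ≫ mor F = A.Mor ◁ S.idm ≫ mor G) : F = G := by
  have e0 : (A.Mor ◁ (S.src ≫ S.idm)) ≫ (A.prod S).tgt =
      ((A.tgt ≫ A.idm) ▷ S.Mor) ≫ (A.prod S).src := by ext <;> simp
  have key : 𝟙 _ = (A.prod S).comp _ _ e0 := by
    rw [prod_comp (w1 := by simp) (w2 := by simp)]
    ext
    · rw [lift_fst, Category.id_comp]
      exact ((A.comp_congr' (g' := (fst A.Mor S.Mor ≫ A.tgt) ≫ A.idm) (f' := fst A.Mor S.Mor)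
          (w' := by simp) (by simp) (by simp)).trans (A.comp_idm _ _ _)).symm
    · rw [lift_snd, Category.id_comp]
      exact ((S.comp_congr' (f' := (snd A.Mor S.Mor ≫ S.src) ≫ S.idm) (g' := snd A.Mor S.Mor)
          (w' := by simp) (by simp) (by simp)).trans (S.idm_comp _ _ _)).symm
  have dec (G : A.prod S ⟶ C) : mor G = C.comp _ _ (w_mor G e0) := by
    rw [← comp_mor G _ _ e0, ← key]
    exact (Category.id_comp _).symm
  have dec1 (G : A.prod S ⟶ C) : (A.Mor ◁ (S.src ≫ S.idm)) ≫ mor G =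
      A.Mor ◁ S.src ≫ A.Mor ◁ S.idm ≫ mor G := by
    rw [MonoidalCategory.whiskerLeft_comp, Category.assoc]
  have dec2 (G : A.prod S ⟶ C) : ((A.tgt ≫ A.idm) ▷ S.Mor) ≫ mor G =
      A.tgt ▷ S.Mor ≫ mor (part0 G) := by
    rw [mor_part0, comp_whiskerRight, Category.assoc]
  refine ICat.hom_ext ?_ ?_
  · rw [← ob_part0, h0, ob_part0]
  · rw [dec F, dec G]
    exact C.comp_congr' (by rw [dec1, dec1, h1]) (by rw [dec2, dec2, h0])

theorem prodMap_part0 {A B S C : ICat V} (i : B ⟶ S) (F : A.prod S ⟶ C) :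
    prodMap (disc A.Ob) i ≫ part0 F = part0 (prodMap A i ≫ F) := by
  refine ICat.hom_ext ?_ ?_
  · rw [ob_part0, ob_comp, ob_part0, ob_prodMap, ob_comp, ob_prodMap]
  · rw [mor_part0, mor_comp, mor_part0, mor_prodMap, mor_comp, mor_prodMap, ← Category.assoc,
      ← Category.assoc]
    congr 1
    exact whisker_exchange _ _

theorem prodMap_part1 {A B S C : ICat V} (i : B ⟶ S) (F : A.prod S ⟶ C) :
    A.Mor ◁ ob i ≫ A.Mor ◁ S.idm ≫ mor F = A.Mor ◁ B.idm ≫ mor (prodMap A i ≫ F) := by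
  rw [mor_comp, mor_prodMap, ← Category.assoc, ← Category.assoc,
    ← MonoidalCategory.whiskerLeft_comp, ← MonoidalCategory.whiskerLeft_comp, idm_mor]

theorem prodMap_reind {X Y : V} {B S : ICat V} (i : B ⟶ S) (a : X ⟶ Y) :
    prodMap (disc X) i ≫ reind a S = reind a B ≫ prodMap (disc Y) i := by
  refine ICat.hom_ext ?_ ?_
  · rw [ob_comp, ob_comp, ob_prodMap, ob_prodMap, ob_reind, ob_reind]
    exact whisker_exchange _ _
  · rw [mor_comp, mor_comp, mor_prodMap, mor_prodMap, mor_reind, mor_reind]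
    exact whisker_exchange _ _

theorem ITrans.toArr_dom {C D : ICat V} {F G : C ⟶ D} (t : ITrans F G) :
    t.toArr ≫ D.arrDom = F := ICat.hom_ext t.src (D.sqMk_top _ _ _ _ _ _ _)

theorem ITrans.toArr_cod {C D : ICat V} {F G : C ⟶ D} (t : ITrans F G) :
    t.toArr ≫ D.arrCod = G := ICat.hom_ext t.tgt (D.sqMk_bot _ _ _ _ _ _ _)

section
variable {A S C : ICat V} (H : (disc A.Ob).prod S ⟶ C) (K : (disc A.Mor).prod S ⟶ C.arr)
  (hs : K ≫ C.arrDom = reind A.src S ≫ H) (ht : K ≫ C.arrCod = reind A.tgt S ≫ H)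
  (hi : A.idm ▷ S.Ob ≫ ob K = ob H ≫ C.idm)
  (hc : ∀ {X : V} (a b : X ⟶ A.Mor) (w : a ≫ A.tgt = b ≫ A.src) (x : X ⟶ S.Ob)
      (w' : (lift a x ≫ ob K) ≫ C.tgt = (lift b x ≫ ob K) ≫ C.src),
      lift (A.comp a b w) x ≫ ob K = C.comp (lift a x ≫ ob K) (lift b x ≫ ob K) w')

theorem mor_glue : ∃ w, mor (glue H K hs ht hi hc) = C.comp
    (lift (fst A.Mor S.Mor) (snd A.Mor S.Mor ≫ S.src) ≫ ob K)
    (lift (fst A.Mor S.Mor ≫ A.tgt) (snd A.Mor S.Mor) ≫ mor H) w := ⟨_, rfl⟩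

theorem part0_glue : part0 (glue H K hs ht hi hc) = H := by
  refine ICat.hom_ext ((ob_part0 _).trans rfl) ?_
  obtain ⟨w, e⟩ := mor_glue H K hs ht hi hc
  rw [mor_part0, e, precomp_comp]
  have e1 : A.idm ▷ S.Mor ≫ lift (fst A.Mor S.Mor) (snd A.Mor S.Mor ≫ S.src) ≫ ob K =
      (A.Ob ◁ S.src ≫ ob H) ≫ C.idm := by
    rw [Category.assoc, ← hi, ← Category.assoc, ← Category.assoc]
    congr 1
    ext <;> simp
  have e2 : A.idm ▷ S.Mor ≫ lift (fst A.Mor S.Mor ≫ A.tgt) (snd A.Mor S.Mor) ≫ mor H =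
      mor H := by
    rw [← Category.assoc]
    refine (congrArg (fun t => t ≫ mor H) ?_).trans (Category.id_comp _)
    ext <;> simp
  have e3 : ((A.Ob ◁ S.src ≫ ob H) ≫ C.idm) ≫ C.tgt = mor H ≫ C.src := by
    rw [mor_src, Category.assoc, idm_tgt, Category.comp_id]
    congr 1
    ext <;> simp
  exact (C.comp_congr' (w' := e3) e1 e2).trans (C.idm_comp _ _ e3)

theorem part1_glue : A.Mor ◁ S.idm ≫ mor (glue H K hs ht hi hc) = ob K := by
  obtain ⟨w, e⟩ := mor_glue H K hs ht hi hc
  rw [e, precomp_comp]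
  have e1 : A.Mor ◁ S.idm ≫ lift (fst A.Mor S.Mor) (snd A.Mor S.Mor ≫ S.src) ≫ ob K = ob K := by
    rw [← Category.assoc]
    refine (congrArg (fun t => t ≫ ob K) ?_).trans (Category.id_comp _)
    ext <;> simp
  have e2 : A.Mor ◁ S.idm ≫ lift (fst A.Mor S.Mor ≫ A.tgt) (snd A.Mor S.Mor) ≫ mor H =
      (A.tgt ▷ S.Ob ≫ ob H) ≫ C.idm := by
    rw [Category.assoc, ← idm_mor, ← Category.assoc, ← Category.assoc]
    congr 1
    ext <;> simp
  have e3 : ob K ≫ C.tgt = ((A.tgt ▷ S.Ob ≫ ob H) ≫ C.idm) ≫ C.src := by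
    have ot : ob K ≫ C.tgt = A.tgt ▷ S.Ob ≫ ob H := (congrArg ob ht).trans (by
      rw [ob_comp, ob_reind])
    rw [ot]; simp
  exact (C.comp_congr' (w' := e3) e1 e2).trans (C.comp_idm _ _ e3)
end

variable [MonoidalClosed V] {J : Type w} {B : J → ICat V} {S : ICat V} {i : ∀ j, B j ⟶ S}

theorem IsCoprod.prod (hS : IsCoprod i) (A : ICat V) : IsCoprod fun j => prodMap A (i j) := by
  intro C G
  obtain ⟨H, hH, -⟩ := hS.disc A.Ob _ fun j => part0 (G j)
  obtain ⟨K, hK, -⟩ := hS.disc A.Mor _ fun j => (part1 (G j)).toArr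
  have oK (j) : A.Mor ◁ ob (i j) ≫ ob K = A.Mor ◁ (B j).idm ≫ mor (G j) := by
    have := congrArg ob (hK j)
    rw [ob_comp, ob_prodMap] at this
    exact this
  have oH (j) : A.Ob ◁ ob (i j) ≫ ob H = ob (G j) := by
    have := congrArg ob (hH j)
    rw [ob_comp, ob_prodMap, ob_part0] at this
    exact this
  have hs : K ≫ C.arrDom = reind A.src S ≫ H := (hS.disc A.Mor).hom_ext fun j => by
    rw [← Category.assoc, hK, ITrans.toArr_dom, ← Category.assoc (prodMap _ _), prodMap_reind,
      Category.assoc, hH]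
  have ht : K ≫ C.arrCod = reind A.tgt S ≫ H := (hS.disc A.Mor).hom_ext fun j => by
    rw [← Category.assoc, hK, ITrans.toArr_cod, ← Category.assoc (prodMap _ _), prodMap_reind,
      Category.assoc, hH]
  have hi : A.idm ▷ S.Ob ≫ ob K = ob H ≫ C.idm := hS.tensor_ob_ext fun j => by
    rw [← Category.assoc, whisker_exchange, Category.assoc, oK, ← Category.assoc, ← Category.assoc,
      oH, ← idm_mor]
    congr 1
    ext <;> simp
  have hc {X : V} (a b : X ⟶ A.Mor) (w : a ≫ A.tgt = b ≫ A.src) (x : X ⟶ S.Ob)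
      (w' : (lift a x ≫ ob K) ≫ C.tgt = (lift b x ≫ ob K) ≫ C.src) :
      lift (A.comp a b w) x ≫ ob K = C.comp (lift a x ≫ ob K) (lift b x ≫ ob K) w' := by
    have w0 : (a ▷ S.Ob ≫ ob K) ≫ C.tgt = (b ▷ S.Ob ≫ ob K) ≫ C.src := by
      have os : ob K ≫ C.src = A.src ▷ S.Ob ≫ ob H := (congrArg ob hs).trans (by
        rw [ob_comp, ob_reind])
      have ot : ob K ≫ C.tgt = A.tgt ▷ S.Ob ≫ ob H := (congrArg ob ht).trans (by
        rw [ob_comp, ob_reind])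
      rw [Category.assoc, ot, Category.assoc, os, ← Category.assoc, ← Category.assoc,
        ← comp_whiskerRight, w, comp_whiskerRight]
    have main : (A.comp a b w) ▷ S.Ob ≫ ob K = C.comp _ _ w0 := hS.tensor_ob_ext fun j => by
      have e (a : X ⟶ A.Mor) : X ◁ ob (i j) ≫ a ▷ S.Ob ≫ ob K =
          lift (fst _ _ ≫ a) (snd _ _ ≫ (B j).idm) ≫ mor (G j) := by
        rw [← Category.assoc, whisker_exchange, Category.assoc, oK, ← Category.assoc]
        congr 1
        ext <;> simp
      have u : lift (fst X (B j).Ob ≫ a) (snd _ _ ≫ (B j).idm) ≫ (A.prod (B j)).tgt =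
          lift (fst X (B j).Ob ≫ b) (snd _ _ ≫ (B j).idm) ≫ (A.prod (B j)).src := by
        ext <;> simp [w]
      refine Eq.trans ?_ (((comp_mor (G j) _ _ u (w_mor (G j) u)).trans
        (C.comp_congr' (e a).symm (e b).symm)).trans (C.precomp_comp _ _ _ w0).symm)
      rw [e]
      rw [prod_comp (w1 := by simp [w]) (w2 := by simp)]
      refine congrArg (fun t => t ≫ mor (G j)) ?_
      ext
      · rw [lift_fst, lift_fst, A.precomp_comp]
        exact A.comp_congr' (lift_fst _ _).symm (lift_fst _ _).symm
      · rw [lift_snd, lift_snd]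
        exact ((B j).idm_comp _ _ (by simp)).symm.trans
          ((B j).comp_congr' (lift_snd _ _).symm (lift_snd _ _).symm)
    have := lift (𝟙 _) x ≫= main
    rw [precomp_comp] at this
    refine Eq.trans ?_ (this.trans (C.comp_congr' ?_ ?_)) <;>
      rw [← Category.assoc, lift_whiskerRight, Category.id_comp]
  have p0 := part0_glue H K hs ht hi hc
  have p1 := part1_glue H K hs ht hi hc
  refine ⟨glue H K hs ht hi hc, fun j => part_ext ?_ ?_, fun F hF => part_ext ?_ ?_⟩
  · rw [← prodMap_part0, p0, hH]
  · rw [← prodMap_part1, p1, oK]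
  · rw [p0]
    apply (hS.disc A.Ob).hom_ext
    intro j
    rw [hH, prodMap_part0, hF]
  · rw [p1]
    apply hS.tensor_ob_ext
    intro j
    rw [oK, prodMap_part1, hF]

end Distrib2
end ICat

namespace ICat

section Coprod

variable {V : Type u} [Category.{v} V] [CartesianMonoidalCategory V] [HasPullbacks V]

theorem prodMap_eq (A : ICat V) {D E : ICat V} (F : D ⟶ E) : prodMap A F = A ◁ F :=
  ICat.hom_ext ((ob_prodMap A F).trans (by
      ext
      · exact (whiskerLeft_fst _ _).trans (congrArg ob (whiskerLeft_fst A F)).symm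
      · exact (whiskerLeft_snd _ _).trans (congrArg ob (whiskerLeft_snd A F)).symm))
    ((mor_prodMap A F).trans (by
      ext
      · exact (whiskerLeft_fst _ _).trans (congrArg mor (whiskerLeft_fst A F)).symm
      · exact (whiskerLeft_snd _ _).trans (congrArg mor (whiskerLeft_snd A F)).symm))

variable [MonoidalClosed V] {J : Type w} {A : J → ICat V} {S : ICat V} {a : ∀ j, A j ⟶ S}

theorem IsCoprod.whiskerLeft (hS : IsCoprod a) (X : ICat V) : IsCoprod fun j => X ◁ a j := by
  have := hS.prod X
  simpa only [prodMap_eq] using this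

/-- The interchange of the factors of a product. -/
noncomputable abbrev sw (X Y : ICat V) : X ⊗ Y ⟶ Y ⊗ X := lift (snd _ _) (fst _ _)

theorem sw_sw (X Y : ICat V) : sw X Y ≫ sw Y X = 𝟙 _ := by
  apply CartesianMonoidalCategory.hom_ext <;> simp [sw]

theorem sw_whisker {X Y Z : ICat V} (f : X ⟶ Y) : f ▷ Z ≫ sw Y Z = sw X Z ≫ Z ◁ f := by
  apply CartesianMonoidalCategory.hom_ext <;> simp [sw]

theorem IsCoprod.whiskerRight (hS : IsCoprod a) (X : ICat V) : IsCoprod fun j => a j ▷ X := by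
  intro C g
  obtain ⟨h, hh, -⟩ := hS.whiskerLeft X C fun j => sw _ _ ≫ g j
  refine ⟨sw _ _ ≫ h, fun j => ?_, fun h' hh' => ?_⟩
  · rw [← Category.assoc, sw_whisker, Category.assoc, hh, ← Category.assoc, sw_sw, Category.id_comp]
  · have : h = sw _ _ ≫ h' := (hS.whiskerLeft X).hom_ext fun j => by
      rw [hh, ← hh']
      simp only [← Category.assoc]
      congr 1
      apply CartesianMonoidalCategory.hom_ext <;> simp [sw]
    rw [this, ← Category.assoc, sw_sw, Category.id_comp]

theorem IsCoprod.tensor {K : Type w} {B : K → ICat V} {T : ICat V} {b : ∀ k, B k ⟶ T}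
    (hS : IsCoprod a) (hT : IsCoprod b) :
    IsCoprod fun p : J × K => a p.1 ⊗ₘ b p.2 := by
  intro C g
  choose h hh _ using fun j => hT.whiskerLeft (A j) C fun k => g (j, k)
  obtain ⟨H, hH, -⟩ := hS.whiskerRight T C h
  refine ⟨H, fun p => ?_, fun H' hH' => ?_⟩
  · change (a p.1 ⊗ₘ b p.2) ≫ H = g p
    rw [tensorHom_def', Category.assoc]
    exact (congrArg _ (hH _)).trans (hh _ _)
  · apply (hS.whiskerRight T).hom_ext
    intro j
    apply (hT.whiskerLeft (A j)).hom_ext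
    intro k
    rw [hH, hh, ← Category.assoc, ← tensorHom_def']
    exact hH' (j, k)

/-- The map out of a coproduct. -/
noncomputable def IsCoprod.desc (hS : IsCoprod a) {C : ICat V} (g : ∀ j, A j ⟶ C) : S ⟶ C :=
  (hS C g).choose

theorem IsCoprod.fac (hS : IsCoprod a) {C : ICat V} (g : ∀ j, A j ⟶ C) (j : J) :
    a j ≫ hS.desc g = g j := (hS C g).choose_spec.1 j

variable [HasColimits (ICat V)]

theorem isCoprod_sigma {J : Type} (A : J → ICat V) : IsCoprod (Sigma.ι A) := fun C g =>
  ⟨Sigma.desc g, fun j => Sigma.ι_desc g j, fun h hh => by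
    apply Sigma.hom_ext
    intro j
    rw [hh, Sigma.ι_desc]⟩

/-- The map out of a product of coproducts with given components. -/
noncomputable def desc2 {J K : Type} {A : J → ICat V} {B : K → ICat V} {C : ICat V}
    (f : ∀ j k, A j ⊗ B k ⟶ C) : (∐ A) ⊗ (∐ B) ⟶ C :=
  ((isCoprod_sigma A).tensor (isCoprod_sigma B)).desc fun p => f p.1 p.2

variable {J K : Type} {A : J → ICat V} {B : K → ICat V} {C : ICat V}

theorem ι_desc2 (f : ∀ j k, A j ⊗ B k ⟶ C) (j : J) (k : K) :
    (Sigma.ι A j ⊗ₘ Sigma.ι B k) ≫ desc2 f = f j k :=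
  ((isCoprod_sigma A).tensor (isCoprod_sigma B)).fac (fun p => f p.1 p.2) (j, k)

theorem hom_ext2 {f g : (∐ A) ⊗ (∐ B) ⟶ C}
    (h : ∀ j k, (Sigma.ι A j ⊗ₘ Sigma.ι B k) ≫ f = (Sigma.ι A j ⊗ₘ Sigma.ι B k) ≫ g) : f = g :=
  ((isCoprod_sigma A).tensor (isCoprod_sigma B)).hom_ext fun p => h p.1 p.2

theorem lift_desc2 {X : ICat V} (f : ∀ j k, A j ⊗ B k ⟶ C) (j : J) (k : K) (x : X ⟶ A j)
    (y : X ⟶ B k) : lift (x ≫ Sigma.ι A j) (y ≫ Sigma.ι B k) ≫ desc2 f = lift x y ≫ f j k := by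
  rw [← ι_desc2 f, ← Category.assoc, lift_map]

end Coprod

section Pi

variable {V : Type u} [Category.{v} V] [HasLimits V]

/-- The product of a family of internal categories. -/
noncomputable abbrev pi {J : Type} (A : J → ICat V) : ICat V :=
  ofPoints (∏ᶜ fun j => (A j).Ob) (∏ᶜ fun j => (A j).Mor) (Limits.Pi.map fun j => (A j).src)
    (Limits.Pi.map fun j => (A j).tgt) (Limits.Pi.map fun j => (A j).idm)
    (fun f g w => Pi.lift fun j => (A j).comp (f ≫ Pi.π _ j) (g ≫ Pi.π _ j)
      (by simpa using congrArg (fun t => t ≫ Pi.π _ j) w))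
    (fun k f g w => by
      apply Pi.hom_ext; intro j
      simp only [Category.assoc, limit.lift_π, Fan.mk_π_app, precomp_comp])
    (by apply Pi.hom_ext; intro j; simp) (by apply Pi.hom_ext; intro j; simp)
    (fun f g w => by apply Pi.hom_ext; intro j; simp)
    (fun f g w => by apply Pi.hom_ext; intro j; simp)
    (fun f => by
      apply Pi.hom_ext; intro j
      simp only [limit.lift_π, Fan.mk_π_app]
      refine ((A j).comp_congr' (f' := ((f ≫ Pi.π _ j) ≫ (A j).src) ≫ (A j).idm) (by simp)
        rfl).trans ((A j).idm_comp _ _ (by simp)))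
    (fun f => by
      apply Pi.hom_ext; intro j
      simp only [limit.lift_π, Fan.mk_π_app]
      refine ((A j).comp_congr' (g' := ((f ≫ Pi.π _ j) ≫ (A j).tgt) ≫ (A j).idm) rfl
        (by simp)).trans ((A j).comp_idm _ _ (by simp)))
    (fun f g h w w' => by
      apply Pi.hom_ext; intro j
      simp only [limit.lift_π, Fan.mk_π_app]
      exact (A j).comp_assoc _ _ _ _ (by simpa using congrArg (fun t => t ≫ Pi.π _ j) w'))

theorem pi_comp {J : Type} (A : J → ICat V) {X : V} (f g : X ⟶ (pi A).Mor)
    (w : f ≫ (pi A).tgt = g ≫ (pi A).src) (j : J) :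
    (pi A).comp f g w ≫ Pi.π _ j = (A j).comp (f ≫ Pi.π _ j) (g ≫ Pi.π _ j)
      (by simpa using congrArg (fun t => t ≫ Pi.π _ j) w) := by
  have : (pi A).comp f g w = Pi.lift fun j => (A j).comp (f ≫ Pi.π _ j) (g ≫ Pi.π _ j)
      (by simpa using congrArg (fun t => t ≫ Pi.π _ j) w) := ofPoints_comp _ _ _ _ _ _ _ _ f g w
  rw [this]
  simp only [limit.lift_π, Fan.mk_π_app]

/-- The projections of `pi`. -/
noncomputable def piπ {J : Type} (A : J → ICat V) (j : J) : pi A ⟶ A j :=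
  IFun.mk' (C := pi A) (Pi.π _ j) (Pi.π _ j) (by simp) (by simp) (by simp)
    (fun f g w w' => pi_comp A f g w j)

/-- The tupling of functors into `pi`. -/
noncomputable def piLift {J : Type} {A : J → ICat V} {X : ICat V} (f : ∀ j, X ⟶ A j) : X ⟶ pi A :=
  IFun.mk' (D := pi A) (Pi.lift fun j => ob (f j)) (Pi.lift fun j => mor (f j))
    (by apply Pi.hom_ext; intro j; simp [mor_src]) (by apply Pi.hom_ext; intro j; simp [mor_tgt])
    (by apply Pi.hom_ext; intro j; simp [idm_mor])
    (fun f' g w w' => by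
      apply Pi.hom_ext; intro j
      rw [pi_comp, Category.assoc]
      simp only [limit.lift_π, Fan.mk_π_app]
      rw [comp_mor (w' := w_mor (f j) w)]
      exact (A j).comp_congr' (by simp) (by simp))

variable {J : Type} {A : J → ICat V} {X Y : ICat V}

theorem piLift_π (f : ∀ j, X ⟶ A j) (j : J) : piLift f ≫ piπ A j = f j :=
  ICat.hom_ext (by exact Pi.lift_π _ _) (by exact Pi.lift_π _ _)

theorem pi_hom_ext {f g : X ⟶ pi A} (h : ∀ j, f ≫ piπ A j = g ≫ piπ A j) : f = g :=
  ICat.hom_ext (Pi.hom_ext _ _ fun j => congrArg ob (h j))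
    (Pi.hom_ext _ _ fun j => congrArg mor (h j))

theorem comp_piLift (k : Y ⟶ X) (f : ∀ j, X ⟶ A j) : k ≫ piLift f = piLift fun j => k ≫ f j :=
  pi_hom_ext fun j => by rw [Category.assoc, piLift_π, piLift_π]

end Pi

end ICat

section Comb

/-- A bijection of index sets of double sums. -/
def sumEquiv {k k' : ℕ} {j : Fin k → ℕ} {j' : Fin k' → ℕ}
    (e : (Σ i, Fin (j i)) ≃ (Σ i, Fin (j' i))) : Fin (∑ i, j i) ≃ Fin (∑ i, j' i) :=
  finSigmaFinEquiv.symm.trans (e.trans finSigmaFinEquiv)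

/-- The permutation of blocks: `(i, a) ↦ (σ i, a)`. -/
def blockPerm {k k' : ℕ} (σ : Fin k ≃ Fin k') (j : Fin k' → ℕ) :
    Fin (∑ i, j (σ i)) ≃ Fin (∑ i, j i) :=
  sumEquiv (Equiv.sigmaCongrLeft (β := fun i => Fin (j i)) σ)

/-- The block sum of permutations: `(i, a) ↦ (i, τ i a)`. -/
def sumPerm {k : ℕ} {j j' : Fin k → ℕ} (τ : ∀ i, Fin (j i) ≃ Fin (j' i)) :
    Fin (∑ i, j i) ≃ Fin (∑ i, j' i) :=
  sumEquiv (Equiv.sigmaCongrRight τ)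

/-- The order-preserving bijection of an iterated sum: `((i, a), b) ↦ (i, (a, b))`. -/
def assocPerm {k : ℕ} (j : Fin k → ℕ) (l : Fin (∑ i, j i) → ℕ) :
    Fin (∑ p, l p) ≃ Fin (∑ i, ∑ a : Fin (j i), l (finSigmaFinEquiv ⟨i, a⟩)) :=
  finSigmaFinEquiv.symm.trans
    (((Equiv.sigmaCongrLeft (β := fun p => Fin (l p)) finSigmaFinEquiv).symm.trans
      ((Equiv.sigmaAssoc fun i a => Fin (l (finSigmaFinEquiv ⟨i, a⟩))).trans
        (Equiv.sigmaCongrRight fun _ => finSigmaFinEquiv))).trans finSigmaFinEquiv)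

theorem sumPerm_apply {k : ℕ} {j j' : Fin k → ℕ} (τ : ∀ i, Fin (j i) ≃ Fin (j' i)) (i : Fin k)
    (a : Fin (j i)) :
    sumPerm τ (finSigmaFinEquiv ⟨i, a⟩) = finSigmaFinEquiv ⟨i, τ i a⟩ := by
  simp only [sumPerm, sumEquiv, Equiv.trans_apply, Equiv.symm_apply_apply]
  rfl

theorem blockPerm_apply {k k' : ℕ} (σ : Fin k ≃ Fin k') (j : Fin k' → ℕ) (i : Fin k)
    (a : Fin (j (σ i))) :
    blockPerm σ j (finSigmaFinEquiv (n := fun i => j (σ i)) ⟨i, a⟩) =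
      finSigmaFinEquiv ⟨σ i, a⟩ := by
  simp only [blockPerm, sumEquiv, Equiv.trans_apply, Equiv.symm_apply_apply]
  rfl

theorem assocPerm_apply {k : ℕ} (j : Fin k → ℕ) (l : Fin (∑ i, j i) → ℕ) (i : Fin k)
    (a : Fin (j i)) (b : Fin (l (finSigmaFinEquiv ⟨i, a⟩))) :
    assocPerm j l (finSigmaFinEquiv ⟨finSigmaFinEquiv ⟨i, a⟩, b⟩) =
      finSigmaFinEquiv (n := fun i => ∑ a : Fin (j i), l (finSigmaFinEquiv ⟨i, a⟩))
        ⟨i, finSigmaFinEquiv (n := fun a => l (finSigmaFinEquiv ⟨i, a⟩)) ⟨a, b⟩⟩ := by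
  simp only [assocPerm, Equiv.trans_apply, Equiv.symm_apply_apply]
  have : (Equiv.sigmaCongrLeft (β := fun p => Fin (l p)) finSigmaFinEquiv).symm
      ⟨finSigmaFinEquiv ⟨i, a⟩, b⟩ = ⟨⟨i, a⟩, b⟩ := by
    rw [Equiv.symm_apply_eq]
    rfl
  rw [this]
  rfl

/-- A based function `{0, …, m} → {0, …, n}`, given by its values on the non-basepoints; `none`
is the basepoint. -/
abbrev FHom (m n : ℕ) : Type := Fin m → Option (Fin n)

namespace FHom

def id (n : ℕ) : FHom n n := some
def comp {m n p : ℕ} (φ : FHom m n) (ψ : FHom n p) : FHom m p := fun i => (φ i).bind ψ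

theorem id_comp {m n : ℕ} (φ : FHom m n) : (id m).comp φ = φ := rfl
theorem comp_id {m n : ℕ} (φ : FHom m n) : φ.comp (id n) = φ := by
  funext i; unfold comp id; cases φ i <;> rfl
theorem comp_assoc {m n p q : ℕ} (φ : FHom m n) (ψ : FHom n p) (χ : FHom p q) :
    (φ.comp ψ).comp χ = φ.comp (ψ.comp χ) := by
  funext i; unfold comp; cases φ i <;> rfl

variable {m n p q : ℕ}

/-- The number of elements that are sent to `j`. -/
def deg (φ : FHom m n) (j : Fin n) : ℕ := (Finset.univ.filter fun i => φ i = some j).card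

/-- The elements that are sent to `j`, in their natural order. -/
def fibEquiv (φ : FHom m n) (j : Fin n) : Fin (φ.deg j) ≃ {i // φ i = some j} :=
  ((Finset.univ.filter fun i => φ i = some j).orderIsoOfFin rfl).toEquiv.trans
    (Equiv.subtypeEquivRight fun i => by simp)

def fib (φ : FHom m n) (j : Fin n) (a : Fin (φ.deg j)) : Fin m := (φ.fibEquiv j a).1

theorem map_fib (φ : FHom m n) (j : Fin n) (a : Fin (φ.deg j)) : φ (φ.fib j a) = some j :=
  (φ.fibEquiv j a).2

theorem fib_injective (φ : FHom m n) (j : Fin n) : Function.Injective (φ.fib j) := fun _ _ h =>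
  (φ.fibEquiv j).injective (Subtype.ext h)

theorem fib_cast (φ : FHom m n) {j j' : Fin n} (h : j = j') {a : Fin (φ.deg j)}
    {a' : Fin (φ.deg j')} (ha : (a : ℕ) = a') : φ.fib j a = φ.fib j' a' := by
  subst h
  rw [Fin.ext ha]

theorem fib_strictMono (φ : FHom m n) (j : Fin n) : StrictMono (φ.fib j) := fun _ _ h =>
  ((Finset.univ.filter fun i => φ i = some j).orderIsoOfFin rfl).strictMono h

/-- The inverse image of `k` under a composite, as a union of inverse images. -/
noncomputable def fibComp (φ : FHom m n) (ψ : FHom n p) (k : Fin p) :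
    {i // φ.comp ψ i = some k} ≃ Σ j : {j // ψ j = some k}, {i // φ i = some j.1} :=
  (Equiv.ofBijective (fun s : Σ j : {j // ψ j = some k}, {i // φ i = some j.1} =>
      (⟨s.2.1, by unfold comp; rw [s.2.2]; exact s.1.2⟩ : {i // φ.comp ψ i = some k}))
    ⟨by
      rintro ⟨⟨j, hj⟩, ⟨i, hi⟩⟩ ⟨⟨j', hj'⟩, ⟨i', hi'⟩⟩ h
      obtain rfl : i = i' := congrArg Subtype.val h
      obtain rfl : j = j' := Option.some_injective _ (hi.symm.trans hi')
      rfl, by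
      rintro ⟨i, hi⟩
      unfold comp at hi
      obtain ⟨j, h1, h2⟩ := Option.bind_eq_some_iff.1 hi
      exact ⟨⟨⟨j, h2⟩, ⟨i, h1⟩⟩, rfl⟩⟩).symm

/-- The bijection from the inverse image of `k` under a composite, in its natural order, to the
union of the blocks `φ⁻¹(j)` for `j` in `ψ⁻¹(k)`. -/
noncomputable def rho (φ : FHom m n) (ψ : FHom n p) (k : Fin p) :
    Fin ((φ.comp ψ).deg k) ≃ Fin (∑ j : Fin (ψ.deg k), φ.deg (ψ.fib k j)) :=
  ((φ.comp ψ).fibEquiv k).trans ((φ.fibComp ψ k).trans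
    (((Equiv.sigmaCongrLeft (β := fun j => {i // φ i = some j.1}) (ψ.fibEquiv k)).symm.trans
      (Equiv.sigmaCongrRight fun j => (φ.fibEquiv (ψ.fib k j)).symm)).trans finSigmaFinEquiv))

theorem rho_spec (φ : FHom m n) (ψ : FHom n p) (k : Fin p) (a : Fin ((φ.comp ψ).deg k)) :
    φ.fib _ (finSigmaFinEquiv.symm (φ.rho ψ k a)).2 = (φ.comp ψ).fib k a := by
  obtain ⟨⟨j, b⟩, h⟩ := finSigmaFinEquiv.surjective (φ.rho ψ k a)
  rw [← h, Equiv.symm_apply_apply]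
  unfold rho at h
  have h2 : (φ.comp ψ).fibEquiv k a = (φ.fibComp ψ k).symm
      (((Equiv.sigmaCongrLeft (β := fun j => {i // φ i = some j.1}) (ψ.fibEquiv k)).symm.trans
      (Equiv.sigmaCongrRight fun j => (φ.fibEquiv (ψ.fib k j)).symm)).symm ⟨j, b⟩) := by
    rw [Equiv.eq_symm_apply, Equiv.eq_symm_apply]
    exact finSigmaFinEquiv.injective h.symm
  exact (congrArg Subtype.val h2).symm

theorem rho_spec' (φ : FHom m n) (ψ : FHom n p) (k : Fin p) (a : Fin ((φ.comp ψ).deg k)) :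
    φ ((φ.comp ψ).fib k a) = some (ψ.fib k (finSigmaFinEquiv.symm (φ.rho ψ k a)).1) := by
  rw [← rho_spec]
  exact map_fib φ _ _

theorem deg_id (n : ℕ) (j : Fin n) : (id n).deg j = 1 := by
  unfold deg id
  rw [Finset.card_eq_one]
  exact ⟨j, by ext i; simp⟩

end FHom
end Comb

namespace ICat
variable (V : Type u) [Category.{v} V] [CartesianMonoidalCategory V] [HasLimits V]

/-- The data of a symmetric operad in `Cat(V)`. The symmetric groups act on the right; the action
of `Σ_n` is indexed by the bijections between standard finite sets. -/
structure OperadData where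
  obj : ℕ → ICat V
  act : ∀ {m n : ℕ}, (Fin m ≃ Fin n) → (obj n ⟶ obj m)
  unit : 𝟙_ (ICat V) ⟶ obj 1
  γ : ∀ {k : ℕ} (j : Fin k → ℕ), obj k ⊗ pi (fun i => obj (j i)) ⟶ obj (∑ i, j i)

variable {V} in
/-- The composition `γ(x; y_1, …, y_k)` of generalized elements. -/
noncomputable def OperadData.gam (O : OperadData V) {X : ICat V} {k : ℕ} {j : Fin k → ℕ}
    (x : X ⟶ O.obj k) (y : ∀ i, X ⟶ O.obj (j i)) : X ⟶ O.obj (∑ i, j i) :=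
  lift x (piLift y) ≫ O.γ j

/-- A (reduced, symmetric) operad in `Cat(V)`. -/
structure Operad extends OperadData V where
  reduced : IsTerminal (obj 0)
  act_refl : ∀ n, act (Equiv.refl (Fin n)) = 𝟙 _
  act_trans : ∀ {m n p : ℕ} (σ : Fin m ≃ Fin n) (τ : Fin n ≃ Fin p),
    act (σ.trans τ) = act τ ≫ act σ
  unit_gam : ∀ {X : ICat V} {n : ℕ} (y : X ⟶ obj n),
    toOperadData.gam (k := 1) (toUnit X ≫ unit) (fun _ => y) =
      y ≫ act (finCongr (by simp))
  gam_unit : ∀ {X : ICat V} {k : ℕ} (x : X ⟶ obj k),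
    toOperadData.gam x (fun _ => toUnit X ≫ unit) = x ≫ act (finCongr (by simp))
  assoc : ∀ {X : ICat V} {k : ℕ} {j : Fin k → ℕ} {l : Fin (∑ i, j i) → ℕ} (x : X ⟶ obj k)
    (y : ∀ i, X ⟶ obj (j i)) (z : ∀ p, X ⟶ obj (l p)),
    toOperadData.gam (toOperadData.gam x y) z =
      toOperadData.gam x (fun i => toOperadData.gam (y i) fun a => z (finSigmaFinEquiv ⟨i, a⟩)) ≫
        act (assocPerm j l)
  equiv_left : ∀ {X : ICat V} {k k' : ℕ} (σ : Fin k ≃ Fin k') {j : Fin k' → ℕ} (x : X ⟶ obj k')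
    (y : ∀ i, X ⟶ obj (j i)),
    toOperadData.gam (x ≫ act σ) (fun i => y (σ i)) = toOperadData.gam x y ≫ act (blockPerm σ j)
  equiv_right : ∀ {X : ICat V} {k : ℕ} {j j' : Fin k → ℕ} (τ : ∀ i, Fin (j i) ≃ Fin (j' i))
    (x : X ⟶ obj k) (y : ∀ i, X ⟶ obj (j' i)),
    toOperadData.gam x (fun i => y i ≫ act (τ i)) = toOperadData.gam x y ≫ act (sumPerm τ)

end ICat

theorem sumPerm_refl {k : ℕ} (j : Fin k → ℕ) :
    sumPerm (fun i => Equiv.refl (Fin (j i))) = Equiv.refl _ := by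
  ext p; simp [sumPerm, sumEquiv]

namespace ICat
variable {V : Type u} [Category.{v} V] [CartesianMonoidalCategory V] [HasLimits V]

namespace Operad
variable (O : Operad V)

theorem comp_gam {X Y : ICat V} (f : Y ⟶ X) {k : ℕ} {j : Fin k → ℕ}
    (x : X ⟶ O.obj k) (y : ∀ i, X ⟶ O.obj (j i)) :
    f ≫ O.gam x y = O.gam (f ≫ x) fun i => f ≫ y i := by
  unfold OperadData.gam
  rw [← Category.assoc, comp_lift, comp_piLift]

theorem gam_congr {X : ICat V} {n k : ℕ} {N : Fin n → ℕ} (c : ∀ b, X ⟶ O.obj (N b))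
    {f f' : Fin k → Fin n} (h : ∀ i, f i = f' i) (x : X ⟶ O.obj k) :
    O.gam x (fun i => c (f i)) = O.gam x (fun i => c (f' i)) ≫
      O.act (sumPerm fun i => finCongr (by rw [h])) := by
  obtain rfl := funext h
  have : (sumPerm fun i => finCongr (rfl : N (f i) = N (f i))) = Equiv.refl _ :=
    sumPerm_refl _
  rw [this, O.act_refl, Category.comp_id]

theorem act_act {m n p : ℕ} {X : ICat V} (x : X ⟶ O.obj p) (τ : Fin n ≃ Fin p) (σ : Fin m ≃ Fin n) :
    (x ≫ O.act τ) ≫ O.act σ = x ≫ O.act (σ.trans τ) := by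
  rw [O.act_trans, Category.assoc]

variable [MonoidalClosed V] [HasColimits (ICat V)]

/-- The summand of the morphism categories of the category of operators indexed by `φ`. -/
noncomputable abbrev summand {m n : ℕ} (φ : FHom m n) : ICat V := pi fun j => O.obj (φ.deg j)

/-- The morphism categories of the category of operators. -/
noncomputable def hom (m n : ℕ) : ICat V := ∐ fun φ : FHom m n => O.summand φ

noncomputable def incl {m n : ℕ} (φ : FHom m n) : O.summand φ ⟶ O.hom m n :=
  Sigma.ι (fun φ : FHom m n => O.summand φ) φ

/-- The morphism `(φ; c)`. -/
noncomputable def pt {X : ICat V} {m n : ℕ} (φ : FHom m n) (c : ∀ j, X ⟶ O.obj (φ.deg j)) :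
    X ⟶ O.hom m n :=
  piLift c ≫ O.incl φ

/-- Composition on summands. -/
noncomputable def compS {m n p : ℕ} (φ : FHom m n) (ψ : FHom n p) :
    O.summand φ ⊗ O.summand ψ ⟶ O.summand (φ.comp ψ) :=
  piLift fun k => O.gam (snd _ _ ≫ piπ _ k) (fun i => fst _ _ ≫ piπ _ (ψ.fib k i)) ≫
    O.act (φ.rho ψ k)

/-- Composition in the category of operators. -/
noncomputable def compD (m n p : ℕ) : O.hom m n ⊗ O.hom n p ⟶ O.hom m p :=
  desc2 fun φ ψ => O.compS φ ψ ≫ O.incl (φ.comp ψ)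

/-- The identities of the category of operators. -/
noncomputable def idD (n : ℕ) : 𝟙_ (ICat V) ⟶ O.hom n n :=
  O.pt (FHom.id n) fun j => O.unit ≫ O.act (finCongr (FHom.deg_id n j))

theorem comp_pt {X Y : ICat V} (f : Y ⟶ X) {m n : ℕ} (φ : FHom m n)
    (c : ∀ j, X ⟶ O.obj (φ.deg j)) : f ≫ O.pt φ c = O.pt φ fun j => f ≫ c j := by
  unfold pt
  rw [← Category.assoc, comp_piLift]

theorem incl_eq_pt {m n : ℕ} (φ : FHom m n) : O.incl φ = O.pt φ fun j => piπ _ j := by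
  unfold pt
  rw [show piLift (fun j => piπ (fun j => O.obj (φ.deg j)) j) = 𝟙 _ from
    pi_hom_ext fun j => by rw [piLift_π, Category.id_comp], Category.id_comp]

theorem hom_ext1 {m n : ℕ} {C : ICat V} {f g : O.hom m n ⟶ C}
    (h : ∀ (X : ICat V) (φ : FHom m n) (c : ∀ j, X ⟶ O.obj (φ.deg j)),
      O.pt φ c ≫ f = O.pt φ c ≫ g) : f = g := by
  apply Sigma.hom_ext
  intro φ
  have := h _ φ fun j => piπ _ j
  rwa [← incl_eq_pt] at this

theorem isCoprod_hom (m n : ℕ) : IsCoprod fun φ : FHom m n => O.incl φ := isCoprod_sigma _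

theorem hom_ext2' {m n m' n' : ℕ} {C : ICat V} {f g : O.hom m n ⊗ O.hom m' n' ⟶ C}
    (h : ∀ (X : ICat V) (φ : FHom m n) (c : ∀ j, X ⟶ O.obj (φ.deg j)) (ψ : FHom m' n')
      (d : ∀ j, X ⟶ O.obj (ψ.deg j)), lift (O.pt φ c) (O.pt ψ d) ≫ f =
        lift (O.pt φ c) (O.pt ψ d) ≫ g) : f = g := by
  apply ((O.isCoprod_hom m n).tensor (O.isCoprod_hom m' n')).hom_ext
  rintro ⟨φ, ψ⟩
  have := h (O.summand φ ⊗ O.summand ψ) φ (fun j => fst _ _ ≫ piπ _ j) ψ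
    (fun j => snd _ _ ≫ piπ _ j)
  rw [← comp_pt, ← comp_pt, ← incl_eq_pt, ← incl_eq_pt] at this
  convert! this using 2 <;> (apply CartesianMonoidalCategory.hom_ext <;> simp)

theorem hom_ext3 {m n m' n' m'' n'' : ℕ} {C : ICat V}
    {f g : O.hom m n ⊗ (O.hom m' n' ⊗ O.hom m'' n'') ⟶ C}
    (h : ∀ (X : ICat V) (φ : FHom m n) (c : ∀ j, X ⟶ O.obj (φ.deg j)) (ψ : FHom m' n')
      (d : ∀ j, X ⟶ O.obj (ψ.deg j)) (χ : FHom m'' n'') (e : ∀ j, X ⟶ O.obj (χ.deg j)),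
      lift (O.pt φ c) (lift (O.pt ψ d) (O.pt χ e)) ≫ f =
        lift (O.pt φ c) (lift (O.pt ψ d) (O.pt χ e)) ≫ g) : f = g := by
  apply ((O.isCoprod_hom m n).tensor
    ((O.isCoprod_hom m' n').tensor (O.isCoprod_hom m'' n''))).hom_ext
  rintro ⟨φ, ψ, χ⟩
  have := h (O.summand φ ⊗ (O.summand ψ ⊗ O.summand χ)) φ (fun j => fst _ _ ≫ piπ _ j) ψ
    (fun j => (snd _ _ ≫ fst _ _) ≫ piπ _ j) χ (fun j => (snd _ _ ≫ snd _ _) ≫ piπ _ j)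
  rw [← comp_pt, ← comp_pt, ← comp_pt, ← incl_eq_pt, ← incl_eq_pt, ← incl_eq_pt] at this
  convert! this using 2 <;> (apply CartesianMonoidalCategory.hom_ext) <;>
    [simp; (apply CartesianMonoidalCategory.hom_ext <;> simp);
     simp; (apply CartesianMonoidalCategory.hom_ext <;> simp)]

theorem pt_comp {X : ICat V} {m n p : ℕ} (φ : FHom m n) (c : ∀ j, X ⟶ O.obj (φ.deg j))
    (ψ : FHom n p) (d : ∀ j, X ⟶ O.obj (ψ.deg j)) :
    lift (O.pt φ c) (O.pt ψ d) ≫ O.compD m n p =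
      O.pt (φ.comp ψ) fun k => O.gam (d k) (fun i => c (ψ.fib k i)) ≫ O.act (φ.rho ψ k) := by
  refine (lift_desc2 (fun φ ψ => O.compS φ ψ ≫ O.incl (φ.comp ψ)) φ ψ (piLift c)
    (piLift d)).trans ?_
  unfold pt compS
  rw [← Category.assoc]
  refine congrArg (fun t => t ≫ O.incl (φ.comp ψ)) ?_
  apply pi_hom_ext
  intro k
  rw [Category.assoc, piLift_π, piLift_π, ← Category.assoc, comp_gam]
  congr 2
  · rw [← Category.assoc, lift_snd, piLift_π]
  · funext i
    rw [← Category.assoc, lift_fst, piLift_π]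

theorem pt_congr {X : ICat V} {m n : ℕ} {φ φ' : FHom m n} (h : φ = φ')
    {c : ∀ j, X ⟶ O.obj (φ.deg j)} {c' : ∀ j, X ⟶ O.obj (φ'.deg j)}
    (e : ∀ j, Fin (φ.deg j) ≃ Fin (φ'.deg j)) (he : ∀ j a, φ'.fib j (e j a) = φ.fib j a)
    (hc : ∀ j, c j = c' j ≫ O.act (e j)) : O.pt φ c = O.pt φ' c' := by
  subst h
  have : c = c' := by
    funext j
    have : e j = Equiv.refl _ := by
      ext a; exact congrArg _ (φ.fib_injective j (he j a))
    rw [hc, this, O.act_refl, Category.comp_id]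
  rw [this]

theorem gam_id {X : ICat V} {m : ℕ} (y : X ⟶ O.obj m) :
    O.gam (k := 1) (toUnit X ≫ O.unit) (fun _ => y) = y ≫ O.act (finCongr (by simp)) :=
  O.unit_gam y

theorem id_comp' {m n : ℕ} {X : ICat V} (φ : FHom m n) (c : ∀ j, X ⟶ O.obj (φ.deg j)) :
    lift (toUnit X ≫ O.idD m) (O.pt φ c) ≫ O.compD m m n = O.pt φ c := by
  unfold idD
  rw [comp_pt, pt_comp]
  have key (k : Fin n) : O.gam (c k) (fun i => toUnit X ≫ O.unit ≫
      O.act (finCongr (FHom.deg_id m (φ.fib k i)))) =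
      c k ≫ O.act ((sumPerm fun i => finCongr (FHom.deg_id m (φ.fib k i))).trans
        (finCongr (by simp))) := by
    have := O.equiv_right (fun i => finCongr (FHom.deg_id m (φ.fib k i))) (c k)
      (fun _ => toUnit X ≫ O.unit)
    simp only [Category.assoc] at this
    rw [this, O.gam_unit, act_act]
  refine O.pt_congr (FHom.id_comp φ) (fun k => ((FHom.id m).rho φ k).trans
    ((sumPerm fun i => finCongr (FHom.deg_id m (φ.fib k i))).trans (finCongr (by simp))))
    (fun k a => ?_) (fun k => ?_)
  · have h := FHom.rho_spec' (FHom.id m) φ k a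
    have h2 := (Option.some_injective _ h).symm
    refine Eq.trans ?_ h2
    congr 1
    obtain ⟨⟨i, b⟩, e⟩ := finSigmaFinEquiv.surjective ((FHom.id m).rho φ k a)
    simp only [Equiv.trans_apply, sumPerm, sumEquiv]
    rw [← e, Equiv.symm_apply_apply]
    ext
    have hb : (b : ℕ) = 0 := by
      have := b.2.trans_eq (FHom.deg_id m (φ.fib k i))
      omega
    simp only [Equiv.sigmaCongrRight_apply, finCongr_apply, Fin.val_cast, finSigmaFinEquiv_apply]
    simp [hb]
  · rw [key, act_act]

theorem comp_id' {m n : ℕ} {X : ICat V} (φ : FHom m n) (c : ∀ j, X ⟶ O.obj (φ.deg j)) :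
    lift (O.pt φ c) (toUnit X ≫ O.idD n) ≫ O.compD m n n = O.pt φ c := by
  unfold idD
  rw [comp_pt, pt_comp]
  have hf (k : Fin n) (i : Fin ((FHom.id n).deg k)) : (FHom.id n).fib k i = k :=
    Option.some_injective _ (FHom.map_fib (FHom.id n) k i)
  let z (k : Fin n) := ((sumPerm fun i => finCongr (congrArg φ.deg (hf k i))).trans
        (blockPerm (finCongr (FHom.deg_id n k)) fun _ => φ.deg k)).trans
        (finCongr (by simp) : _ ≃ Fin (φ.deg k))
  have key (k : Fin n) : O.gam (toUnit X ≫ O.unit ≫ O.act (finCongr (FHom.deg_id n k)))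
      (fun i => c ((FHom.id n).fib k i)) = c k ≫ O.act (z k) := by
    have := O.equiv_left (finCongr (FHom.deg_id n k)) (toUnit X ≫ O.unit) (fun _ => c k)
    rw [Category.assoc] at this
    rw [O.gam_congr c (hf k)]
    refine (congrArg (fun t => t ≫ _) this).trans ?_
    rw [gam_id, act_act, act_act]
  refine O.pt_congr (FHom.comp_id φ) (fun k => (φ.rho (FHom.id n) k).trans (z k))
    (fun k a => ?_) (fun k => ?_)
  · refine Eq.trans ?_ (FHom.rho_spec φ (FHom.id n) k a)
    obtain ⟨⟨i, b⟩, e⟩ := finSigmaFinEquiv.surjective (φ.rho (FHom.id n) k a)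
    refine φ.fib_cast (by rw [hf]) ?_
    simp only [Equiv.trans_apply, z, sumPerm, sumEquiv, blockPerm]
    rw [← e, Equiv.symm_apply_apply]
    simp only [Equiv.sigmaCongrRight_apply, finCongr_apply, Fin.val_cast, Equiv.symm_apply_apply]
    have : (Equiv.sigmaCongrLeft (β := fun _ => Fin (φ.deg k)) (finCongr (FHom.deg_id n k)))
      ⟨i, Fin.cast (congrArg φ.deg (hf k i)) b⟩ = ⟨0, Fin.cast (congrArg φ.deg (hf k i)) b⟩ :=
      Sigma.ext (Subsingleton.elim _ _) HEq.rfl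
    refine (congrArg (fun t => (finSigmaFinEquiv t).val) this).trans ?_
    rw [Equiv.symm_apply_apply]
    simp [finSigmaFinEquiv_apply]
  · rw [key, act_act]

theorem assoc' {m n p q : ℕ} {X : ICat V} (φ : FHom m n) (c : ∀ j, X ⟶ O.obj (φ.deg j))
    (ψ : FHom n p) (d : ∀ j, X ⟶ O.obj (ψ.deg j)) (χ : FHom p q)
    (e : ∀ j, X ⟶ O.obj (χ.deg j)) :
    lift (lift (O.pt φ c) (O.pt ψ d) ≫ O.compD m n p) (O.pt χ e) ≫ O.compD m p q =
      lift (O.pt φ c) (lift (O.pt ψ d) (O.pt χ e) ≫ O.compD n p q) ≫ O.compD m n q := by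
  rw [pt_comp, pt_comp, pt_comp, pt_comp]
  -- the common value
  let t (l : Fin q) : X ⟶ _ := O.gam (e l) fun k => O.gam (d (χ.fib l k)) fun a =>
    c (ψ.fib (χ.fib l k) a)
  let E1 (l : Fin q) := ((φ.comp ψ).rho χ l).trans (sumPerm fun k => φ.rho ψ (χ.fib l k))
  have h1 (l : Fin q) : (O.gam (e l) fun i => (O.gam (d (χ.fib l i)) fun i_1 =>
      c (ψ.fib (χ.fib l i) i_1)) ≫ O.act (φ.rho ψ (χ.fib l i))) ≫ O.act ((φ.comp ψ).rho χ l) =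
      t l ≫ O.act (E1 l) := by
    rw [O.equiv_right, act_act]
  let idx (l : Fin q) (r : Fin (∑ k : Fin (χ.deg l), ψ.deg (χ.fib l k))) : Fin n :=
    ψ.fib _ (finSigmaFinEquiv.symm r).2
  have hidx (l : Fin q) (i) : (ψ.comp χ).fib l i = idx l (ψ.rho χ l i) :=
    (FHom.rho_spec ψ χ l i).symm
  have hidx' (l : Fin q) (k) (a) : idx l (finSigmaFinEquiv ⟨k, a⟩) = ψ.fib (χ.fib l k) a := by
    simp only [idx]
    rw [Equiv.symm_apply_apply]
  let E2 (l : Fin q) := (φ.rho (ψ.comp χ) l).trans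
    ((sumPerm fun i => finCongr (congrArg φ.deg (hidx l i))).trans
      ((blockPerm (ψ.rho χ l) fun r => φ.deg (idx l r)).trans
        ((assocPerm _ _).trans
          (sumPerm fun k => sumPerm fun a => finCongr (congrArg φ.deg (hidx' l k a))))))
  have h2 (l : Fin q) : (O.gam ((O.gam (e l) fun i => d (χ.fib l i)) ≫ O.act (ψ.rho χ l)) fun i =>
      c ((ψ.comp χ).fib l i)) ≫ O.act (φ.rho (ψ.comp χ) l) = t l ≫ O.act (E2 l) := by
    rw [O.gam_congr c (hidx l), O.equiv_left (ψ.rho χ l) _ (fun r => c (idx l r)), O.assoc]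
    have h3 : (fun i => O.gam (d (χ.fib l i)) fun a => c (idx l (finSigmaFinEquiv ⟨i, a⟩))) =
        fun i => (O.gam (d (χ.fib l i)) fun a => c (ψ.fib (χ.fib l i) a)) ≫
          O.act (sumPerm fun a => finCongr (congrArg φ.deg (hidx' l i a))) :=
      funext fun i => O.gam_congr c (hidx' l i) _
    rw [h3, O.equiv_right, act_act, act_act, act_act, act_act]
    exact congrArg (fun z => t l ≫ O.act z) (Equiv.ext fun _ => by rfl)
  refine O.pt_congr (FHom.comp_assoc φ ψ χ) (fun l => (E1 l).trans (E2 l).symm)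
    (fun l a => ?_) (fun l => ?_)
  · let L (x : Fin (∑ k, ∑ a, φ.deg (ψ.fib (χ.fib l k) a))) : Fin m :=
      φ.fib _ (finSigmaFinEquiv.symm (finSigmaFinEquiv.symm x).2).2
    have hL (k a b) : L (finSigmaFinEquiv (n := fun k => ∑ a, φ.deg (ψ.fib (χ.fib l k) a))
        ⟨k, finSigmaFinEquiv (n := fun a => φ.deg (ψ.fib (χ.fib l k) a)) ⟨a, b⟩⟩) =
        φ.fib _ b := by
      simp only [L]
      rw [Equiv.symm_apply_apply, Equiv.symm_apply_apply]
    have hL' (k x) : L (finSigmaFinEquiv (n := fun k => ∑ a, φ.deg (ψ.fib (χ.fib l k) a))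
        ⟨k, x⟩) = φ.fib _ (finSigmaFinEquiv.symm x).2 := by
      simp only [L]
      rw [Equiv.symm_apply_apply]
    have c1 (a) : L (E1 l a) = ((φ.comp ψ).comp χ).fib l a := by
      rw [← FHom.rho_spec (φ.comp ψ) χ l a]
      obtain ⟨⟨k, x⟩, h⟩ := finSigmaFinEquiv.surjective ((φ.comp ψ).rho χ l a)
      have : E1 l a = finSigmaFinEquiv ⟨k, φ.rho ψ _ x⟩ := by
        simp only [E1, Equiv.trans_apply]
        rw [← h, sumPerm_apply]
      rw [this, hL', FHom.rho_spec, ← h, Equiv.symm_apply_apply]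
    have c3 (r) (y : Fin (φ.deg (idx l r))) :
        L (sumPerm (fun k => sumPerm fun a => finCongr (congrArg φ.deg (hidx' l k a)))
          (assocPerm _ (fun r => φ.deg (idx l r)) (finSigmaFinEquiv ⟨r, y⟩))) = φ.fib _ y := by
      obtain ⟨⟨k, a⟩, rfl⟩ := finSigmaFinEquiv.surjective r
      rw [assocPerm_apply, sumPerm_apply, sumPerm_apply, hL]
      exact φ.fib_cast (hidx' l k a).symm rfl
    have c2 (b) : L (E2 l b) = (φ.comp (ψ.comp χ)).fib l b := by
      rw [← FHom.rho_spec φ (ψ.comp χ) l b]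
      obtain ⟨⟨i, x⟩, h⟩ := finSigmaFinEquiv.surjective (φ.rho (ψ.comp χ) l b)
      rw [← h, Equiv.symm_apply_apply]
      simp only [E2, Equiv.trans_apply]
      rw [← h, sumPerm_apply, blockPerm_apply]
      rw [c3]
      exact φ.fib_cast (hidx l i).symm rfl
    have := (c2 ((E2 l).symm (E1 l a))).symm
    rw [Equiv.apply_symm_apply] at this
    exact this.trans (c1 a)
  · rw [h1, h2, act_act]
    congr 2
    ext; simp

end Operad
end ICat

namespace FHom

/-- The morphisms of the subcategory `Π`. -/
def Small {m n : ℕ} (φ : FHom m n) : Prop := ∀ j, φ.deg j ≤ 1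

theorem small_id (n : ℕ) : (id n).Small := fun j => (deg_id n j).le

theorem Small.comp {m n p : ℕ} {φ : FHom m n} {ψ : FHom n p} (hφ : φ.Small) (hψ : ψ.Small) :
    (φ.comp ψ).Small := fun k => by
  rw [Fin.equiv_iff_eq.1 ⟨φ.rho ψ k⟩]
  refine (Finset.sum_le_card_nsmul _ _ 1 fun i _ => hφ _).trans ?_
  simpa using hψ k

end FHom

/-- The morphisms of the category `Π`. -/
abbrev PHom (m n : ℕ) : Type := {φ : FHom m n // φ.Small}

namespace ICat
variable {V : Type u} [Category.{v} V] [CartesianMonoidalCategory V] [MonoidalClosed V]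
  [HasLimits V] [HasColimits (ICat V)]

section Discrete

variable (V) in
/-- The discrete internal category `∐_S *` on a set. -/
noncomputable abbrev VS (S : Type) : ICat V := ∐ fun _ : S => 𝟙_ (ICat V)

/-- The element `s`. -/
noncomputable def el {S : Type} (X : ICat V) (s : S) : X ⟶ VS V S :=
  toUnit X ≫ Sigma.ι (fun _ : S => 𝟙_ (ICat V)) s

theorem comp_el {S : Type} {X Y : ICat V} (f : X ⟶ Y) (s : S) : f ≫ el Y s = el X s := by
  unfold el; rw [← Category.assoc, toUnit_unique (f ≫ toUnit Y) (toUnit X)]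

theorem isCoprod_VS (S : Type) : IsCoprod fun s : S => el (𝟙_ (ICat V)) s := by
  have := isCoprod_sigma (fun _ : S => 𝟙_ (ICat V))
  convert! this using 2
  unfold el
  rw [toUnit_unique (toUnit (𝟙_ (ICat V))) (𝟙 _), Category.id_comp]

theorem VS_ext {S : Type} {C : ICat V} {f g : VS V S ⟶ C}
    (h : ∀ X s, el X s ≫ f = el X s ≫ g) : f = g :=
  (isCoprod_VS S).hom_ext fun s => h _ s

theorem VS_ext2 {S S' : Type} {C : ICat V} {f g : VS V S ⊗ VS V S' ⟶ C}
    (h : ∀ X s s', lift (el X s) (el X s') ≫ f = lift (el X s) (el X s') ≫ g) : f = g := by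
  refine ((isCoprod_VS S).tensor (isCoprod_VS S')).hom_ext fun p => ?_
  have := h (𝟙_ (ICat V) ⊗ 𝟙_ (ICat V)) p.1 p.2
  rw [← comp_el (fst _ _), ← comp_el (snd _ _)] at this
  convert! this using 2

theorem VS_ext3 {S S' S'' : Type} {C : ICat V} {f g : VS V S ⊗ (VS V S' ⊗ VS V S'') ⟶ C}
    (h : ∀ X s s' s'', lift (el X s) (lift (el X s') (el X s'')) ≫ f =
      lift (el X s) (lift (el X s') (el X s'')) ≫ g) : f = g := by
  refine ((isCoprod_VS S).tensor ((isCoprod_VS S').tensor (isCoprod_VS S''))).hom_ext fun p => ?_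
  have := h (𝟙_ (ICat V) ⊗ (𝟙_ (ICat V) ⊗ 𝟙_ (ICat V))) p.1 p.2.1 p.2.2
  rw [← comp_el (fst _ _), ← comp_el (snd _ _ ≫ fst _ _) p.2.1,
    ← comp_el (snd _ _ ≫ snd _ _) p.2.2] at this
  convert! this using 2 <;> (apply CartesianMonoidalCategory.hom_ext) <;>
    [simp; (apply CartesianMonoidalCategory.hom_ext <;> simp);
     simp; (apply CartesianMonoidalCategory.hom_ext <;> simp)]

variable (V) in
/-- The functor of discrete categories induced by a function. -/
noncomputable def vmap {S T : Type} (f : S → T) : VS V S ⟶ VS V T :=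
  Sigma.desc (C := ICat V) (f := fun _ : S => 𝟙_ (ICat V)) fun s => el _ (f s)

variable (V) in
/-- The functor of discrete categories induced by a function of two variables. -/
noncomputable def vmap2 {S S' T : Type} (f : S → S' → T) : VS V S ⊗ VS V S' ⟶ VS V T :=
  desc2 fun s s' => el _ (f s s')

theorem el_vmap {S T : Type} (f : S → T) (X : ICat V) (s : S) :
    el X s ≫ vmap V f = el X (f s) := by
  unfold vmap
  rw [el, Category.assoc]
  refine (congrArg (fun t => toUnit X ≫ t) (Sigma.ι_desc
    (f := fun _ : S => 𝟙_ (ICat V)) (fun s => (el (𝟙_ (ICat V)) (f s) : _ ⟶ VS V T)) s)).trans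
    (comp_el _ _)

theorem el_vmap2 {S S' T : Type} (f : S → S' → T) (X : ICat V) (s : S) (s' : S') :
    lift (el X s) (el X s') ≫ vmap2 V f = el X (f s s') :=
  (lift_desc2 _ _ _ _ _).trans (comp_el _ _)

variable (V) in
/-- A category with objects the natural numbers, as a discrete `V`-2-category. -/
@[reducible] noncomputable def discreteTwoCat (H : ℕ → ℕ → Type) (i : ∀ n, H n n)
    (c : ∀ {m n p}, H m n → H n p → H m p)
    (hi : ∀ {m n} (f : H m n), c (i m) f = f) (hi' : ∀ {m n} (f : H m n), c f (i n) = f)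
    (ha : ∀ {m n p q} (f : H m n) (g : H n p) (h : H p q), c (c f g) h = c f (c g h)) :
    EnrichedCategory (ICat V) ℕ where
  Hom m n := VS V (H m n)
  id n := el _ (i n)
  comp m n p := vmap2 V c
  id_comp m n := VS_ext fun X s => by
    have : el X s ≫ (λ_ _).inv ≫ el (𝟙_ (ICat V)) (i m) ▷ VS V (H m n) =
        lift (el X (i m)) (el X s) := by
      apply CartesianMonoidalCategory.hom_ext <;> simp [comp_el]
    rw [← Category.assoc (λ_ _).inv, ← Category.assoc, this, el_vmap2, hi, Category.comp_id]
  comp_id m n := VS_ext fun X s => by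
    have : el X s ≫ (ρ_ _).inv ≫ VS V (H m n) ◁ el (𝟙_ (ICat V)) (i n) =
        lift (el X s) (el X (i n)) := by
      apply CartesianMonoidalCategory.hom_ext <;> simp [comp_el]
    rw [← Category.assoc (ρ_ _).inv, ← Category.assoc, this, el_vmap2, hi', Category.comp_id]
  assoc m n p q := VS_ext3 fun X f g h => by
    have h1 : lift (el X f) (lift (el X g) (el X h)) ≫ (α_ _ _ _).inv ≫ vmap2 V c ▷ VS V (H p q) =
        lift (el X (c f g)) (el X h) := by
      rw [← Category.assoc, lift_lift_associator_inv, lift_whiskerRight, el_vmap2]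
    have h2 : lift (el X f) (lift (el X g) (el X h)) ≫ VS V (H m n) ◁ vmap2 V c =
        lift (el X f) (el X (c g h)) := by
      rw [lift_whiskerLeft, el_vmap2]
    rw [← Category.assoc (α_ _ _ _).inv, ← Category.assoc, h1, ← Category.assoc, h2, el_vmap2,
      el_vmap2, ha]

variable (V) in
/-- The category `F` of finite based sets, as a discrete `V`-2-category. -/
@[reducible] noncomputable def Fcat : EnrichedCategory (ICat V) ℕ :=
  discreteTwoCat V FHom FHom.id FHom.comp FHom.id_comp FHom.comp_id FHom.comp_assoc

variable (V) in
/-- The category `Π`, as a discrete `V`-2-category. -/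
@[reducible] noncomputable def Pcat : EnrichedCategory (ICat V) ℕ :=
  discreteTwoCat V PHom (fun n => ⟨FHom.id n, FHom.small_id n⟩)
    (fun φ ψ => ⟨φ.1.comp ψ.1, φ.2.comp ψ.2⟩) (fun _ => Subtype.ext (FHom.id_comp _))
    (fun _ => Subtype.ext (FHom.comp_id _)) (fun _ _ _ => Subtype.ext (FHom.comp_assoc _ _ _))

end Discrete

end ICat

namespace ICat

section Enriched
variable {V : Type u} [Category.{v} V] [CartesianMonoidalCategory V] [HasLimits V]

/-- A `V`-2-functor that is the identity on objects. -/
structure IdFunctor {K : Type w} (D E : EnrichedCategory (ICat V) K) where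
  map : ∀ a b : K, D.Hom a b ⟶ E.Hom a b
  map_id : ∀ a, D.id a ≫ map a a = E.id a
  map_comp : ∀ a b c, D.comp a b c ≫ map a c = (map a b ⊗ₘ map b c) ≫ E.comp a b c

variable {K : Type w} (E : EnrichedCategory (ICat V) K)

/-- Composition of 1-cells (and 2-cells) of a `V`-2-category, first `f`, then `g`. -/
noncomputable def cmpX {X : ICat V} {a b c : K} (f : X ⟶ E.Hom a b) (g : X ⟶ E.Hom b c) :
    X ⟶ E.Hom a c := lift f g ≫ E.comp a b c

theorem comp_cmpX {X Y : ICat V} (k : Y ⟶ X) {a b c : K} (f : X ⟶ E.Hom a b)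
    (g : X ⟶ E.Hom b c) : k ≫ cmpX E f g = cmpX E (k ≫ f) (k ≫ g) := by
  rw [cmpX, ← Category.assoc, comp_lift]; rfl

theorem cmpX_assoc {X : ICat V} {a b c d : K} (f : X ⟶ E.Hom a b) (g : X ⟶ E.Hom b c)
    (h : X ⟶ E.Hom c d) : cmpX E (cmpX E f g) h = cmpX E f (cmpX E g h) := by
  have := congrArg (fun t => lift f (lift g h) ≫ t) (E.assoc a b c d)
  rw [← Category.assoc, ← Category.assoc, lift_lift_associator_inv, lift_whiskerRight,
    ← Category.assoc, lift_whiskerLeft] at this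
  exact this

theorem cmpX_id {X : ICat V} {a b : K} (f : X ⟶ E.Hom a b) :
    cmpX E f (toUnit X ≫ E.id b) = f := by
  have := congrArg (fun t => f ≫ t) (E.comp_id a b)
  have h : f ≫ (ρ_ _).inv ≫ E.Hom a b ◁ E.id b = lift f (toUnit X ≫ E.id b) := by
    apply CartesianMonoidalCategory.hom_ext <;> simp
  rw [← Category.assoc (ρ_ _).inv, ← Category.assoc, h, Category.comp_id] at this
  exact this

theorem id_cmpX {X : ICat V} {a b : K} (f : X ⟶ E.Hom a b) :
    cmpX E (toUnit X ≫ E.id a) f = f := by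
  have := congrArg (fun t => f ≫ t) (E.id_comp a b)
  have h : f ≫ (λ_ _).inv ≫ E.id a ▷ E.Hom a b = lift (toUnit X ≫ E.id a) f := by
    apply CartesianMonoidalCategory.hom_ext <;> simp
  rw [← Category.assoc (λ_ _).inv, ← Category.assoc, h, Category.comp_id] at this
  exact this

/-- A `V_*`-2-category: the morphism categories are based, and composition is trivial if one
of the variables is. -/
structure Based where
  pt : ∀ a b : K, 𝟙_ (ICat V) ⟶ E.Hom a b
  pt_comp : ∀ {X : ICat V} (a b c : K) (g : X ⟶ E.Hom b c),
    cmpX E (toUnit X ≫ pt a b) g = toUnit X ≫ pt a c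
  comp_pt : ∀ {X : ICat V} (a b c : K) (f : X ⟶ E.Hom a b),
    cmpX E f (toUnit X ≫ pt b c) = toUnit X ≫ pt a c

/-- A `V`-2-category with a zero object is a `V_*`-2-category. -/
noncomputable def Based.ofZero (z : K) (toZ : ∀ a, IsTerminal (E.Hom a z))
    (fromZ : ∀ a, IsTerminal (E.Hom z a)) : Based E where
  pt a b := cmpX E ((toZ a).from _) ((fromZ b).from _)
  pt_comp a b c g := by
    rw [comp_cmpX, comp_cmpX, cmpX_assoc]
    congr 1
    exact (fromZ c).hom_ext _ _
  comp_pt a b c f := by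
    rw [comp_cmpX, comp_cmpX, ← cmpX_assoc]
    congr 1
    exact (toZ a).hom_ext _ _

end Enriched

section
variable (V : Type u) [Category.{v} V] [CartesianMonoidalCategory V] [MonoidalClosed V]
  [HasLimits V] [HasColimits (ICat V)]

/-- A reduced `Cat(V)`-category of operators over `F`. The objects are the based sets
`{0, 1, …, n}`. -/
structure CatOp where
  enr : EnrichedCategory (ICat V) ℕ
  toZero : ∀ n, IsTerminal (enr.Hom n 0)
  fromZero : ∀ n, IsTerminal (enr.Hom 0 n)
  ι : IdFunctor (Pcat V) enr
  ξ : IdFunctor enr (Fcat V)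
  ι_ξ : ∀ m n, ι.map m n ≫ ξ.map m n = vmap V (fun φ : PHom m n => (φ.1 : FHom m n))

variable {V}

/-- The basepoints of a reduced category of operators. -/
noncomputable def CatOp.based (D : CatOp V) : Based D.enr := .ofZero D.enr 0 D.toZero D.fromZero

end

namespace Operad
section
variable {V : Type u} [Category.{v} V] [CartesianMonoidalCategory V] [HasLimits V] (O : Operad V)

/-- The element `*` of `O(0)` and the element `1` of `O(1)`. -/
noncomputable def low (X : ICat V) : ∀ n : ℕ, n ≤ 1 → (X ⟶ O.obj n)
  | 0, _ => O.reduced.from X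
  | 1, _ => toUnit X ≫ O.unit
  | _ + 2, h => absurd h (by omega)

def IsLow {X : ICat V} {n : ℕ} (x : X ⟶ O.obj n) : Prop :=
  n ≤ 1 ∧ ∀ e : Fin 1 ≃ Fin n, x ≫ O.act e = toUnit X ≫ O.unit

theorem isLow_low (X : ICat V) (n : ℕ) (h : n ≤ 1) : O.IsLow (O.low X n h) := by
  refine ⟨h, fun e => ?_⟩
  have : n = 1 := by simpa using (Fintype.card_congr e).symm
  subst this
  rw [Subsingleton.elim e (Equiv.refl _), O.act_refl, Category.comp_id]
  rfl

variable {O}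

theorem IsLow.ext {X : ICat V} {n : ℕ} {x y : X ⟶ O.obj n} (hx : O.IsLow x) (hy : O.IsLow y) :
    x = y := by
  obtain rfl | rfl : n = 0 ∨ n = 1 := by have := hx.1; omega
  · exact O.reduced.hom_ext _ _
  · have h1 := hx.2 (Equiv.refl _)
    have h2 := hy.2 (Equiv.refl _)
    rw [O.act_refl, Category.comp_id] at h1 h2
    rw [h1, h2]

theorem IsLow.act {X : ICat V} {m n : ℕ} {x : X ⟶ O.obj n} (hx : O.IsLow x) (σ : Fin m ≃ Fin n) :
    O.IsLow (x ≫ O.act σ) := by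
  refine ⟨?_, fun e => ?_⟩
  · have : m = n := by simpa using Fintype.card_congr σ
    exact this ▸ hx.1
  · rw [act_act, hx.2]

theorem IsLow.gam {X : ICat V} {k : ℕ} {j : Fin k → ℕ} {x : X ⟶ O.obj k}
    {y : ∀ i, X ⟶ O.obj (j i)} (hx : O.IsLow x) (hy : ∀ i, O.IsLow (y i)) :
    O.IsLow (O.gam x y) := by
  obtain rfl | rfl : k = 0 ∨ k = 1 := by have := hx.1; omega
  · refine ⟨by simp, fun e => ?_⟩
    have := Fintype.card_congr e
    simp at this
  · obtain ⟨n, rfl⟩ : ∃ n, j = fun _ => n := ⟨j 0, funext fun i => by rw [Subsingleton.elim i 0]⟩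
    obtain ⟨z, rfl⟩ : ∃ z, y = fun _ => z := ⟨y 0, funext fun i => by rw [Subsingleton.elim i 0]⟩
    have h := hx.2 (Equiv.refl _)
    rw [O.act_refl, Category.comp_id] at h
    rw [h, O.unit_gam]
    exact (hy 0).act _

end

variable {V : Type u} [Category.{v} V] [CartesianMonoidalCategory V] [MonoidalClosed V]
  [HasLimits V] [HasColimits (ICat V)] (O : Operad V)

/-- The category of operators of an operad, as a `V`-2-category. -/
@[reducible] noncomputable def opCat : EnrichedCategory (ICat V) ℕ where
  Hom := O.hom
  id := O.idD
  comp := O.compD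
  id_comp m n := O.hom_ext1 fun X φ c => by
    have : O.pt φ c ≫ (λ_ _).inv ≫ O.idD m ▷ O.hom m n =
        lift (toUnit X ≫ O.idD m) (O.pt φ c) := by
      apply CartesianMonoidalCategory.hom_ext <;> simp
    rw [← Category.assoc (λ_ _).inv, ← Category.assoc, this, id_comp', Category.comp_id]
  comp_id m n := O.hom_ext1 fun X φ c => by
    have : O.pt φ c ≫ (ρ_ _).inv ≫ O.hom m n ◁ O.idD n =
        lift (O.pt φ c) (toUnit X ≫ O.idD n) := by
      apply CartesianMonoidalCategory.hom_ext <;> simp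
    rw [← Category.assoc (ρ_ _).inv, ← Category.assoc, this, comp_id', Category.comp_id]
  assoc m n p q := O.hom_ext3 fun X φ c ψ d χ e => by
    have h1 : lift (O.pt φ c) (lift (O.pt ψ d) (O.pt χ e)) ≫ (α_ _ _ _).inv ≫
        O.compD m n p ▷ O.hom p q =
        lift (lift (O.pt φ c) (O.pt ψ d) ≫ O.compD m n p) (O.pt χ e) := by
      rw [← Category.assoc, lift_lift_associator_inv, lift_whiskerRight]
    have h2 : lift (O.pt φ c) (lift (O.pt ψ d) (O.pt χ e)) ≫ O.hom m n ◁ O.compD n p q =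
        lift (O.pt φ c) (lift (O.pt ψ d) (O.pt χ e) ≫ O.compD n p q) := by
      rw [lift_whiskerLeft]
    rw [← Category.assoc (α_ _ _ _).inv, ← Category.assoc, h1, ← Category.assoc, h2, assoc']

/-- The morphism `(φ; c)` with `φ` in `Π` and all `c_j` equal to `*` or `1`. -/
noncomputable def lowPt (X : ICat V) {m n : ℕ} (φ : PHom m n) : X ⟶ O.hom m n :=
  O.pt φ.1 fun j => O.low X _ (φ.2 j)

theorem comp_lowPt {X Y : ICat V} (f : X ⟶ Y) {m n : ℕ} (φ : PHom m n) :
    f ≫ O.lowPt Y φ = O.lowPt X φ := by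
  unfold lowPt
  rw [comp_pt]
  congr 1
  funext j
  refine IsLow.ext ⟨φ.2 j, fun e => ?_⟩ (O.isLow_low _ _ _)
  rw [Category.assoc, (O.isLow_low _ _ _).2, ← Category.assoc, toUnit_unique (f ≫ toUnit Y)]

/-- The functor from `Π`. -/
noncomputable def iotaMap (m n : ℕ) : VS V (PHom m n) ⟶ O.hom m n :=
  Sigma.desc (f := fun _ : PHom m n => 𝟙_ (ICat V)) fun φ => O.lowPt (𝟙_ (ICat V)) φ

/-- The functor to `F`. -/
noncomputable def xiMap (m n : ℕ) : O.hom m n ⟶ VS V (FHom m n) :=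
  Sigma.desc (f := fun φ : FHom m n => O.summand φ) fun φ => el (O.summand φ) φ

theorem el_iota {m n : ℕ} (X : ICat V) (φ : PHom m n) :
    el X φ ≫ O.iotaMap m n = O.lowPt X φ := by
  unfold iotaMap
  rw [el, Category.assoc]
  exact (congrArg (fun t => toUnit X ≫ t) (Sigma.ι_desc (f := fun _ : PHom m n => 𝟙_ (ICat V))
    (fun φ => O.lowPt (𝟙_ (ICat V)) φ) φ)).trans (O.comp_lowPt _ _)

theorem pt_xi {m n : ℕ} {X : ICat V} (φ : FHom m n) (c : ∀ j, X ⟶ O.obj (φ.deg j)) :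
    O.pt φ c ≫ O.xiMap m n = el X φ := by
  unfold xiMap pt
  refine (Category.assoc _ _ _).trans ?_
  exact (congrArg (fun t => piLift c ≫ t) (Sigma.ι_desc (f := fun φ : FHom m n => O.summand φ)
    (fun φ => (el (O.summand φ) φ : _ ⟶ VS V (FHom m n))) φ)).trans (comp_el _ _)

theorem terminal_of_unique {m n : ℕ} (φ₀ : FHom m n) (hφ : ∀ φ, φ = φ₀)
    (h : ∀ j, φ₀.deg j = 0) : Nonempty (IsTerminal (O.hom m n)) := by
  let d : O.hom m n ⟶ O.summand φ₀ := Sigma.desc (f := fun φ : FHom m n => O.summand φ) fun φ =>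
    eqToHom (congrArg (fun φ : FHom m n => O.summand φ) (hφ φ))
  have h1 : O.incl φ₀ ≫ d = 𝟙 _ :=
    (Sigma.ι_desc (f := fun φ : FHom m n => O.summand φ) _ _).trans rfl
  have h2 : d ≫ O.incl φ₀ = 𝟙 _ := (O.isCoprod_hom m n).hom_ext fun φ => by
    obtain rfl := hφ φ
    rw [← Category.assoc, h1, Category.id_comp, Category.comp_id]
  have t : ∀ j, Nonempty (IsTerminal (O.obj (φ₀.deg j))) := fun j => by
    rw [h j]; exact ⟨O.reduced⟩
  exact ⟨IsTerminal.ofUniqueHom (fun X => piLift (fun j => (t j).some.from X) ≫ O.incl φ₀)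
    fun X f => by
      rw [← Category.comp_id f, ← h2, ← Category.assoc]
      congr 1
      exact pi_hom_ext fun j => (t j).some.hom_ext _ _⟩

theorem terminal_to (m : ℕ) : Nonempty (IsTerminal (O.hom m 0)) := by
  refine O.terminal_of_unique (fun _ => none) (fun φ => funext fun i => ?_) fun j => j.elim0
  rcases φ i with _ | j
  · rfl
  · exact j.elim0

theorem terminal_from (n : ℕ) : Nonempty (IsTerminal (O.hom 0 n)) :=
  O.terminal_of_unique Fin.elim0 (fun _ => Subsingleton.elim _ _)
    fun j => by unfold FHom.deg; simp

/-- The category of operators of an operad. -/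
noncomputable def catOp : CatOp V where
  enr := O.opCat
  toZero m := (O.terminal_to m).some
  fromZero n := (O.terminal_from n).some
  ι :=
    { map := O.iotaMap
      map_id := fun n => by
        refine (O.el_iota _ _).trans ?_
        unfold lowPt
        change _ = O.idD n
        unfold idD
        congr 1
        funext j
        refine IsLow.ext (O.isLow_low _ _ _) (IsLow.act ⟨le_rfl, fun e => ?_⟩ _)
        rw [Subsingleton.elim e (Equiv.refl _), O.act_refl, Category.comp_id,
          toUnit_unique (toUnit (𝟙_ (ICat V))) (𝟙 _), Category.id_comp]
      map_comp := fun m n p => VS_ext2 fun X φ ψ => by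
        rw [← Category.assoc, ← Category.assoc, lift_map, el_iota, el_iota]
        refine (congrArg (fun t => t ≫ O.iotaMap m p) (el_vmap2 _ X φ ψ)).trans ?_
        rw [el_iota]
        refine Eq.trans ?_ (O.pt_comp _ _ _ _).symm
        unfold lowPt
        congr 1
        funext k
        exact IsLow.ext (O.isLow_low _ _ _)
          (((O.isLow_low _ _ _).gam fun i => O.isLow_low _ _ _).act _) }
  ξ :=
    { map := O.xiMap
      map_id := fun n => O.pt_xi _ _
      map_comp := fun m n p => O.hom_ext2' fun X φ c ψ d => by
        rw [← Category.assoc, ← Category.assoc, lift_map, pt_xi, pt_xi]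
        refine (congrArg (fun t => t ≫ O.xiMap m p) (O.pt_comp _ _ _ _)).trans ?_
        rw [pt_xi]
        exact (el_vmap2 _ X φ ψ).symm }
  ι_ξ m n := VS_ext fun X φ => by
    rw [← Category.assoc, el_iota, el_vmap]
    exact O.pt_xi _ _

end Operad
end ICat

namespace ICat

section PseudoPermutative
variable {V : Type u} [Category.{v} V] [CartesianMonoidalCategory V] [HasLimits V]

/-- An invertible internal natural transformation. -/
structure IIso {C D : ICat V} (F G : C ⟶ D) where
  hom : ITrans F G
  inv : ITrans G F
  hom_inv : D.comp hom.app inv.app (by rw [hom.tgt, inv.src]) = ob F ≫ D.idm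
  inv_hom : D.comp inv.app hom.app (by rw [inv.tgt, hom.src]) = ob G ≫ D.idm

/-- The vertical composite of the listed generalized morphisms (the first one is applied first)
is defined and equal to `m`. -/
def IsPasting (C : ICat V) {T : V} : List (T ⟶ C.Mor) → (T ⟶ C.Mor) → Prop
  | [], _ => False
  | [x], m => x = m
  | x :: y :: l, m => ∃ (r : T ⟶ C.Mor) (h : x ≫ C.tgt = r ≫ C.src),
      IsPasting C (y :: l) r ∧ C.comp x r h = m

/-- Two vertical composites are defined and equal. -/
def SamePasting (C : ICat V) {T : V} (l l' : List (T ⟶ C.Mor)) : Prop :=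
  ∃ m, C.IsPasting l m ∧ C.IsPasting l' m

/-- The pair of two generalized objects. -/
noncomputable def obPair {C D : ICat V} {T : V} (f : T ⟶ C.Ob) (g : T ⟶ D.Ob) :
    T ⟶ (C ⊗ D).Ob := (lift f g : T ⟶ C.Ob ⊗ D.Ob)

/-- The pair of two generalized morphisms. -/
noncomputable def morPair {C D : ICat V} {T : V} (f : T ⟶ C.Mor) (g : T ⟶ D.Mor) :
    T ⟶ (C ⊗ D).Mor := (lift f g : T ⟶ C.Mor ⊗ D.Mor)

variable {K : Type w} (E : EnrichedCategory (ICat V) K)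

/-- The generalized 1-cells of a `V`-2-category. -/
abbrev Cell1 (T : V) (a b : K) : Type v := T ⟶ (E.Hom a b).Ob
/-- The generalized 2-cells of a `V`-2-category. -/
abbrev Cell2 (T : V) (a b : K) : Type v := T ⟶ (E.Hom a b).Mor

variable {E} {T : V}

/-- The identity 2-cell. -/
noncomputable def one {a b : K} (f : Cell1 E T a b) : Cell2 E T a b := f ≫ (E.Hom a b).idm

variable (E)

/-- The 1-cell given by an object of a morphism category. -/
noncomputable def constCell {a b : K} (T : V) (x : 𝟙_ (ICat V) ⟶ E.Hom a b) : Cell1 E T a b :=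
  (toUnit T : T ⟶ (𝟙_ (ICat V)).Ob) ≫ ob x

/-- The identity 1-cell. -/
noncomputable def id1 (T : V) (a : K) : Cell1 E T a a := constCell E T (E.id a)

/-- The composite of 1-cells, first `f` then `g`. -/
noncomputable def comp1 {a b c : K} (f : Cell1 E T a b) (g : Cell1 E T b c) : Cell1 E T a c :=
  obPair f g ≫ ob (E.comp a b c)

/-- The horizontal composite of 2-cells, first `x` then `y`. -/
noncomputable def comp2 {a b c : K} (x : Cell2 E T a b) (y : Cell2 E T b c) : Cell2 E T a c :=
  morPair x y ≫ mor (E.comp a b c)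

/-- Transport along equalities of objects. -/
noncomputable def homCast {a a' b b' : K} (h : a = a') (h' : b = b') :
    E.Hom a b ⟶ E.Hom a' b' := eqToHom (by rw [h, h'])

noncomputable def cast1 {a a' b b' : K} (h : a = a') (h' : b = b') (f : Cell1 E T a b) :
    Cell1 E T a' b' := f ≫ ob (homCast E h h')

noncomputable def cast2 {a a' b b' : K} (h : a = a') (h' : b = b') (x : Cell2 E T a b) :
    Cell2 E T a' b' := x ≫ mor (homCast E h h')

/-- The interchange of the middle factors. -/
noncomputable def middle (A B C D : ICat V) : (A ⊗ B) ⊗ (C ⊗ D) ⟶ (A ⊗ C) ⊗ (B ⊗ D) :=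
  lift (fst _ _ ⊗ₘ fst _ _) (snd _ _ ⊗ₘ snd _ _)

/-- The data of a pseudofunctor of two variables that is given by multiplication on objects. The
transformation `θ` goes from the composite of products to the product of composites. -/
structure SmashData [Mul K] where
  map : ∀ a b c d : K, E.Hom a b ⊗ E.Hom c d ⟶ E.Hom (a * c) (b * d)
  θ : ∀ a b b' c d d' : K,
    IIso ((map a b c d ⊗ₘ map b b' d d') ≫ E.comp (a * c) (b * d) (b' * d'))
      (middle (E.Hom a b) (E.Hom c d) (E.Hom b b') (E.Hom d d') ≫
        (E.comp a b b' ⊗ₘ E.comp c d d') ≫ map a b' c d')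

variable {E}

namespace SmashData
section
variable [Mul K] (S : SmashData E)

/-- The product of 1-cells. -/
noncomputable def sm1 {a b c d : K} (f : Cell1 E T a b) (g : Cell1 E T c d) :
    Cell1 E T (a * c) (b * d) := obPair f g ≫ ob (S.map a b c d)

/-- The product of 2-cells. -/
noncomputable def sm2 {a b c d : K} (x : Cell2 E T a b) (y : Cell2 E T c d) :
    Cell2 E T (a * c) (b * d) := morPair x y ≫ mor (S.map a b c d)

variable {a b b' c d d' : K}

/-- The component `(g₁ ⊛ g₂) ∘ (f₁ ⊛ f₂) ⟶ (g₁ ∘ f₁) ⊛ (g₂ ∘ f₂)` of the pseudofunctoriality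
constraint. -/
noncomputable def th (f₁ : Cell1 E T a b) (f₂ : Cell1 E T c d) (g₁ : Cell1 E T b b')
    (g₂ : Cell1 E T d d') : Cell2 E T (a * c) (b' * d') :=
  obPair (obPair f₁ f₂) (obPair g₁ g₂) ≫ (S.θ a b b' c d d').hom.app

/-- The inverse of `th`. -/
noncomputable def thInv (f₁ : Cell1 E T a b) (f₂ : Cell1 E T c d) (g₁ : Cell1 E T b b')
    (g₂ : Cell1 E T d d') : Cell2 E T (a * c) (b' * d') :=
  obPair (obPair f₁ f₂) (obPair g₁ g₂) ≫ (S.θ a b b' c d d').inv.app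

/-- The pseudofunctoriality constraint is the identity at the given 1-cells. -/
def ThIsId (f₁ : Cell1 E T a b) (f₂ : Cell1 E T c d) (g₁ : Cell1 E T b b')
    (g₂ : Cell1 E T d d') : Prop :=
  S.th f₁ f₂ g₁ g₂ = one (S.sm1 (comp1 E f₁ g₁) (comp1 E f₂ g₂))
end

/-- The axioms of a strict pseudo-monoidal `V_*`-2-category with unit object `1`. Functors and
transformations out of smash products of based categories are functors and transformations out
of the products that are trivial when one of the variables is at the basepoint. -/
structure IsMonoidal [Monoid K] (S : SmashData E) (B : Based E) : Prop where
  /-- the functors on morphism categories are based -/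
  pt_map : ∀ {X : ICat V} (a b : K) {c d : K} (g : X ⟶ E.Hom c d),
    lift (toUnit X ≫ B.pt a b) g ≫ S.map a b c d = toUnit X ≫ B.pt (a * c) (b * d)
  map_pt : ∀ {X : ICat V} {a b : K} (c d : K) (f : X ⟶ E.Hom a b),
    lift f (toUnit X ≫ B.pt c d) ≫ S.map a b c d = toUnit X ≫ B.pt (a * c) (b * d)
  /-- the constraints are based -/
  th_pt : ∀ {T : V} {a b b' c d d' : K} (f₁ : Cell1 E T a b) (f₂ : Cell1 E T c d)
    (g₁ : Cell1 E T b b') (g₂ : Cell1 E T d d'),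
    (f₁ = constCell E T (B.pt a b) ∨ f₂ = constCell E T (B.pt c d) ∨
      g₁ = constCell E T (B.pt b b') ∨ g₂ = constCell E T (B.pt d d')) →
    S.th f₁ f₂ g₁ g₂ = one (constCell E T (B.pt (a * c) (b' * d')))
  /-- identities are preserved -/
  map_id : ∀ a c : K, lift (E.id a) (E.id c) ≫ S.map a a c c = E.id (a * c)
  /-- the constraints are unital -/
  th_id_left : ∀ {T : V} {a b c d : K} (g₁ : Cell1 E T a b) (g₂ : Cell1 E T c d),
    S.ThIsId (id1 E T a) (id1 E T c) g₁ g₂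
  th_id_right : ∀ {T : V} {a b c d : K} (f₁ : Cell1 E T a b) (f₂ : Cell1 E T c d),
    S.ThIsId f₁ f₂ (id1 E T b) (id1 E T d)
  /-- the constraints are compatible with triple composition -/
  th_comp : ∀ {T : V} {a a' a'' a''' c c' c'' c''' : K} (f₁ : Cell1 E T a a')
    (f₂ : Cell1 E T c c') (g₁ : Cell1 E T a' a'') (g₂ : Cell1 E T c' c'')
    (h₁ : Cell1 E T a'' a''') (h₂ : Cell1 E T c'' c'''),
    SamePasting _
      [comp2 E (one (S.sm1 f₁ f₂)) (S.th g₁ g₂ h₁ h₂),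
        S.th f₁ f₂ (comp1 E g₁ h₁) (comp1 E g₂ h₂)]
      [comp2 E (S.th f₁ f₂ g₁ g₂) (one (S.sm1 h₁ h₂)),
        S.th (comp1 E f₁ g₁) (comp1 E f₂ g₂) h₁ h₂]
  /-- strict associativity -/
  map_assoc : ∀ {X : ICat V} {a b c d e k : K} (f : X ⟶ E.Hom a b) (g : X ⟶ E.Hom c d)
    (h : X ⟶ E.Hom e k),
    lift (lift f g ≫ S.map a b c d) h ≫ S.map (a * c) (b * d) e k ≫
        homCast E (mul_assoc a c e) (mul_assoc b d k) =
      lift f (lift g h ≫ S.map c d e k) ≫ S.map a b (c * e) (d * k)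
  th_assoc : ∀ {T : V} {a a' a'' b b' b'' c c' c'' : K} (f₁ : Cell1 E T a a')
    (f₂ : Cell1 E T b b') (f₃ : Cell1 E T c c') (g₁ : Cell1 E T a' a'')
    (g₂ : Cell1 E T b' b'') (g₃ : Cell1 E T c' c''),
    SamePasting _
      [cast2 E (mul_assoc _ _ _) (mul_assoc _ _ _) (S.th (S.sm1 f₁ f₂) f₃ (S.sm1 g₁ g₂) g₃),
        cast2 E (mul_assoc _ _ _) (mul_assoc _ _ _)
          (S.sm2 (S.th f₁ f₂ g₁ g₂) (one (comp1 E f₃ g₃)))]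
      [S.th f₁ (S.sm1 f₂ f₃) g₁ (S.sm1 g₂ g₃),
        S.sm2 (one (comp1 E f₁ g₁)) (S.th f₂ f₃ g₂ g₃)]
  /-- strict unitality -/
  one_map : ∀ {X : ICat V} {a b : K} (f : X ⟶ E.Hom a b),
    lift (toUnit X ≫ E.id 1) f ≫ S.map 1 1 a b ≫ homCast E (one_mul a) (one_mul b) = f
  map_one : ∀ {X : ICat V} {a b : K} (f : X ⟶ E.Hom a b),
    lift f (toUnit X ≫ E.id 1) ≫ S.map a b 1 1 ≫ homCast E (mul_one a) (mul_one b) = f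
  th_one_left : ∀ {T : V} {a b c : K} (f : Cell1 E T a b) (g : Cell1 E T b c),
    S.ThIsId (id1 E T 1) f (id1 E T 1) g
  th_one_right : ∀ {T : V} {a b c : K} (f : Cell1 E T a b) (g : Cell1 E T b c),
    S.ThIsId f (id1 E T 1) g (id1 E T 1)

/-- The data of a pseudotransformation from `(f, g) ↦ f ⊛ g` to `(f, g) ↦ g ⊛ f`: 1-cells and
invertible transformations `(g ⊛ f) ∘ τ ⟶ τ ∘ (f ⊛ g)`. -/
structure SymmetryData [Mul K] (S : SmashData E) where
  tau : ∀ a b : K, 𝟙_ (ICat V) ⟶ E.Hom (a * b) (b * a)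
  tauHat : ∀ a b c d : K,
    IIso (lift (toUnit _ ≫ tau a c) (sw (E.Hom a b) (E.Hom c d) ≫ S.map c d a b) ≫
        E.comp (a * c) (c * a) (d * b))
      (lift (S.map a b c d) (toUnit _ ≫ tau b d) ≫ E.comp (a * c) (b * d) (d * b))

namespace SymmetryData
section
variable [Mul K] {S : SmashData E} (R : SymmetryData S)

/-- The 1-cell of the symmetry. -/
noncomputable def t1 (T : V) (a b : K) : Cell1 E T (a * b) (b * a) := constCell E T (R.tau a b)

/-- The component `(g ⊛ f) ∘ τ ⟶ τ ∘ (f ⊛ g)` of the pseudonaturality constraint. -/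
noncomputable def th {a b c d : K} (f : Cell1 E T a b) (g : Cell1 E T c d) :
    Cell2 E T (a * c) (d * b) := obPair f g ≫ (R.tauHat a b c d).hom.app
end

/-- The axioms of the symmetry of a pseudo-permutative `V_*`-2-category. -/
structure IsSymmetry [Monoid K] {S : SmashData E} (R : SymmetryData S) (B : Based E) : Prop where
  /-- the constraints are based -/
  th_pt : ∀ {T : V} {a b c d : K} (f : Cell1 E T a b) (g : Cell1 E T c d),
    (f = constCell E T (B.pt a b) ∨ g = constCell E T (B.pt c d)) →
    R.th f g = one (constCell E T (B.pt (a * c) (d * b)))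
  /-- compatibility with identities -/
  th_id : ∀ (T : V) (a c : K), R.th (id1 E T a) (id1 E T c) = one (R.t1 T a c)
  /-- compatibility with composition -/
  th_comp : ∀ {T : V} {a a' a'' c c' c'' : K} (f₁ : Cell1 E T a a') (f₂ : Cell1 E T c c')
    (g₁ : Cell1 E T a' a'') (g₂ : Cell1 E T c' c''),
    SamePasting _
      [comp2 E (R.th f₁ f₂) (one (S.sm1 g₂ g₁)), comp2 E (one (S.sm1 f₁ f₂)) (R.th g₁ g₂),
        comp2 E (S.th f₁ f₂ g₁ g₂) (one (R.t1 T a'' c''))]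
      [comp2 E (one (R.t1 T a c)) (S.th f₂ f₁ g₂ g₁), R.th (comp1 E f₁ g₁) (comp1 E f₂ g₂)]
  /-- the symmetry axiom -/
  tau_tau : ∀ a b : K, lift (R.tau a b) (R.tau b a) ≫ E.comp _ _ _ = E.id (a * b)
  th_th : ∀ {T : V} {a b c d : K} (f : Cell1 E T a b) (g : Cell1 E T c d),
    IsPasting _ [comp2 E (one (R.t1 T a c)) (R.th g f), comp2 E (R.th f g) (one (R.t1 T d b))]
      (one (S.sm1 f g))
  /-- the hexagon axiom -/
  tau_mul : ∀ (T : V) (a b c : K),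
    cast1 E (mul_assoc a b c).symm rfl (R.t1 T a (b * c)) =
      comp1 E (S.sm1 (R.t1 T a b) (id1 E T c))
        (cast1 E (mul_assoc b a c).symm (mul_assoc b c a).symm
          (S.sm1 (id1 E T b) (R.t1 T a c)))
  th_mul : ∀ {T : V} {a a' b b' c c' : K} (f : Cell1 E T a a') (g : Cell1 E T b b')
    (h : Cell1 E T c c'),
    SamePasting _
      [cast2 E (mul_assoc a b c).symm rfl (R.th f (S.sm1 g h))]
      ([S.th (id1 E T b) (R.t1 T a c) g (S.sm1 h f), S.sm2 (one g) (R.th f h),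
          S.thInv g (S.sm1 f h) (id1 E T b') (R.t1 T a' c')].map (fun x =>
        comp2 E (one (S.sm1 (R.t1 T a b) (id1 E T c)))
          (cast2 E (mul_assoc b a c).symm (mul_assoc b' c' a').symm x)) ++
      [S.th (R.t1 T a b) (id1 E T c) (S.sm1 g f) h, S.sm2 (R.th f g) (one h),
          S.thInv (S.sm1 f g) h (R.t1 T a' b') (id1 E T c')].map (fun x =>
        comp2 E x (cast2 E (mul_assoc b' a' c').symm (mul_assoc b' c' a').symm
          (one (S.sm1 (id1 E T b') (R.t1 T a' c'))))))

end SymmetryData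
end SmashData

/-- A pseudo-permutative structure, with unit object `1` and with product given by
multiplication on objects. -/
structure PseudoPermutative [Monoid K] (E : EnrichedCategory (ICat V) K) (B : Based E) where
  smash : SmashData E
  isMonoidal : smash.IsMonoidal B
  symm : smash.SymmetryData
  isSymmetry : symm.IsSymmetry B

end PseudoPermutative

end ICat

namespace FHom
variable {m n p q : ℕ}

/-- The smash product of based functions; pairs are ordered lexicographically. -/
def smash (φ : FHom m n) (ψ : FHom p q) : FHom (m * p) (n * q) := fun ℓ =>
  (φ (finProdFinEquiv.symm ℓ).1).bind fun j =>
    (ψ (finProdFinEquiv.symm ℓ).2).map fun k => finProdFinEquiv (j, k)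

theorem smash_eq_some (φ : FHom m n) (ψ : FHom p q) (a : Fin (m * p)) (ℓ : Fin (n * q)) :
    φ.smash ψ a = some ℓ ↔ φ (finProdFinEquiv.symm a).1 = some (finProdFinEquiv.symm ℓ).1 ∧
      ψ (finProdFinEquiv.symm a).2 = some (finProdFinEquiv.symm ℓ).2 := by
  obtain ⟨⟨j, k⟩, rfl⟩ := finProdFinEquiv.surjective ℓ
  rw [Equiv.symm_apply_apply]
  unfold smash
  constructor
  · intro h
    obtain ⟨j', h1, h2⟩ := Option.bind_eq_some_iff.1 h
    obtain ⟨k', h3, h4⟩ := Option.map_eq_some_iff.1 h2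
    have := finProdFinEquiv.injective h4
    simp only [Prod.mk.injEq] at this
    obtain ⟨rfl, rfl⟩ := this
    exact ⟨h1, h3⟩
  · rintro ⟨h1, h2⟩
    rw [h1, h2]
    rfl

theorem deg_smash (φ : FHom m n) (ψ : FHom p q) (ℓ : Fin (n * q)) :
    (φ.smash ψ).deg ℓ =
      φ.deg (finProdFinEquiv.symm ℓ).1 * ψ.deg (finProdFinEquiv.symm ℓ).2 := by
  unfold deg
  rw [← Finset.card_product]
  refine Finset.card_equiv finProdFinEquiv.symm fun a => ?_
  rw [Finset.mem_filter, Finset.mem_product, Finset.mem_filter, Finset.mem_filter, smash_eq_some]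
  simp

theorem Small.smash {φ : FHom m n} {ψ : FHom p q} (hφ : φ.Small) (hψ : ψ.Small) :
    (φ.smash ψ).Small := fun ℓ => by
  rw [deg_smash]
  exact mul_le_one' (hφ _) (hψ _)

/-- The bijection `(i, i') ↦ (i', i)`. -/
def tauEquiv (m p : ℕ) : Fin (m * p) ≃ Fin (p * m) :=
  finProdFinEquiv.symm.trans ((Equiv.prodComm _ _).trans finProdFinEquiv)

/-- The symmetry of the smash product. -/
def tau (m p : ℕ) : FHom (m * p) (p * m) := fun ℓ => some (tauEquiv m p ℓ)

theorem small_tau (m p : ℕ) : (tau m p).Small := fun j => by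
  unfold deg tau
  rw [Finset.card_le_one]
  intro a ha b hb
  have h1 := (Finset.mem_filter.1 ha).2
  have h2 := (Finset.mem_filter.1 hb).2
  exact (tauEquiv m p).injective (Option.some_injective _ (h1.trans h2.symm))

theorem deg_tau (m p : ℕ) (j : Fin (p * m)) : (tau m p).deg j = 1 := by
  unfold deg tau
  rw [Finset.card_eq_one]
  refine ⟨(tauEquiv m p).symm j, ?_⟩
  ext a
  simp [Equiv.eq_symm_apply]

/-- The inverse images of the composite `τ` followed by `ψ ∧ φ`. -/
theorem deg_tau_smash (φ : FHom m n) (ψ : FHom p q) (ℓ : Fin (q * n)) :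
    ((tau m p).comp (ψ.smash φ)).deg ℓ =
      φ.deg (finProdFinEquiv.symm ℓ).2 * ψ.deg (finProdFinEquiv.symm ℓ).1 := by
  rw [Fin.equiv_iff_eq.1 ⟨(tau m p).rho (ψ.smash φ) ℓ⟩]
  simp only [deg_tau, Finset.sum_const, Finset.card_univ, Fintype.card_fin, smul_eq_mul, mul_one]
  rw [deg_smash, mul_comm]

end FHom

namespace PHom
variable {m n p q : ℕ}

/-- The smash product on `Π`. -/
def smash (φ : PHom m n) (ψ : PHom p q) : PHom (m * p) (n * q) := ⟨φ.1.smash ψ.1, φ.2.smash ψ.2⟩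

/-- The symmetry on `Π`. -/
def tau (m p : ℕ) : PHom (m * p) (p * m) := ⟨FHom.tau m p, FHom.small_tau m p⟩

end PHom

namespace ICat
variable {V : Type u} [Category.{v} V] [CartesianMonoidalCategory V] [MonoidalClosed V]
  [HasLimits V] [HasColimits (ICat V)]

namespace CatOp
variable (D : CatOp V)

/-- The given 1-cell of `D` comes from `Π`. -/
def FromPi {T : V} {m n : ℕ} (f : Cell1 D.enr T m n) : Prop :=
  ∃ p : T ⟶ (VS V (PHom m n)).Ob, f = p ≫ ob (D.ι.map m n)

/-- A pseudo-commutative structure on a reduced category of operators over `F`. -/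
structure PseudoCommutative extends PseudoPermutative D.enr D.based where
  /-- the product restricts to the smash product on `Π` -/
  ι_map : ∀ m n p q : ℕ, (D.ι.map m n ⊗ₘ D.ι.map p q) ≫ smash.map m n p q =
    vmap2 V PHom.smash ≫ D.ι.map (m * p) (n * q)
  /-- the product projects to the smash product on `F` -/
  map_ξ : ∀ m n p q : ℕ, smash.map m n p q ≫ D.ξ.map (m * p) (n * q) =
    (D.ξ.map m n ⊗ₘ D.ξ.map p q) ≫ vmap2 V FHom.smash
  /-- the product is strict relative to `Π`: the constraint is the identity if one variable, or
  if the first or the second morphism in both variables, is restricted to `Π` -/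
  strict : ∀ {T : V} {m n p m' n' p' : ℕ} (f₁ : Cell1 D.enr T m n) (f₂ : Cell1 D.enr T m' n')
    (g₁ : Cell1 D.enr T n p) (g₂ : Cell1 D.enr T n' p'),
    (D.FromPi f₁ ∧ D.FromPi g₁) ∨ (D.FromPi f₂ ∧ D.FromPi g₂) ∨
      (D.FromPi g₁ ∧ D.FromPi g₂) ∨ (D.FromPi f₁ ∧ D.FromPi f₂) →
    smash.ThIsId f₁ f₂ g₁ g₂
  /-- the symmetry restricts to the symmetry on `Π` -/
  tau_eq : ∀ m p : ℕ, symm.tau m p = el (𝟙_ (ICat V)) (PHom.tau m p) ≫ D.ι.map _ _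
  tauHat_eq : ∀ {T : V} {m n p q : ℕ} (f : Cell1 D.enr T m n) (g : Cell1 D.enr T p q),
    D.FromPi f → D.FromPi g → symm.th f g = one (comp1 D.enr (symm.t1 T m p) (smash.sm1 g f))

end CatOp

namespace Operad
section
variable {V : Type u} [Category.{v} V] [CartesianMonoidalCategory V] [HasLimits V] (O : Operad V)

/-- The intrinsic pairing `x ⊗ y = γ(x; y, …, y)`. -/
noncomputable def pairing (j k : ℕ) : O.obj j ⊗ O.obj k ⟶ O.obj (j * k) :=
  O.gam (fst (O.obj j) (O.obj k)) (fun _ => snd (O.obj j) (O.obj k)) ≫ O.act (finCongr (by simp))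

/-- The composition of the operad on generalized objects. -/
noncomputable def gamOb {T : V} {k : ℕ} {j : Fin k → ℕ} (x : T ⟶ (O.obj k).Ob)
    (y : ∀ i, T ⟶ (O.obj (j i)).Ob) : T ⟶ (O.obj (∑ i, j i)).Ob :=
  obPair x (Pi.lift y : T ⟶ ∏ᶜ fun i => (O.obj (j i)).Ob) ≫ ob (O.γ j)

/-- The composition of the operad on generalized morphisms. -/
noncomputable def gamMor {T : V} {k : ℕ} {j : Fin k → ℕ} (x : T ⟶ (O.obj k).Mor)
    (y : ∀ i, T ⟶ (O.obj (j i)).Mor) : T ⟶ (O.obj (∑ i, j i)).Mor :=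
  morPair x (Pi.lift y : T ⟶ ∏ᶜ fun i => (O.obj (j i)).Mor) ≫ mor (O.γ j)

end

/-- The product of permutations, for the lexicographic ordering of pairs. -/
def prodPerm {j k : ℕ} (σ : Equiv.Perm (Fin j)) (τ : Equiv.Perm (Fin k)) :
    Fin (j * k) ≃ Fin (j * k) :=
  finProdFinEquiv.symm.trans ((Equiv.prodCongr σ τ).trans finProdFinEquiv)

/-- The distributivity bijection `(b, (i, a)) ↦ (i, (b, a))`. -/
def distPerm (l : ℕ) {j : ℕ} (k : Fin j → ℕ) : Fin (l * ∑ i, k i) ≃ Fin (∑ i, l * k i) :=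
  finProdFinEquiv.symm.trans
    (((Equiv.prodCongr (Equiv.refl _) finSigmaFinEquiv.symm).trans
      ((Equiv.mk (fun x => ⟨x.2.1, (x.1, x.2.2)⟩) (fun x => (x.2.1, ⟨x.1, x.2.2⟩))
        (fun _ => rfl) (fun _ => rfl) :
          Fin l × (Σ i, Fin (k i)) ≃ Σ i, Fin l × Fin (k i)).trans
        (Equiv.sigmaCongrRight fun _ => finProdFinEquiv))).trans finSigmaFinEquiv)

theorem sum_prod_snd (l : ℕ) {j : ℕ} (k : Fin j → ℕ) :
    l * ∑ i, k i = ∑ p : Fin (l * j), k (finProdFinEquiv.symm p).2 := by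
  rw [← finProdFinEquiv.sum_comp]
  simp [Fintype.sum_prod_type]

/-- A pseudo-commutative structure on an operad. -/
structure PseudoCommutative (O : Operad V) where
  /-- the invertible transformation `(x ⊗ y) τ ⟶ y ⊗ x` -/
  α : ∀ j k : ℕ, IIso (O.pairing j k ≫ O.act (FHom.tauEquiv k j))
    (sw (O.obj j) (O.obj k) ≫ O.pairing k j)
  α_one : ∀ {T : V} {n : ℕ} (y : T ⟶ (O.obj n).Ob),
    obPair ((toUnit T : T ⟶ (𝟙_ (ICat V)).Ob) ≫ ob O.unit) y ≫ (α 1 n).hom.app =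
      (obPair ((toUnit T : T ⟶ (𝟙_ (ICat V)).Ob) ≫ ob O.unit) y ≫
        ob (O.pairing 1 n ≫ O.act (FHom.tauEquiv n 1))) ≫ (O.obj (n * 1)).idm
  α_symm : ∀ {T : V} {j k : ℕ} (x : T ⟶ (O.obj j).Ob) (y : T ⟶ (O.obj k).Ob),
    IsPasting _ [(obPair x y ≫ (α j k).hom.app) ≫ mor (O.act (FHom.tauEquiv j k)),
        obPair y x ≫ (α k j).hom.app]
      ((obPair x y ≫ ob (O.pairing j k)) ≫ (O.obj (j * k)).idm)
  α_equivariant : ∀ {T : V} {j k : ℕ} (σ : Equiv.Perm (Fin k)) (ρ : Equiv.Perm (Fin j))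
    (x : T ⟶ (O.obj j).Ob) (y : T ⟶ (O.obj k).Ob),
    (obPair x y ≫ (α j k).hom.app) ≫ mor (O.act (prodPerm σ ρ)) =
      obPair (x ≫ ob (O.act ρ)) (y ≫ ob (O.act σ)) ≫ (α j k).hom.app
  α_gam : ∀ {T : V} {j l : ℕ} {k : Fin j → ℕ} (x : T ⟶ (O.obj j).Ob)
    (y : ∀ i, T ⟶ (O.obj (k i)).Ob) (z : T ⟶ (O.obj l).Ob),
    IsPasting _
      [O.gamMor (x ≫ (O.obj j).idm) (fun i => obPair (y i) z ≫ (α (k i) l).hom.app) ≫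
          mor (O.act (distPerm l k)),
        O.gamMor (j := fun p => k (finProdFinEquiv.symm p).2) (obPair x z ≫ (α j l).hom.app)
            (fun p => y (finProdFinEquiv.symm p).2 ≫ (O.obj _).idm) ≫
          mor (O.act (finCongr (sum_prod_snd l k)))]
      (obPair (O.gamOb x y) z ≫ (α (∑ i, k i) l).hom.app)

namespace PseudoCommutative
variable {O : Operad V}

/-- The product `(φ; c) ⊛ (ψ; d) = (φ ∧ ψ; (c_j ⊗ d_k)_{j, k})`. -/
noncomputable def smashPt (O : Operad V) {X : ICat V} {m n p q : ℕ} (φ : FHom m n)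
    (c : ∀ j, X ⟶ O.obj (φ.deg j)) (ψ : FHom p q) (d : ∀ k, X ⟶ O.obj (ψ.deg k)) :
    X ⟶ O.hom (m * p) (n * q) :=
  O.pt (φ.smash ψ) fun ℓ =>
    lift (c (finProdFinEquiv.symm ℓ).1) (d (finProdFinEquiv.symm ℓ).2) ≫
      O.pairing _ _ ≫ O.act (finCongr (FHom.deg_smash φ ψ ℓ))

/-- A generalized object of the summand indexed by `φ`. -/
noncomputable def ptOb (O : Operad V) {T : V} {m n : ℕ} (φ : FHom m n)
    (c : ∀ j, T ⟶ (O.obj (φ.deg j)).Ob) : T ⟶ (O.hom m n).Ob :=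
  (Pi.lift c : T ⟶ ∏ᶜ fun j => (O.obj (φ.deg j)).Ob) ≫ ob (O.incl φ)

/-- A generalized morphism of the summand indexed by `φ`. -/
noncomputable def ptMor (O : Operad V) {T : V} {m n : ℕ} (φ : FHom m n)
    (c : ∀ j, T ⟶ (O.obj (φ.deg j)).Mor) : T ⟶ (O.hom m n).Mor :=
  (Pi.lift c : T ⟶ ∏ᶜ fun j => (O.obj (φ.deg j)).Mor) ≫ mor (O.incl φ)

/-- The 2-cell with components `α : (d_k ⊗ c_j) τ ⟶ c_j ⊗ d_k` for the pairs `(k, j)`. -/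
noncomputable def symPt (A : O.PseudoCommutative) {T : V} {m n p q : ℕ} (φ : FHom m n)
    (c : ∀ j, T ⟶ (O.obj (φ.deg j)).Ob) (ψ : FHom p q) (d : ∀ k, T ⟶ (O.obj (ψ.deg k)).Ob) :
    T ⟶ (O.hom (m * p) (q * n)).Mor :=
  ptMor O ((FHom.tau m p).comp (ψ.smash φ)) fun ℓ =>
    (obPair (d (finProdFinEquiv.symm ℓ).1) (c (finProdFinEquiv.symm ℓ).2) ≫ (A.α _ _).hom.app) ≫
      mor (O.act (finCongr (FHom.deg_tau_smash φ ψ ℓ)))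

end PseudoCommutative
end Operad
end ICat

/-!
The product on the category of operators is given by the intrinsic pairing. Its
pseudofunctoriality constraint is built from `α`: for morphisms with entries `y`, `z`, followed by
morphisms with entries `x`, `w`, source and target of the constraint have the entries
`γ(x ⊗ w; y_s ⊗ z_p)` and `γ(x; y) ⊗ γ(w; z)`. After associativity these are `γ(x; -)` of
`γ(w ⊗ y_s; z)`, up to a permutation, and of `γ(y_s ⊗ w; z)`, so that `γ(id_x; γ(α_{w, y_s}; id_z))`
leads from one to the other (`Lab.inter`). The constraint of the symmetry has the entries
`α_{d_k, c_j}`.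

*Labels.* All axioms would carry permutations that compare orders of the inputs. To avoid this, the
inputs of elements of `O` are labelled by arbitrary finite sets (`Lab`), so that `γ(x; y)` has
labels in a disjoint union and `x ⊗ y` in a product; the permutations then become evident
bijections of label sets, and most of their compatibilities hold by `rfl`. The lexicographic orders
enter only where labels are numbered. A morphism of the category of operators is given in the same
way by a family of labelled elements over a span of finite sets (`cell`); the numberings of the
index sets determine the based function and the orders of its inverse images, and composition
(`cell_comp`), product and symmetry do not involve any reordering.

*Coproducts.* The morphism categories are coproducts over based functions, and the products of
coproducts that occur are coproducts, as the ambient category is cartesian closed. Functors and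
transformations are therefore defined, and equalities of pastings checked, on summands with
generalized elements (`ITrans.ofPoints`, `IIso.desc`, `IsCoprod.local1`, `same_cells1`).

*Axioms.* On families, each axiom becomes a statement on `α` for every coordinate. The
decomposition of `α_{γ(x; y), z}` (`Lab.alpha_gam`) yields that of `α_{z, γ(x; y)}` by symmetry
(`Lab.alpha_gam'`). By these, compatibility of the product with triple composition
(`Lab.inter_comp`) and associativity (`Lab.inter_assoc`) both amount to the fact that components of
`α` at different levels of a nested composition commute. Compatibility of the symmetry with
composition (`Lab.alpha_gam_gam`) is the decomposition of `α_{γ(w; z), γ(x; y)}` into four factors,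
of which one cancels. The hexagon is the decomposition of `α_{y ⊗ z, x}` (`Lab.alpha_tens`), and the
symmetry axiom that of `α`. Finally `α_{x, y}` is an identity if `x` or `y` is `1` or `*`, which
gives the unit, basepoint and strictness conditions (`Lab.alpha_low_left`, `Lab.alpha_low_right`).
-/

/-! ### Generalized elements of internal categories -/

namespace ICat

section Stages
variable (V : Type u) [Category.{v} V] [CartesianMonoidalCategory V] [HasLimits V]

/-- A product-preserving functor from internal categories to sets. Its elements are the generalized
elements of one kind: functors out of a fixed internal category, generalized objects, or
generalized morphisms. Identities between formulas with generalized elements hold for all three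
kinds at once. -/
structure Stage where
  obj : ICat V → Type v
  map : ∀ {C D : ICat V}, (C ⟶ D) → obj C → obj D
  map_id : ∀ {C : ICat V} (x : obj C), map (𝟙 C) x = x
  map_comp : ∀ {C D E : ICat V} (f : C ⟶ D) (g : D ⟶ E) (x : obj C),
    map (f ≫ g) x = map g (map f x)
  star : obj (𝟙_ (ICat V))
  star_eq : ∀ x : obj (𝟙_ (ICat V)), x = star
  pair : ∀ {C D : ICat V}, obj C → obj D → obj (C ⊗ D)
  map_fst : ∀ {C D : ICat V} (x : obj C) (y : obj D), map (fst C D) (pair x y) = x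
  map_snd : ∀ {C D : ICat V} (x : obj C) (y : obj D), map (snd C D) (pair x y) = y
  pair_ext : ∀ {C D : ICat V} {x y : obj (C ⊗ D)}, map (fst C D) x = map (fst C D) y →
    map (snd C D) x = map (snd C D) y → x = y
  tuple : ∀ {J : Type} {A : J → ICat V}, (∀ j, obj (A j)) → obj (pi A)
  map_π : ∀ {J : Type} {A : J → ICat V} (x : ∀ j, obj (A j)) (j : J),
    map (piπ A j) (tuple x) = x j
  tuple_ext : ∀ {J : Type} {A : J → ICat V} {x y : obj (pi A)},
    (∀ j, map (piπ A j) x = map (piπ A j) y) → x = y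

variable {V}

namespace Stage

attribute [simp] map_id map_fst map_snd map_π

/-- A natural transformation of stages. -/
structure Hom (F G : Stage V) where
  app : ∀ {C : ICat V}, F.obj C → G.obj C
  nat : ∀ {C D : ICat V} (f : C ⟶ D) (x : F.obj C), app (F.map f x) = G.map f (app x)

variable {F G : Stage V}

theorem Hom.pair (h : Hom F G) {C D : ICat V} (x : F.obj C) (y : F.obj D) :
    h.app (F.pair x y) = G.pair (h.app x) (h.app y) :=
  G.pair_ext (by rw [← h.nat, F.map_fst, G.map_fst]) (by rw [← h.nat, F.map_snd, G.map_snd])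

theorem Hom.tuple (h : Hom F G) {J : Type} {A : J → ICat V} (x : ∀ j, F.obj (A j)) :
    h.app (F.tuple x) = G.tuple fun j => h.app (x j) :=
  G.tuple_ext fun j => by rw [← h.nat, F.map_π, G.map_π]

theorem map_lift {X C D : ICat V} (f : X ⟶ C) (g : X ⟶ D) (x : F.obj X) :
    F.map (lift f g) x = F.pair (F.map f x) (F.map g x) :=
  F.pair_ext (by rw [← F.map_comp, lift_fst, F.map_fst]) (by rw [← F.map_comp, lift_snd, F.map_snd])

theorem map_tensor {C D C' D' : ICat V} (f : C ⟶ C') (g : D ⟶ D') (x : F.obj C) (y : F.obj D) :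
    F.map (f ⊗ₘ g) (F.pair x y) = F.pair (F.map f x) (F.map g y) :=
  F.pair_ext (by rw [← F.map_comp, tensorHom_fst, F.map_comp, F.map_fst, F.map_fst])
    (by rw [← F.map_comp, tensorHom_snd, F.map_comp, F.map_snd, F.map_snd])

theorem map_piLift {X : ICat V} {J : Type} {A : J → ICat V} (f : ∀ j, X ⟶ A j) (x : F.obj X) :
    F.map (piLift f) x = F.tuple fun j => F.map (f j) x :=
  F.tuple_ext fun j => by rw [← F.map_comp, piLift_π, F.map_π]

theorem pair_eta {C D : ICat V} (x : F.obj (C ⊗ D)) :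
    F.pair (F.map (fst C D) x) (F.map (snd C D) x) = x :=
  F.pair_ext (F.map_fst _ _) (F.map_snd _ _)

theorem obj_subsingleton (F : Stage V) {C : ICat V} (hC : IsTerminal C) (x y : F.obj C) :
    x = y := by
  have h (z : F.obj C) : z = F.map (hC.from (𝟙_ (ICat V))) F.star := by
    rw [← F.star_eq (F.map (toUnit C) z), ← F.map_comp, hC.hom_ext (toUnit C ≫ hC.from _) (𝟙 C),
      F.map_id]
  rw [h x, h y]

variable (V)

/-- Functors out of `X`. -/
noncomputable def funs (X : ICat V) : Stage V where
  obj C := X ⟶ C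
  map f x := x ≫ f
  map_id := Category.comp_id
  map_comp f g x := (Category.assoc x f g).symm
  star := toUnit X
  star_eq _ := toUnit_unique _ _
  pair x y := lift x y
  map_fst := lift_fst
  map_snd := lift_snd
  pair_ext := CartesianMonoidalCategory.hom_ext _ _
  tuple x := piLift x
  map_π := piLift_π
  tuple_ext := pi_hom_ext

/-- Generalized objects, defined at stage `T`. -/
noncomputable def obs (T : V) : Stage V where
  obj C := T ⟶ C.Ob
  map f x := x ≫ ICat.ob f
  map_id := Category.comp_id
  map_comp _ _ x := (Category.assoc x _ _).symm
  star := (toUnit T : T ⟶ 𝟙_ V)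
  star_eq x := toUnit_unique (C := V) (X := T) x _
  pair x y := obPair x y
  map_fst x y := lift_fst x y
  map_snd x y := lift_snd x y
  pair_ext h h' := CartesianMonoidalCategory.hom_ext _ _ h h'
  tuple {_ A} x := (Pi.lift x : T ⟶ ∏ᶜ fun j => (A j).Ob)
  map_π x j := Pi.lift_π x j
  tuple_ext h := Pi.hom_ext _ _ h

/-- Generalized morphisms, defined at stage `T`. -/
noncomputable def mors (T : V) : Stage V where
  obj C := T ⟶ C.Mor
  map f x := x ≫ ICat.mor f
  map_id := Category.comp_id
  map_comp _ _ x := (Category.assoc x _ _).symm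
  star := (toUnit T : T ⟶ 𝟙_ V)
  star_eq x := toUnit_unique (C := V) (X := T) x _
  pair x y := morPair x y
  map_fst x y := lift_fst x y
  map_snd x y := lift_snd x y
  pair_ext h h' := CartesianMonoidalCategory.hom_ext _ _ h h'
  tuple {_ A} x := (Pi.lift x : T ⟶ ∏ᶜ fun j => (A j).Mor)
  map_π x j := Pi.lift_π x j
  tuple_ext h := Pi.hom_ext _ _ h

variable {V}

/-- The source of a generalized morphism. -/
def src (T : V) : Hom (mors V T) (obs V T) where
  app {C} x := (x ≫ C.src : T ⟶ C.Ob)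
  nat {C _} f x := (Category.assoc _ _ _).trans
    ((congrArg (fun t => (x : T ⟶ C.Mor) ≫ t) (mor_src f)).trans (Category.assoc _ _ _).symm)

/-- The target of a generalized morphism. -/
def tgt (T : V) : Hom (mors V T) (obs V T) where
  app {C} x := (x ≫ C.tgt : T ⟶ C.Ob)
  nat {C _} f x := (Category.assoc _ _ _).trans
    ((congrArg (fun t => (x : T ⟶ C.Mor) ≫ t) (mor_tgt f)).trans (Category.assoc _ _ _).symm)

/-- The identity morphism of a generalized object. -/
def idm (T : V) : Hom (obs V T) (mors V T) where
  app {C} x := (x ≫ C.idm : T ⟶ C.Mor)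
  nat {C _} f x := (Category.assoc _ _ _).trans
    ((congrArg (fun t => (x : T ⟶ C.Ob) ≫ t) (idm_mor f).symm).trans (Category.assoc _ _ _).symm)

/-- Change of the stage of definition, for generalized objects. -/
def preOb {T T' : V} (k : T' ⟶ T) : Hom (obs V T) (obs V T') where
  app {C} x := (k ≫ x : T' ⟶ C.Ob)
  nat _ x := (Category.assoc k x _).symm

/-- Change of the stage of definition, for generalized morphisms. -/
def preMor {T T' : V} (k : T' ⟶ T) : Hom (mors V T) (mors V T') where
  app {C} x := (k ≫ x : T' ⟶ C.Mor)
  nat _ x := (Category.assoc k x _).symm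

/-- Evaluation of functors at an element. -/
def ev {X : ICat V} (x : F.obj X) : Hom (funs V X) F where
  app f := F.map f x
  nat g f := F.map_comp f g x

/-- The generalized morphism `z` is the composite of `x` and `y`, in this order; this includes that
the target of `x` is the source of `y`. -/
def CompIs {T : V} {C : ICat V} (x y z : (mors V T).obj C) : Prop :=
  ∃ h : (x : T ⟶ C.Mor) ≫ C.tgt = (y : T ⟶ C.Mor) ≫ C.src, C.comp x y h = z

variable {T : V} {C D : ICat V}

theorem CompIs.map {x y z : (mors V T).obj C} (h : CompIs x y z) (f : C ⟶ D) :
    CompIs ((mors V T).map f x) ((mors V T).map f y) ((mors V T).map f z) := by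
  obtain ⟨h, rfl⟩ := h
  exact ⟨w_mor f h, (comp_mor f _ _ _ _).symm⟩

theorem CompIs.pair {x y z : (mors V T).obj C} {x' y' z' : (mors V T).obj D} (h : CompIs x y z)
    (h' : CompIs x' y' z') :
    CompIs ((mors V T).pair x x') ((mors V T).pair y y') ((mors V T).pair z z') := by
  obtain ⟨h, rfl⟩ := h
  obtain ⟨h', rfl⟩ := h'
  have e1 : lift x x' ≫ fst _ _ = x := lift_fst (C := V) _ _
  have e2 : lift x x' ≫ snd _ _ = x' := lift_snd (C := V) _ _
  have e3 : lift y y' ≫ fst _ _ = y := lift_fst (C := V) _ _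
  have e4 : lift y y' ≫ snd _ _ = y' := lift_snd (C := V) _ _
  refine ⟨(obs V T).pair_ext ?_ ?_, ?_⟩
  · exact ((src T).nat _ ((mors V T).pair y y')).symm.trans
      ((congrArg (src T).app ((mors V T).map_fst y y')).trans (h.symm.trans
      ((congrArg (tgt T).app ((mors V T).map_fst x x')).symm.trans ((tgt T).nat _ _)))) |>.symm
  · exact ((src T).nat _ ((mors V T).pair y y')).symm.trans
      ((congrArg (src T).app ((mors V T).map_snd y y')).trans (h'.symm.trans
      ((congrArg (tgt T).app ((mors V T).map_snd x x')).symm.trans ((tgt T).nat _ _)))) |>.symm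
  · refine (prod_comp C D _ _ _ (congrArg₂ (fun s t => s ≫ C.tgt = t ≫ C.src) e1 e3 ▸ h)
      (congrArg₂ (fun s t => s ≫ D.tgt = t ≫ D.src) e2 e4 ▸ h')).trans ?_
    change lift _ _ = lift _ _
    congr 1
    · exact C.comp_congr' e1 e3
    · exact D.comp_congr' e2 e4

theorem CompIs.tuple {J : Type} {A : J → ICat V} {x y z : ∀ j, (mors V T).obj (A j)}
    (h : ∀ j, CompIs (x j) (y j) (z j)) :
    CompIs ((mors V T).tuple x) ((mors V T).tuple y) ((mors V T).tuple z) := by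
  choose h h' using h
  refine ⟨(obs V T).tuple_ext fun j => ?_, (mors V T).tuple_ext fun j => ?_⟩
  · exact ((src T).nat _ ((mors V T).tuple y)).symm.trans
      ((congrArg (src T).app ((mors V T).map_π y j)).trans ((h j).symm.trans
      ((congrArg (tgt T).app ((mors V T).map_π x j)).symm.trans ((tgt T).nat _ _)))) |>.symm
  · refine (pi_comp A _ _ _ j).trans ?_
    refine Eq.trans ?_ ((mors V T).map_π z j).symm
    rw [← h' j]
    exact (A j).comp_congr' ((mors V T).map_π x j) ((mors V T).map_π y j)

theorem CompIs.pre {x y z : (mors V T).obj C} (h : CompIs x y z) {T' : V} (k : T' ⟶ T) :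
    CompIs ((preMor k).app x) ((preMor k).app y) ((preMor k).app z) := by
  obtain ⟨h, rfl⟩ := h
  exact ⟨(Category.assoc k x _).trans ((congrArg (fun t => k ≫ t) h).trans
    (Category.assoc k y _).symm), (precomp_comp C k _ _ h).symm⟩

theorem CompIs.unique {x y z z' : (mors V T).obj C} (h : CompIs x y z) (h' : CompIs x y z') :
    z = z' := by
  obtain ⟨h, rfl⟩ := h
  obtain ⟨h', rfl⟩ := h'
  rfl

theorem CompIs.src {x y z : (mors V T).obj C} (h : CompIs x y z) :
    (src T).app z = (src T).app x := by
  obtain ⟨h, rfl⟩ := h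
  exact C.comp_src _ _ _

theorem CompIs.tgt {x y z : (mors V T).obj C} (h : CompIs x y z) :
    (tgt T).app z = (tgt T).app y := by
  obtain ⟨h, rfl⟩ := h
  exact C.comp_tgt _ _ _

@[simp] theorem src_idm {a : (obs V T).obj C} : (src T).app ((idm T).app a) = a :=
  (Category.assoc a _ _).trans ((congrArg (fun t => (a : T ⟶ C.Ob) ≫ t) C.idm_src).trans
    (Category.comp_id _))

@[simp] theorem tgt_idm {a : (obs V T).obj C} : (tgt T).app ((idm T).app a) = a :=
  (Category.assoc a _ _).trans ((congrArg (fun t => (a : T ⟶ C.Ob) ≫ t) C.idm_tgt).trans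
    (Category.comp_id _))

theorem CompIs.id_left {x : (mors V T).obj C} {a : (obs V T).obj C} (h : (Stage.src T).app x = a) :
    CompIs ((idm T).app a) x x := by
  subst h
  exact ⟨tgt_idm, C.idm_comp _ _ _⟩

theorem CompIs.id_right {x : (mors V T).obj C} {a : (obs V T).obj C} (h : (Stage.tgt T).app x = a) :
    CompIs x ((idm T).app a) x := by
  subst h
  exact ⟨src_idm.symm, C.comp_idm _ _ _⟩

theorem CompIs.assoc {a b c ab bc r : (mors V T).obj C} (h1 : CompIs a b ab) (h2 : CompIs ab c r)
    (h3 : CompIs b c bc) : CompIs a bc r := by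
  obtain ⟨h1, rfl⟩ := h1
  obtain ⟨h2, rfl⟩ := h2
  obtain ⟨h3, rfl⟩ := h3
  exact ⟨h1.trans (C.comp_src _ _ _).symm, (C.comp_assoc _ _ _ _ _).symm⟩

theorem CompIs.assoc' {a b c ab bc r : (mors V T).obj C} (h1 : CompIs a b ab) (h2 : CompIs a bc r)
    (h3 : CompIs b c bc) : CompIs ab c r := by
  obtain ⟨h1, rfl⟩ := h1
  obtain ⟨h3, rfl⟩ := h3
  obtain ⟨h2, rfl⟩ := h2
  exact ⟨(C.comp_tgt _ _ _).trans h3, C.comp_assoc _ _ _ _ _⟩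

theorem CompIs.exists {x y : (mors V T).obj C} (h : (Stage.tgt T).app x = (Stage.src T).app y) :
    ∃ z, CompIs x y z := ⟨_, h, rfl⟩

theorem CompIs.mid {x y z : (mors V T).obj C} (h : CompIs x y z) :
    (Stage.tgt T).app x = (Stage.src T).app y := h.1

theorem isPasting_two {x y z : T ⟶ C.Mor} :
    IsPasting C [x, y] z ↔ CompIs (V := V) x y z := by
  simp only [IsPasting, CompIs]
  constructor
  · rintro ⟨r, h, rfl, h'⟩; exact ⟨h, h'⟩
  · rintro ⟨h, h'⟩; exact ⟨y, h, rfl, h'⟩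

theorem isPasting_cons {x y z : T ⟶ C.Mor} {l : List (T ⟶ C.Mor)} :
    IsPasting C (x :: y :: l) z ↔ ∃ r, IsPasting C (y :: l) r ∧ CompIs (V := V) x r z := by
  simp only [IsPasting, CompIs]
  constructor
  · rintro ⟨r, h, h1, h'⟩; exact ⟨r, h1, h, h'⟩
  · rintro ⟨r, h1, h, h'⟩; exact ⟨r, h, h1, h'⟩

end Stage
end Stages
end ICat

/-! ### Elements of an operad with labelled inputs -/

namespace ICat
open Stage
section Labelled
variable {V : Type u} [Category.{v} V] [CartesianMonoidalCategory V] [HasLimits V]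

namespace Operad
variable (O : Operad V) (F : Stage V) {G : Stage V}

/-- The action of bijections on generalized elements. -/
noncomputable def actF {m n : ℕ} (σ : Fin m ≃ Fin n) (x : F.obj (O.obj n)) : F.obj (O.obj m) :=
    F.map (O.act σ) x

/-- The composition of the operad on generalized elements. -/
noncomputable def gamF {k : ℕ} {j : Fin k → ℕ} (x : F.obj (O.obj k)) (y : ∀ i, F.obj (O.obj (j i)))
    :
    F.obj (O.obj (∑ i, j i)) := F.map (O.γ j) (F.pair x (F.tuple y))

/-- The unit of the operad as a generalized element. -/
noncomputable def unitF : F.obj (O.obj 1) := F.map O.unit F.star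

variable {F}

theorem actF_actF {m n p : ℕ} (τ : Fin n ≃ Fin p) (σ : Fin m ≃ Fin n) (x : F.obj (O.obj p)) :
    O.actF F σ (O.actF F τ x) = O.actF F (σ.trans τ) x := by
  unfold actF
  rw [O.act_trans, F.map_comp]

theorem actF_refl {n : ℕ} (x : F.obj (O.obj n)) : O.actF F (Equiv.refl _) x = x := by
  unfold actF
  rw [O.act_refl, F.map_id]

theorem app_actF (h : F.Hom G) {m n : ℕ} (σ : Fin m ≃ Fin n) (x : F.obj (O.obj n)) :
    h.app (O.actF F σ x) = O.actF G σ (h.app x) := h.nat _ _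

theorem app_gamF (h : F.Hom G) {k : ℕ} {j : Fin k → ℕ} (x : F.obj (O.obj k))
    (y : ∀ i, F.obj (O.obj (j i))) :
    h.app (O.gamF F x y) = O.gamF G (h.app x) fun i => h.app (y i) := by
  unfold gamF
  rw [h.nat, h.pair, h.tuple]

theorem app_unitF (h : F.Hom G) : h.app (O.unitF F) = O.unitF G := by
  unfold unitF
  rw [h.nat, G.star_eq (h.app _)]

theorem map_gam {X : ICat V} {k : ℕ} {j : Fin k → ℕ} (f : X ⟶ O.obj k)
    (g : ∀ i, X ⟶ O.obj (j i)) (x : F.obj X) :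
    F.map (O.gam f g) x = O.gamF F (F.map f x) fun i => F.map (g i) x :=
  O.app_gamF (ev x) f g

theorem map_unit {X : ICat V} (x : F.obj X) : F.map (toUnit X ≫ O.unit) x = O.unitF F :=
  O.app_unitF (ev x)

theorem unitF_gamF {n : ℕ} (y : F.obj (O.obj n)) :
    O.gamF F (k := 1) (O.unitF F) (fun _ => y) = O.actF F (finCongr (by simp)) y := by
  have := congrArg (fun f => F.map f y) (O.unit_gam (𝟙 (O.obj n)))
  simp only [map_gam, map_unit, F.map_id, Category.id_comp] at this
  exact this

theorem gamF_unitF {k : ℕ} (x : F.obj (O.obj k)) :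
    O.gamF F x (fun _ => O.unitF F) = O.actF F (finCongr (by simp)) x := by
  have := congrArg (fun f => F.map f x) (O.gam_unit (𝟙 (O.obj k)))
  simp only [map_gam, map_unit, F.map_id, Category.id_comp] at this
  exact this

theorem gamF_assoc {k : ℕ} {j : Fin k → ℕ} {l : Fin (∑ i, j i) → ℕ} (x : F.obj (O.obj k))
    (y : ∀ i, F.obj (O.obj (j i))) (z : ∀ p, F.obj (O.obj (l p))) :
    O.gamF F (O.gamF F x y) z =
      O.actF F (assocPerm j l)
        (O.gamF F x fun i => O.gamF F (y i) fun a => z (finSigmaFinEquiv ⟨i, a⟩)) := by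
  have := congrArg (fun f => F.map f (F.pair x (F.pair (F.tuple y) (F.tuple z))))
    (O.assoc (fst _ _) (fun i => snd _ _ ≫ fst _ _ ≫ piπ _ i)
      (fun p => snd _ _ ≫ snd _ _ ≫ piπ _ p))
  simp only [map_gam, F.map_comp, F.map_fst, F.map_snd, F.map_π] at this
  exact this

theorem gamF_equiv_left {k k' : ℕ} (σ : Fin k ≃ Fin k') {j : Fin k' → ℕ} (x : F.obj (O.obj k'))
    (y : ∀ i, F.obj (O.obj (j i))) :
    O.gamF F (O.actF F σ x) (fun i => y (σ i)) = O.actF F (blockPerm σ j) (O.gamF F x y) := by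
  have := congrArg (fun f => F.map f (F.pair x (F.tuple y)))
    (O.equiv_left σ (fst _ _) (fun i => snd _ _ ≫ piπ _ i))
  simp only [map_gam, F.map_comp, F.map_fst, F.map_snd, F.map_π] at this
  exact this

theorem gamF_equiv_right {k : ℕ} {j j' : Fin k → ℕ} (τ : ∀ i, Fin (j i) ≃ Fin (j' i))
    (x : F.obj (O.obj k)) (y : ∀ i, F.obj (O.obj (j' i))) :
    O.gamF F x (fun i => O.actF F (τ i) (y i)) = O.actF F (sumPerm τ) (O.gamF F x y) := by
  have := congrArg (fun f => F.map f (F.pair x (F.tuple y)))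
    (O.equiv_right τ (fst _ _) (fun i => snd _ _ ≫ piπ _ i))
  simp only [map_gam, F.map_comp, F.map_fst, F.map_snd, F.map_π] at this
  exact this

end Operad

/-- The generalized elements of `O(S)`, for a finite set `S`: an element of `O(n)` whose inputs are
labelled by the elements of `S`. It is encoded through a chosen numbering of `S`. -/
@[ext]
structure Lab (O : Operad V) (F : Stage V) (S : Type) : Type v where
  ofVal ::
  val : F.obj (O.obj (Nat.card S))

namespace Lab
variable {O : Operad V} {F G : Stage V} {S S' S'' P Q R : Type} [Finite S] [Finite S'] [Finite S'']
  [Finite P] [Finite Q] [Finite R]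

/-- The element of `O(n)` obtained by numbering the labels. -/
noncomputable def at' {n : ℕ} (x : Lab O F S) (a : Fin n ≃ S) : F.obj (O.obj n) :=
  O.actF F (a.trans (Finite.equivFin S)) x.val

/-- The labelled element obtained from an element of `O(n)` and a labelling of its inputs. -/
noncomputable def mk {n : ℕ} (a : Fin n ≃ S) (x : F.obj (O.obj n)) : Lab O F S :=
  ⟨O.actF F ((Finite.equivFin S).symm.trans a.symm) x⟩

/-- Reindexing along a bijection of label sets. -/
noncomputable def re (x : Lab O F S') (e : S ≃ S') : Lab O F S :=
  ⟨O.actF F ((Finite.equivFin S).symm.trans (e.trans (Finite.equivFin S'))) x.val⟩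

theorem mk_at {m n : ℕ} (a : Fin n ≃ S) (x : F.obj (O.obj n)) (b : Fin m ≃ S) :
    (mk a x).at' b = O.actF F (b.trans a.symm) x := by
  unfold mk at'
  rw [Operad.actF_actF]
  congr 1
  ext; simp

@[simp] theorem mk_at_self {n : ℕ} (a : Fin n ≃ S) (x : F.obj (O.obj n)) : (mk a x).at' a = x := by
  rw [mk_at, Equiv.self_trans_symm, Operad.actF_refl]

@[simp] theorem at_mk {n : ℕ} (x : Lab O F S) (a : Fin n ≃ S) : mk a (x.at' a) = x := by
  unfold mk at'
  ext1
  rw [Operad.actF_actF]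
  convert! O.actF_refl x.val
  ext; simp

theorem ext_at {n : ℕ} (a : Fin n ≃ S) {x y : Lab O F S} (h : x.at' a = y.at' a) : x = y := by
  rw [← at_mk x a, h, at_mk]

theorem actF_at {m n : ℕ} (x : Lab O F S) (a : Fin n ≃ S) (σ : Fin m ≃ Fin n) :
    O.actF F σ (x.at' a) = x.at' (σ.trans a) := by
  unfold at'
  rw [Operad.actF_actF]
  rfl

theorem re_at {n : ℕ} (x : Lab O F S') (e : S ≃ S') (a : Fin n ≃ S) :
    (x.re e).at' a = x.at' (a.trans e) := by
  unfold re at'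
  rw [Operad.actF_actF]
  congr 1
  ext; simp

theorem re_re (x : Lab O F S'') (e : S' ≃ S'') (f : S ≃ S') : (x.re e).re f = x.re (f.trans e) :=
  ext_at (Finite.equivFin S).symm (by rw [re_at, re_at, re_at]; rfl)

@[simp] theorem re_refl (x : Lab O F S) : x.re (Equiv.refl S) = x :=
  ext_at (Finite.equivFin S).symm (by rw [re_at]; rfl)

/-- The value of a natural transformation of stages at a labelled element. -/
noncomputable def ap (h : F.Hom G) (x : Lab O F S) : Lab O G S := ⟨h.app x.val⟩

theorem ap_at (h : F.Hom G) {n : ℕ} (x : Lab O F S) (a : Fin n ≃ S) :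
    (x.ap h).at' a = h.app (x.at' a) := (O.app_actF h _ x.val).symm

theorem ap_mk (h : F.Hom G) {n : ℕ} (a : Fin n ≃ S) (x : F.obj (O.obj n)) :
    (mk a x).ap h = mk a (h.app x) := Lab.ext (O.app_actF h _ x)

theorem ap_re (h : F.Hom G) (x : Lab O F S') (e : S ≃ S') : (x.re e).ap h = (x.ap h).re e :=
  Lab.ext (O.app_actF h _ x.val)

/-- `x` is the reindexing of `x'` along `e`. Equations between operadic formulas take this form,
because the two sides are labelled by different, canonically isomorphic, sets. -/
def Eqv (e : S ≃ S') (x : Lab O F S) (x' : Lab O F S') : Prop := x = x'.re e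

theorem Eqv.refl (x : Lab O F S) : Eqv (Equiv.refl S) x x := (re_refl x).symm

theorem Eqv.of_re (x : Lab O F S') (e : S ≃ S') : Eqv e (x.re e) x := rfl

theorem Eqv.trans {e : S ≃ S'} {e' : S' ≃ S''} {x : Lab O F S} {x' : Lab O F S'}
    {x'' : Lab O F S''} (h : Eqv e x x') (h' : Eqv e' x' x'') : Eqv (e.trans e') x x'' := by
  unfold Eqv at *
  rw [h, h', re_re]

theorem Eqv.symm {e : S ≃ S'} {x : Lab O F S} {x' : Lab O F S'} (h : Eqv e x x') :
    Eqv e.symm x' x := by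
  unfold Eqv at *
  rw [h, re_re, Equiv.symm_trans_self, re_refl]

theorem Eqv.of_eq {e e' : S ≃ S'} {x : Lab O F S} {x' : Lab O F S'} (h : Eqv e x x')
    (he : ∀ a, e a = e' a) : Eqv e' x x' := by
  obtain rfl := Equiv.ext he
  exact h

theorem Eqv.of_eq_symm {e e' : S ≃ S'} {x : Lab O F S} {x' : Lab O F S'} (h : Eqv e x x')
    (he : ∀ a, e.symm a = e'.symm a) : Eqv e' x x' :=
  h.of_eq fun a => by rw [← e'.symm_apply_eq, ← he, e.symm_apply_apply]

theorem Eqv.ap (h : F.Hom G) {e : S ≃ S'} {x : Lab O F S} {x' : Lab O F S'} (hx : Eqv e x x') :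
    Eqv e (x.ap h) (x'.ap h) := by
  unfold Eqv at *
  rw [hx, ap_re]

theorem Eqv.at_eq {e : S ≃ S'} {x : Lab O F S} {x' : Lab O F S'} (hx : Eqv e x x') {n : ℕ}
    (a : Fin n ≃ S) : x.at' a = x'.at' (a.trans e) := by
  rw [← re_at, ← hx]

/-- Members of a family with equal indices. -/
theorem Eqv.fam {ι : Type} {K : ι → Type} [∀ i, Finite (K i)] (x : ∀ i, Lab O F (K i)) {i i' : ι}
    (h : i = i') : Eqv (Equiv.cast (congrArg K h)) (x i) (x i') := by
  subst h
  exact Eqv.refl _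

section Gam
variable {K K' : S → Type} [∀ s, Finite (K s)] [∀ s, Finite (K' s)]

/-- The numbering of a disjoint union given by numberings. -/
def sigNum {k : ℕ} {j : Fin k → ℕ} (a : Fin k ≃ S) (b : ∀ i, Fin (j i) ≃ K (a i)) :
    Fin (∑ i, j i) ≃ Σ s, K s := finSigmaFinEquiv.symm.trans (Equiv.sigmaCongr a b)

theorem sigNum_apply {k : ℕ} {j : Fin k → ℕ} (a : Fin k ≃ S) (b : ∀ i, Fin (j i) ≃ K (a i))
    (i : Fin k) (t : Fin (j i)) : sigNum a b (finSigmaFinEquiv ⟨i, t⟩) = ⟨a i, b i t⟩ := by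
  unfold sigNum
  rw [Equiv.trans_apply, Equiv.symm_apply_apply]
  rfl

/-- The composition `γ(x; (y_s))`; its inputs are labelled by the disjoint union of the labels. -/
noncomputable def gam (x : Lab O F S) (y : ∀ s, Lab O F (K s)) : Lab O F (Σ s, K s) :=
  mk (sigNum (Finite.equivFin S).symm fun _ => (Finite.equivFin _).symm)
    (O.gamF F (x.at' (Finite.equivFin S).symm) fun _ => (y _).at' (Finite.equivFin _).symm)

/-- In any numberings of the labels, the composition is that of the operad. -/
theorem gam_at {k : ℕ} {j : Fin k → ℕ} (a : Fin k ≃ S) (b : ∀ i, Fin (j i) ≃ K (a i))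
    (x : Lab O F S) (y : ∀ s, Lab O F (K s)) :
    (gam x y).at' (sigNum a b) = O.gamF F (x.at' a) fun i => (y (a i)).at' (b i) := by
  obtain ⟨σ, rfl⟩ : ∃ σ : Fin k ≃ Fin (Nat.card S), a = σ.trans (Finite.equivFin S).symm :=
    ⟨a.trans (Finite.equivFin S), by ext; simp⟩
  have h1 : (fun i => (y ((σ.trans (Finite.equivFin S).symm) i)).at' (b i)) =
      fun i => O.actF F ((b i).trans (Finite.equivFin (K ((Finite.equivFin S).symm (σ i)))))
        ((y ((Finite.equivFin S).symm (σ i))).at' (Finite.equivFin _).symm) := by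
    funext i
    rw [actF_at]
    congr 1
    exact Equiv.ext fun t => (Equiv.symm_apply_apply _ _).symm
  rw [h1, O.gamF_equiv_right, ← actF_at]
  rw [O.gamF_equiv_left σ (x.at' _)
    (fun i => (y ((Finite.equivFin S).symm i)).at' (Finite.equivFin _).symm)]
  unfold gam
  rw [mk_at, Operad.actF_actF]
  congr 1
  ext p
  obtain ⟨⟨i, t⟩, rfl⟩ := finSigmaFinEquiv.surjective p
  rw [Equiv.trans_apply, Equiv.trans_apply, sumPerm_apply, blockPerm_apply, sigNum_apply]
  congr 1
  rw [Equiv.symm_apply_eq, sigNum_apply]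
  exact Sigma.ext rfl (heq_of_eq (Equiv.symm_apply_apply _ _).symm)

theorem ap_gam (h : F.Hom G) (x : Lab O F S) (y : ∀ s, Lab O F (K s)) :
    (gam x y).ap h = gam (x.ap h) fun s => (y s).ap h := by
  unfold gam
  rw [ap_mk, O.app_gamF, ap_at]
  simp only [ap_at]

/-- The equivariance of the operadic composition, as naturality in the label sets. -/
theorem Eqv.gam {K' : S' → Type} [∀ s, Finite (K' s)] {σ : S ≃ S'} {τ : ∀ s, K s ≃ K' (σ s)}
    {x : Lab O F S} {x' : Lab O F S'} {y : ∀ s, Lab O F (K s)} {y' : ∀ s, Lab O F (K' s)}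
    (hx : Eqv σ x x') (hy : ∀ s, Eqv (τ s) (y s) (y' (σ s))) :
    Eqv (Equiv.sigmaCongr σ τ) (gam x y) (gam x' y') := by
  refine ext_at (sigNum (Finite.equivFin S).symm fun _ => (Finite.equivFin _).symm) ?_
  rw [re_at]
  have h := gam_at ((Finite.equivFin S).symm.trans σ)
    (fun i => (Finite.equivFin (K _)).symm.trans (τ ((Finite.equivFin S).symm i))) x' y'
  have e : (sigNum (Finite.equivFin S).symm fun i =>
      (Finite.equivFin (K ((Finite.equivFin S).symm i))).symm).trans (Equiv.sigmaCongr σ τ) =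
      sigNum (K := K') ((Finite.equivFin S).symm.trans σ)
        (fun i => (Finite.equivFin (K _)).symm.trans (τ ((Finite.equivFin S).symm i))) := by
    ext1 p
    obtain ⟨⟨i, t⟩, rfl⟩ := finSigmaFinEquiv.surjective p
    rw [Equiv.trans_apply, sigNum_apply, sigNum_apply]
    rfl
  rw [e]
  refine Eq.trans ?_ h.symm
  rw [gam_at, hx.at_eq]
  congr 1
  funext i
  exact (hy _).at_eq _

theorem Eqv.gam_right {τ : ∀ s, K s ≃ K' s} (x : Lab O F S) {y : ∀ s, Lab O F (K s)}
    {y' : ∀ s, Lab O F (K' s)} (hy : ∀ s, Eqv (τ s) (y s) (y' s)) :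
    Eqv (Equiv.sigmaCongrRight τ) (Lab.gam x y) (Lab.gam x y') :=
  (Eqv.gam (σ := Equiv.refl S) (Eqv.refl x) hy).of_eq fun _ => rfl

/-- The bijection `⟨⟨s, k⟩, l⟩ ↦ ⟨s, ⟨k, l⟩⟩`. -/
def sigAssoc (L : (Σ s, K s) → Type) : (Σ p, L p) ≃ Σ s, Σ k : K s, L ⟨s, k⟩ where
  toFun p := ⟨p.1.1, p.1.2, p.2⟩
  invFun p := ⟨⟨p.1, p.2.1⟩, p.2.2⟩
  left_inv _ := rfl
  right_inv _ := rfl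

theorem sigNum_assoc {L : (Σ s, K s) → Type} [∀ p, Finite (L p)] {k : ℕ} {j : Fin k → ℕ}
    (a : Fin k ≃ S) (b : ∀ i, Fin (j i) ≃ K (a i)) {l : Fin (∑ i, j i) → ℕ}
    (c : ∀ p, Fin (l p) ≃ L (sigNum a b p))
    (c' : ∀ i t, Fin (l (finSigmaFinEquiv ⟨i, t⟩)) ≃ L ⟨a i, b i t⟩)
    (h : ∀ i t r, (⟨_, c (finSigmaFinEquiv ⟨i, t⟩) r⟩ : Σ p, L p) = ⟨⟨a i, b i t⟩, c' i t r⟩) :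
    (sigNum (sigNum a b) c).trans (sigAssoc L) = (assocPerm j l).trans
      (sigNum (K := fun s => Σ k : K s, L ⟨s, k⟩) a
        fun i => sigNum (K := fun k => L ⟨a i, k⟩) (b i) (c' i)) := by
  ext1 p
  obtain ⟨⟨p, r⟩, rfl⟩ := finSigmaFinEquiv.surjective p
  obtain ⟨⟨i, t⟩, rfl⟩ := finSigmaFinEquiv.surjective p
  rw [Equiv.trans_apply, Equiv.trans_apply, sigNum_apply, h, assocPerm_apply, sigNum_apply]
  exact (congrArg (Sigma.mk (a i)) (sigNum_apply (K := fun k => L ⟨a i, k⟩) (b i) (c' i) t r)).symm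

/-- The associativity of the operadic composition. -/
theorem gam_assoc {L : (Σ s, K s) → Type} [∀ p, Finite (L p)] (x : Lab O F S)
    (y : ∀ s, Lab O F (K s)) (z : ∀ p, Lab O F (L p)) :
    Eqv (sigAssoc L) (gam (gam x y) z) (gam x fun s => gam (y s) fun k => z ⟨s, k⟩) := by
  obtain ⟨k, ⟨a⟩⟩ : ∃ k, Nonempty (Fin k ≃ S) := ⟨_, ⟨(Finite.equivFin S).symm⟩⟩
  obtain ⟨j, ⟨b⟩⟩ : ∃ j : Fin k → ℕ, Nonempty (∀ i, Fin (j i) ≃ K (a i)) :=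
    ⟨_, ⟨fun i => (Finite.equivFin (K (a i))).symm⟩⟩
  obtain ⟨l, ⟨c⟩⟩ : ∃ l : Fin (∑ i, j i) → ℕ, Nonempty (∀ p, Fin (l p) ≃ L (sigNum a b p)) :=
    ⟨_, ⟨fun p => (Finite.equivFin (L (sigNum a b p))).symm⟩⟩
  refine ext_at (sigNum (sigNum a b) c) ?_
  rw [re_at, sigNum_assoc a b c (fun i t => (c _).trans
    (Equiv.cast (congrArg L (sigNum_apply a b i t))))
    (fun i t r => Sigma.ext (sigNum_apply a b i t) (by simp)), gam_at, gam_at, O.gamF_assoc, ←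
        actF_at, gam_at]
  congr 2
  funext i
  rw [gam_at]
  congr 1
  funext t
  exact (Eqv.fam z (sigNum_apply a b i t)).at_eq _

end Gam

/-- The unit of the operad, labelled by a set with one element. -/
noncomputable def unit [Unique S] : Lab O F S := mk (Equiv.ofUnique (Fin 1) S) (O.unitF F)

theorem ap_unit (h : F.Hom G) [Unique S] : (unit : Lab O F S).ap h = unit := by
  unfold unit
  rw [ap_mk, O.app_unitF]

theorem unit_at [Unique S] (a : Fin 1 ≃ S) : (unit : Lab O F S).at' a = O.unitF F := by
  rw [Subsingleton.elim a (Equiv.ofUnique (Fin 1) S)]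
  exact mk_at_self _ _

theorem unit_gam [Unique S] {K : S → Type} [∀ s, Finite (K s)] (y : ∀ s, Lab O F (K s)) :
    Eqv (Equiv.uniqueSigma K) (gam unit y) (y default) := by
  refine ext_at (sigNum (j := fun _ => Nat.card (K default)) (Equiv.ofUnique (Fin 1) S)
    (fun _ => (Finite.equivFin (K default)).symm)) ?_
  refine (gam_at (K := K) (j := fun _ => Nat.card (K default)) (Equiv.ofUnique (Fin 1) S)
    (fun _ => (Finite.equivFin (K default)).symm) unit y).trans ?_
  refine (congrArg (fun t => O.gamF F t _) (unit_at _)).trans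
    ((O.unitF_gamF ((y default).at' (Finite.equivFin (K default)).symm)).trans ?_)
  refine Eq.trans ?_ (re_at _ _ _).symm
  rw [actF_at]
  refine congrArg (fun t => at' (y default) t) ?_
  ext1 p
  obtain ⟨⟨i, t⟩, rfl⟩ := finSigmaFinEquiv.surjective p
  obtain rfl := Subsingleton.elim i 0
  refine Eq.trans ?_ (congrArg (Equiv.uniqueSigma K) (sigNum_apply (K := K)
    (Equiv.ofUnique (Fin 1) S) (fun _ => (Finite.equivFin (K default)).symm) 0 t).symm)
  refine congrArg (Finite.equivFin (K default)).symm ?_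
  ext
  simp [finSigmaFinEquiv_apply]

theorem gam_unit {K : S → Type} [∀ s, Unique (K s)] (x : Lab O F S) :
    Eqv (Equiv.sigmaUnique S K) (gam x fun _ => unit) x := by
  refine ext_at (sigNum (j := fun _ => 1) (Finite.equivFin S).symm
    (fun _ => Equiv.ofUnique (Fin 1) _)) ?_
  rw [gam_at, re_at]
  simp only [unit_at]
  rw [O.gamF_unitF, actF_at]
  congr 1
  ext1 p
  obtain ⟨⟨i, t⟩, rfl⟩ := finSigmaFinEquiv.surjective p
  obtain rfl := Subsingleton.elim t 0
  rw [Equiv.trans_apply, Equiv.trans_apply, sigNum_apply]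
  change (Finite.equivFin S).symm _ = (Finite.equivFin S).symm i
  congr 1
  ext
  simp [finSigmaFinEquiv_apply]

end Lab
end Labelled
end ICat

/-! ### The intrinsic pairing on labelled elements -/

namespace ICat
open Stage
section Tensor
variable {V : Type u} [Category.{v} V] [CartesianMonoidalCategory V] [HasLimits V]

namespace Lab
variable {O : Operad V} {F G : Stage V} {S S' S'' P Q R R' : Type} [Finite S] [Finite S']
  [Finite S''] [Finite P] [Finite Q] [Finite R] [Finite R']

/-- The numbering of a product given by numberings, in lexicographic order. -/
def prodNum {j k : ℕ} (a : Fin j ≃ S) (b : Fin k ≃ R) : Fin (j * k) ≃ S × R :=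
  finProdFinEquiv.symm.trans (Equiv.prodCongr a b)

@[simp] theorem prodNum_apply {j k : ℕ} (a : Fin j ≃ S) (b : Fin k ≃ R) (i : Fin j) (t : Fin k) :
    prodNum a b (finProdFinEquiv (i, t)) = (a i, b t) := by
  unfold prodNum
  rw [Equiv.trans_apply, Equiv.symm_apply_apply]
  rfl

/-- The intrinsic pairing `x ⊗ y`; its inputs are labelled by pairs. -/
noncomputable def tens (x : Lab O F S) (y : Lab O F R) : Lab O F (S × R) :=
  (gam x fun _ => y).re (Equiv.sigmaEquivProd S R).symm

/-- The intrinsic pairing is the composition with a constant family. -/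
theorem tens_eqv (x : Lab O F S) (y : Lab O F R) :
    Eqv (Equiv.sigmaEquivProd S R).symm (tens x y) (gam x fun _ => y) := rfl

theorem tens_at {j k : ℕ} (a : Fin j ≃ S) (b : Fin k ≃ R) (x : Lab O F S) (y : Lab O F R) :
    (tens x y).at' (prodNum a b) = F.map (O.pairing j k) (F.pair (x.at' a) (y.at' b)) := by
  unfold Operad.pairing tens
  rw [F.map_comp, O.map_gam, F.map_fst, F.map_snd, re_at]
  change _ = O.actF F _ _
  rw [← gam_at a (fun _ => b) x (fun _ => y), actF_at]
  congr 1
  ext1 p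
  obtain ⟨⟨i, t⟩, rfl⟩ := finProdFinEquiv.surjective p
  have : finCongr (by simp) (finProdFinEquiv (i, t)) =
      finSigmaFinEquiv (n := fun _ : Fin j => k) ⟨i, t⟩ := by
    ext
    simp [finProdFinEquiv, finSigmaFinEquiv_apply, mul_comm, add_comm]
  rw [Equiv.trans_apply, Equiv.trans_apply, prodNum_apply, this, sigNum_apply]
  rfl

theorem ap_tens (h : F.Hom G) (x : Lab O F S) (y : Lab O F R) :
    (tens x y).ap h = tens (x.ap h) (y.ap h) := by
  unfold tens
  rw [ap_re, ap_gam]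

theorem tens_unit [Unique R] (x : Lab O F S) : Eqv (Equiv.prodUnique S R) (tens x unit) x :=
  ((tens_eqv _ _).trans (gam_unit x)).of_eq fun _ => rfl

theorem unit_tens [Unique S] (y : Lab O F R) : Eqv (Equiv.uniqueProd R S) (tens unit y) y :=
  ((tens_eqv _ _).trans (unit_gam fun _ => y)).of_eq fun p => by
    obtain ⟨s, r⟩ := p
    obtain rfl := Subsingleton.elim s default
    rfl

/-- An operad is reduced: there is only one element without inputs. -/
theorem ext_empty [IsEmpty S] (x y : Lab O F S) : x = y :=
  ext_at (Equiv.equivOfIsEmpty (Fin 0) S) (F.obj_subsingleton O.reduced _ _)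

/-- `x` has at most one input, and is the unit `1` if it has one. These are the elements `*` and `1`
that make up the morphisms coming from `Π`. -/
structure IsLow (x : Lab O F S) : Prop where
  subsingleton : Subsingleton S
  at_eq : ∀ e : Fin 1 ≃ S, x.at' e = O.unitF F

theorem isLow_unit [Unique S] : IsLow (unit : Lab O F S) := ⟨inferInstance, unit_at⟩

theorem isLow_of_isEmpty [IsEmpty S] (x : Lab O F S) : IsLow x :=
  ⟨inferInstance, fun e => isEmptyElim (e 0)⟩

theorem IsLow.eq_unit [Unique S] {x : Lab O F S} (h : IsLow x) : x = unit :=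
  ext_at (Equiv.ofUnique (Fin 1) S) (by rw [h.at_eq, unit_at])

theorem IsLow.ext {x y : Lab O F S} (hx : IsLow x) (hy : IsLow y) : x = y := by
  have := hx.subsingleton
  rcases isEmpty_or_nonempty S with h | ⟨⟨s⟩⟩
  · exact ext_empty x y
  · let : Unique S := ⟨⟨s⟩, fun t => Subsingleton.elim t s⟩
    rw [hx.eq_unit, hy.eq_unit]

theorem IsLow.eqv {x : Lab O F S} {x' : Lab O F S'} (hx : IsLow x) (hx' : IsLow x') (e : S ≃ S') :
    Eqv e x x' :=
  hx.ext ⟨hx.subsingleton, fun f => by rw [re_at, hx'.at_eq]⟩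

theorem IsLow.re {x : Lab O F S'} (hx : IsLow x) (e : S ≃ S') : IsLow (x.re e) :=
  ⟨have := hx.subsingleton; e.subsingleton, fun f => by rw [re_at, hx.at_eq]⟩

theorem IsLow.gam {K : S → Type} [∀ s, Finite (K s)] {x : Lab O F S} {y : ∀ s, Lab O F (K s)}
    (hx : IsLow x) (hy : ∀ s, IsLow (y s)) : IsLow (Lab.gam x y) := by
  have := hx.subsingleton
  rcases isEmpty_or_nonempty S with h | ⟨⟨s⟩⟩
  · exact isLow_of_isEmpty _
  · let : Unique S := ⟨⟨s⟩, fun t => Subsingleton.elim t s⟩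
    rw [hx.eq_unit]
    have h := Lab.unit_gam y
    unfold Eqv at h
    rw [h]
    exact (hy _).re _

theorem IsLow.tens {x : Lab O F S} {y : Lab O F R} (hx : IsLow x) (hy : IsLow y) :
    IsLow (Lab.tens x y) := (hx.gam fun _ => hy).re _

variable {T : V}

/-- The source of a labelled generalized morphism. -/
noncomputable abbrev src (x : Lab O (mors V T) S) : Lab O (obs V T) S := x.ap (Stage.src T)
/-- The target of a labelled generalized morphism. -/
noncomputable abbrev tgt (x : Lab O (mors V T) S) : Lab O (obs V T) S := x.ap (Stage.tgt T)
/-- The identity of a labelled generalized object. -/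
noncomputable abbrev one (x : Lab O (obs V T) S) : Lab O (mors V T) S := x.ap (Stage.idm T)

@[simp] theorem src_one (x : Lab O (obs V T) S) : x.one.src = x := Lab.ext src_idm
@[simp] theorem tgt_one (x : Lab O (obs V T) S) : x.one.tgt = x := Lab.ext tgt_idm

/-- The labelled generalized morphism `z` is the composite of `x` and `y`, in this order. A relation
is used in place of an operation, since composition is defined only for matching target and
source. -/
def Cmp (x y z : Lab O (mors V T) S) : Prop := CompIs x.val y.val z.val

theorem Cmp.at {x y z : Lab O (mors V T) S} (h : Cmp x y z) {n : ℕ} (a : Fin n ≃ S) :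
    CompIs (x.at' a) (y.at' a) (z.at' a) := CompIs.map h _

theorem Cmp.mk {n : ℕ} (a : Fin n ≃ S) {x y z : (mors V T).obj (O.obj n)} (h : CompIs x y z) :
    Cmp (Lab.mk a x) (Lab.mk a y) (Lab.mk a z) := CompIs.map h _

theorem Cmp.of_at {x y z : Lab O (mors V T) S} {n : ℕ} (a : Fin n ≃ S)
    (h : CompIs (x.at' a) (y.at' a) (z.at' a)) : Cmp x y z := by
  have := Cmp.mk a h
  simpa only [at_mk] using this

theorem Cmp.re {x y z : Lab O (mors V T) S'} (h : Cmp x y z) (e : S ≃ S') :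
    Cmp (x.re e) (y.re e) (z.re e) := CompIs.map h _

theorem Cmp.gam {K : S → Type} [∀ s, Finite (K s)] {x y z : Lab O (mors V T) S}
    {x' y' z' : ∀ s, Lab O (mors V T) (K s)} (h : Cmp x y z)
    (h' : ∀ s, Cmp (x' s) (y' s) (z' s)) :
    Cmp (Lab.gam x x') (Lab.gam y y') (Lab.gam z z') :=
  Cmp.mk _ (((h.at _).pair (CompIs.tuple fun _ => (h' _).at _)).map _)

theorem Cmp.id_left {x : Lab O (mors V T) S} {a : Lab O (obs V T) S} (h : x.src = a) :
    Cmp a.one x x := CompIs.id_left (congrArg Lab.val h)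

theorem Cmp.id_right {x : Lab O (mors V T) S} {a : Lab O (obs V T) S} (h : x.tgt = a) :
    Cmp x a.one x := CompIs.id_right (congrArg Lab.val h)

theorem Cmp.one (a : Lab O (obs V T) S) : Cmp a.one a.one a.one := Cmp.id_left (src_one a)

theorem Cmp.unique {x y z z' : Lab O (mors V T) S} (h : Cmp x y z) (h' : Cmp x y z') : z = z' :=
  Lab.ext (CompIs.unique h h')

theorem Cmp.mid {x y z : Lab O (mors V T) S} (h : Cmp x y z) : x.tgt = y.src :=
  Lab.ext (CompIs.mid h)

theorem Cmp.src {x y z : Lab O (mors V T) S} (h : Cmp x y z) : z.src = x.src :=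
  Lab.ext (CompIs.src h)

theorem Cmp.tgt {x y z : Lab O (mors V T) S} (h : Cmp x y z) : z.tgt = y.tgt :=
  Lab.ext (CompIs.tgt h)

theorem Cmp.exists {x y : Lab O (mors V T) S} (h : x.tgt = y.src) : ∃ z, Cmp x y z :=
  let ⟨z, hz⟩ := CompIs.exists (congrArg Lab.val h); ⟨⟨z⟩, hz⟩

theorem Cmp.assoc {a b c ab bc r : Lab O (mors V T) S} (h1 : Cmp a b ab) (h2 : Cmp ab c r)
    (h3 : Cmp b c bc) : Cmp a bc r := CompIs.assoc h1 h2 h3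

theorem Cmp.assoc' {a b c ab bc r : Lab O (mors V T) S} (h1 : Cmp a b ab) (h2 : Cmp a bc r)
    (h3 : Cmp b c bc) : Cmp ab c r := CompIs.assoc' h1 h2 h3

theorem Cmp.of_eqv {e : S ≃ S'} {x y z : Lab O (mors V T) S} {x' y' z' : Lab O (mors V T) S'}
    (h : Cmp x' y' z') (hx : Eqv e x x') (hy : Eqv e y y') (hz : Eqv e z z') : Cmp x y z := by
  unfold Eqv at *
  rw [hx, hy, hz]
  exact h.re e

end Lab
end Tensor

/-! ### The transformation `α` on labelled elements -/

section Alpha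
variable {V : Type u} [Category.{v} V] [CartesianMonoidalCategory V] [HasLimits V]
variable {O : Operad V} (A : O.PseudoCommutative) {S S' R R' Z : Type} [Finite S] [Finite S']
  [Finite R] [Finite R'] [Finite Z] {T : V}

namespace Lab

/-- The component `α_{x,y}` at generalized objects. -/
noncomputable def alphaF {j k : ℕ} (x : (obs V T).obj (O.obj j)) (y : (obs V T).obj (O.obj k)) :
    (mors V T).obj (O.obj (k * j)) := (obPair x y : T ⟶ _) ≫ (A.α j k).hom.app

theorem src_alphaF {j k : ℕ} (x : (obs V T).obj (O.obj j)) (y : (obs V T).obj (O.obj k)) :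
    (Stage.src T).app (alphaF A x y) =
      O.actF _ (FHom.tauEquiv k j) ((obs V T).map (O.pairing j k) ((obs V T).pair x y)) :=
  (Category.assoc _ _ _).trans ((congrArg (fun t => obPair x y ≫ t) (A.α j k).hom.src).trans
    ((obs V T).map_comp _ _ _))

theorem tgt_alphaF {j k : ℕ} (x : (obs V T).obj (O.obj j)) (y : (obs V T).obj (O.obj k)) :
    (Stage.tgt T).app (alphaF A x y) = (obs V T).map (O.pairing k j) ((obs V T).pair y x) := by
  refine (Category.assoc _ _ _).trans ((congrArg (fun t => obPair x y ≫ t)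
    (A.α j k).hom.tgt).trans (((obs V T).map_comp _ _ ((obs V T).pair x y)).trans ?_))
  rw [Stage.map_lift, (obs V T).map_fst, (obs V T).map_snd]

theorem alphaF_equivariant {j k : ℕ} (σ : Equiv.Perm (Fin k)) (ρ : Equiv.Perm (Fin j))
    (x : (obs V T).obj (O.obj j)) (y : (obs V T).obj (O.obj k)) :
    O.actF _ (Operad.prodPerm σ ρ) (alphaF A x y) = alphaF A (O.actF _ ρ x) (O.actF _ σ y) :=
  A.α_equivariant σ ρ x y

theorem alphaF_nat {j k : ℕ} (f : (mors V T).obj (O.obj j)) (g : (mors V T).obj (O.obj k)) :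
    ∃ z, CompIs (O.actF _ (FHom.tauEquiv k j) ((mors V T).map (O.pairing j k) ((mors V T).pair f
        g)))
        (alphaF A ((Stage.tgt T).app f) ((Stage.tgt T).app g)) z ∧
      CompIs (alphaF A ((Stage.src T).app f) ((Stage.src T).app g))
        ((mors V T).map (O.pairing k j) ((mors V T).pair g f)) z := by
  have e1 := (Stage.tgt T).pair f g
  have e2 := (Stage.src T).pair f g
  have e3 : (mors V T).map (O.pairing j k ≫ O.act (FHom.tauEquiv k j)) ((mors V T).pair f g) =
      O.actF _ (FHom.tauEquiv k j) ((mors V T).map (O.pairing j k) ((mors V T).pair f g)) :=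
    (mors V T).map_comp _ _ _
  have e4 : (mors V T).map (sw (O.obj j) (O.obj k) ≫ O.pairing k j) ((mors V T).pair f g) =
      (mors V T).map (O.pairing k j) ((mors V T).pair g f) := by
    rw [(mors V T).map_comp, Stage.map_lift, (mors V T).map_fst, (mors V T).map_snd]
  have w : (Stage.tgt T).app ((mors V T).map (O.pairing j k ≫ O.act (FHom.tauEquiv k j))
      ((mors V T).pair f g)) =
      (Stage.src T).app (alphaF A ((Stage.tgt T).app f) ((Stage.tgt T).app g)) := by
    rw [src_alphaF, e3, O.app_actF, (Stage.tgt T).nat, (Stage.tgt T).pair]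
  have w' : (Stage.tgt T).app (alphaF A ((Stage.src T).app f) ((Stage.src T).app g)) =
      (Stage.src T).app ((mors V T).map (sw (O.obj j) (O.obj k) ≫ O.pairing k j)
        ((mors V T).pair f g)) := by
    rw [tgt_alphaF, e4, (Stage.src T).nat, (Stage.src T).pair]
  have h1 : ((Stage.tgt T).app ((mors V T).pair f g) : T ⟶ _) ≫ (A.α j k).hom.app =
      alphaF A ((Stage.tgt T).app f) ((Stage.tgt T).app g) :=
    congrArg (fun t => (t : T ⟶ (O.obj j ⊗ O.obj k).Ob) ≫ (A.α j k).hom.app) e1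
  have h2 : ((Stage.src T).app ((mors V T).pair f g) : T ⟶ _) ≫ (A.α j k).hom.app =
      alphaF A ((Stage.src T).app f) ((Stage.src T).app g) :=
    congrArg (fun t => (t : T ⟶ (O.obj j ⊗ O.obj k).Ob) ≫ (A.α j k).hom.app) e2
  have W := w.trans (congrArg (Stage.src T).app h1.symm)
  have W' := (congrArg (Stage.tgt T).app h2).trans w'
  rw [← e3, ← e4, ← h1, ← h2]
  exact ⟨_, ⟨W, rfl⟩, W', ((A.α j k).hom.nat' ((mors V T).pair f g) W W').symm⟩

/-- The transformation `α_{x,y}` for labelled elements; its inputs are labelled by pairs. -/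
noncomputable def alpha (x : Lab O (obs V T) S) (y : Lab O (obs V T) R) : Lab O (mors V T) (R × S)
    :=
  mk (prodNum (Finite.equivFin R).symm (Finite.equivFin S).symm)
    (alphaF A (x.at' (Finite.equivFin S).symm) (y.at' (Finite.equivFin R).symm))

theorem alpha_at {j k : ℕ} (a : Fin j ≃ S) (b : Fin k ≃ R) (x : Lab O (obs V T) S)
    (y : Lab O (obs V T) R) :
    (alpha A x y).at' (prodNum b a) = alphaF A (x.at' a) (y.at' b) := by
  obtain rfl : j = Nat.card S := by simpa using Nat.card_congr a
  obtain rfl : k = Nat.card R := by simpa using Nat.card_congr b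
  unfold alpha
  have h1 : x.at' a = O.actF _ (a.trans (Finite.equivFin S)) (x.at' (Finite.equivFin S).symm) := by
    rw [actF_at]; congr 1; ext; simp
  have h2 : y.at' b = O.actF _ (b.trans (Finite.equivFin R)) (y.at' (Finite.equivFin R).symm) := by
    rw [actF_at]; congr 1; ext; simp
  rw [mk_at, h1, h2, ← alphaF_equivariant]
  congr 1

theorem alpha_src (x : Lab O (obs V T) S) (y : Lab O (obs V T) R) :
    (alpha A x y).src = (tens x y).re (Equiv.prodComm R S) := by
  refine ext_at (prodNum (Finite.equivFin R).symm (Finite.equivFin S).symm) ?_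
  rw [ap_at, alpha_at, src_alphaF, ← tens_at, actF_at, re_at]
  congr 1
  ext1 p
  obtain ⟨⟨i, t⟩, rfl⟩ := finProdFinEquiv.surjective p
  simp [FHom.tauEquiv]

theorem alpha_tgt (x : Lab O (obs V T) S) (y : Lab O (obs V T) R) :
    (alpha A x y).tgt = tens y x := by
  refine ext_at (prodNum (Finite.equivFin R).symm (Finite.equivFin S).symm) ?_
  rw [ap_at, alpha_at, tgt_alphaF, ← tens_at]

/-- The equivariance of `α`, as naturality in the label sets. -/
theorem Eqv.alpha {σ : S ≃ S'} {τ : R ≃ R'} {x : Lab O (obs V T) S} {x' : Lab O (obs V T) S'}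
    {y : Lab O (obs V T) R} {y' : Lab O (obs V T) R'} (hx : Eqv σ x x') (hy : Eqv τ y y') :
    Eqv (Equiv.prodCongr τ σ) (Lab.alpha A x y) (Lab.alpha A x' y') := by
  refine ext_at (prodNum (Finite.equivFin R).symm (Finite.equivFin S).symm) ?_
  have e : (prodNum (Finite.equivFin R).symm (Finite.equivFin S).symm).trans
      (Equiv.prodCongr τ σ) = prodNum ((Finite.equivFin R).symm.trans τ)
        ((Finite.equivFin S).symm.trans σ) := rfl
  rw [re_at, e, alpha_at, alpha_at, hx.at_eq, hy.at_eq]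

/-- The naturality of `α` in both variables. -/
theorem alpha_nat (x : Lab O (mors V T) S) (y : Lab O (mors V T) R) :
    ∃ z, Cmp ((tens x y).re (Equiv.prodComm R S)) (alpha A x.tgt y.tgt) z ∧
      Cmp (alpha A x.src y.src) (tens y x) z := by
  obtain ⟨z, h1, h2⟩ := alphaF_nat A (x.at' (Finite.equivFin S).symm)
    (y.at' (Finite.equivFin R).symm)
  refine ⟨mk (prodNum (Finite.equivFin R).symm (Finite.equivFin S).symm) z,
    Cmp.of_at (prodNum (Finite.equivFin R).symm (Finite.equivFin S).symm) ?_,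
    Cmp.of_at (prodNum (Finite.equivFin R).symm (Finite.equivFin S).symm) ?_⟩
  · rw [mk_at_self, alpha_at, ap_at, ap_at, re_at]
    rw [← tens_at, actF_at] at h1
    convert! h1 using 2
    ext1 p
    obtain ⟨⟨i, t⟩, rfl⟩ := finProdFinEquiv.surjective p
    simp [FHom.tauEquiv]
  · rw [mk_at_self, alpha_at, ap_at, ap_at, tens_at]
    exact h2

/-- The symmetry of `α`; on labelled elements the permutation `τ` is the interchange of the
components of the labels. -/
theorem alpha_symm (x : Lab O (obs V T) S) (y : Lab O (obs V T) R) :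
    Cmp ((alpha A x y).re (Equiv.prodComm S R)) (alpha A y x) (tens x y).one := by
  refine Cmp.of_at (prodNum (Finite.equivFin S).symm (Finite.equivFin R).symm) ?_
  have h := isPasting_two.1 (A.α_symm (x.at' (Finite.equivFin S).symm)
    (y.at' (Finite.equivFin R).symm))
  rw [re_at, alpha_at, ap_at, tens_at]
  have e : O.actF _ (FHom.tauEquiv (Nat.card S) (Nat.card R))
      (alphaF A (x.at' (Finite.equivFin S).symm) (y.at' (Finite.equivFin R).symm)) =
      (alpha A x y).at' ((prodNum (Finite.equivFin S).symm (Finite.equivFin R).symm).trans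
        (Equiv.prodComm S R)) := by
    rw [← alpha_at, actF_at]
    congr 1
    ext1 p
    obtain ⟨⟨i, t⟩, rfl⟩ := finProdFinEquiv.surjective p
    simp [FHom.tauEquiv]
  rw [← e]
  exact h

/-- `α_{y,x}` is inverse to `α_{x,y}`. -/
theorem alpha_inv (x : Lab O (obs V T) S) (y : Lab O (obs V T) R) :
    Cmp (alpha A x y) ((alpha A y x).re (Equiv.prodComm R S))
      ((tens x y).re (Equiv.prodComm R S)).one := by
  have h := (alpha_symm A x y).re (Equiv.prodComm R S)
  rw [re_re, ← ap_re] at h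
  convert! h
  exact (re_refl _).symm

/-- `α_{1, y}` is an identity by unitality, and `α_{*, y}` because its source and its target have
no inputs. -/
theorem alpha_low_left {x : Lab O (obs V T) S} (hx : IsLow x) (y : Lab O (obs V T) R) :
    alpha A x y = (tens y x).one := by
  have := hx.subsingleton
  rcases isEmpty_or_nonempty S with h | ⟨⟨s⟩⟩
  · exact ext_empty _ _
  · have key : alpha A x y = (alpha A x y).src.one := by
      let : Unique S := ⟨⟨s⟩, fun t => Subsingleton.elim t s⟩
      refine ext_at (prodNum (Finite.equivFin R).symm (Equiv.ofUnique (Fin 1) S)) ?_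
      rw [ap_at, ap_at, alpha_at, hx.at_eq, src_alphaF]
      exact (A.α_one (y.at' (Finite.equivFin R).symm)).trans
        (congrArg (Stage.idm T).app ((obs V T).map_comp _ _ _))
    have h2 := congrArg Lab.tgt key
    rw [tgt_one, alpha_tgt] at h2
    rw [key, ← h2]

/-- By symmetry `α_{x, y}` is inverse to `α_{y, x}`, which is an identity. -/
theorem alpha_low_right {y : Lab O (obs V T) R} (hy : IsLow y) (x : Lab O (obs V T) S) :
    alpha A x y = (tens y x).one := by
  have h := alpha_inv A x y
  rw [alpha_low_left A hy, ← ap_re] at h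
  have h2 := h.unique (Cmp.id_right (by rw [h.mid, src_one]))
  have h3 := congrArg Lab.tgt h2
  rw [tgt_one, alpha_tgt] at h3
  rw [← h2, h3]

end Lab
end Alpha
end ICat

/-! ### The distributivity law of `α` -/

namespace ICat
open Stage

theorem sum_range_mod (k : ℕ → ℕ) {i j : ℕ} (hi : i < j) (b : ℕ) :
    ∑ n ∈ Finset.range (i + j * b), k (n % j) =
      (∑ n ∈ Finset.range j, k n) * b + ∑ n ∈ Finset.range i, k n := by
  induction b with
  | zero =>
    rw [Nat.mul_zero, Nat.mul_zero, Nat.add_zero, Nat.zero_add]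
    exact Finset.sum_congr rfl fun n hn => by
      rw [Nat.mod_eq_of_lt ((Finset.mem_range.1 hn).trans hi)]
  | succ b ih =>
    have h1 : ∑ n ∈ Finset.range j, k (n % j) = ∑ n ∈ Finset.range j, k n :=
      Finset.sum_congr rfl fun n hn => by rw [Nat.mod_eq_of_lt (Finset.mem_range.1 hn)]
    rw [show i + j * (b + 1) = j + (i + j * b) by ring, Finset.sum_range_add, h1]
    simp only [Nat.add_mod_left]
    rw [ih]
    ring

/-- The lexicographic order of the elements `(b, (i, t))` agrees with that of the elements
`((b, i), t)`. -/
theorem finCongr_sum_prod_snd (l : ℕ) {j : ℕ} (k : Fin j → ℕ) (b : Fin l) (i : Fin j)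
    (t : Fin (k i)) :
    finCongr (Operad.sum_prod_snd l k) (finProdFinEquiv (b, finSigmaFinEquiv ⟨i, t⟩)) =
      finSigmaFinEquiv (n := fun p => k (finProdFinEquiv.symm p).2)
        ⟨finProdFinEquiv (b, i), Fin.cast (by rw [Equiv.symm_apply_apply]) t⟩ := by
  -- the extension by zero allows to sum over initial segments of `ℕ`
  let k' : ℕ → ℕ := fun n => if h : n < j then k ⟨n, h⟩ else 0
  have h0 : ∑ i, k i = ∑ n ∈ Finset.range j, k' n := by
    rw [Finset.sum_range]
    exact Finset.sum_congr rfl fun i _ => by simp [k']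
  have h1 : ∑ i' : Fin (i : ℕ), k (Fin.castLE i.2.le i') = ∑ n ∈ Finset.range i, k' n := by
    rw [Finset.sum_range]
    exact Finset.sum_congr rfl fun i' _ => by
      simp only [k', i'.2.trans i.2, dite_true]
      rfl
  have h2 : ∑ p : Fin (i + j * b : ℕ), k (finProdFinEquiv.symm
        (Fin.castLE (finProdFinEquiv (b, i)).2.le p : Fin (l * j))).2 =
      ∑ n ∈ Finset.range (i + j * b), k' (n % j) := by
    rw [Finset.sum_range]
    refine Finset.sum_congr rfl fun p _ => ?_
    simp only [k', Nat.mod_lt _ i.pos, dite_true]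
    rfl
  ext
  rw [sum_range_mod k' i.2 b] at h2
  simp only [finCongr_apply, Fin.val_cast, finProdFinEquiv_apply_val, finSigmaFinEquiv_apply]
  refine Eq.trans ?_ (congrArg (· + (t : ℕ)) h2.symm)
  rw [← h0, ← h1]
  ring

section Dist
variable {V : Type u} [Category.{v} V] [CartesianMonoidalCategory V] [HasLimits V]
variable {O : Operad V} (A : O.PseudoCommutative) {S Z : Type} [Finite S] [Finite Z] {T : V}
  {K : S → Type} [∀ s, Finite (K s)]

namespace Lab

/-- The bijection `(b, (s, k)) ↦ (s, (b, k))`. -/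
def dist (K : S → Type) (Z : Type) : Z × (Σ s, K s) ≃ Σ s, Z × K s where
  toFun p := ⟨p.2.1, p.1, p.2.2⟩
  invFun p := (p.2.1, ⟨p.1, p.2.2⟩)
  left_inv _ := rfl
  right_inv _ := rfl

/-- The bijection `(b, (s, k)) ↦ ((b, s), k)`. -/
def distL (K : S → Type) (Z : Type) : Z × (Σ s, K s) ≃ Σ p : Z × S, K p.2 where
  toFun p := ⟨(p.1, p.2.1), p.2.2⟩
  invFun p := (p.1.1, ⟨p.1.2, p.2⟩)
  left_inv _ := rfl
  right_inv _ := rfl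

/-- The decomposition of `α_{γ(x; y), z}` into `γ(id_x; α_{y_s, z})`, followed by
`γ(α_{x, z}; id)`. The distributivity permutation of the operadic axiom is the relabelling
`dist`; the relabelling `distL` preserves the lexicographic order. -/
theorem alpha_gam (x : Lab O (obs V T) S) (y : ∀ s, Lab O (obs V T) (K s))
    (z : Lab O (obs V T) Z) :
    Cmp ((gam x.one fun s => alpha A (y s) z).re (dist K Z))
      ((gam (alpha A x z) fun p => (y p.2).one).re (distL K Z)) (alpha A (gam x y) z) := by
  obtain ⟨j, ⟨a⟩⟩ : ∃ k, Nonempty (Fin k ≃ S) := ⟨_, ⟨(Finite.equivFin S).symm⟩⟩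
  obtain ⟨k, ⟨b⟩⟩ : ∃ k : Fin j → ℕ, Nonempty (∀ i, Fin (k i) ≃ K (a i)) :=
    ⟨_, ⟨fun i => (Finite.equivFin (K (a i))).symm⟩⟩
  obtain ⟨l, ⟨c⟩⟩ : ∃ l, Nonempty (Fin l ≃ Z) := ⟨_, ⟨(Finite.equivFin Z).symm⟩⟩
  refine Cmp.of_at (prodNum c (sigNum a b)) ?_
  have h := isPasting_two.1 (A.α_gam (x.at' a) (fun i => (y (a i)).at' (b i)) (z.at' c))
  have e1 : (prodNum c (sigNum a b)).trans (dist K Z) = (Operad.distPerm l k).trans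
      (sigNum (K := fun s => Z × K s) a fun i => prodNum c (b i)) := by
    ext1 p
    obtain ⟨⟨β, p⟩, rfl⟩ := finProdFinEquiv.surjective p
    obtain ⟨⟨i, t⟩, rfl⟩ := finSigmaFinEquiv.surjective p
    have : Operad.distPerm l k (finProdFinEquiv (β, finSigmaFinEquiv ⟨i, t⟩)) =
        finSigmaFinEquiv (n := fun i => l * k i) ⟨i, finProdFinEquiv (β, t)⟩ := by
      simp [Operad.distPerm]
    rw [Equiv.trans_apply, Equiv.trans_apply, this, prodNum_apply, sigNum_apply, sigNum_apply,
      prodNum_apply]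
    rfl
  have e2 : (prodNum c (sigNum a b)).trans (distL K Z) =
      (finCongr (Operad.sum_prod_snd l k)).trans (sigNum (K := fun p : Z × S => K p.2)
        (prodNum c a) fun p => b (finProdFinEquiv.symm p).2) := by
    ext1 p
    obtain ⟨⟨β, p⟩, rfl⟩ := finProdFinEquiv.surjective p
    obtain ⟨⟨i, t⟩, rfl⟩ := finSigmaFinEquiv.surjective p
    rw [Equiv.trans_apply, Equiv.trans_apply, finCongr_sum_prod_snd, prodNum_apply, sigNum_apply]
    refine Eq.trans ?_ (sigNum_apply (K := fun p : Z × S => K p.2) (prodNum c a)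
      (fun p => b (finProdFinEquiv.symm p).2) (finProdFinEquiv (β, i)) _).symm
    have key : ∀ (q : Fin l × Fin j) (_ : q = (β, i)) (h : k i = k q.2),
        (⟨(c β, a i), b i t⟩ : Σ p : Z × S, K p.2) = ⟨(c q.1, a q.2), b q.2 (Fin.cast h t)⟩ := by
      rintro _ rfl h
      rfl
    exact key (finProdFinEquiv.symm (finProdFinEquiv (β, i))) (Equiv.symm_apply_apply _ _) _
  have g := gam_at (K := fun p : Z × S => K p.2) (prodNum c a)
    (fun p => b (finProdFinEquiv.symm p).2) (alpha A x z) fun p => (y p.2).one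
  have g1 := g.trans (congrArg₂ (fun u v => O.gamF (mors V T) u v) (alpha_at A a c x z)
    (funext fun p => ap_at (Stage.idm T) (y (prodNum c a p).2) (b (finProdFinEquiv.symm p).2)))
  have g2 := (actF_at _ _ _).symm.trans
    (congrArg (O.actF _ (finCongr (Operad.sum_prod_snd l k))) g1)
  rw [re_at, re_at, e1, e2, ← actF_at, gam_at, alpha_at, gam_at]
  simp only [alpha_at, ap_at]
  refine Eq.mpr (congrArg (fun t => CompIs _ t _) g2) ?_
  exact h

theorem Eqv.trans_eq {S' : Type} [Finite S'] {F : Stage V} {e : S ≃ S'} {x : Lab O F S}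
    {x' x'' : Lab O F S'} (h : Eqv e x x') (h' : x' = x'') : Eqv e x x'' := h' ▸ h

theorem Eqv.eq_trans {S' : Type} [Finite S'] {F : Stage V} {e : S ≃ S'} {x x₀ : Lab O F S}
    {x' : Lab O F S'} (h : x₀ = x) (h' : Eqv e x x') : Eqv e x₀ x' := h ▸ h'

/-- A one-sided inverse on the left agrees with one on the right. -/
theorem Cmp.inv_unique {N M W : Lab O (mors V T) S} {a b : Lab O (obs V T) S}
    (h : Cmp N M a.one) (h' : Cmp M W b.one) : N = W := by
  have h1 : Cmp a.one W W := Cmp.id_left (h'.mid.symm.trans (h.tgt.symm.trans (tgt_one a)))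
  have h2 : Cmp N b.one N := Cmp.id_right (h.mid.trans (h'.src.symm.trans (src_one b)))
  exact h2.unique (h.assoc h1 h')

/-- The inverse of a composite is the composite of the inverses. -/
theorem Cmp.inv_comp {N M P P' Q Q' : Lab O (mors V T) S} {a b c : Lab O (obs V T) S}
    (h : Cmp P P' M) (h1 : Cmp P' Q' a.one) (h2 : Cmp P Q b.one) (h3 : Cmp N M c.one) :
    Cmp Q' Q N := by
  obtain ⟨W, hW⟩ := Cmp.exists (x := Q') (y := Q)
    (by rw [← h2.mid, h.mid, ← h1.src, ← h1.tgt, src_one, tgt_one])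
  have h4 : Cmp P a.one P := Cmp.id_right (by rw [h.mid, ← h1.src, src_one])
  have h5 : Cmp M W b.one := (h.assoc' h4 h1).assoc h2 hW
  rwa [h3.inv_unique h5]

/-- The decomposition of `α_{z, γ(x; y)}` into `γ(α_{z, x}; id)`, followed by
`γ(id_x; α_{z, y_s})`. It is obtained by inverting that of `α_{γ(x; y), z}`. -/
theorem alpha_gam' (x : Lab O (obs V T) S) (y : ∀ s, Lab O (obs V T) (K s))
    (z : Lab O (obs V T) Z) :
    Cmp ((gam (alpha A z x) fun p => (y p.1).one).re
        ⟨fun p => ⟨(p.1.1, p.2), p.1.2⟩, fun p => (⟨p.1.1, p.2⟩, p.1.2), fun _ => rfl, fun _ =>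
            rfl⟩)
      ((gam x.one fun s => alpha A z (y s)).re
        ⟨fun p => ⟨p.1.1, p.1.2, p.2⟩, fun p => (⟨p.1, p.2.1⟩, p.2.2), fun _ => rfl, fun _ => rfl⟩)
      (alpha A z (gam x y)) := by
  let e₁ : (Σ s, K s) × Z ≃ Σ p : S × Z, K p.1 :=
    ⟨fun p => ⟨(p.1.1, p.2), p.1.2⟩, fun p => (⟨p.1.1, p.2⟩, p.1.2), fun _ => rfl, fun _ => rfl⟩
  let e₂ : (Σ s, K s) × Z ≃ Σ s, K s × Z :=
    ⟨fun p => ⟨p.1.1, p.1.2, p.2⟩, fun p => (⟨p.1, p.2.1⟩, p.2.2), fun _ => rfl, fun _ => rfl⟩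
  have h1 : Cmp (((gam (alpha A x z) fun p => (y p.2).one).re (distL K Z)).re
      (Equiv.prodComm (Σ s, K s) Z)) ((gam (alpha A z x) fun p => (y p.1).one).re e₁)
      ((gam (tens x z) fun p => y p.1).re e₁).one := by
    have h := (alpha_symm A x z).gam (K := fun p => K p.1) fun p => Cmp.one (y p.1)
    refine h.of_eqv (e := e₁) ?_ rfl ?_
    · have g := Eqv.gam (σ := Equiv.prodComm S Z) (K := fun p : S × Z => K p.1)
        (K' := fun p : Z × S => K p.2) (τ := fun _ => Equiv.refl _)
        (y := fun p => (y p.1).one) (y' := fun p => (y p.2).one)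
        (Eqv.of_re (alpha A x z) (Equiv.prodComm S Z)) fun p => Eqv.refl (y p.1).one
      exact (((Eqv.of_re _ _).trans (Eqv.of_re _ _)).trans g.symm).of_eq fun _ => rfl
    · exact ((Eqv.of_re _ _).ap _).trans_eq (ap_gam _ _ _)
  have h2 : Cmp (((gam x.one fun s => alpha A (y s) z).re (dist K Z)).re
      (Equiv.prodComm (Σ s, K s) Z)) ((gam x.one fun s => alpha A z (y s)).re e₂)
      ((gam x fun s => tens (y s) z).re e₂).one := by
    refine ((Cmp.one x).gam fun s => alpha_symm A (y s) z).of_eqv (e := e₂) ?_ rfl ?_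
    · have g := Eqv.gam_right x.one fun s => Eqv.of_re (alpha A (y s) z) (Equiv.prodComm (K s) Z)
      exact (((Eqv.of_re _ _).trans (Eqv.of_re _ _)).trans g.symm).of_eq fun _ => rfl
    · exact ((Eqv.of_re _ _).ap _).trans_eq (ap_gam _ _ _)
  exact ((alpha_gam A x y z).re (Equiv.prodComm (Σ s, K s) Z)).inv_comp h1 h2
    (alpha_inv A z (gam x y))

end Lab
end Dist
end ICat

/-! ### Inverse images under smash products of based functions -/

namespace FHom

theorem finProd_lt {m n : ℕ} {a b : Fin m × Fin n}
    (h : a.1 < b.1 ∨ a.1 = b.1 ∧ a.2 < b.2) : finProdFinEquiv a < finProdFinEquiv b := by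
  obtain ⟨a1, a2⟩ := a
  obtain ⟨b1, b2⟩ := b
  rw [Fin.lt_def, finProdFinEquiv_apply_val, finProdFinEquiv_apply_val]
  rcases h with h | ⟨rfl, h⟩
  · have h : (a1 : ℕ) + 1 ≤ b1 := h
    have := Nat.mul_le_mul_left n h
    have := a2.2
    simp only
    rw [Nat.mul_add] at *
    omega
  · have h : (a2 : ℕ) < b2 := h
    simp only
    omega

theorem lex_of_finProd_lt {m n : ℕ} {a b : Fin m × Fin n}
    (h : finProdFinEquiv a < finProdFinEquiv b) : a.1 < b.1 ∨ a.1 = b.1 ∧ a.2 < b.2 := by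
  by_contra hc
  rcases lt_trichotomy a.1 b.1 with h1 | h1 | h1
  · exact hc (Or.inl h1)
  · rcases lt_trichotomy a.2 b.2 with h2 | h2 | h2
    · exact hc (Or.inr ⟨h1, h2⟩)
    · exact h.ne (by rw [Prod.ext h1 h2])
    · exact lt_asymm h (finProd_lt (Or.inr ⟨h1.symm, h2⟩))
  · exact lt_asymm h (finProd_lt (Or.inl h1))

/-- The numbering of an inverse image is the only increasing one. -/
theorem fib_unique {m n : ℕ} (φ : FHom m n) (j : Fin n) (f : Fin (φ.deg j) → Fin m)
    (hf : StrictMono f) (h : ∀ a, φ (f a) = some j) (a : Fin (φ.deg j)) : f a = φ.fib j a := by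
  have h1 := Finset.orderEmbOfFin_unique (s := Finset.univ.filter fun i => φ i = some j) rfl
    (f := f) (fun a => Finset.mem_filter.2 ⟨Finset.mem_univ _, h a⟩) hf
  have h2 := Finset.orderEmbOfFin_unique (s := Finset.univ.filter fun i => φ i = some j) rfl
    (f := φ.fib j) (fun a => Finset.mem_filter.2 ⟨Finset.mem_univ _, φ.map_fib j a⟩)
        (φ.fib_strictMono j)
  rw [h1, h2]

theorem pair_strictMono {m p a b N : ℕ} {f : Fin a → Fin m} {g : Fin b → Fin p}
    (hf : StrictMono f) (hg : StrictMono g) (h : N = a * b) :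
    StrictMono fun i : Fin N => finProdFinEquiv
      (f (finProdFinEquiv.symm (finCongr h i)).1, g (finProdFinEquiv.symm (finCongr h i)).2) := by
  subst h
  intro i i' hi
  obtain ⟨x, rfl⟩ := finProdFinEquiv.surjective i
  obtain ⟨x', rfl⟩ := finProdFinEquiv.surjective i'
  simp only [finCongr_refl, Equiv.refl_apply, Equiv.symm_apply_apply]
  rcases lex_of_finProd_lt hi with h | ⟨h, h'⟩
  · exact finProd_lt (Or.inl (hf h))
  · exact finProd_lt (Or.inr ⟨congrArg f h, hg h'⟩)

theorem fib_smash {m n p q : ℕ} (φ : FHom m n) (ψ : FHom p q) (l : Fin (n * q))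
    (a : Fin ((φ.smash ψ).deg l)) :
    (φ.smash ψ).fib l a = finProdFinEquiv
      (φ.fib _ (finProdFinEquiv.symm (finCongr (deg_smash φ ψ l) a)).1,
        ψ.fib _ (finProdFinEquiv.symm (finCongr (deg_smash φ ψ l) a)).2) := by
  refine (fib_unique (φ.smash ψ) l _ (pair_strictMono (φ.fib_strictMono _) (ψ.fib_strictMono _)
    (deg_smash φ ψ l)) (fun a => ?_) a).symm
  rw [smash_eq_some, Equiv.symm_apply_apply]
  exact ⟨map_fib _ _ _, map_fib _ _ _⟩

theorem fib_tau_smash {m n p q : ℕ} (φ : FHom m n) (ψ : FHom p q) (l : Fin (q * n))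
    (a : Fin (((tau m p).comp (ψ.smash φ)).deg l)) :
    ((tau m p).comp (ψ.smash φ)).fib l a = finProdFinEquiv
      (φ.fib _ (finProdFinEquiv.symm (finCongr (deg_tau_smash φ ψ l) a)).1,
        ψ.fib _ (finProdFinEquiv.symm (finCongr (deg_tau_smash φ ψ l) a)).2) := by
  refine (fib_unique _ l _ (pair_strictMono (φ.fib_strictMono _) (ψ.fib_strictMono _)
    (deg_tau_smash φ ψ l)) (fun a => ?_) a).symm
  unfold tau comp
  rw [Option.bind_some, smash_eq_some]
  simp only [tauEquiv, Equiv.trans_apply, Equiv.symm_apply_apply, Equiv.prodComm_apply,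
    Prod.swap_prod_mk]
  exact ⟨map_fib _ _ _, map_fib _ _ _⟩

end FHom

/-! ### Spans and the morphisms of the category of operators -/

namespace ICat
open Stage

/-- A family of finite sets `K b`, indexed by `B`, with an injection of their disjoint union into
`A`. Up to numberings of `A` and `B` this is a based function from `A` to `B`. -/
structure Span (A B : Type) where
  K : B → Type
  fin : ∀ b, Finite (K b)
  leg : ∀ b, K b → A
  inj : Function.Injective fun p : Σ b, K b => leg p.1 p.2

attribute [instance] Span.fin

namespace Span
variable {A B C A' B' : Type}

theorem leg_injective (s : Span A B) (b : B) : Function.Injective (s.leg b) := fun k k' h => by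
  have := s.inj (a₁ := ⟨b, k⟩) (a₂ := ⟨b, k'⟩) h
  simpa using this

/-- The identity. -/
abbrev id (A : Type) : Span A A where
  K _ := Unit
  fin _ := inferInstance
  leg a _ := a
  inj := by rintro ⟨a, _⟩ ⟨b, _⟩ (h : a = b); subst h; rfl

/-- Composition, first `s` then `t`. -/
abbrev comp (s : Span A B) (t : Span B C) : Span A C where
  K c := Σ k : t.K c, s.K (t.leg c k)
  fin _ := inferInstance
  leg c p := s.leg _ p.2
  inj := by
    rintro ⟨c, k, l⟩ ⟨c', k', l'⟩ h
    have h1 := s.inj (a₁ := ⟨_, l⟩) (a₂ := ⟨_, l'⟩) h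
    have h2 := t.inj (a₁ := ⟨c, k⟩) (a₂ := ⟨c', k'⟩) (congrArg Sigma.fst h1)
    simp only [Sigma.mk.injEq] at h2
    obtain ⟨rfl, h2⟩ := h2
    obtain rfl := eq_of_heq h2
    simp only [Sigma.mk.injEq, heq_eq_eq, true_and] at h1
    obtain rfl := h1
    rfl

/-- The product. -/
abbrev prod (s : Span A B) (t : Span A' B') : Span (A × A') (B × B') where
  K b := s.K b.1 × t.K b.2
  fin _ := inferInstance
  leg b k := (s.leg _ k.1, t.leg _ k.2)
  inj := by
    rintro ⟨⟨b, b'⟩, k, k'⟩ ⟨⟨c, c'⟩, l, l'⟩ h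
    have h1 := s.inj (a₁ := ⟨b, k⟩) (a₂ := ⟨c, l⟩) (congrArg Prod.fst h)
    have h2 := t.inj (a₁ := ⟨b', k'⟩) (a₂ := ⟨c', l'⟩) (congrArg Prod.snd h)
    simp only [Sigma.mk.injEq] at h1 h2
    obtain ⟨rfl, h1⟩ := h1
    obtain ⟨rfl, h2⟩ := h2
    obtain rfl := eq_of_heq h1
    obtain rfl := eq_of_heq h2
    rfl

/-- The span of a bijection. -/
abbrev ofEquiv (e : A ≃ B) : Span A B where
  K _ := Unit
  fin _ := inferInstance
  leg b _ := e.symm b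
  inj := by
    rintro ⟨a, _⟩ ⟨b, _⟩ h
    obtain rfl := e.symm.injective h
    rfl

/-- The empty family. -/
abbrev zero (A B : Type) : Span A B where
  K _ := Empty
  fin _ := inferInstance
  leg _ k := k.elim
  inj := by rintro ⟨_, k⟩; exact k.elim

/-- The inverse images of a based function. -/
abbrev ofHom {m n : ℕ} (φ : FHom m n) : Span (Fin m) (Fin n) where
  K j := Fin (φ.deg j)
  fin _ := inferInstance
  leg j a := φ.fib j a
  inj := by
    rintro ⟨j, a⟩ ⟨j', a'⟩ (h : φ.fib j a = φ.fib j' a')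
    have := φ.map_fib j a
    rw [h, φ.map_fib] at this
    obtain rfl := Option.some_injective _ this
    rw [φ.fib_injective _ h]

variable {m n : ℕ} (v : A ≃ Fin m) (u : B ≃ Fin n) (s : Span A B)

open Classical in
/-- The based function given by a span and numberings. -/
noncomputable def hom : FHom m n := fun i =>
  if h : ∃ p : Σ b, s.K b, v (s.leg p.1 p.2) = i then some (u h.choose.1) else none

theorem hom_eq_some (i : Fin m) (j : Fin n) :
    s.hom v u i = some j ↔ ∃ k : s.K (u.symm j), v (s.leg _ k) = i := by
  unfold hom
  constructor
  · intro h
    split_ifs at h with h1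
    obtain ⟨⟨b, k⟩, hk, hb⟩ : ∃ p : Σ b, s.K b, v (s.leg p.1 p.2) = i ∧ some (u p.1) = some j :=
      ⟨h1.choose, h1.choose_spec, h⟩
    obtain rfl : b = u.symm j := u.eq_symm_apply.2 (Option.some_injective _ hb)
    exact ⟨k, hk⟩
  · rintro ⟨k, rfl⟩
    have h1 : ∃ p : Σ b, s.K b, v (s.leg p.1 p.2) = v (s.leg _ k) := ⟨⟨_, k⟩, rfl⟩
    rw [dif_pos h1]
    have := s.inj (a₁ := h1.choose) (a₂ := ⟨_, k⟩) (v.injective h1.choose_spec)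
    rw [this, Equiv.apply_symm_apply]

/-- The labels of `K b`, as elements of an inverse image. -/
noncomputable def fibNum (j : Fin n) : s.K (u.symm j) ≃ {i // s.hom v u i = some j} :=
  Equiv.ofBijective (fun k => ⟨v (s.leg _ k), (s.hom_eq_some v u _ _).2 ⟨k, rfl⟩⟩)
    ⟨fun _ _ h => s.leg_injective _ (v.injective (congrArg Subtype.val h)),
      fun ⟨i, hi⟩ => by
        obtain ⟨k, hk⟩ := (s.hom_eq_some v u i j).1 hi
        exact ⟨k, Subtype.ext hk⟩⟩

/-- The numbering of `K b`, in the order of the numbers of the images in `A`. -/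
noncomputable def num (j : Fin n) : Fin ((s.hom v u).deg j) ≃ s.K (u.symm j) :=
  ((s.hom v u).fibEquiv j).trans (s.fibNum v u j).symm

theorem leg_num (j : Fin n) (a : Fin ((s.hom v u).deg j)) :
    v (s.leg _ (s.num v u j a)) = (s.hom v u).fib j a :=
  congrArg Subtype.val (Equiv.apply_symm_apply (s.fibNum v u j) ((s.hom v u).fibEquiv j a))

end Span

section Cells
variable {V : Type u} [Category.{v} V] [CartesianMonoidalCategory V] [MonoidalClosed V]
  [HasLimits V] [HasColimits (ICat V)]
variable {O : Operad V} {F G : Stage V} {A B C A' B' : Type} {m n p q : ℕ}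

/-- The generalized element `(φ; c)` of a morphism category. -/
noncomputable def ptF (O : Operad V) (F : Stage V) (φ : FHom m n)
    (c : ∀ j, F.obj (O.obj (φ.deg j))) : F.obj (O.hom m n) := F.map (O.incl φ) (F.tuple c)

theorem map_pt {X : ICat V} (φ : FHom m n) (c : ∀ j, X ⟶ O.obj (φ.deg j)) (x : F.obj X) :
    F.map (O.pt φ c) x = ptF O F φ fun j => F.map (c j) x := by
  unfold Operad.pt ptF
  rw [F.map_comp, map_piLift]

theorem app_ptF (h : F.Hom G) (φ : FHom m n) (c : ∀ j, F.obj (O.obj (φ.deg j))) :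
    h.app (ptF O F φ c) = ptF O G φ fun j => h.app (c j) := by
  unfold ptF
  rw [h.nat, h.tuple]

/-- The generalized element of a morphism category of the category of operators that is given by
a family of labelled elements of the operad, for numberings `v` and `u` of the index sets. -/
noncomputable def cell (v : A ≃ Fin m) (u : B ≃ Fin n) (s : Span A B)
    (c : ∀ b, Lab O F (s.K b)) : F.obj (O.hom m n) :=
  ptF O F (s.hom v u) fun j => (c (u.symm j)).at' (s.num v u j)

/-- The morphism `(φ; x)` is determined by numberings of the families of labels that are
compatible with the numberings of the inverse images of `φ`. -/
theorem ptF_eq_cell (φ : FHom m n) (x : ∀ j, F.obj (O.obj (φ.deg j))) {v : A ≃ Fin m}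
    {u : B ≃ Fin n} {s : Span A B} {c : ∀ b, Lab O F (s.K b)} (β : Fin n → B)
    (hβ : ∀ j, u (β j) = j) (e : ∀ j, Fin (φ.deg j) ≃ s.K (β j))
    (he : ∀ j a, v (s.leg _ (e j a)) = φ.fib j a) (hx : ∀ j, x j = (c (β j)).at' (e j)) :
    ptF O F φ x = cell v u s c := by
  obtain rfl : β = u.symm := funext fun j => (u.symm_apply_eq.2 (hβ j).symm).symm
  have key : φ = s.hom v u := by
    have h (i : Fin m) (j : Fin n) : φ i = some j ↔ s.hom v u i = some j := by
      rw [Span.hom_eq_some]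
      constructor
      · intro h
        obtain ⟨a, ha⟩ := (φ.fibEquiv j).surjective ⟨i, h⟩
        exact ⟨e j a, (he j a).trans (congrArg Subtype.val ha)⟩
      · rintro ⟨k, rfl⟩
        obtain ⟨a, rfl⟩ := (e j).surjective k
        rw [he]
        exact φ.map_fib _ _
    funext i
    exact Option.ext fun j => h i j
  subst key
  unfold cell
  congr 1
  funext j
  rw [hx]
  congr 1
  ext1 a
  exact s.leg_injective _ (v.injective ((he j a).trans (s.leg_num v u j a).symm))

theorem ptF_eq (φ : FHom m n) (x : ∀ j, F.obj (O.obj (φ.deg j))) :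
    ptF O F φ x = cell (Equiv.refl _) (Equiv.refl _) (Span.ofHom φ)
      fun j => Lab.mk (Equiv.refl (Fin (φ.deg j))) (x j) :=
  ptF_eq_cell φ x (fun j => j) (fun _ => rfl) (fun _ => Equiv.refl _) (fun _ _ => rfl)
    fun _ => (Lab.mk_at_self _ _).symm

/-- Two families give the same morphism if bijections of the index sets carry one to the other and
preserve the numberings. -/
theorem cell_congr {v : A ≃ Fin m} {u : B ≃ Fin n} {s : Span A B} {c : ∀ b, Lab O F (s.K b)}
    {v' : A' ≃ Fin m} {u' : B' ≃ Fin n} {s' : Span A' B'} {c' : ∀ b, Lab O F (s'.K b)}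
    (σ : A ≃ A') (ρ : B ≃ B') (hv : ∀ a, v' (σ a) = v a) (hu : ∀ b, u' (ρ b) = u b)
    (e : ∀ b, s.K b ≃ s'.K (ρ b)) (he : ∀ b k, s'.leg _ (e b k) = σ (s.leg b k))
    (hc : ∀ b, Lab.Eqv (e b) (c b) (c' (ρ b))) : cell v u s c = cell v' u' s' c' :=
  ptF_eq_cell _ _ (fun j => ρ (u.symm j)) (fun j => by rw [hu, Equiv.apply_symm_apply])
    (fun j => (s.num v u j).trans (e _))
    (fun j a => by rw [Equiv.trans_apply, he, hv, Span.leg_num])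
    fun j => (hc _).at_eq _

/-- The case of equal index sets. -/
theorem cell_congr' {v : A ≃ Fin m} {u : B ≃ Fin n} {s s' : Span A B}
    {c : ∀ b, Lab O F (s.K b)} {c' : ∀ b, Lab O F (s'.K b)}
    (e : ∀ b, s.K b ≃ s'.K b) (he : ∀ b k, s'.leg _ (e b k) = s.leg b k)
    (hc : ∀ b, Lab.Eqv (e b) (c b) (c' b)) : cell v u s c = cell v u s' c' :=
  cell_congr (Equiv.refl A) (Equiv.refl B) (fun _ => rfl) (fun _ => rfl) e he hc

theorem app_cell (h : F.Hom G) (v : A ≃ Fin m) (u : B ≃ Fin n) (s : Span A B)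
    (c : ∀ b, Lab O F (s.K b)) : h.app (cell v u s c) = cell v u s fun b => (c b).ap h := by
  unfold cell
  rw [app_ptF]
  simp only [Lab.ap_at]

theorem compIs_cell {T : V} {v : A ≃ Fin m} {u : B ≃ Fin n} {s : Span A B}
    {x y z : ∀ b, Lab O (mors V T) (s.K b)} (h : ∀ b, Lab.Cmp (x b) (y b) (z b)) :
    CompIs (cell v u s x) (cell v u s y) (cell v u s z) :=
  (CompIs.tuple fun _ => (h _).at _).map _

theorem map_homCast {K : Type w} (E : EnrichedCategory (ICat V) K) {a b : K} (x : F.obj (E.Hom a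
    b)) :
    F.map (homCast E rfl rfl) x = x := by
  unfold homCast
  rw [eqToHom_refl, F.map_id]

theorem cell_cast {m' n' : ℕ} (h : m = m') (h' : n = n') (v : A ≃ Fin m) (u : B ≃ Fin n)
    (s : Span A B) (c : ∀ b, Lab O F (s.K b)) :
    F.map (homCast O.opCat h h') (cell v u s c) =
      cell (v.trans (finCongr h)) (u.trans (finCongr h')) s c := by
  subst h h'
  exact map_homCast O.opCat (cell v u s c)

theorem ptF_comp (φ : FHom m n) (c : ∀ j, F.obj (O.obj (φ.deg j)))
    (ψ : FHom n p) (d : ∀ j, F.obj (O.obj (ψ.deg j))) :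
    F.map (O.compD m n p) (F.pair (ptF O F φ c) (ptF O F ψ d)) =
      ptF O F (φ.comp ψ) fun k =>
        O.actF F (φ.rho ψ k) (O.gamF F (d k) fun i => c (ψ.fib k i)) := by
  have h := congrArg (fun t => F.map t (F.pair (F.tuple c) (F.tuple d)))
    (O.pt_comp φ (fun j => fst _ _ ≫ piπ _ j) ψ (fun j => snd _ _ ≫ piπ _ j))
  simp only [F.map_comp, map_lift, map_pt, O.map_gam, F.map_fst, F.map_snd, F.map_π] at h
  exact h

/-- Composition of families is the operadic composition of their members. The permutation `ρ` in the
composition of the category of operators disappears, since it only reorders the labels. -/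
theorem cell_comp {v : A ≃ Fin m} {u : B ≃ Fin n} {w : C ≃ Fin p} (s : Span A B) (t : Span B C)
    (c : ∀ b, Lab O F (s.K b)) (d : ∀ b, Lab O F (t.K b)) :
    F.map (O.compD m n p) (F.pair (cell v u s c) (cell u w t d)) =
      cell v w (s.comp t) fun b => Lab.gam (d b) fun k => c (t.leg b k) := by
  have hu (k : Fin p) (i : Fin ((t.hom u w).deg k)) :
      u.symm ((t.hom u w).fib k i) = t.leg _ (t.num u w k i) := by
    rw [Equiv.symm_apply_eq, Span.leg_num]
  refine (ptF_comp _ _ _ _).trans ?_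
  let N (k : Fin p) : Fin (∑ i, (s.hom v u).deg ((t.hom u w).fib k i)) ≃
      Σ l : t.K (w.symm k), s.K (t.leg _ l) :=
    Lab.sigNum (K := fun l => s.K (t.leg _ l)) (t.num u w k)
      fun i => (s.num v u _).trans (Equiv.cast (congrArg s.K (hu k i)))
  refine ptF_eq_cell _ _ w.symm (fun j => w.apply_symm_apply j)
    (fun k => ((s.hom v u).rho (t.hom u w) k).trans (N k)) (fun k a => ?_) fun k => ?_
  · refine Eq.trans ?_ ((s.hom v u).rho_spec (t.hom u w) k a)
    obtain ⟨⟨i, r⟩, hr⟩ := finSigmaFinEquiv.surjective ((s.hom v u).rho (t.hom u w) k a)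
    have hN : N k ((s.hom v u).rho (t.hom u w) k a) =
        ⟨t.num u w k i, Equiv.cast (congrArg s.K (hu k i)) (s.num v u _ r)⟩ :=
      (congrArg (N k) hr.symm).trans (Lab.sigNum_apply (K := fun l => s.K (t.leg _ l)) (t.num u w k)
        (fun i => (s.num v u _).trans (Equiv.cast (congrArg s.K (hu k i)))) i r)
    refine (congrArg (fun q : Σ l : t.K (w.symm k), s.K (t.leg _ l) => v (s.leg _ q.2)) hN).trans ?_
    rw [← hr, Equiv.symm_apply_apply]
    have key : ∀ {b b' : B} (h : b = b') (l : s.K b),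
        s.leg b' (Equiv.cast (congrArg s.K h) l) = s.leg b l := by
      rintro b _ rfl l; rfl
    exact (congrArg v (key (hu k i) _)).trans (s.leg_num v u _ r)
  · refine Eq.trans ?_ (Lab.actF_at _ (N k) _)
    refine congrArg (O.actF F _) (Eq.trans ?_ (Lab.gam_at (K := fun l => s.K (t.leg _ l)) _ _ _
        _).symm)
    congr 1
    funext i
    exact (Lab.Eqv.fam c (hu k i)).at_eq _

theorem cell_id (v : A ≃ Fin n) :
    F.map (O.idD n) F.star = cell v v (Span.id A) fun _ => (Lab.unit : Lab O F Unit) := by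
  unfold Operad.idD
  rw [map_pt]
  refine ptF_eq_cell _ _ v.symm (fun j => v.apply_symm_apply j)
    (fun j => (finCongr (FHom.deg_id n j)).trans (Equiv.ofUnique (Fin 1) Unit))
    (fun j a => ?_) fun j => ?_
  · have := (FHom.id n).map_fib j a
    refine (v.apply_symm_apply j).trans ?_
    exact (Option.some_injective _ this).symm
  · exact (F.map_comp _ _ _).trans ((congrArg (O.actF F _) (Lab.unit_at _).symm).trans
      (Lab.actF_at (Lab.unit : Lab O F Unit) (Equiv.ofUnique (Fin 1) Unit) _))

end Cells
end ICat

/-! ### The product as a functor -/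

namespace ICat
open Stage

section Cells2
variable {V : Type u} [Category.{v} V] [CartesianMonoidalCategory V] [MonoidalClosed V]
  [HasLimits V] [HasColimits (ICat V)]
variable {O : Operad V} {F G : Stage V} {A B C A' B' : Type} {m n p q : ℕ}

/-- The functor given on summands by the intrinsic pairing. -/
noncomputable def Operad.smashMap (O : Operad V) (m n p q : ℕ) :
    O.hom m n ⊗ O.hom p q ⟶ O.hom (m * p) (n * q) :=
  desc2 fun φ ψ => Operad.PseudoCommutative.smashPt O φ (fun j => fst _ _ ≫ piπ _ j) ψ
    fun k => snd _ _ ≫ piπ _ k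

theorem lift_pt_smashMap {X : ICat V} (φ : FHom m n) (c : ∀ j, X ⟶ O.obj (φ.deg j))
    (ψ : FHom p q) (d : ∀ k, X ⟶ O.obj (ψ.deg k)) :
    lift (O.pt φ c) (O.pt ψ d) ≫ O.smashMap m n p q =
      Operad.PseudoCommutative.smashPt O φ c ψ d := by
  refine (lift_desc2 (fun (φ : FHom m n) (ψ : FHom p q) =>
    Operad.PseudoCommutative.smashPt O φ (fun j => fst (O.summand φ) (O.summand ψ) ≫ piπ _ j) ψ
      fun k => snd (O.summand φ) (O.summand ψ) ≫ piπ _ k) φ ψ (piLift c) (piLift d)).trans ?_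
  unfold Operad.PseudoCommutative.smashPt
  rw [Operad.comp_pt]
  congr 1
  funext l
  rw [← Category.assoc, comp_lift]
  simp only [← Category.assoc, lift_fst, lift_snd, piLift_π]

theorem ptF_smash (φ : FHom m n) (c : ∀ j, F.obj (O.obj (φ.deg j)))
    (ψ : FHom p q) (d : ∀ j, F.obj (O.obj (ψ.deg j))) :
    F.map (O.smashMap m n p q) (F.pair (ptF O F φ c) (ptF O F ψ d)) =
      ptF O F (φ.smash ψ) fun l => O.actF F (finCongr (FHom.deg_smash φ ψ l))
        (F.map (O.pairing _ _) (F.pair (c (finProdFinEquiv.symm l).1)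
          (d (finProdFinEquiv.symm l).2))) := by
  have h := congrArg (fun t => F.map t (F.pair (F.tuple c) (F.tuple d)))
    (lift_pt_smashMap φ (fun j => fst _ _ ≫ piπ _ j) ψ (fun j => snd _ _ ≫ piπ _ j))
  unfold Operad.PseudoCommutative.smashPt at h
  simp only [F.map_comp, map_lift, map_pt, F.map_fst, F.map_snd, F.map_π] at h
  exact h

theorem cell_smash {v : A ≃ Fin m} {u : B ≃ Fin n} {v' : A' ≃ Fin p} {u' : B' ≃ Fin q}
    (s : Span A B) (t : Span A' B') (c : ∀ b, Lab O F (s.K b)) (d : ∀ b, Lab O F (t.K b)) :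
    F.map (O.smashMap m n p q) (F.pair (cell v u s c) (cell v' u' t d)) =
      cell ((Equiv.prodCongr v v').trans finProdFinEquiv)
        ((Equiv.prodCongr u u').trans finProdFinEquiv) (s.prod t)
        fun b => Lab.tens (c b.1) (d b.2) := by
  refine (ptF_smash _ _ _ _).trans ?_
  refine ptF_eq_cell _ _
    (fun l => (u.symm (finProdFinEquiv.symm l).1, u'.symm (finProdFinEquiv.symm l).2))
    (fun l => (congrArg finProdFinEquiv (Prod.ext (u.apply_symm_apply _)
      (u'.apply_symm_apply _))).trans (finProdFinEquiv.apply_symm_apply l))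
    (fun l => (finCongr (FHom.deg_smash _ _ l)).trans
      (Lab.prodNum (s.num v u _) (t.num v' u' _))) (fun l a => ?_) fun l => ?_
  · refine Eq.trans ?_ (FHom.fib_smash _ _ l a).symm
    rw [← Span.leg_num, ← Span.leg_num]
    rfl
  · refine Eq.trans ?_ (Lab.actF_at (Lab.tens (c _) (d _))
      (Lab.prodNum (s.num v u _) (t.num v' u' _)) _)
    rw [Lab.tens_at]

/-- The numbers of pairs, in lexicographic order. -/
abbrev lexNum (v : A ≃ Fin m) (v' : A' ≃ Fin p) : A × A' ≃ Fin (m * p) :=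
  (Equiv.prodCongr v v').trans finProdFinEquiv

theorem isLow_mk_low {k : ℕ} (h : k ≤ 1) {S : Type} [Finite S] (e : Fin k ≃ S) :
    Lab.IsLow (Lab.mk e (F.map (O.low (𝟙_ (ICat V)) k h) F.star)) := by
  refine ⟨?_, fun e' => ?_⟩
  · have : Subsingleton (Fin k) := Fin.subsingleton_iff_le_one.2 h
    exact e.symm.subsingleton
  · rw [Lab.mk_at]
    have := congrArg (fun t => F.map t F.star) ((O.isLow_low (𝟙_ (ICat V)) k h).2 (e'.trans e.symm))
    simp only [F.map_comp] at this
    refine this.trans ?_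
    rw [F.star_eq (F.map (toUnit _) F.star)]
    rfl

/-- The morphisms that come from `Π` are given by the elements `*` and `1`. -/
theorem lowPt_eq_cell (φ : PHom m n) {v : A ≃ Fin m} {u : B ≃ Fin n} {s : Span A B}
    {c : ∀ b, Lab O F (s.K b)} (hc : ∀ b, Lab.IsLow (c b)) (β : Fin n → B)
    (hβ : ∀ j, u (β j) = j) (e : ∀ j, Fin (φ.1.deg j) ≃ s.K (β j))
    (he : ∀ j a, v (s.leg _ (e j a)) = φ.1.fib j a) :
    F.map (O.lowPt (𝟙_ (ICat V)) φ) F.star = cell v u s c := by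
  unfold Operad.lowPt
  rw [map_pt]
  refine ptF_eq_cell _ _ β hβ e he fun j => ?_
  rw [← (isLow_mk_low (φ.2 j) (e j)).ext (hc (β j)), Lab.mk_at_self]

theorem lowPt_eq (φ : PHom m n) : ∃ c, (∀ b, Lab.IsLow (c b)) ∧
    F.map (O.lowPt (𝟙_ (ICat V)) φ) F.star =
      cell (Equiv.refl _) (Equiv.refl _) (Span.ofHom φ.1) c :=
  ⟨fun j => Lab.mk (Equiv.refl (Fin (φ.1.deg j))) _, fun j => isLow_mk_low (φ.2 j) _,
    lowPt_eq_cell φ (fun j => isLow_mk_low (φ.2 j) _) (fun j => j) (fun _ => rfl)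
      (fun _ => Equiv.refl _) fun _ _ => rfl⟩

theorem cell_tau (v : A ≃ Fin m) (v' : B ≃ Fin p) :
    F.map (O.lowPt (𝟙_ (ICat V)) (PHom.tau m p)) F.star =
      cell (lexNum v v') (lexNum v' v) (Span.ofEquiv (Equiv.prodComm A B))
        fun _ => (Lab.unit : Lab O F Unit) := by
  refine lowPt_eq_cell _ (fun _ => Lab.isLow_unit (S := Unit)) (lexNum v' v).symm
    (fun j => (lexNum v' v).apply_symm_apply j)
    (fun j => (finCongr (FHom.deg_tau m p j)).trans (Equiv.ofUnique (Fin 1) Unit)) fun j a => ?_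
  have h := Option.some_injective _ ((FHom.tau m p).map_fib j a)
  obtain ⟨⟨i, i'⟩, hi⟩ := finProdFinEquiv.surjective ((FHom.tau m p).fib j a)
  refine Eq.trans ?_ hi
  rw [← hi] at h
  subst h
  change lexNum v v' ((lexNum v' v).symm _).swap = _
  simp [FHom.tauEquiv, lexNum]

theorem cell_zero (v : A ≃ Fin m) (u : B ≃ Fin n) (c : ∀ b, Lab O F ((Span.zero A B).K b)) :
    F.map (O.catOp.based.pt m n) F.star = cell v u (Span.zero A B) c := by
  have h : F.map (O.catOp.based.pt m n) F.star = F.map (O.compD m 0 n)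
      (F.pair (F.map ((O.catOp.toZero m).from _) F.star)
        (F.map ((O.catOp.fromZero n).from _) F.star)) :=
    (F.map_comp _ _ _).trans (congrArg _ (map_lift _ _ _))
  refine h.trans (Eq.trans (congrArg₂ (fun a b => F.map (O.compD m 0 n) (F.pair a b))
    (F.obj_subsingleton (O.catOp.toZero m) _ (cell v (Equiv.equivOfIsEmpty Empty (Fin 0))
      (Span.zero A Empty) fun b => b.elim))
    (F.obj_subsingleton (O.catOp.fromZero n) _ (cell (Equiv.equivOfIsEmpty Empty (Fin 0)) u
      (Span.zero Empty B) c))) ?_)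
  refine (cell_comp _ _ _ _).trans (cell_congr' (fun b => ⟨fun k => k.1, fun k => k.elim,
    fun k => k.1.elim, fun k => k.elim⟩) (fun b k => k.1.elim) fun b => ?_)
  have : IsEmpty (Σ k : (Span.zero Empty B).K b, (Span.zero A Empty).K
      ((Span.zero Empty B).leg b k)) := ⟨fun k => k.1.elim⟩
  exact Lab.ext_empty _ _

/-- A span all of whose members are empty gives the basepoint. -/
theorem cell_eq_zero {v : A ≃ Fin m} {u : B ≃ Fin n} {s : Span A B} {c : ∀ b, Lab O F (s.K b)}
    (h : ∀ b, IsEmpty (s.K b)) : cell v u s c = F.map (O.catOp.based.pt m n) F.star := by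
  have (b : B) : IsEmpty ((Span.zero A B).K b) := inferInstanceAs (IsEmpty Empty)
  rw [cell_zero v u fun b => Lab.mk (Equiv.equivOfIsEmpty (Fin 0) Empty) (F.map
    (O.reduced.from _) F.star)]
  exact cell_congr' (fun b => Equiv.equivOfIsEmpty _ _) (fun b k => isEmptyElim k)
    fun b => Lab.ext_empty _ _

end Cells2
end ICat

/-! ### Transformations and pastings on coproducts -/

namespace ICat
open Stage

section Transf
variable {V : Type u} [Category.{v} V] [CartesianMonoidalCategory V] [HasLimits V]
variable {X C : ICat V} {F G F' G' : X ⟶ C}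

/-- A natural transformation may be given by its components at generalized objects, compatibly with
change of the stage `T` of definition. It is recovered from the component at the universal
object. -/
noncomputable def ITrans.ofPoints (t : ∀ {T : V}, (T ⟶ X.Ob) → (T ⟶ C.Mor))
    (src : ∀ {T : V} (z : T ⟶ X.Ob), t z ≫ C.src = z ≫ ob F)
    (tgt : ∀ {T : V} (z : T ⟶ X.Ob), t z ≫ C.tgt = z ≫ ob G)
    (pre : ∀ {T T' : V} (k : T' ⟶ T) (z : T ⟶ X.Ob), k ≫ t z = t (k ≫ z))
    (nat : ∀ {T : V} (f : T ⟶ X.Mor), ∃ r, CompIs (V := V) (f ≫ mor F) (t (f ≫ X.tgt)) r ∧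
      CompIs (V := V) (t (f ≫ X.src)) (f ≫ mor G) r) : ITrans F G where
  app := t (𝟙 _)
  src := (src _).trans (Category.id_comp _)
  tgt := (tgt _).trans (Category.id_comp _)
  nat := by
    obtain ⟨r, ⟨h1, e1⟩, h2, e2⟩ := nat (𝟙 X.Mor)
    refine Eq.trans ?_ (e1.trans (e2.symm.trans ?_))
    · exact C.comp_congr' (Category.id_comp _).symm
        ((pre _ _).trans (congrArg t (by rw [Category.comp_id, Category.id_comp])))
    · exact C.comp_congr'
        ((pre _ _).trans (congrArg t (by rw [Category.comp_id, Category.id_comp]))).symm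
        (Category.id_comp _)

theorem CompIs.congr {T : V} {x y z x' y' z' : (mors V T).obj C} (h : CompIs x y z) (hx : x' = x)
    (hy : y' = y) (hz : z' = z) : CompIs x' y' z' := by
  subst hx hy hz; exact h

/-- A natural transformation is invertible if its components are. -/
noncomputable def IIso.ofHom (t : ITrans F G) (inv : X.Ob ⟶ C.Mor)
    (h1 : CompIs (V := V) t.app inv (ob F ≫ C.idm))
    (h2 : CompIs (V := V) inv t.app (ob G ≫ C.idm)) : IIso F G where
  hom := t
  inv :=
    { app := inv
      src := by
        have := h2.src
        exact this.symm.trans (src_idm (T := X.Ob) (a := ob G))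
      tgt := by
        have := h1.tgt
        exact this.symm.trans (tgt_idm (T := X.Ob) (a := ob F))
      nat := by
        have n1 : CompIs (V := V) (mor F) (X.tgt ≫ t.app) _ :=
          ⟨by rw [mor_tgt, Category.assoc, t.src], rfl⟩
        have n2 : CompIs (V := V) (X.src ≫ t.app) (mor G) _ :=
          ⟨by rw [mor_src, Category.assoc, t.tgt], t.nat.symm⟩
        have a1 := h2.pre X.src
        have a2 := h1.pre X.tgt
        obtain ⟨r', hr'⟩ := CompIs.exists (x := X.src ≫ inv) (y := mor F) (by
          refine (a1.mid).trans ?_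
          exact n2.src.symm.trans n1.src)
        have b1 := a1.assoc (CompIs.congr (CompIs.id_left (x := mor G) (a := X.src ≫ ob G)
          (mor_src G)) (Category.assoc _ _ _).symm rfl rfl) n2
        have b2 := hr'.assoc' b1 n1
        have b3 := b2.assoc' (CompIs.congr (CompIs.id_right (x := r') (a := X.tgt ≫ ob F)
          (by rw [hr'.tgt]; exact mor_tgt F)) rfl (Category.assoc _ _ _).symm rfl) a2
        obtain ⟨_, e1⟩ := hr'
        obtain ⟨_, e2⟩ := b3
        exact e2.trans e1.symm }
  hom_inv := h1.2
  inv_hom := h2.2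

/-- Transport along equalities of functors. -/
def ITrans.cast (t : ITrans F G) (hF : F = F') (hG : G = G') : ITrans F' G' where
  app := t.app
  src := t.src.trans (congrArg ob hF)
  tgt := t.tgt.trans (congrArg ob hG)
  nat := by
    subst hF hG
    exact t.nat

variable [MonoidalClosed V] {J : Type w} {B : J → ICat V} {i : ∀ j, B j ⟶ X}

/-- A natural transformation of functors out of a coproduct is given by its restrictions. -/
noncomputable def ITrans.desc (hX : IsCoprod i) (t : ∀ j, ITrans (i j ≫ F) (i j ≫ G)) :
    ITrans F G :=
  (ITrans.ofArr (hX.desc fun j => (t j).toArr)).cast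
    (hX.hom_ext fun j => by rw [← Category.assoc, hX.fac, ITrans.toArr_dom])
    (hX.hom_ext fun j => by rw [← Category.assoc, hX.fac, ITrans.toArr_cod])

theorem ITrans.ob_desc (hX : IsCoprod i) (t : ∀ j, ITrans (i j ≫ F) (i j ≫ G)) (j : J) :
    ob (i j) ≫ (ITrans.desc hX t).app = (t j).app :=
  congrArg ob (hX.fac (fun j => (t j).toArr) j)

/-- An invertible natural transformation of functors out of a coproduct is given by its
restrictions. -/
noncomputable def IIso.desc (hX : IsCoprod i) (t : ∀ j, IIso (i j ≫ F) (i j ≫ G)) : IIso F G where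
  hom := ITrans.desc hX fun j => (t j).hom
  inv := ITrans.desc hX fun j => (t j).inv
  hom_inv := hX.ob_ext fun j => by
    rw [precomp_comp]
    exact (C.comp_congr' (ITrans.ob_desc hX _ j) (ITrans.ob_desc hX _ j)).trans
      ((t j).hom_inv.trans (Category.assoc _ _ _))
  inv_hom := hX.ob_ext fun j => by
    rw [precomp_comp]
    exact (C.comp_congr' (ITrans.ob_desc hX _ j) (ITrans.ob_desc hX _ j)).trans
      ((t j).inv_hom.trans (Category.assoc _ _ _))

end Transf

section Local
variable {V : Type u} [Category.{v} V] [CartesianMonoidalCategory V] [HasLimits V]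
variable {C : ICat V} {T T' : V}

theorem IsPasting.pre (k : T' ⟶ T) : ∀ {l : List (T ⟶ C.Mor)} {m : T ⟶ C.Mor},
    IsPasting C l m → IsPasting C (l.map fun x => k ≫ x) (k ≫ m)
  | [], _, h => h
  | [_], _, h => congrArg (k ≫ ·) h
  | _ :: _ :: _, _, ⟨r, h, h1, h2⟩ => ⟨k ≫ r, by rw [Category.assoc, h, Category.assoc],
      IsPasting.pre k h1, by rw [← h2, precomp_comp]⟩

theorem IsPasting.unique : ∀ {l : List (T ⟶ C.Mor)} {m m' : T ⟶ C.Mor},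
    IsPasting C l m → IsPasting C l m' → m = m'
  | [], _, _, h, _ => h.elim
  | [_], _, _, h, h' => h.symm.trans h'
  | _ :: _ :: _, _, _, ⟨r, h, h1, h2⟩, ⟨r', h', h1', h2'⟩ => by
      obtain rfl := h1.unique h1'
      exact h2.symm.trans h2'

theorem SamePasting.pre (k : T' ⟶ T) {l l' : List (T ⟶ C.Mor)} (h : SamePasting C l l') :
    SamePasting C (l.map fun x => k ≫ x) (l'.map fun x => k ≫ x) :=
  let ⟨_, h1, h2⟩ := h
  ⟨_, h1.pre k, h2.pre k⟩

variable {J : Type w} {B : J → ICat V} {S : ICat V} {i : ∀ j, B j ⟶ S}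

/-- A list of 2-cells has a composite if its restrictions to the summands of a coproduct do: the
objects of the summands are jointly epimorphic. -/
theorem IsCoprod.isPasting (hS : IsCoprod i) : ∀ {l : List (S.Ob ⟶ C.Mor)}, l ≠ [] →
    (∀ j, ∃ m, IsPasting C (l.map fun x => ob (i j) ≫ x) m) → ∃ m, IsPasting C l m
  | [], h, _ => (h rfl).elim
  | [x], _, _ => ⟨x, rfl⟩
  | x :: y :: l, _, h => by
      obtain ⟨r, hr⟩ := hS.isPasting (l := y :: l) (by simp) fun j => by
        obtain ⟨_, r, _, h1, _⟩ := h j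
        exact ⟨r, h1⟩
      have e : x ≫ C.tgt = r ≫ C.src := hS.ob_ext fun j => by
        obtain ⟨_, r', h0, h1, _⟩ := h j
        rw [← Category.assoc, h0, ← Category.assoc]
        exact congrArg (· ≫ C.src) (h1.unique (hr.pre (ob (i j))))
      exact ⟨_, r, e, hr, rfl⟩

/-- Equality of pastings may be checked on the summands of a coproduct. -/
theorem IsCoprod.samePasting (hS : IsCoprod i) {l l' : List (S.Ob ⟶ C.Mor)} (hl : l ≠ [])
    (hl' : l' ≠ []) (h : ∀ j, SamePasting C (l.map fun x => ob (i j) ≫ x)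
      (l'.map fun x => ob (i j) ≫ x)) : SamePasting C l l' := by
  obtain ⟨m, hm⟩ := hS.isPasting hl fun j => let ⟨m, h1, _⟩ := h j; ⟨m, h1⟩
  obtain ⟨m', hm'⟩ := hS.isPasting hl' fun j => let ⟨m, _, h1⟩ := h j; ⟨m, h1⟩
  refine ⟨m, hm, ?_⟩
  have : m = m' := hS.ob_ext fun j => by
    obtain ⟨r, h1, h2⟩ := h j
    exact ((hm.pre _).unique h1).trans (h2.unique (hm'.pre _))
  exact this ▸ hm'

/-- A family of nonempty lists of 2-cells, depending on a generalized object of `S`, that is natural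
in the stage of definition. -/
structure Local (S C : ICat V) (L : ∀ {T : V}, (T ⟶ S.Ob) → List (T ⟶ C.Mor)) : Prop where
  pre : ∀ {T T' : V} (k : T' ⟶ T) (z : T ⟶ S.Ob), L (k ≫ z) = (L z).map fun x => k ≫ x
  ne_nil : ∀ {T : V} (z : T ⟶ S.Ob), L z ≠ []

/-- Equality of pastings that are natural in the stage of definition may be checked on the
generalized objects of the summands. -/
theorem IsCoprod.local1 (hS : IsCoprod i) {L L' : ∀ {T : V}, (T ⟶ S.Ob) → List (T ⟶ C.Mor)}
    (hL : Local S C L) (hL' : Local S C L')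
    (h : ∀ (T : V) (j) (a : T ⟶ (B j).Ob), SamePasting C (L (a ≫ ob (i j))) (L' (a ≫ ob (i j))))
    {T : V} (z : T ⟶ S.Ob) : SamePasting C (L z) (L' z) := by
  have key : SamePasting C (L (𝟙 S.Ob)) (L' (𝟙 S.Ob)) :=
    hS.samePasting (hL.ne_nil _) (hL'.ne_nil _) fun j => by
      have := h _ j (𝟙 _)
      rw [Category.id_comp] at this
      rw [← hL.pre, ← hL'.pre, Category.comp_id]
      exact this
  have := key.pre z
  rwa [← hL.pre, ← hL'.pre, Category.comp_id] at this

end Local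
end ICat

/-! ### The interchange of pairing and composition -/

namespace ICat
open Stage

namespace Lab
section Interchange
variable {V : Type u} [Category.{v} V] [CartesianMonoidalCategory V] [HasLimits V]
variable {O : Operad V} (A : O.PseudoCommutative) {F G : Stage V} {T : V}
  {S P S' P' : Type} [Finite S] [Finite P] [Finite S'] [Finite P']
  {R : S → Type} {Q : P → Type} [∀ s, Finite (R s)] [∀ p, Finite (Q p)]
  {R' : S' → Type} {Q' : P' → Type} [∀ s, Finite (R' s)] [∀ p, Finite (Q' p)]

/-- The bijection `((s, r), (p, q)) ↦ (s, ((r, p), q))`. -/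
def mid (R : S → Type) (Q : P → Type) :
    (Σ s, R s) × (Σ p, Q p) ≃ Σ s, Σ rp : R s × P, Q rp.2 where
  toFun a := ⟨a.1.1, (a.1.2, a.2.1), a.2.2⟩
  invFun a := (⟨a.1, a.2.1.1⟩, ⟨a.2.1.2, a.2.2⟩)
  left_inv _ := rfl
  right_inv _ := rfl

/-- The bijection `((s, p), (r, q)) ↦ ((s, r), (p, q))`. -/
def swapMid (R : S → Type) (Q : P → Type) :
    (Σ a : S × P, R a.1 × Q a.2) ≃ (Σ s, R s) × (Σ p, Q p) where
  toFun a := (⟨a.1.1, a.2.1⟩, ⟨a.1.2, a.2.2⟩)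
  invFun a := ⟨(a.1.1, a.2.1), (a.1.2, a.2.2)⟩
  left_inv _ := rfl
  right_inv _ := rfl

/-- The element `γ(x; γ(c_s; z_p))` for elements `c_s` with labels `(r, p)`. -/
noncomputable def mids (x : Lab O F S) (c : ∀ s, Lab O F (R s × P)) (z : ∀ p, Lab O F (Q p)) :
    Lab O F ((Σ s, R s) × (Σ p, Q p)) :=
  (gam x fun s => gam (c s) fun rp => z rp.2).re (mid R Q)

theorem ap_mids (h : F.Hom G) (x : Lab O F S) (c : ∀ s, Lab O F (R s × P))
    (z : ∀ p, Lab O F (Q p)) :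
    (mids x c z).ap h = mids (x.ap h) (fun s => (c s).ap h) fun p => (z p).ap h := by
  unfold mids
  rw [ap_re, ap_gam]
  simp only [ap_gam]

theorem src_mids (x : Lab O (mors V T) S) (c : ∀ s, Lab O (mors V T) (R s × P))
    (z : ∀ p, Lab O (mors V T) (Q p)) :
    (mids x c z).src = mids x.src (fun s => (c s).src) fun p => (z p).src := ap_mids _ _ _ _

theorem tgt_mids (x : Lab O (mors V T) S) (c : ∀ s, Lab O (mors V T) (R s × P))
    (z : ∀ p, Lab O (mors V T) (Q p)) :
    (mids x c z).tgt = mids x.tgt (fun s => (c s).tgt) fun p => (z p).tgt := ap_mids _ _ _ _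

theorem one_mids (x : Lab O (obs V T) S) (c : ∀ s, Lab O (obs V T) (R s × P))
    (z : ∀ p, Lab O (obs V T) (Q p)) :
    (mids x c z).one = mids x.one (fun s => (c s).one) fun p => (z p).one := ap_mids _ _ _ _

theorem Cmp.mids {x x' x'' : Lab O (mors V T) S} {c c' c'' : ∀ s, Lab O (mors V T) (R s × P)}
    {z z' z'' : ∀ p, Lab O (mors V T) (Q p)} (hx : Cmp x x' x'') (hc : ∀ s, Cmp (c s) (c' s) (c''
        s))
    (hz : ∀ p, Cmp (z p) (z' p) (z'' p)) :
    Cmp (Lab.mids x c z) (Lab.mids x' c' z') (Lab.mids x'' c'' z'') :=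
  (hx.gam fun s => (hc s).gam fun _ => hz _).re _

theorem Eqv.mids {σ : S ≃ S'} {π : P ≃ P'} {ρ : ∀ s, R s ≃ R' (σ s)} {κ : ∀ p, Q p ≃ Q' (π p)}
    {x : Lab O F S} {x' : Lab O F S'} {c : ∀ s, Lab O F (R s × P)} {c' : ∀ s, Lab O F (R' s × P')}
    {z : ∀ p, Lab O F (Q p)} {z' : ∀ p, Lab O F (Q' p)} (hx : Eqv σ x x')
    (hc : ∀ s, Eqv (Equiv.prodCongr (ρ s) π) (c s) (c' (σ s)))
    (hz : ∀ p, Eqv (κ p) (z p) (z' (π p))) :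
    Eqv (Equiv.prodCongr (Equiv.sigmaCongr σ ρ) (Equiv.sigmaCongr π κ)) (Lab.mids x c z)
      (Lab.mids x' c' z') := by
  have h0 (s : S) : Eqv (Equiv.sigmaCongr (Equiv.prodCongr (ρ s) π) fun rp => κ rp.2)
      (Lab.gam (c s) fun rp => z rp.2) (Lab.gam (c' (σ s)) fun rp => z' rp.2) :=
    Eqv.gam (K := fun rp : R s × P => Q rp.2) (K' := fun rp : R' (σ s) × P' => Q' rp.2)
      (σ := Equiv.prodCongr (ρ s) π) (τ := fun rp => κ rp.2) (y := fun rp => z rp.2)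
      (y' := fun rp => z' rp.2) (hc s) fun rp => hz rp.2
  have h := Eqv.gam (K := fun s => Σ rp : R s × P, Q rp.2)
    (K' := fun s => Σ rp : R' s × P', Q' rp.2)
    (τ := fun s => Equiv.sigmaCongr (Equiv.prodCongr (ρ s) π) fun rp => κ rp.2)
    (y := fun s => Lab.gam (c s) fun rp => z rp.2)
    (y' := fun s => Lab.gam (c' s) fun rp => z' rp.2) hx h0
  exact (((Eqv.of_re _ _).trans h).trans (Eqv.of_re _ (mid R' Q')).symm).of_eq fun _ => rfl

/-- The bijection `(p, (r, q)) ↦ ((r, p), q)`. -/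
def outerSwap (R : Type) (Q : P → Type) : (Σ p, R × Q p) ≃ Σ rp : R × P, Q rp.2 where
  toFun a := ⟨(a.2.1, a.1), a.2.2⟩
  invFun a := ⟨a.1.2, (a.1.1, a.2)⟩
  left_inv _ := rfl
  right_inv _ := rfl

/-- `γ(w; y ⊗ z_p)` is `γ(w ⊗ y; z_p)`. -/
theorem gam_tens_right {R : Type} [Finite R] (w : Lab O F P) (y : Lab O F R)
    (z : ∀ p, Lab O F (Q p)) : Eqv (outerSwap R Q) (gam w fun p => tens y (z p))
      (gam ((tens w y).re (Equiv.prodComm R P)) fun rp => z rp.2) := by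
  have k1 := Eqv.gam_right w fun p => tens_eqv y (z p)
  have k2 := gam_assoc (L := fun a : Σ _ : P, R => Q a.1) w (fun _ => y) fun a => z a.1
  have k3 := Eqv.gam (K := fun rp : R × P => Q rp.2) (K' := fun a : Σ _ : P, R => Q a.1)
    (τ := fun _ => Equiv.refl _) (y := fun rp => z rp.2) (y' := fun a => z a.1)
    ((Eqv.of_re _ (Equiv.prodComm R P)).trans (tens_eqv w y)) fun rp => Eqv.refl (z rp.2)
  exact ((k1.trans k2.symm).trans k3.symm).of_eq_symm fun _ => rfl

/-- The source of the interchange. -/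
theorem tens_gam_tens (x : Lab O F S) (w : Lab O F P) (y : ∀ s, Lab O F (R s))
    (z : ∀ p, Lab O F (Q p)) :
    Eqv (swapMid R Q) (gam (tens x w) fun a : S × P => tens (y a.1) (z a.2))
      (mids x (fun s => (tens w (y s)).re (Equiv.prodComm (R s) P)) z) := by
  have h1 := Eqv.gam (K := fun a : S × P => R a.1 × Q a.2)
    (K' := fun a : Σ _ : S, P => R a.1 × Q a.2) (τ := fun _ => Equiv.refl _)
    (y := fun a : S × P => tens (y a.1) (z a.2)) (y' := fun a => tens (y a.1) (z a.2))
    (tens_eqv x w) fun a => Eqv.refl _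
  have h2 := gam_assoc (L := fun a : Σ _ : S, P => R a.1 × Q a.2) x (fun _ => w)
    fun a => tens (y a.1) (z a.2)
  have h3 (s : S) := gam_tens_right w (y s) z
  have h4 := Eqv.gam_right x h3
  exact (((h1.trans h2).trans h4).trans (Eqv.of_re _ (mid R Q)).symm).of_eq fun _ => rfl

/-- The target of the interchange. -/
theorem gam_tens_gam (x : Lab O F S) (w : Lab O F P) (y : ∀ s, Lab O F (R s))
    (z : ∀ p, Lab O F (Q p)) :
    tens (gam x y) (gam w z) = mids x (fun s => tens (y s) w) z := by
  have h1 := tens_eqv (gam x y) (gam w z)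
  have h2 := gam_assoc (L := fun _ : Σ s, R s => Σ p, Q p) x y fun _ => gam w z
  have h3 (s : S) : Eqv
      (⟨fun a => ⟨(a.1, a.2.1), a.2.2⟩, fun a => ⟨a.1.1, ⟨a.1.2, a.2⟩⟩, fun _ => rfl, fun _ => rfl⟩
          :
        (Σ _ : R s, Σ p, Q p) ≃ Σ rp : R s × P, Q rp.2) (gam (y s) fun _ => gam w z)
      (gam (tens (y s) w) fun rp => z rp.2) := by
    have k1 := gam_assoc (L := fun a : Σ _ : R s, P => Q a.2) (y s) (fun _ => w) fun a => z a.2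
    have k2 := Eqv.gam (K := fun rp : R s × P => Q rp.2) (K' := fun a : Σ _ : R s, P => Q a.2)
      (τ := fun _ => Equiv.refl _) (y := fun rp => z rp.2) (y' := fun a => z a.2)
      (tens_eqv (y s) w) fun rp => Eqv.refl (z rp.2)
    exact (k1.symm.trans k2.symm).of_eq_symm fun _ => rfl
  have h4 := ((h1.trans h2).trans (Eqv.gam_right x h3)).trans (Eqv.of_re _ (mid R Q)).symm
  exact Eq.trans (h4.of_eq (e' := Equiv.refl _) fun _ => rfl) (re_refl _)

theorem gam_tens_tens (x : Lab O F S) (w : Lab O F P) (y : ∀ s, Lab O F (R s))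
    (z : ∀ p, Lab O F (Q p)) :
    (gam (tens x w) fun a : S × P => tens (y a.1) (z a.2)).re (swapMid R Q).symm =
      mids x (fun s => (tens w (y s)).re (Equiv.prodComm (R s) P)) z :=
  Eq.symm (tens_gam_tens x w y z).symm

/-- The component of the pseudofunctoriality constraint of the product:
`γ(id_x; γ(α_{w, y_s}; id_{z_p}))`, from `γ(x ⊗ w; y_s ⊗ z_p)` to `γ(x; y) ⊗ γ(w; z)`. Here `x`
and `w` belong to the second pair of morphisms, `y` and `z` to the first. -/
noncomputable def inter (x : Lab O (obs V T) S) (w : Lab O (obs V T) P)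
    (y : ∀ s, Lab O (obs V T) (R s)) (z : ∀ p, Lab O (obs V T) (Q p)) :
    Lab O (mors V T) ((Σ s, R s) × (Σ p, Q p)) :=
  mids x.one (fun s => alpha A w (y s)) fun p => (z p).one

/-- The inverse of `inter`. -/
noncomputable def interInv (x : Lab O (obs V T) S) (w : Lab O (obs V T) P)
    (y : ∀ s, Lab O (obs V T) (R s)) (z : ∀ p, Lab O (obs V T) (Q p)) :
    Lab O (mors V T) ((Σ s, R s) × (Σ p, Q p)) :=
  mids x.one (fun s => (alpha A (y s) w).re (Equiv.prodComm (R s) P)) fun p => (z p).one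

theorem Eqv.inter {σ : S ≃ S'} {π : P ≃ P'} {ρ : ∀ s, R s ≃ R' (σ s)} {κ : ∀ p, Q p ≃ Q' (π p)}
    {x : Lab O (obs V T) S} {x' : Lab O (obs V T) S'} {w : Lab O (obs V T) P}
    {w' : Lab O (obs V T) P'} {y : ∀ s, Lab O (obs V T) (R s)} {y' : ∀ s, Lab O (obs V T) (R' s)}
    {z : ∀ p, Lab O (obs V T) (Q p)} {z' : ∀ p, Lab O (obs V T) (Q' p)} (hx : Eqv σ x x')
    (hw : Eqv π w w') (hy : ∀ s, Eqv (ρ s) (y s) (y' (σ s)))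
    (hz : ∀ p, Eqv (κ p) (z p) (z' (π p))) :
    Eqv (Equiv.prodCongr (Equiv.sigmaCongr σ ρ) (Equiv.sigmaCongr π κ)) (Lab.inter A x w y z)
      (Lab.inter A x' w' y' z') :=
  Eqv.mids (hx.ap _) (fun s => Eqv.alpha A hw (hy s)) fun p => (hz p).ap _

variable (x : Lab O (obs V T) S) (w : Lab O (obs V T) P)
    (y : ∀ s, Lab O (obs V T) (R s)) (z : ∀ p, Lab O (obs V T) (Q p))

theorem inter_src : (inter A x w y z).src =
    (gam (tens x w) fun a : S × P => tens (y a.1) (z a.2)).re (swapMid R Q).symm := by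
  rw [gam_tens_tens]
  unfold inter
  rw [src_mids]
  simp only [alpha_src, src_one]

theorem inter_tgt : (inter A x w y z).tgt = tens (gam x y) (gam w z) := by
  unfold inter
  rw [gam_tens_gam, tgt_mids]
  simp only [alpha_tgt, tgt_one]

theorem inter_inv : Cmp (inter A x w y z) (interInv A x w y z) (inter A x w y z).src.one := by
  have h := (Cmp.one x).mids (fun s => alpha_inv A w (y s)) fun p => Cmp.one (z p)
  convert! h
  unfold inter
  rw [src_mids, one_mids]
  simp only [alpha_src, src_one]

theorem inv_inter : Cmp (interInv A x w y z) (inter A x w y z) (inter A x w y z).tgt.one := by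
  have h := (Cmp.one x).mids (fun s => alpha_symm A (y s) w) fun p => Cmp.one (z p)
  convert! h
  unfold inter
  rw [tgt_mids, one_mids]
  simp only [alpha_tgt, tgt_one]

theorem inter_nat (x : Lab O (mors V T) S) (w : Lab O (mors V T) P)
    (y : ∀ s, Lab O (mors V T) (R s)) (z : ∀ p, Lab O (mors V T) (Q p)) :
    ∃ r, Cmp ((gam (tens x w) fun a : S × P => tens (y a.1) (z a.2)).re (swapMid R Q).symm)
        (inter A x.tgt w.tgt (fun s => (y s).tgt) fun p => (z p).tgt) r ∧
      Cmp (inter A x.src w.src (fun s => (y s).src) fun p => (z p).src)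
        (tens (gam x y) (gam w z)) r := by
  choose r h1 h2 using fun s => alpha_nat A w (y s)
  refine ⟨mids x r z, ?_, ?_⟩
  · rw [gam_tens_tens]
    exact (Cmp.id_right rfl).mids h1 fun p => Cmp.id_right rfl
  · rw [gam_tens_gam]
    exact (Cmp.id_left rfl).mids h2 fun p => Cmp.id_left rfl

/-- The interchange is an identity if the second morphism of the second variable is in `Π`, as all
`α_{w, y_s}` are. -/
theorem inter_low_right {w : Lab O (obs V T) P} (hw : IsLow w) :
    inter A x w y z = (tens (gam x y) (gam w z)).one := by
  unfold inter
  rw [gam_tens_gam, one_mids]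
  simp only [alpha_low_left A hw]

/-- The interchange is an identity if the first morphism of the first variable is in `Π`, as all
`α_{w, y_s}` are. -/
theorem inter_low_left {y : ∀ s, Lab O (obs V T) (R s)} (hy : ∀ s, IsLow (y s)) :
    inter A x w y z = (tens (gam x y) (gam w z)).one := by
  unfold inter
  rw [gam_tens_gam, one_mids]
  simp only [alpha_low_right A (hy _)]

end Interchange
end Lab
end ICat

/-! ### The pseudofunctoriality constraint of the product -/

namespace ICat
open Stage

namespace Lab
section Pre
variable {V : Type u} [Category.{v} V] [CartesianMonoidalCategory V] [HasLimits V]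
variable {O : Operad V} (A : O.PseudoCommutative) {T T' : V}
  {S P : Type} [Finite S] [Finite P]
  {R : S → Type} {Q : P → Type} [∀ s, Finite (R s)] [∀ p, Finite (Q p)]

theorem alphaF_pre {j l : ℕ} (k : T' ⟶ T) (x : (obs V T).obj (O.obj j))
    (y : (obs V T).obj (O.obj l)) : (preMor k).app (alphaF A x y) =
      alphaF A ((preOb k).app x) ((preOb k).app y) :=
  (Category.assoc _ _ _).symm.trans
    (congrArg (fun t : (obs V T').obj (O.obj j ⊗ O.obj l) => t ≫ (A.α j l).hom.app)
      ((preOb k).pair x y))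

theorem alpha_pre (k : T' ⟶ T) (x : Lab O (obs V T) S) (y : Lab O (obs V T) P) :
    (alpha A x y).ap (preMor k) = alpha A (x.ap (preOb k)) (y.ap (preOb k)) := by
  unfold alpha
  rw [ap_mk, alphaF_pre, ap_at, ap_at]

theorem one_pre (k : T' ⟶ T) (x : Lab O (obs V T) S) :
    x.one.ap (preMor k) = (x.ap (preOb k)).one :=
  Lab.ext (Category.assoc _ _ _).symm

theorem inter_pre (k : T' ⟶ T) (x : Lab O (obs V T) S) (w : Lab O (obs V T) P)
    (y : ∀ s, Lab O (obs V T) (R s)) (z : ∀ p, Lab O (obs V T) (Q p)) :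
    (inter A x w y z).ap (preMor k) = inter A (x.ap (preOb k)) (w.ap (preOb k))
      (fun s => (y s).ap (preOb k)) fun p => (z p).ap (preOb k) := by
  unfold inter
  rw [ap_mids]
  simp only [alpha_pre, one_pre]

end Pre
end Lab

section Theta
variable {V : Type u} [Category.{v} V] [CartesianMonoidalCategory V] [MonoidalClosed V]
  [HasLimits V] [HasColimits (ICat V)]
variable {O : Operad V} (A : O.PseudoCommutative) {F G : Stage V} {T : V}
  {X Y Z X' Y' Z' : Type} {m n p m' n' p' : ℕ}

/-- The coordinates of an element of a summand. -/
noncomputable def coord (φ : FHom m n) (c : F.obj (O.summand φ)) (j : Fin n) :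
    Lab O F ((Span.ofHom φ).K j) := Lab.mk (Equiv.refl (Fin (φ.deg j))) (F.map (piπ _ j) c)

theorem map_incl (φ : FHom m n) (c : F.obj (O.summand φ)) : F.map (O.incl φ) c =
    cell (Equiv.refl _) (Equiv.refl _) (Span.ofHom φ) (coord φ c) := by
  have h : F.tuple (fun j => F.map (piπ (fun j => O.obj (φ.deg j)) j) c) = c :=
    F.tuple_ext fun j => F.map_π _ j
  exact (congrArg (F.map (O.incl φ)) h.symm).trans (ptF_eq φ fun j => F.map (piπ (fun j => O.obj
      (φ.deg j)) j) c)

theorem ap_coord (h : F.Hom G) (φ : FHom m n) (c : F.obj (O.summand φ)) (j : Fin n) :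
    (coord φ c j).ap h = coord φ (h.app c) j :=
  (Lab.ap_mk h _ _).trans (congrArg _ (h.nat _ _))

theorem cell_smash_comp {v : X ≃ Fin m} {u : Y ≃ Fin n} {w : Z ≃ Fin p} {v' : X' ≃ Fin m'}
    {u' : Y' ≃ Fin n'} {w' : Z' ≃ Fin p'} (s : Span X Y) (t : Span Y Z) (s' : Span X' Y')
    (t' : Span Y' Z') (x : ∀ b, Lab O F (s.K b)) (y : ∀ c, Lab O F (t.K c))
    (x' : ∀ b, Lab O F (s'.K b)) (y' : ∀ c, Lab O F (t'.K c)) :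
    F.map (O.compD (m * m') (n * n') (p * p'))
      (F.pair (F.map (O.smashMap m n m' n') (F.pair (cell v u s x) (cell v' u' s' x')))
        (F.map (O.smashMap n p n' p') (F.pair (cell u w t y) (cell u' w' t' y')))) =
      cell (lexNum v v') (lexNum w w') ((s.comp t).prod (s'.comp t')) fun c =>
        (Lab.gam (Lab.tens (y c.1) (y' c.2)) fun k =>
          Lab.tens (x (t.leg c.1 k.1)) (x' (t'.leg c.2 k.2))).re
            (Lab.swapMid (fun k => s.K (t.leg c.1 k)) fun k => s'.K (t'.leg c.2 k)).symm := by
  rw [cell_smash, cell_smash]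
  refine (cell_comp _ _ _ _).trans ?_
  refine cell_congr' (fun c => Lab.swapMid (fun k => s.K (t.leg c.1 k))
    fun k => s'.K (t'.leg c.2 k)) (fun _ _ => rfl) fun c => ?_
  exact Lab.Eqv.symm (Lab.Eqv.of_re _ _)

theorem cell_comp_smash {v : X ≃ Fin m} {u : Y ≃ Fin n} {w : Z ≃ Fin p} {v' : X' ≃ Fin m'}
    {u' : Y' ≃ Fin n'} {w' : Z' ≃ Fin p'} (s : Span X Y) (t : Span Y Z) (s' : Span X' Y')
    (t' : Span Y' Z') (x : ∀ b, Lab O F (s.K b)) (y : ∀ c, Lab O F (t.K c))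
    (x' : ∀ b, Lab O F (s'.K b)) (y' : ∀ c, Lab O F (t'.K c)) :
    F.map (O.smashMap m p m' p')
      (F.pair (F.map (O.compD m n p) (F.pair (cell v u s x) (cell u w t y)))
        (F.map (O.compD m' n' p') (F.pair (cell v' u' s' x') (cell u' w' t' y')))) =
      cell (lexNum v v') (lexNum w w') ((s.comp t).prod (s'.comp t')) fun c =>
        Lab.tens (Lab.gam (y c.1) fun k => x (t.leg c.1 k))
          (Lab.gam (y' c.2) fun k => x' (t'.leg c.2 k)) :=
  (congrArg₂ (fun a b => F.map (O.smashMap m p m' p') (F.pair a b)) (cell_comp s t x y)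
    (cell_comp s' t' x' y')).trans (cell_smash _ _ _ _)

/-- The component of the pseudofunctoriality constraint of the product at four morphisms. -/
noncomputable def interCell (v : X ≃ Fin m) (w : Z ≃ Fin p) (v' : X' ≃ Fin m') (w' : Z' ≃ Fin p')
    (s : Span X Y) (t : Span Y Z) (s' : Span X' Y')
    (t' : Span Y' Z') (x : ∀ b, Lab O (obs V T) (s.K b)) (y : ∀ c, Lab O (obs V T) (t.K c))
    (x' : ∀ b, Lab O (obs V T) (s'.K b)) (y' : ∀ c, Lab O (obs V T) (t'.K c)) :
    (mors V T).obj (O.hom (m * m') (p * p')) :=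
  cell (lexNum v v') (lexNum w w') ((s.comp t).prod (s'.comp t')) fun c =>
    Lab.inter A (y c.1) (y' c.2) (fun k => x (t.leg c.1 k)) fun k => x' (t'.leg c.2 k)

/-- The inverse of `interCell`. -/
noncomputable def interInvCell (v : X ≃ Fin m) (w : Z ≃ Fin p) (v' : X' ≃ Fin m')
    (w' : Z' ≃ Fin p') (s : Span X Y) (t : Span Y Z) (s' : Span X' Y')
    (t' : Span Y' Z') (x : ∀ b, Lab O (obs V T) (s.K b)) (y : ∀ c, Lab O (obs V T) (t.K c))
    (x' : ∀ b, Lab O (obs V T) (s'.K b)) (y' : ∀ c, Lab O (obs V T) (t'.K c)) :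
    (mors V T).obj (O.hom (m * m') (p * p')) :=
  cell (lexNum v v') (lexNum w w') ((s.comp t).prod (s'.comp t')) fun c =>
    Lab.interInv A (y c.1) (y' c.2) (fun k => x (t.leg c.1 k)) fun k => x' (t'.leg c.2 k)

section
variable (v : X ≃ Fin m) (u : Y ≃ Fin n) (w : Z ≃ Fin p) (v' : X' ≃ Fin m')
    (u' : Y' ≃ Fin n') (w' : Z' ≃ Fin p') (s : Span X Y) (t : Span Y Z) (s' : Span X' Y')
    (t' : Span Y' Z') (x : ∀ b, Lab O (obs V T) (s.K b)) (y : ∀ c, Lab O (obs V T) (t.K c))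
    (x' : ∀ b, Lab O (obs V T) (s'.K b)) (y' : ∀ c, Lab O (obs V T) (t'.K c))

theorem interCell_src : (Stage.src T).app (interCell A v w v' w' s t s' t' x y x' y') =
    (obs V T).map (O.compD (m * m') (n * n') (p * p'))
      ((obs V T).pair ((obs V T).map (O.smashMap m n m' n') ((obs V T).pair (cell v u s x) (cell v'
          u' s' x')))
        ((obs V T).map (O.smashMap n p n' p') ((obs V T).pair (cell u w t y) (cell u' w' t' y'))))
            := by
  unfold interCell
  rw [app_cell, cell_smash_comp]
  congr 1
  funext c
  exact Lab.inter_src A _ _ _ _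

theorem interCell_tgt : (Stage.tgt T).app (interCell A v w v' w' s t s' t' x y x' y') =
    (obs V T).map (O.smashMap m p m' p')
      ((obs V T).pair ((obs V T).map (O.compD m n p) ((obs V T).pair (cell v u s x) (cell u w t y)))
        ((obs V T).map (O.compD m' n' p') ((obs V T).pair (cell v' u' s' x') (cell u' w' t' y'))))
            := by
  unfold interCell
  rw [app_cell, cell_comp_smash]
  congr 1
  funext c
  exact Lab.inter_tgt A _ _ _ _

theorem interCell_inv : CompIs (interCell A v w v' w' s t s' t' x y x' y')
    (interInvCell A v w v' w' s t s' t' x y x' y') ((Stage.idm T).app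
      ((Stage.src T).app (interCell A v w v' w' s t s' t' x y x' y'))) := by
  unfold interCell
  rw [app_cell, app_cell]
  exact compIs_cell fun c => Lab.inter_inv A _ _ _ _

theorem interInvCell_inter : CompIs (interInvCell A v w v' w' s t s' t' x y x' y')
    (interCell A v w v' w' s t s' t' x y x' y') ((Stage.idm T).app
      ((Stage.tgt T).app (interCell A v w v' w' s t s' t' x y x' y'))) := by
  unfold interCell
  rw [app_cell, app_cell]
  exact compIs_cell fun c => Lab.inv_inter A _ _ _ _

theorem interCell_pre {T' : V} (k : T' ⟶ T) :
    (preMor k).app (interCell A v w v' w' s t s' t' x y x' y') =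
      interCell A v w v' w' s t s' t' (fun b => (x b).ap (preOb k)) (fun b => (y b).ap (preOb k))
        (fun b => (x' b).ap (preOb k)) (fun b => (y' b).ap (preOb k)) := by
  unfold interCell
  rw [app_cell]
  congr 1
  funext c
  exact Lab.inter_pre A k _ _ _ _
end

theorem interCell_nat (v : X ≃ Fin m) (u : Y ≃ Fin n) (w : Z ≃ Fin p) (v' : X' ≃ Fin m')
    (u' : Y' ≃ Fin n') (w' : Z' ≃ Fin p') (s : Span X Y) (t : Span Y Z) (s' : Span X' Y')
    (t' : Span Y' Z') (x : ∀ b, Lab O (mors V T) (s.K b)) (y : ∀ c, Lab O (mors V T) (t.K c))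
    (x' : ∀ b, Lab O (mors V T) (s'.K b)) (y' : ∀ c, Lab O (mors V T) (t'.K c)) :
    ∃ r, CompIs ((mors V T).map (O.compD (m * m') (n * n') (p * p'))
        ((mors V T).pair ((mors V T).map (O.smashMap m n m' n')
          ((mors V T).pair (cell v u s x) (cell v' u' s' x')))
        ((mors V T).map (O.smashMap n p n' p')
          ((mors V T).pair (cell u w t y) (cell u' w' t' y')))))
        (interCell A v w v' w' s t s' t' (fun b => (x b).tgt) (fun b => (y b).tgt)
          (fun b => (x' b).tgt) (fun b => (y' b).tgt)) r ∧
      CompIs (interCell A v w v' w' s t s' t' (fun b => (x b).src) (fun b => (y b).src)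
          (fun b => (x' b).src) (fun b => (y' b).src))
        ((mors V T).map (O.smashMap m p m' p')
          ((mors V T).pair ((mors V T).map (O.compD m n p)
            ((mors V T).pair (cell v u s x) (cell u w t y)))
          ((mors V T).map (O.compD m' n' p')
            ((mors V T).pair (cell v' u' s' x') (cell u' w' t' y'))))) r := by
  choose r h1 h2 using fun c : Z × Z' => Lab.inter_nat A (y c.1) (y' c.2)
    (fun k => x (t.leg c.1 k)) fun k => x' (t'.leg c.2 k)
  rw [cell_smash_comp, cell_comp_smash]
  exact ⟨cell (lexNum v v') (lexNum w w') ((s.comp t).prod (s'.comp t')) r,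
    compIs_cell h1, compIs_cell h2⟩

end Theta
end ICat

namespace ICat
open Stage

section Theta
variable {V : Type u} [Category.{v} V] [CartesianMonoidalCategory V] [MonoidalClosed V]
  [HasLimits V] [HasColimits (ICat V)]
variable {O : Operad V} (A : O.PseudoCommutative) {F G : Stage V} {T : V}
  {X Y Z X' Y' Z' : Type} {m n p m' n' p' : ℕ}

/-- The inclusion of a summand of the source of the pseudofunctoriality constraint. -/
noncomputable abbrev incl4 (O : Operad V) (φ : FHom m n) (φ' : FHom m' n') (ψ : FHom n p)
    (ψ' : FHom n' p') :
    (O.summand φ ⊗ O.summand φ') ⊗ (O.summand ψ ⊗ O.summand ψ') ⟶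
      (O.hom m n ⊗ O.hom m' n') ⊗ (O.hom n p ⊗ O.hom n' p') :=
  (O.incl φ ⊗ₘ O.incl φ') ⊗ₘ (O.incl ψ ⊗ₘ O.incl ψ')

theorem map_incl4 (φ : FHom m n) (φ' : FHom m' n') (ψ : FHom n p) (ψ' : FHom n' p')
    (a : F.obj (O.summand φ)) (a' : F.obj (O.summand φ')) (b : F.obj (O.summand ψ))
    (b' : F.obj (O.summand ψ')) :
    F.map (incl4 O φ φ' ψ ψ') (F.pair (F.pair a a') (F.pair b b')) =
      F.pair (F.pair (F.map (O.incl φ) a) (F.map (O.incl φ') a'))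
        (F.pair (F.map (O.incl ψ) b) (F.map (O.incl ψ') b')) := by
  rw [map_tensor, map_tensor, map_tensor]

theorem map_middle {C D C' D' : ICat V} (a : F.obj C) (a' : F.obj D) (b : F.obj C')
    (b' : F.obj D') : F.map (middle C D C' D') (F.pair (F.pair a a') (F.pair b b')) =
      F.pair (F.pair a b) (F.pair a' b') := by
  unfold middle
  rw [map_lift, map_tensor, map_tensor]
  simp

/-- The source of the pseudofunctoriality constraint of the product. -/
noncomputable abbrev thetaSrc (O : Operad V) (m n p m' n' p' : ℕ) :
    (O.hom m n ⊗ O.hom m' n') ⊗ (O.hom n p ⊗ O.hom n' p') ⟶ O.hom (m * m') (p * p') :=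
  (O.smashMap m n m' n' ⊗ₘ O.smashMap n p n' p') ≫ O.compD (m * m') (n * n') (p * p')

/-- The target of the pseudofunctoriality constraint of the product. -/
noncomputable abbrev thetaTgt (O : Operad V) (m n p m' n' p' : ℕ) :
    (O.hom m n ⊗ O.hom m' n') ⊗ (O.hom n p ⊗ O.hom n' p') ⟶ O.hom (m * m') (p * p') :=
  middle _ _ _ _ ≫ (O.compD m n p ⊗ₘ O.compD m' n' p') ≫ O.smashMap m p m' p'

theorem map_thetaSrc (a : F.obj (O.hom m n)) (a' : F.obj (O.hom m' n')) (b : F.obj (O.hom n p))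
    (b' : F.obj (O.hom n' p')) :
    F.map (thetaSrc O m n p m' n' p') (F.pair (F.pair a a') (F.pair b b')) =
      F.map (O.compD (m * m') (n * n') (p * p')) (F.pair (F.map (O.smashMap m n m' n') (F.pair a
          a'))
        (F.map (O.smashMap n p n' p') (F.pair b b'))) := by
  rw [F.map_comp, map_tensor]

theorem map_thetaTgt (a : F.obj (O.hom m n)) (a' : F.obj (O.hom m' n')) (b : F.obj (O.hom n p))
    (b' : F.obj (O.hom n' p')) :
    F.map (thetaTgt O m n p m' n' p') (F.pair (F.pair a a') (F.pair b b')) =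
      F.map (O.smashMap m p m' p') (F.pair (F.map (O.compD m n p) (F.pair a b))
        (F.map (O.compD m' n' p') (F.pair a' b'))) := by
  rw [F.map_comp, F.map_comp, map_middle, map_tensor]

section
variable (φ : FHom m n) (φ' : FHom m' n') (ψ : FHom n p) (ψ' : FHom n' p')

/-- The components of the pseudofunctoriality constraint on a summand. -/
noncomputable def thetaPt (z : (obs V T).obj ((O.summand φ ⊗ O.summand φ') ⊗ (O.summand ψ ⊗
    O.summand ψ'))) :
    (mors V T).obj (O.hom (m * m') (p * p')) :=
  interCell A (Equiv.refl _) (Equiv.refl _) (Equiv.refl _) (Equiv.refl _) (Span.ofHom φ)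
    (Span.ofHom ψ) (Span.ofHom φ') (Span.ofHom ψ')
    (coord φ ((obs V T).map (fst _ _) ((obs V T).map (fst _ _) z)))
    (coord ψ ((obs V T).map (fst _ _) ((obs V T).map (snd _ _) z)))
    (coord φ' ((obs V T).map (snd _ _) ((obs V T).map (fst _ _) z)))
    (coord ψ' ((obs V T).map (snd _ _) ((obs V T).map (snd _ _) z)))

/-- The components of the inverse of the pseudofunctoriality constraint on a summand. -/
noncomputable def thetaInvPt (z : (obs V T).obj ((O.summand φ ⊗ O.summand φ') ⊗ (O.summand ψ ⊗
    O.summand ψ'))) :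
    (mors V T).obj (O.hom (m * m') (p * p')) :=
  interInvCell A (Equiv.refl _) (Equiv.refl _) (Equiv.refl _) (Equiv.refl _) (Span.ofHom φ)
    (Span.ofHom ψ) (Span.ofHom φ') (Span.ofHom ψ')
    (coord φ ((obs V T).map (fst _ _) ((obs V T).map (fst _ _) z)))
    (coord ψ ((obs V T).map (fst _ _) ((obs V T).map (snd _ _) z)))
    (coord φ' ((obs V T).map (snd _ _) ((obs V T).map (fst _ _) z)))
    (coord ψ' ((obs V T).map (snd _ _) ((obs V T).map (snd _ _) z)))

theorem ap_coord_map (h : F.Hom G) {C D : ICat V} (φ : FHom m n) (f : C ⟶ O.summand φ) (g : D ⟶ C)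
    (z : F.obj D) : (fun b => (coord φ (F.map f (F.map g z)) b).ap h) =
      coord φ (G.map f (G.map g (h.app z))) :=
  funext fun b => (ap_coord h φ _ b).trans (by rw [h.nat, h.nat])

theorem thetaPt_pre {T' : V} (k : T' ⟶ T)
    (z : (obs V T).obj ((O.summand φ ⊗ O.summand φ') ⊗ (O.summand ψ ⊗ O.summand ψ'))) :
    (preMor k).app (thetaPt A φ φ' ψ ψ' z) = thetaPt A φ φ' ψ ψ' ((preOb k).app z) := by
  refine (interCell_pre A _ _ _ _ _ _ _ _ _ _ _ _ k).trans ?_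
  rw [ap_coord_map, ap_coord_map, ap_coord_map, ap_coord_map]
  rfl

theorem pair4_eta {C D C' D' : ICat V} (z : F.obj ((C ⊗ D) ⊗ (C' ⊗ D'))) :
    F.pair (F.pair (F.map (fst _ _) (F.map (fst _ _) z)) (F.map (snd _ _) (F.map (fst _ _) z)))
      (F.pair (F.map (fst _ _) (F.map (snd _ _) z)) (F.map (snd _ _) (F.map (snd _ _) z))) = z := by
  rw [pair_eta, pair_eta, pair_eta]

theorem map_incl4_thetaSrc (z : F.obj ((O.summand φ ⊗ O.summand φ') ⊗ (O.summand ψ ⊗ O.summand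
    ψ'))) :
    F.map (incl4 O φ φ' ψ ψ' ≫ thetaSrc O m n p m' n' p') z =
      F.map (O.compD (m * m') (n * n') (p * p')) (F.pair (F.map (O.smashMap m n m' n')
        (F.pair (cell (Equiv.refl _) (Equiv.refl _) (Span.ofHom φ)
            (coord φ (F.map (fst _ _) (F.map (fst _ _) z))))
          (cell (Equiv.refl _) (Equiv.refl _) (Span.ofHom φ')
            (coord φ' (F.map (snd _ _) (F.map (fst _ _) z))))))
        (F.map (O.smashMap n p n' p')
          (F.pair (cell (Equiv.refl _) (Equiv.refl _) (Span.ofHom ψ)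
            (coord ψ (F.map (fst _ _) (F.map (snd _ _) z))))
          (cell (Equiv.refl _) (Equiv.refl _) (Span.ofHom ψ')
            (coord ψ' (F.map (snd _ _) (F.map (snd _ _) z))))))) := by
  rw [F.map_comp, ← pair4_eta z, map_incl4, map_thetaSrc, map_incl, map_incl, map_incl, map_incl,
    pair4_eta]

theorem map_incl4_thetaTgt (z : F.obj ((O.summand φ ⊗ O.summand φ') ⊗ (O.summand ψ ⊗ O.summand
    ψ'))) :
    F.map (incl4 O φ φ' ψ ψ' ≫ thetaTgt O m n p m' n' p') z =
      F.map (O.smashMap m p m' p') (F.pair (F.map (O.compD m n p)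
        (F.pair (cell (Equiv.refl _) (Equiv.refl _) (Span.ofHom φ)
            (coord φ (F.map (fst _ _) (F.map (fst _ _) z))))
          (cell (Equiv.refl _) (Equiv.refl _) (Span.ofHom ψ)
            (coord ψ (F.map (fst _ _) (F.map (snd _ _) z))))))
        (F.map (O.compD m' n' p')
          (F.pair (cell (Equiv.refl _) (Equiv.refl _) (Span.ofHom φ')
            (coord φ' (F.map (snd _ _) (F.map (fst _ _) z))))
          (cell (Equiv.refl _) (Equiv.refl _) (Span.ofHom ψ')
            (coord ψ' (F.map (snd _ _) (F.map (snd _ _) z))))))) := by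
  rw [F.map_comp, ← pair4_eta z, map_incl4, map_thetaTgt, map_incl, map_incl, map_incl, map_incl,
    pair4_eta]

theorem thetaPt_nat (f : (mors V T).obj ((O.summand φ ⊗ O.summand φ') ⊗ (O.summand ψ ⊗ O.summand
    ψ'))) :
    ∃ r, CompIs ((mors V T).map (incl4 O φ φ' ψ ψ' ≫ thetaSrc O m n p m' n' p') f)
        (thetaPt A φ φ' ψ ψ' ((Stage.tgt T).app f)) r ∧
      CompIs (thetaPt A φ φ' ψ ψ' ((Stage.src T).app f))
        ((mors V T).map (incl4 O φ φ' ψ ψ' ≫ thetaTgt O m n p m' n' p') f) r := by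
  obtain ⟨r, h1, h2⟩ := interCell_nat A (Equiv.refl _) (Equiv.refl _) (Equiv.refl _)
    (Equiv.refl _) (Equiv.refl _) (Equiv.refl _) (Span.ofHom φ)
    (Span.ofHom ψ) (Span.ofHom φ') (Span.ofHom ψ')
    (coord φ ((mors V T).map (fst _ _) ((mors V T).map (fst _ _) f)))
    (coord ψ ((mors V T).map (fst _ _) ((mors V T).map (snd _ _) f)))
    (coord φ' ((mors V T).map (snd _ _) ((mors V T).map (fst _ _) f)))
    (coord ψ' ((mors V T).map (snd _ _) ((mors V T).map (snd _ _) f)))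
  rw [ap_coord_map, ap_coord_map, ap_coord_map, ap_coord_map] at h1 h2
  exact ⟨r, CompIs.congr h1 (map_incl4_thetaSrc (F := mors V T) φ φ' ψ ψ' f) rfl rfl,
    CompIs.congr h2 rfl (map_incl4_thetaTgt (F := mors V T) φ φ' ψ ψ' f) rfl⟩

/-- The restriction of the pseudofunctoriality constraint to a summand. -/
noncomputable def thetaTrans : ITrans (incl4 O φ φ' ψ ψ' ≫ thetaSrc O m n p m' n' p')
    (incl4 O φ φ' ψ ψ' ≫ thetaTgt O m n p m' n' p') :=
  ITrans.ofPoints (fun {T} z => thetaPt (T := T) A φ φ' ψ ψ' z)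
    (fun {T} z => (interCell_src A _ (Equiv.refl _) _ _ (Equiv.refl _) _ _ _ _ _ _ _ _ _).trans
      (map_incl4_thetaSrc (F := obs V T) φ φ' ψ ψ' z).symm)
    (fun {T} z => (interCell_tgt A _ (Equiv.refl _) _ _ (Equiv.refl _) _ _ _ _ _ _ _ _ _).trans
      (map_incl4_thetaTgt (F := obs V T) φ φ' ψ ψ' z).symm)
    (fun {T _} k z => thetaPt_pre (T := T) A φ φ' ψ ψ' k z)
    (fun {T} f => thetaPt_nat (T := T) A φ φ' ψ ψ' f)

/-- The restriction of the pseudofunctoriality constraint to a summand, with its inverse. -/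
noncomputable def thetaIso : IIso (incl4 O φ φ' ψ ψ' ≫ thetaSrc O m n p m' n' p')
    (incl4 O φ φ' ψ ψ' ≫ thetaTgt O m n p m' n' p') :=
  IIso.ofHom (thetaTrans A φ φ' ψ ψ') (thetaInvPt A φ φ' ψ ψ' (𝟙 _))
    (CompIs.congr (interCell_inv A _ _ _ _ _ _ _ _ _ _ _ _) rfl rfl
      (congrArg (Stage.idm _).app (thetaTrans A φ φ' ψ ψ').src.symm))
    (CompIs.congr (interInvCell_inter A _ _ _ _ _ _ _ _ _ _ _ _) rfl rfl
      (congrArg (Stage.idm _).app (thetaTrans A φ φ' ψ ψ').tgt.symm))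

end

theorem isCoprod4 (O : Operad V) (m n p m' n' p' : ℕ) :
    IsCoprod fun J : (FHom m n × FHom m' n') × (FHom n p × FHom n' p') =>
      incl4 O J.1.1 J.1.2 J.2.1 J.2.2 :=
  IsCoprod.tensor
    (a := fun J : FHom m n × FHom m' n' => O.incl J.1 ⊗ₘ O.incl J.2)
    (b := fun J : FHom n p × FHom n' p' => O.incl J.1 ⊗ₘ O.incl J.2)
    (IsCoprod.tensor (a := fun φ : FHom m n => O.incl φ) (b := fun φ : FHom m' n' => O.incl φ)
      (O.isCoprod_hom m n) (O.isCoprod_hom m' n'))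
    (IsCoprod.tensor (a := fun φ : FHom n p => O.incl φ) (b := fun φ : FHom n' p' => O.incl φ)
      (O.isCoprod_hom n p) (O.isCoprod_hom n' p'))

/-- The pseudofunctoriality constraint of the product. -/
noncomputable def theta (m n p m' n' p' : ℕ) :
    IIso (thetaSrc O m n p m' n' p') (thetaTgt O m n p m' n' p') :=
  IIso.desc (isCoprod4 O m n p m' n' p') fun J => thetaIso A J.1.1 J.1.2 J.2.1 J.2.2

/-- The product given by the intrinsic pairing. -/
noncomputable def Operad.PseudoCommutative.smashData : SmashData O.catOp.enr where
  map m n p q := O.smashMap m n p q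
  θ m n p m' n' p' := theta A m n p m' n' p'

theorem th_ptF (φ : FHom m n) (φ' : FHom m' n') (ψ : FHom n p) (ψ' : FHom n' p')
    (a : (obs V T).obj (O.summand φ)) (a' : (obs V T).obj (O.summand φ'))
    (b : (obs V T).obj (O.summand ψ)) (b' : (obs V T).obj (O.summand ψ')) :
    A.smashData.th ((obs V T).map (O.incl φ) a) ((obs V T).map (O.incl φ') a')
      ((obs V T).map (O.incl ψ) b) ((obs V T).map (O.incl ψ') b') =
    interCell A (Equiv.refl _) (Equiv.refl _) (Equiv.refl _) (Equiv.refl _) (Span.ofHom φ)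
      (Span.ofHom ψ) (Span.ofHom φ') (Span.ofHom ψ') (coord φ a) (coord ψ b) (coord φ' a')
      (coord ψ' b') := by
  let z := (obs V T).pair ((obs V T).pair a a') ((obs V T).pair b b')
  have h1 : A.smashData.th ((obs V T).map (O.incl φ) a) ((obs V T).map (O.incl φ') a')
      ((obs V T).map (O.incl ψ) b) ((obs V T).map (O.incl ψ') b') =
      ((obs V T).map (incl4 O φ φ' ψ ψ') z : T ⟶ _) ≫ (theta A m n p m' n' p').hom.app :=
    congrArg (fun t : T ⟶ ((O.hom m n ⊗ O.hom m' n') ⊗ (O.hom n p ⊗ O.hom n' p')).Ob =>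
      t ≫ (theta A m n p m' n' p').hom.app) (map_incl4 φ φ' ψ ψ' a a' b b').symm
  have h2 : ((obs V T).map (incl4 O φ φ' ψ ψ') z : T ⟶ _) ≫ (theta A m n p m' n' p').hom.app =
      (z : T ⟶ _) ≫ (thetaTrans A φ φ' ψ ψ').app :=
    (Category.assoc _ _ _).trans (congrArg (fun t => (z : T ⟶ _) ≫ t)
      (ITrans.ob_desc (isCoprod4 O m n p m' n' p')
        (fun J => (thetaIso A J.1.1 J.1.2 J.2.1 J.2.2).hom) ((φ, φ'), (ψ, ψ'))))
  have h3 : (z : T ⟶ _) ≫ (thetaTrans A φ φ' ψ ψ').app = thetaPt (T := T) A φ φ' ψ ψ' z :=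
    (thetaPt_pre A φ φ' ψ ψ' (z : T ⟶ _) (𝟙 _)).trans
      (congrArg (fun z => thetaPt (T := T) A φ φ' ψ ψ' z) (Category.comp_id (z : T ⟶ _)))
  refine h1.trans (h2.trans (h3.trans ?_))
  unfold thetaPt
  simp only [z, (obs V T).map_fst, (obs V T).map_snd]
  rfl

end Theta
end ICat

/-! ### The operations of the category of operators on families -/

namespace ICat
open Stage

section ThCell
variable {V : Type u} [Category.{v} V] [CartesianMonoidalCategory V] [MonoidalClosed V]
  [HasLimits V] [HasColimits (ICat V)]
variable {O : Operad V} (A : O.PseudoCommutative) {T T' : V}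
  {X Y Z X' Y' Z' : Type} {m n p m' n' p' : ℕ}

/-- The 1-cell of the category of operators given by a family of labelled objects of the operad. -/
noncomputable def cell1 (v : X ≃ Fin m) (u : Y ≃ Fin n) (s : Span X Y)
    (c : ∀ b, Lab O (obs V T) (s.K b)) : Cell1 O.catOp.enr T m n := cell v u s c

/-- The 2-cell of the category of operators given by a family of labelled morphisms of the
operad. -/
noncomputable def cell2 (v : X ≃ Fin m) (u : Y ≃ Fin n) (s : Span X Y)
    (c : ∀ b, Lab O (mors V T) (s.K b)) : Cell2 O.catOp.enr T m n := cell v u s c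

theorem coord_tuple {F : Stage V} (φ : FHom m n) (c : ∀ j, F.obj (O.obj (φ.deg j))) (j : Fin n) :
    coord φ (F.tuple c) j = Lab.mk (Equiv.refl (Fin (φ.deg j))) (c j) :=
  congrArg (Lab.mk (Equiv.refl (Fin (φ.deg j)))) (F.map_π c j)

theorem mk_at_eqv {F : Stage V} {k : ℕ} {S : Type} [Finite S] (a : Fin k ≃ S) (x : Lab O F S) :
    Lab.Eqv a (Lab.mk (Equiv.refl (Fin k)) (x.at' a)) x :=
  Lab.ext_at (Equiv.refl (Fin k)) (by rw [Lab.mk_at_self, Lab.re_at]; rfl)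

theorem coord_eqv {F : Stage V} (v : X ≃ Fin m) (u : Y ≃ Fin n) (s : Span X Y)
    (c : ∀ b, Lab O F (s.K b)) (j : Fin n) :
    Lab.Eqv (s.num v u j) (coord (s.hom v u)
      (F.tuple fun j => (c (u.symm j)).at' (s.num v u j)) j) (c (u.symm j)) := by
  rw [coord_tuple]
  exact mk_at_eqv _ _

theorem num_leg (v : X ≃ Fin m) (u : Y ≃ Fin n) (s : Span X Y) (k : Fin n)
    (i : Fin ((s.hom v u).deg k)) : v.symm ((s.hom v u).fib k i) = s.leg _ (s.num v u k i) := by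
  rw [Equiv.symm_apply_eq, Span.leg_num]

theorem leg_cast (s : Span X Y) {b b' : Y} (h : b = b') (k : s.K b) :
    s.leg b' (Equiv.cast (congrArg s.K h) k) = s.leg b k := by
  subst h; rfl

theorem coord_eqv' {F : Stage V} (v : X ≃ Fin m) (u : Y ≃ Fin n) (s : Span X Y)
    (c : ∀ b, Lab O F (s.K b)) {j : Fin n} {b : Y} (h : u.symm j = b) :
    Lab.Eqv ((s.num v u j).trans (Equiv.cast (congrArg s.K h))) (coord (s.hom v u)
      (F.tuple fun j => (c (u.symm j)).at' (s.num v u j)) j) (c b) :=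
  (coord_eqv v u s c j).trans (Lab.Eqv.fam c h)

theorem th_cell (v : X ≃ Fin m) (u : Y ≃ Fin n) (w : Z ≃ Fin p) (v' : X' ≃ Fin m')
    (u' : Y' ≃ Fin n') (w' : Z' ≃ Fin p') (s : Span X Y) (t : Span Y Z) (s' : Span X' Y')
    (t' : Span Y' Z') (x : ∀ b, Lab O (obs V T) (s.K b)) (y : ∀ c, Lab O (obs V T) (t.K c))
    (x' : ∀ b, Lab O (obs V T) (s'.K b)) (y' : ∀ c, Lab O (obs V T) (t'.K c)) :
    A.smashData.th (cell1 v u s x) (cell1 v' u' s' x') (cell1 u w t y) (cell1 u' w' t' y') =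
      cell2 (lexNum v v') (lexNum w w') ((s.comp t).prod (s'.comp t')) fun c =>
        Lab.inter A (y c.1) (y' c.2) (fun k => x (t.leg c.1 k)) fun k => x' (t'.leg c.2 k) := by
  refine (th_ptF A (s.hom v u) (s'.hom v' u') (t.hom u w) (t'.hom u' w') _ _ _ _).trans ?_
  refine cell_congr (Equiv.prodCongr v.symm v'.symm) (Equiv.prodCongr w.symm w'.symm)
    (fun a => congrArg finProdFinEquiv (Prod.ext (v.apply_symm_apply _) (v'.apply_symm_apply _)))
    (fun b => congrArg finProdFinEquiv (Prod.ext (w.apply_symm_apply _) (w'.apply_symm_apply _)))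
    (fun c => Equiv.prodCongr
      (Equiv.sigmaCongr (t.num u w c.1) fun i => (s.num v u _).trans
        (Equiv.cast (congrArg s.K (num_leg u w t c.1 i))))
      (Equiv.sigmaCongr (t'.num u' w' c.2) fun i => (s'.num v' u' _).trans
        (Equiv.cast (congrArg s'.K (num_leg u' w' t' c.2 i))))) (fun c k => ?_) fun c => ?_
  · exact Prod.ext
      ((leg_cast s (num_leg u w t c.1 k.1.1) _).trans (num_leg v u s _ k.1.2).symm)
      ((leg_cast s' (num_leg u' w' t' c.2 k.2.1) _).trans (num_leg v' u' s' _ k.2.2).symm)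
  · exact Lab.Eqv.inter A (coord_eqv u w t y c.1) (coord_eqv u' w' t' y' c.2)
      (fun i => coord_eqv' v u s x (num_leg u w t c.1 i))
      fun i => coord_eqv' v' u' s' x' (num_leg u' w' t' c.2 i)

/-- Where the constraint of the product is an identity, so is its inverse. -/
theorem thInv_eq {a b b' c d d' : ℕ} (f₁ : Cell1 O.catOp.enr T a b) (f₂ : Cell1 O.catOp.enr T c d)
    (g₁ : Cell1 O.catOp.enr T b b') (g₂ : Cell1 O.catOp.enr T d d')
    (h : A.smashData.ThIsId f₁ f₂ g₁ g₂) : A.smashData.thInv f₁ f₂ g₁ g₂ =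
      one (A.smashData.sm1 (comp1 O.catOp.enr f₁ g₁) (comp1 O.catOp.enr f₂ g₂)) := by
  have h1 := (A.smashData.θ a b b' c d d').hom_inv
  have h2 : CompIs (V := V) (A.smashData.θ a b b' c d d').hom.app
      (A.smashData.θ a b b' c d d').inv.app _ := ⟨_, h1⟩
  have h3 := h2.pre (obPair (obPair f₁ f₂) (obPair g₁ g₂))
  obtain ⟨e, h4⟩ : ∃ e, CompIs (V := V) (A.smashData.th f₁ f₂ g₁ g₂) (A.smashData.thInv f₁ f₂ g₁ g₂)
      ((Stage.idm T).app e) := ⟨_, ICat.CompIs.congr h3 rfl rfl (Category.assoc _ _ _)⟩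
  unfold SmashData.ThIsId at h
  rw [h] at h4
  have h5 := h4.unique (CompIs.id_left (h4.mid.symm.trans tgt_idm))
  have h6 := src_idm.symm.trans (h4.src.trans src_idm)
  exact h5.symm.trans (congrArg (Stage.idm T).app h6)

section
variable (v : X ≃ Fin m) (u : Y ≃ Fin n) (w : Z ≃ Fin p) (v' : X' ≃ Fin m') (u' : Y' ≃ Fin n')
  (s : Span X Y) (t : Span Y Z) (s' : Span X' Y')

theorem comp1_cell (x : ∀ b, Lab O (obs V T) (s.K b)) (y : ∀ c, Lab O (obs V T) (t.K c)) :
    comp1 O.catOp.enr (cell1 v u s x) (cell1 u w t y) =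
      cell1 v w (s.comp t) fun c => Lab.gam (y c) fun k => x (t.leg c k) :=
  cell_comp s t x y

theorem comp2_cell (x : ∀ b, Lab O (mors V T) (s.K b)) (y : ∀ c, Lab O (mors V T) (t.K c)) :
    comp2 O.catOp.enr (cell2 v u s x) (cell2 u w t y) =
      cell2 v w (s.comp t) fun c => Lab.gam (y c) fun k => x (t.leg c k) :=
  cell_comp s t x y

theorem sm1_cell (x : ∀ b, Lab O (obs V T) (s.K b)) (y : ∀ c, Lab O (obs V T) (s'.K c)) :
    A.smashData.sm1 (cell1 v u s x) (cell1 v' u' s' y) =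
      cell1 (lexNum v v') (lexNum u u') (s.prod s') fun b => Lab.tens (x b.1) (y b.2) :=
  cell_smash s s' x y

theorem sm2_cell (x : ∀ b, Lab O (mors V T) (s.K b)) (y : ∀ c, Lab O (mors V T) (s'.K c)) :
    A.smashData.sm2 (cell2 v u s x) (cell2 v' u' s' y) =
      cell2 (lexNum v v') (lexNum u u') (s.prod s') fun b => Lab.tens (x b.1) (y b.2) :=
  cell_smash s s' x y

theorem one_cell (x : ∀ b, Lab O (obs V T) (s.K b)) :
    one (cell1 v u s x) = cell2 v u s fun b => (x b).one := app_cell (Stage.idm T) v u s x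

theorem cast1_cell {a b : ℕ} (h : m = a) (h' : n = b) (x : ∀ b, Lab O (obs V T) (s.K b)) :
    cast1 O.catOp.enr h h' (cell1 v u s x) =
      cell1 (v.trans (finCongr h)) (u.trans (finCongr h')) s x := cell_cast h h' v u s x

theorem cast2_cell {a b : ℕ} (h : m = a) (h' : n = b) (x : ∀ b, Lab O (mors V T) (s.K b)) :
    cast2 O.catOp.enr h h' (cell2 v u s x) =
      cell2 (v.trans (finCongr h)) (u.trans (finCongr h')) s x := cell_cast h h' v u s x

theorem id1_cell (v : X ≃ Fin m) : id1 O.catOp.enr T m = cell1 v v (Span.id X) fun _ => Lab.unit :=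
  cell_id (F := obs V T) v

theorem constCell_tau (v : X ≃ Fin m) (v' : Y ≃ Fin p) :
    constCell O.catOp.enr T (O.lowPt (𝟙_ (ICat V)) (PHom.tau m p)) =
      cell1 (lexNum v v') (lexNum v' v) (Span.ofEquiv (Equiv.prodComm X Y)) fun _ => Lab.unit :=
  cell_tau (F := obs V T) v v'

theorem constCell_pt (v : X ≃ Fin m) (u : Y ≃ Fin n) :
    ∃ c, constCell O.catOp.enr T (O.catOp.based.pt m n) = cell1 v u (Span.zero X Y) c := by
  exact ⟨fun b => Lab.mk (Equiv.equivOfIsEmpty (Fin 0) Empty) ((obs V T).map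
    (O.reduced.from _) (obs V T).star), cell_zero (F := obs V T) v u _⟩

theorem cell2_eq_zero {s : Span X Y} (c : ∀ b, Lab O (mors V T) (s.K b))
    (h : ∀ b, IsEmpty (s.K b)) : cell2 v u s c =
      one (constCell O.catOp.enr T (O.catOp.based.pt m n)) :=
  (cell_eq_zero (F := mors V T) h).trans (((Stage.idm T).nat (O.catOp.based.pt m n)
    (obs V T).star).trans (congrArg _ ((mors V T).star_eq _))).symm

end

theorem constCell_lowPt (φ : PHom m n) : ∃ c, (∀ b, Lab.IsLow (c b)) ∧
    constCell O.catOp.enr T (O.lowPt (𝟙_ (ICat V)) φ) =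
      cell1 (Equiv.refl _) (Equiv.refl _) (Span.ofHom φ.1) c := lowPt_eq (F := obs V T) φ

/-- Morphisms from a summand. -/
theorem ob_incl (φ : FHom m n) (a : T ⟶ (O.summand φ).Ob) :
    (a ≫ ob (O.incl φ) : Cell1 O.catOp.enr T m n) =
      cell1 (Equiv.refl _) (Equiv.refl _) (Span.ofHom φ) (coord (F := obs V T) φ a) :=
  map_incl (F := obs V T) φ a

section Pre
variable {K : Type w} {E : EnrichedCategory (ICat V) K} (k : T' ⟶ T) {a b c d : K}

theorem pre_comp1 (f : Cell1 E T a b) (g : Cell1 E T b c) :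
    comp1 E (k ≫ f) (k ≫ g) = k ≫ comp1 E f g :=
  (congrArg ((obs V T').map (E.comp a b c)) ((preOb k).pair f g).symm).trans
    ((preOb k).nat (E.comp a b c) ((obs V T).pair f g)).symm

theorem pre_comp2 (f : Cell2 E T a b) (g : Cell2 E T b c) :
    comp2 E (k ≫ f) (k ≫ g) = k ≫ comp2 E f g :=
  (congrArg ((mors V T').map (E.comp a b c)) ((preMor k).pair f g).symm).trans
    ((preMor k).nat (E.comp a b c) ((mors V T).pair f g)).symm

theorem pre_one (f : Cell1 E T a b) : one (k ≫ f) = k ≫ one f := Category.assoc _ _ _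

theorem pre_cast2 {a' b' : K} (h : a = a') (h' : b = b') (f : Cell2 E T a b) :
    cast2 E h h' (k ≫ f) = k ≫ cast2 E h h' f := Category.assoc _ _ _

theorem pre_constCell (x : 𝟙_ (ICat V) ⟶ E.Hom a b) :
    constCell E T' x = k ≫ constCell E T x :=
  (congrArg ((obs V T').map x) ((obs V T').star_eq _).symm).trans
    ((preOb k).nat x (obs V T).star).symm

theorem pre_id1 : id1 E T' a = k ≫ id1 E T a := pre_constCell k _

variable [Mul K] {S : SmashData E}

theorem pre_sm1 (f : Cell1 E T a b) (g : Cell1 E T c d) :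
    S.sm1 (k ≫ f) (k ≫ g) = k ≫ S.sm1 f g :=
  (congrArg ((obs V T').map (S.map a b c d)) ((preOb k).pair f g).symm).trans
    ((preOb k).nat (S.map a b c d) ((obs V T).pair f g)).symm

theorem pre_sm2 (f : Cell2 E T a b) (g : Cell2 E T c d) :
    S.sm2 (k ≫ f) (k ≫ g) = k ≫ S.sm2 f g :=
  (congrArg ((mors V T').map (S.map a b c d)) ((preMor k).pair f g).symm).trans
    ((preMor k).nat (S.map a b c d) ((mors V T).pair f g)).symm

theorem pre_obPair {C D : ICat V} (f : T ⟶ C.Ob) (g : T ⟶ D.Ob) :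
    obPair (k ≫ f) (k ≫ g) = k ≫ obPair f g := ((preOb k).pair (C := C) (D := D) f g).symm

theorem pre_th {b' d' : K} (f₁ : Cell1 E T a b) (f₂ : Cell1 E T c d) (g₁ : Cell1 E T b b')
    (g₂ : Cell1 E T d d') :
    S.th (k ≫ f₁) (k ≫ f₂) (k ≫ g₁) (k ≫ g₂) = k ≫ S.th f₁ f₂ g₁ g₂ := by
  unfold SmashData.th
  rw [pre_obPair, pre_obPair, pre_obPair, Category.assoc]

variable (R : S.SymmetryData)

theorem pre_t1 : R.t1 T' a b = k ≫ R.t1 T a b := pre_constCell k _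

theorem pre_tauHat (f : Cell1 E T a b) (g : Cell1 E T c d) :
    R.th (k ≫ f) (k ≫ g) = k ≫ R.th f g := by
  unfold SmashData.SymmetryData.th
  rw [pre_obPair, Category.assoc]

end Pre
end ThCell
end ICat

namespace ICat
open Stage

section Local
variable {V : Type u} [Category.{v} V] [CartesianMonoidalCategory V] [MonoidalClosed V]
  [HasLimits V]
variable {C S₁ S₂ S₃ S₄ : ICat V} {J₁ J₂ J₃ J₄ : Type w}
  {B₁ : J₁ → ICat V} {B₂ : J₂ → ICat V} {B₃ : J₃ → ICat V} {B₄ : J₄ → ICat V}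
  {i₁ : ∀ j, B₁ j ⟶ S₁} {i₂ : ∀ j, B₂ j ⟶ S₂} {i₃ : ∀ j, B₃ j ⟶ S₃} {i₄ : ∀ j, B₄ j ⟶ S₄}
  {T : V}

theorem map_fst_tensor {F : Stage V} {C D C' D' : ICat V} (f : C ⟶ C') (g : D ⟶ D')
    (a : F.obj (C ⊗ D)) : F.map (fst C' D') (F.map (f ⊗ₘ g) a) = F.map f (F.map (fst C D) a) := by
  rw [← F.map_comp, ← F.map_comp, tensorHom_fst]

theorem map_snd_tensor {F : Stage V} {C D C' D' : ICat V} (f : C ⟶ C') (g : D ⟶ D')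
    (a : F.obj (C ⊗ D)) : F.map (snd C' D') (F.map (f ⊗ₘ g) a) = F.map g (F.map (snd C D) a) := by
  rw [← F.map_comp, ← F.map_comp, tensorHom_snd]

/-- Equality of pastings may be checked on summands, in two variables. -/
theorem IsCoprod.local2 (h₁ : IsCoprod i₁) (h₂ : IsCoprod i₂)
    {L L' : ∀ {T : V}, (T ⟶ S₁.Ob) → (T ⟶ S₂.Ob) → List (T ⟶ C.Mor)}
    (hL : ∀ {T T' : V} (k : T' ⟶ T) (x : T ⟶ S₁.Ob) (y : T ⟶ S₂.Ob),
      L (k ≫ x) (k ≫ y) = (L x y).map (k ≫ ·) ∧ L x y ≠ [])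
    (hL' : ∀ {T T' : V} (k : T' ⟶ T) (x : T ⟶ S₁.Ob) (y : T ⟶ S₂.Ob),
      L' (k ≫ x) (k ≫ y) = (L' x y).map (k ≫ ·) ∧ L' x y ≠ [])
    (h : ∀ (T : V) (j₁ j₂) (x : T ⟶ (B₁ j₁).Ob) (y : T ⟶ (B₂ j₂).Ob), SamePasting C
      (L (x ≫ ob (i₁ j₁)) (y ≫ ob (i₂ j₂))) (L' (x ≫ ob (i₁ j₁)) (y ≫ ob (i₂ j₂))))
    (x : T ⟶ S₁.Ob) (y : T ⟶ S₂.Ob) : SamePasting C (L x y) (L' x y) := by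
  have loc (L : ∀ {T : V}, (T ⟶ S₁.Ob) → (T ⟶ S₂.Ob) → List (T ⟶ C.Mor))
      (hL : ∀ {T T' : V} (k : T' ⟶ T) (x : T ⟶ S₁.Ob) (y : T ⟶ S₂.Ob),
        L (k ≫ x) (k ≫ y) = (L x y).map (k ≫ ·) ∧ L x y ≠ []) :
      Local (S₁ ⊗ S₂) C fun {T} z => L ((obs V T).map (fst _ _) z) ((obs V T).map (snd _ _) z) :=
    ⟨fun {T T'} k z => (congrArg₂ (fun a b => L a b) ((preOb k).nat _ z).symm
      ((preOb k).nat _ z).symm).trans (hL k _ _).1, fun {T} z => (hL (𝟙 T) _ _).2⟩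
  have := (h₁.tensor h₂).local1 (loc L hL) (loc L' hL') (fun T j a => by
    refine (congrArg₂ (fun x y => SamePasting C (L x y) (L' x y))
      (map_fst_tensor (F := obs V T) _ _ a) (map_snd_tensor (F := obs V T) _ _ a)).mpr ?_
    exact h T j.1 j.2 _ _) (obPair x y)
  exact (congrArg₂ (fun x y => SamePasting C (L x y) (L' x y)) ((obs V T).map_fst x y)
    ((obs V T).map_snd x y)).mp this

theorem IsCoprod.local3 (h₁ : IsCoprod i₁) (h₂ : IsCoprod i₂) (h₃ : IsCoprod i₃)
    {L L' : ∀ {T : V}, (T ⟶ S₁.Ob) → (T ⟶ S₂.Ob) → (T ⟶ S₃.Ob) → List (T ⟶ C.Mor)}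
    (hL : ∀ {T T' : V} (k : T' ⟶ T) (x : T ⟶ S₁.Ob) (y : T ⟶ S₂.Ob) (z : T ⟶ S₃.Ob),
      L (k ≫ x) (k ≫ y) (k ≫ z) = (L x y z).map (k ≫ ·) ∧ L x y z ≠ [])
    (hL' : ∀ {T T' : V} (k : T' ⟶ T) (x : T ⟶ S₁.Ob) (y : T ⟶ S₂.Ob) (z : T ⟶ S₃.Ob),
      L' (k ≫ x) (k ≫ y) (k ≫ z) = (L' x y z).map (k ≫ ·) ∧ L' x y z ≠ [])
    (h : ∀ (T : V) (j₁ j₂ j₃) (x : T ⟶ (B₁ j₁).Ob) (y : T ⟶ (B₂ j₂).Ob) (z : T ⟶ (B₃ j₃).Ob),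
      SamePasting C (L (x ≫ ob (i₁ j₁)) (y ≫ ob (i₂ j₂)) (z ≫ ob (i₃ j₃)))
        (L' (x ≫ ob (i₁ j₁)) (y ≫ ob (i₂ j₂)) (z ≫ ob (i₃ j₃))))
    (x : T ⟶ S₁.Ob) (y : T ⟶ S₂.Ob) (z : T ⟶ S₃.Ob) : SamePasting C (L x y z) (L' x y z) := by
  have := h₁.local2 (h₂.tensor h₃)
    (L := fun {T} x z => L x ((obs V T).map (fst _ _) z) ((obs V T).map (snd _ _) z))
    (L' := fun {T} x z => L' x ((obs V T).map (fst _ _) z) ((obs V T).map (snd _ _) z))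
    (fun {T T'} k x z => ⟨(congrArg₂ (fun a b => L (k ≫ x) a b) ((preOb k).nat _ z).symm
      ((preOb k).nat _ z).symm).trans (hL k _ _ _).1, (hL k _ _ _).2⟩)
    (fun {T T'} k x z => ⟨(congrArg₂ (fun a b => L' (k ≫ x) a b) ((preOb k).nat _ z).symm
      ((preOb k).nat _ z).symm).trans (hL' k _ _ _).1, (hL' k _ _ _).2⟩)
    (fun T j₁ j x a => (congrArg₂ (fun y z => SamePasting C (L (x ≫ ob (i₁ j₁)) y z)
      (L' (x ≫ ob (i₁ j₁)) y z))
        (map_fst_tensor (F := obs V T) _ _ a) (map_snd_tensor (F := obs V T) _ _ a)).mpr (h T j₁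
            j.1 j.2 _ _ _)) x (obPair y z)
  exact (congrArg₂ (fun y z => SamePasting C (L x y z) (L' x y z)) ((obs V T).map_fst y z)
    ((obs V T).map_snd y z)).mp this

theorem IsCoprod.local4 (h₁ : IsCoprod i₁) (h₂ : IsCoprod i₂) (h₃ : IsCoprod i₃)
    (h₄ : IsCoprod i₄)
    {L L' : ∀ {T : V}, (T ⟶ S₁.Ob) → (T ⟶ S₂.Ob) → (T ⟶ S₃.Ob) → (T ⟶ S₄.Ob) →
      List (T ⟶ C.Mor)}
    (hL : ∀ {T T' : V} (k : T' ⟶ T) (x : T ⟶ S₁.Ob) (y : T ⟶ S₂.Ob) (z : T ⟶ S₃.Ob)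
      (t : T ⟶ S₄.Ob), L (k ≫ x) (k ≫ y) (k ≫ z) (k ≫ t) = (L x y z t).map (k ≫ ·) ∧
        L x y z t ≠ [])
    (hL' : ∀ {T T' : V} (k : T' ⟶ T) (x : T ⟶ S₁.Ob) (y : T ⟶ S₂.Ob) (z : T ⟶ S₃.Ob)
      (t : T ⟶ S₄.Ob), L' (k ≫ x) (k ≫ y) (k ≫ z) (k ≫ t) = (L' x y z t).map (k ≫ ·) ∧
        L' x y z t ≠ [])
    (h : ∀ (T : V) (j₁ j₂ j₃ j₄) (x : T ⟶ (B₁ j₁).Ob) (y : T ⟶ (B₂ j₂).Ob)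
      (z : T ⟶ (B₃ j₃).Ob) (t : T ⟶ (B₄ j₄).Ob), SamePasting C
        (L (x ≫ ob (i₁ j₁)) (y ≫ ob (i₂ j₂)) (z ≫ ob (i₃ j₃)) (t ≫ ob (i₄ j₄)))
        (L' (x ≫ ob (i₁ j₁)) (y ≫ ob (i₂ j₂)) (z ≫ ob (i₃ j₃)) (t ≫ ob (i₄ j₄))))
    (x : T ⟶ S₁.Ob) (y : T ⟶ S₂.Ob) (z : T ⟶ S₃.Ob) (t : T ⟶ S₄.Ob) :
    SamePasting C (L x y z t) (L' x y z t) := by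
  have := h₁.local3 h₂ (h₃.tensor h₄)
    (L := fun {T} x y z => L x y ((obs V T).map (fst _ _) z) ((obs V T).map (snd _ _) z))
    (L' := fun {T} x y z => L' x y ((obs V T).map (fst _ _) z) ((obs V T).map (snd _ _) z))
    (fun {T T'} k x y z => ⟨(congrArg₂ (fun a b => L (k ≫ x) (k ≫ y) a b) ((preOb k).nat _ z).symm
      ((preOb k).nat _ z).symm).trans (hL k _ _ _ _).1, (hL k _ _ _ _).2⟩)
    (fun {T T'} k x y z => ⟨(congrArg₂ (fun a b => L' (k ≫ x) (k ≫ y) a b)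
      ((preOb k).nat _ z).symm ((preOb k).nat _ z).symm).trans (hL' k _ _ _ _).1,
      (hL' k _ _ _ _).2⟩)
    (fun T j₁ j₂ j x y a => (congrArg₂ (fun z t => SamePasting C
      (L (x ≫ ob (i₁ j₁)) (y ≫ ob (i₂ j₂)) z t)
      (L' (x ≫ ob (i₁ j₁)) (y ≫ ob (i₂ j₂)) z t))
        (map_fst_tensor (F := obs V T) _ _ a) (map_snd_tensor (F := obs V T) _ _ a)).mpr
        (h T j₁ j₂ j.1 j.2 _ _ _ _)) x y (obPair z t)
  exact (congrArg₂ (fun z t => SamePasting C (L x y z t) (L' x y z t)) ((obs V T).map_fst z t)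
    ((obs V T).map_snd z t)).mp this

theorem IsCoprod.local6 {S₅ S₆ : ICat V} {J₅ J₆ : Type w} {B₅ : J₅ → ICat V} {B₆ : J₆ → ICat V}
    {i₅ : ∀ j, B₅ j ⟶ S₅} {i₆ : ∀ j, B₆ j ⟶ S₆} (h₁ : IsCoprod i₁) (h₂ : IsCoprod i₂)
    (h₃ : IsCoprod i₃) (h₄ : IsCoprod i₄) (h₅ : IsCoprod i₅) (h₆ : IsCoprod i₆)
    {L L' : ∀ {T : V}, (T ⟶ S₁.Ob) → (T ⟶ S₂.Ob) → (T ⟶ S₃.Ob) → (T ⟶ S₄.Ob) →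
      (T ⟶ S₅.Ob) → (T ⟶ S₆.Ob) → List (T ⟶ C.Mor)}
    (hL : ∀ {T T' : V} (k : T' ⟶ T) (x : T ⟶ S₁.Ob) (y : T ⟶ S₂.Ob) (z : T ⟶ S₃.Ob)
      (t : T ⟶ S₄.Ob) (u : T ⟶ S₅.Ob) (v : T ⟶ S₆.Ob),
      L (k ≫ x) (k ≫ y) (k ≫ z) (k ≫ t) (k ≫ u) (k ≫ v) = (L x y z t u v).map (k ≫ ·) ∧
        L x y z t u v ≠ [])
    (hL' : ∀ {T T' : V} (k : T' ⟶ T) (x : T ⟶ S₁.Ob) (y : T ⟶ S₂.Ob) (z : T ⟶ S₃.Ob)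
      (t : T ⟶ S₄.Ob) (u : T ⟶ S₅.Ob) (v : T ⟶ S₆.Ob),
      L' (k ≫ x) (k ≫ y) (k ≫ z) (k ≫ t) (k ≫ u) (k ≫ v) = (L' x y z t u v).map (k ≫ ·) ∧
        L' x y z t u v ≠ [])
    (h : ∀ (T : V) (j₁ j₂ j₃ j₄ j₅ j₆) (x : T ⟶ (B₁ j₁).Ob) (y : T ⟶ (B₂ j₂).Ob)
      (z : T ⟶ (B₃ j₃).Ob) (t : T ⟶ (B₄ j₄).Ob) (u : T ⟶ (B₅ j₅).Ob) (v : T ⟶ (B₆ j₆).Ob),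
      SamePasting C
        (L (x ≫ ob (i₁ j₁)) (y ≫ ob (i₂ j₂)) (z ≫ ob (i₃ j₃)) (t ≫ ob (i₄ j₄)) (u ≫ ob (i₅ j₅))
          (v ≫ ob (i₆ j₆)))
        (L' (x ≫ ob (i₁ j₁)) (y ≫ ob (i₂ j₂)) (z ≫ ob (i₃ j₃)) (t ≫ ob (i₄ j₄)) (u ≫ ob (i₅ j₅))
          (v ≫ ob (i₆ j₆))))
    (x : T ⟶ S₁.Ob) (y : T ⟶ S₂.Ob) (z : T ⟶ S₃.Ob) (t : T ⟶ S₄.Ob) (u : T ⟶ S₅.Ob)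
    (v : T ⟶ S₆.Ob) : SamePasting C (L x y z t u v) (L' x y z t u v) := by
  have := h₁.local4 h₂ (h₃.tensor h₄) (h₅.tensor h₆)
    (L := fun {T} x y z u => L x y ((obs V T).map (fst _ _) z) ((obs V T).map (snd _ _) z)
      ((obs V T).map (fst _ _) u) ((obs V T).map (snd _ _) u))
    (L' := fun {T} x y z u => L' x y ((obs V T).map (fst _ _) z) ((obs V T).map (snd _ _) z)
      ((obs V T).map (fst _ _) u) ((obs V T).map (snd _ _) u))
    (fun {T T'} k x y z u => by
      refine ⟨Eq.trans ?_ (hL k _ _ _ _ _ _).1, (hL k _ _ _ _ _ _).2⟩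
      exact congr (congr (congrArg₂ (fun a b => L (k ≫ x) (k ≫ y) a b) ((preOb k).nat _ z).symm
        ((preOb k).nat _ z).symm) ((preOb k).nat _ u).symm) ((preOb k).nat _ u).symm)
    (fun {T T'} k x y z u => by
      refine ⟨Eq.trans ?_ (hL' k _ _ _ _ _ _).1, (hL' k _ _ _ _ _ _).2⟩
      exact congr (congr (congrArg₂ (fun a b => L' (k ≫ x) (k ≫ y) a b) ((preOb k).nat _ z).symm
        ((preOb k).nat _ z).symm) ((preOb k).nat _ u).symm) ((preOb k).nat _ u).symm)
    (fun T j₁ j₂ j j' x y a b => by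
      have e (L : ∀ {T : V}, (T ⟶ S₁.Ob) → (T ⟶ S₂.Ob) → (T ⟶ S₃.Ob) → (T ⟶ S₄.Ob) →
          (T ⟶ S₅.Ob) → (T ⟶ S₆.Ob) → List (T ⟶ C.Mor)) :=
        congr (congr (congrArg₂ (fun z t => L (x ≫ ob (i₁ j₁)) (y ≫ ob (i₂ j₂)) z t)
          (map_fst_tensor (F := obs V T) (i₃ j.1) (i₄ j.2) a)
          (map_snd_tensor (F := obs V T) (i₃ j.1) (i₄ j.2) a))
          (map_fst_tensor (F := obs V T) (i₅ j'.1) (i₆ j'.2) b))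
          (map_snd_tensor (F := obs V T) (i₅ j'.1) (i₆ j'.2) b)
      exact (congrArg₂ (SamePasting C) (e L) (e L')).mpr
        (h T j₁ j₂ j.1 j.2 j'.1 j'.2 _ _ _ _ _ _)) x y (obPair z t) (obPair u v)
  have e (L : ∀ {T : V}, (T ⟶ S₁.Ob) → (T ⟶ S₂.Ob) → (T ⟶ S₃.Ob) → (T ⟶ S₄.Ob) →
      (T ⟶ S₅.Ob) → (T ⟶ S₆.Ob) → List (T ⟶ C.Mor)) :=
    congr (congr (congrArg₂ (fun z t => L x y z t) ((obs V T).map_fst z t)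
      ((obs V T).map_snd z t)) ((obs V T).map_fst u v)) ((obs V T).map_snd u v)
  exact (congrArg₂ (SamePasting C) (e L) (e L')).mp this

end Local

/-! ### Reduction to families of labelled objects -/

section LocalCells
variable {V : Type u} [Category.{v} V] [CartesianMonoidalCategory V] [MonoidalClosed V]
  [HasLimits V] [HasColimits (ICat V)]
variable {O : Operad V} {C : ICat V} {T : V}
  {m₁ n₁ m₂ n₂ m₃ n₃ m₄ n₄ m₅ n₅ m₆ n₆ : ℕ}

/-- The 1-cell given by a span of standard finite sets. -/
noncomputable abbrev stdCell {m n : ℕ} (s : Span (Fin m) (Fin n))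
    (x : ∀ b, Lab O (obs V T) (s.K b)) : Cell1 O.catOp.enr T m n :=
  cell1 (Equiv.refl _) (Equiv.refl _) s x

/-- A 1-cell in the summand indexed by `φ`. -/
noncomputable def inclCell {m n : ℕ} (φ : FHom m n) (a : T ⟶ (O.summand φ).Ob) :
    Cell1 O.catOp.enr T m n := a ≫ ob (O.incl φ)

theorem inclCell_eq {m n : ℕ} (φ : FHom m n) (a : T ⟶ (O.summand φ).Ob) :
    inclCell φ a = stdCell (Span.ofHom φ) (coord (F := obs V T) φ a) := ob_incl φ a

/-- Equality of natural pastings may be checked on the 1-cells given by families of labelled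
objects, which need only be done for spans of standard finite sets. -/
theorem same_cells1
    {L L' : ∀ {T : V}, Cell1 O.catOp.enr T m₁ n₁ → List (T ⟶ C.Mor)}
    (hL : ∀ {T T' : V} (k : T' ⟶ T) (x : Cell1 O.catOp.enr T m₁ n₁),
      L (k ≫ x) = (L x).map (k ≫ ·) ∧ L x ≠ [])
    (hL' : ∀ {T T' : V} (k : T' ⟶ T) (x : Cell1 O.catOp.enr T m₁ n₁),
      L' (k ≫ x) = (L' x).map (k ≫ ·) ∧ L' x ≠ [])
    (h : ∀ (T : V) (s₁ : Span (Fin m₁) (Fin n₁)) (x : ∀ b, Lab O (obs V T) (s₁.K b)),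
        SamePasting C (L (stdCell s₁ x)) (L' (stdCell s₁ x)))
    (x : Cell1 O.catOp.enr T m₁ n₁) : SamePasting C (L x) (L' x) :=
  (O.isCoprod_hom m₁ n₁).local1 (L := L) (L' := L') ⟨fun k x => (hL k x).1, fun x => (hL (𝟙 _) x).2⟩
    ⟨fun k x => (hL' k x).1, fun x => (hL' (𝟙 _) x).2⟩
    (fun T φ a => by
      change SamePasting C (L (inclCell φ a))
        (L' (inclCell φ a))
      rw [inclCell_eq]
      exact h T _ _) x

theorem same_cells2
    {L L' : ∀ {T : V}, Cell1 O.catOp.enr T m₁ n₁ → Cell1 O.catOp.enr T m₂ n₂ → List (T ⟶ C.Mor)}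
    (hL : ∀ {T T' : V} (k : T' ⟶ T) (x : Cell1 O.catOp.enr T m₁ n₁)
      (y : Cell1 O.catOp.enr T m₂ n₂), L (k ≫ x) (k ≫ y) = (L x y).map (k ≫ ·) ∧ L x y ≠ [])
    (hL' : ∀ {T T' : V} (k : T' ⟶ T) (x : Cell1 O.catOp.enr T m₁ n₁)
      (y : Cell1 O.catOp.enr T m₂ n₂), L' (k ≫ x) (k ≫ y) = (L' x y).map (k ≫ ·) ∧ L' x y ≠ [])
    (h : ∀ (T : V) (s₁ : Span (Fin m₁) (Fin n₁)) (s₂ : Span (Fin m₂) (Fin n₂))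
      (x : ∀ b, Lab O (obs V T) (s₁.K b)) (y : ∀ b, Lab O (obs V T) (s₂.K b)),
        SamePasting C (L (stdCell s₁ x) (stdCell s₂ y)) (L' (stdCell s₁ x) (stdCell s₂ y)))
    (x : Cell1 O.catOp.enr T m₁ n₁) (y : Cell1 O.catOp.enr T m₂ n₂) :
    SamePasting C (L x y) (L' x y) :=
  (O.isCoprod_hom m₁ n₁).local2 (O.isCoprod_hom m₂ n₂) (L := L) (L' := L') hL hL'
    (fun T φ ψ a b => by
      change SamePasting C (L (inclCell φ a) (inclCell ψ b))
        (L' (inclCell φ a) (inclCell ψ b))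
      rw [inclCell_eq, inclCell_eq]
      exact h T _ _ _ _) x y

theorem same_cells3
    {L L' : ∀ {T : V}, Cell1 O.catOp.enr T m₁ n₁ → Cell1 O.catOp.enr T m₂ n₂ →
      Cell1 O.catOp.enr T m₃ n₃ → List (T ⟶ C.Mor)}
    (hL : ∀ {T T' : V} (k : T' ⟶ T) (x : Cell1 O.catOp.enr T m₁ n₁)
      (y : Cell1 O.catOp.enr T m₂ n₂) (z : Cell1 O.catOp.enr T m₃ n₃),
      L (k ≫ x) (k ≫ y) (k ≫ z) = (L x y z).map (k ≫ ·) ∧ L x y z ≠ [])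
    (hL' : ∀ {T T' : V} (k : T' ⟶ T) (x : Cell1 O.catOp.enr T m₁ n₁)
      (y : Cell1 O.catOp.enr T m₂ n₂) (z : Cell1 O.catOp.enr T m₃ n₃),
      L' (k ≫ x) (k ≫ y) (k ≫ z) = (L' x y z).map (k ≫ ·) ∧ L' x y z ≠ [])
    (h : ∀ (T : V) (s₁ : Span (Fin m₁) (Fin n₁)) (s₂ : Span (Fin m₂) (Fin n₂))
      (s₃ : Span (Fin m₃) (Fin n₃))
      (x : ∀ b, Lab O (obs V T) (s₁.K b)) (y : ∀ b, Lab O (obs V T) (s₂.K b))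
      (z : ∀ b, Lab O (obs V T) (s₃.K b)), SamePasting C
        (L (stdCell s₁ x) (stdCell s₂ y) (stdCell s₃ z))
        (L' (stdCell s₁ x) (stdCell s₂ y) (stdCell s₃ z)))
    (x : Cell1 O.catOp.enr T m₁ n₁) (y : Cell1 O.catOp.enr T m₂ n₂)
    (z : Cell1 O.catOp.enr T m₃ n₃) : SamePasting C (L x y z) (L' x y z) :=
  (O.isCoprod_hom m₁ n₁).local3 (O.isCoprod_hom m₂ n₂) (O.isCoprod_hom m₃ n₃) (L := L) (L' := L')
    hL hL' (fun T φ ψ χ a b c => by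
      change SamePasting C (L (inclCell φ a) (inclCell ψ b) (inclCell χ c))
        (L' (inclCell φ a) (inclCell ψ b) (inclCell χ c))
      rw [inclCell_eq, inclCell_eq, inclCell_eq]
      exact h T _ _ _ _ _ _) x y z

theorem same_cells4
    {L L' : ∀ {T : V}, Cell1 O.catOp.enr T m₁ n₁ → Cell1 O.catOp.enr T m₂ n₂ →
      Cell1 O.catOp.enr T m₃ n₃ → Cell1 O.catOp.enr T m₄ n₄ → List (T ⟶ C.Mor)}
    (hL : ∀ {T T' : V} (k : T' ⟶ T) (x : Cell1 O.catOp.enr T m₁ n₁)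
      (y : Cell1 O.catOp.enr T m₂ n₂) (z : Cell1 O.catOp.enr T m₃ n₃)
      (t : Cell1 O.catOp.enr T m₄ n₄),
      L (k ≫ x) (k ≫ y) (k ≫ z) (k ≫ t) = (L x y z t).map (k ≫ ·) ∧ L x y z t ≠ [])
    (hL' : ∀ {T T' : V} (k : T' ⟶ T) (x : Cell1 O.catOp.enr T m₁ n₁)
      (y : Cell1 O.catOp.enr T m₂ n₂) (z : Cell1 O.catOp.enr T m₃ n₃)
      (t : Cell1 O.catOp.enr T m₄ n₄),
      L' (k ≫ x) (k ≫ y) (k ≫ z) (k ≫ t) = (L' x y z t).map (k ≫ ·) ∧ L' x y z t ≠ [])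
    (h : ∀ (T : V) (s₁ : Span (Fin m₁) (Fin n₁)) (s₂ : Span (Fin m₂) (Fin n₂))
      (s₃ : Span (Fin m₃) (Fin n₃)) (s₄ : Span (Fin m₄) (Fin n₄))
      (x : ∀ b, Lab O (obs V T) (s₁.K b)) (y : ∀ b, Lab O (obs V T) (s₂.K b))
      (z : ∀ b, Lab O (obs V T) (s₃.K b)) (t : ∀ b, Lab O (obs V T) (s₄.K b)), SamePasting C
        (L (stdCell s₁ x) (stdCell s₂ y) (stdCell s₃ z) (stdCell s₄ t))
        (L' (stdCell s₁ x) (stdCell s₂ y) (stdCell s₃ z) (stdCell s₄ t)))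
    (x : Cell1 O.catOp.enr T m₁ n₁) (y : Cell1 O.catOp.enr T m₂ n₂)
    (z : Cell1 O.catOp.enr T m₃ n₃) (t : Cell1 O.catOp.enr T m₄ n₄) :
    SamePasting C (L x y z t) (L' x y z t) :=
  (O.isCoprod_hom m₁ n₁).local4 (O.isCoprod_hom m₂ n₂) (O.isCoprod_hom m₃ n₃)
    (O.isCoprod_hom m₄ n₄) (L := L) (L' := L') hL hL' (fun T φ ψ χ ω a b c d => by
      change SamePasting C (L (inclCell φ a) (inclCell ψ b) (inclCell χ c) (inclCell ω d))
        (L' (inclCell φ a) (inclCell ψ b) (inclCell χ c) (inclCell ω d))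
      rw [inclCell_eq, inclCell_eq, inclCell_eq, inclCell_eq]
      exact h T _ _ _ _ _ _ _ _) x y z t

theorem same_cells6
    {L L' : ∀ {T : V}, Cell1 O.catOp.enr T m₁ n₁ → Cell1 O.catOp.enr T m₂ n₂ →
      Cell1 O.catOp.enr T m₃ n₃ → Cell1 O.catOp.enr T m₄ n₄ → Cell1 O.catOp.enr T m₅ n₅ →
      Cell1 O.catOp.enr T m₆ n₆ → List (T ⟶ C.Mor)}
    (hL : ∀ {T T' : V} (k : T' ⟶ T) (x : Cell1 O.catOp.enr T m₁ n₁)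
      (y : Cell1 O.catOp.enr T m₂ n₂) (z : Cell1 O.catOp.enr T m₃ n₃)
      (t : Cell1 O.catOp.enr T m₄ n₄) (u : Cell1 O.catOp.enr T m₅ n₅)
      (v : Cell1 O.catOp.enr T m₆ n₆),
      L (k ≫ x) (k ≫ y) (k ≫ z) (k ≫ t) (k ≫ u) (k ≫ v) = (L x y z t u v).map (k ≫ ·) ∧
        L x y z t u v ≠ [])
    (hL' : ∀ {T T' : V} (k : T' ⟶ T) (x : Cell1 O.catOp.enr T m₁ n₁)
      (y : Cell1 O.catOp.enr T m₂ n₂) (z : Cell1 O.catOp.enr T m₃ n₃)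
      (t : Cell1 O.catOp.enr T m₄ n₄) (u : Cell1 O.catOp.enr T m₅ n₅)
      (v : Cell1 O.catOp.enr T m₆ n₆),
      L' (k ≫ x) (k ≫ y) (k ≫ z) (k ≫ t) (k ≫ u) (k ≫ v) = (L' x y z t u v).map (k ≫ ·) ∧
        L' x y z t u v ≠ [])
    (h : ∀ (T : V) (s₁ : Span (Fin m₁) (Fin n₁)) (s₂ : Span (Fin m₂) (Fin n₂))
      (s₃ : Span (Fin m₃) (Fin n₃)) (s₄ : Span (Fin m₄) (Fin n₄)) (s₅ : Span (Fin m₅) (Fin n₅))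
      (s₆ : Span (Fin m₆) (Fin n₆))
      (x : ∀ b, Lab O (obs V T) (s₁.K b)) (y : ∀ b, Lab O (obs V T) (s₂.K b))
      (z : ∀ b, Lab O (obs V T) (s₃.K b)) (t : ∀ b, Lab O (obs V T) (s₄.K b))
      (u : ∀ b, Lab O (obs V T) (s₅.K b)) (v : ∀ b, Lab O (obs V T) (s₆.K b)), SamePasting C
        (L (stdCell s₁ x) (stdCell s₂ y) (stdCell s₃ z) (stdCell s₄ t) (stdCell s₅ u)
          (stdCell s₆ v))
        (L' (stdCell s₁ x) (stdCell s₂ y) (stdCell s₃ z) (stdCell s₄ t) (stdCell s₅ u)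
          (stdCell s₆ v)))
    (x : Cell1 O.catOp.enr T m₁ n₁) (y : Cell1 O.catOp.enr T m₂ n₂)
    (z : Cell1 O.catOp.enr T m₃ n₃) (t : Cell1 O.catOp.enr T m₄ n₄)
    (u : Cell1 O.catOp.enr T m₅ n₅) (v : Cell1 O.catOp.enr T m₆ n₆) :
    SamePasting C (L x y z t u v) (L' x y z t u v) :=
  (O.isCoprod_hom m₁ n₁).local6 (O.isCoprod_hom m₂ n₂) (O.isCoprod_hom m₃ n₃)
    (O.isCoprod_hom m₄ n₄) (O.isCoprod_hom m₅ n₅) (O.isCoprod_hom m₆ n₆) (L := L) (L' := L') hL hL'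
    (fun T φ ψ χ ω φ' ψ' a b c d a' b' => by
      change SamePasting C (L (inclCell φ a) (inclCell ψ b) (inclCell χ c) (inclCell ω d) (inclCell
          φ' a') (inclCell ψ' b'))
        (L' (inclCell φ a) (inclCell ψ b) (inclCell χ c) (inclCell ω d) (inclCell φ' a') (inclCell
            ψ' b'))
      rw [inclCell_eq, inclCell_eq, inclCell_eq, inclCell_eq, inclCell_eq, inclCell_eq]
      exact h T _ _ _ _ _ _ _ _ _ _ _ _) x y z t u v

end LocalCells
end ICat

/-! ### The symmetry constraint -/

namespace ICat
open Stage

/-- The product of two spans, followed by the interchange of the factors of the target. -/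
abbrev Span.prodSwap {A B A' B' : Type} (s : Span A B) (t : Span A' B') :
    Span (A × A') (B' × B) where
  K b := s.K b.2 × t.K b.1
  fin _ := inferInstance
  leg b k := (s.leg _ k.1, t.leg _ k.2)
  inj := by
    rintro ⟨⟨b', b⟩, k, k'⟩ ⟨⟨c', c⟩, l, l'⟩ h
    have := (s.prod t).inj (a₁ := ⟨(b, b'), (k, k')⟩) (a₂ := ⟨(c, c'), (l, l')⟩) h
    simp only [Sigma.mk.injEq, Prod.mk.injEq] at this
    obtain ⟨⟨rfl, rfl⟩, h⟩ := this
    obtain ⟨rfl, rfl⟩ := Prod.mk.inj (eq_of_heq h)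
    rfl

section TauHat
variable {V : Type u} [Category.{v} V] [CartesianMonoidalCategory V] [MonoidalClosed V]
  [HasLimits V] [HasColimits (ICat V)]
variable {O : Operad V} (A : O.PseudoCommutative) {F G : Stage V} {T T' : V}
  {X Y X' Y' : Type} {m n m' n' : ℕ}

theorem cell_tau_smash (v : X ≃ Fin m) (u : Y ≃ Fin n) (v' : X' ≃ Fin m') (u' : Y' ≃ Fin n')
    (s : Span X Y) (s' : Span X' Y') (x : ∀ b, Lab O F (s.K b)) (x' : ∀ b, Lab O F (s'.K b)) :
    F.map (O.compD (m * m') (m' * m) (n' * n)) (F.pair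
      (F.map (O.lowPt (𝟙_ (ICat V)) (PHom.tau m m')) F.star)
      (F.map (O.smashMap m' n' m n) (F.pair (cell v' u' s' x') (cell v u s x)))) =
    cell (lexNum v v') (lexNum u' u) (s.prodSwap s') fun b =>
      (Lab.tens (x' b.1) (x b.2)).re (Equiv.prodComm _ _) := by
  rw [cell_tau v v', cell_smash]
  refine (cell_comp _ _ _ _).trans ?_
  refine cell_congr' (fun b => (Equiv.sigmaUnique _ _).trans (Equiv.prodComm _ _))
    (fun _ _ => rfl) fun b => ?_
  exact (Lab.gam_unit _).trans (Lab.Eqv.of_re _ _).symm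

theorem cell_smash_tau (v : X ≃ Fin m) (u : Y ≃ Fin n) (v' : X' ≃ Fin m') (u' : Y' ≃ Fin n')
    (s : Span X Y) (s' : Span X' Y') (x : ∀ b, Lab O F (s.K b)) (x' : ∀ b, Lab O F (s'.K b)) :
    F.map (O.compD (m * m') (n * n') (n' * n)) (F.pair
      (F.map (O.smashMap m n m' n') (F.pair (cell v u s x) (cell v' u' s' x')))
      (F.map (O.lowPt (𝟙_ (ICat V)) (PHom.tau n n')) F.star)) =
    cell (lexNum v v') (lexNum u' u) (s.prodSwap s') fun b => Lab.tens (x b.2) (x' b.1) := by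
  rw [cell_tau u u', cell_smash]
  refine (cell_comp _ _ _ _).trans ?_
  exact cell_congr' (fun b => Equiv.uniqueSigma _) (fun _ _ => rfl) fun b => Lab.unit_gam _

/-- The component of the symmetry constraint at two morphisms. -/
noncomputable def symCell (v : X ≃ Fin m) (u : Y ≃ Fin n) (v' : X' ≃ Fin m') (u' : Y' ≃ Fin n')
    (s : Span X Y) (s' : Span X' Y') (x : ∀ b, Lab O (obs V T) (s.K b))
    (x' : ∀ b, Lab O (obs V T) (s'.K b)) : (mors V T).obj (O.hom (m * m') (n' * n)) :=
  cell (lexNum v v') (lexNum u' u) (s.prodSwap s') fun b => Lab.alpha A (x' b.1) (x b.2)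

/-- The inverse of `symCell`. -/
noncomputable def symInvCell (v : X ≃ Fin m) (u : Y ≃ Fin n) (v' : X' ≃ Fin m') (u' : Y' ≃ Fin n')
    (s : Span X Y) (s' : Span X' Y') (x : ∀ b, Lab O (obs V T) (s.K b))
    (x' : ∀ b, Lab O (obs V T) (s'.K b)) : (mors V T).obj (O.hom (m * m') (n' * n)) :=
  cell (lexNum v v') (lexNum u' u) (s.prodSwap s') fun b =>
    (Lab.alpha A (x b.2) (x' b.1)).re (Equiv.prodComm _ _)

section
variable (v : X ≃ Fin m) (u : Y ≃ Fin n) (v' : X' ≃ Fin m') (u' : Y' ≃ Fin n')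
    (s : Span X Y) (s' : Span X' Y') (x : ∀ b, Lab O (obs V T) (s.K b))
    (x' : ∀ b, Lab O (obs V T) (s'.K b))

theorem symCell_src : (Stage.src T).app (symCell A v u v' u' s s' x x') =
    (obs V T).map (O.compD (m * m') (m' * m) (n' * n)) ((obs V T).pair
      ((obs V T).map (O.lowPt (𝟙_ (ICat V)) (PHom.tau m m')) (obs V T).star)
      ((obs V T).map (O.smashMap m' n' m n) ((obs V T).pair (cell v' u' s' x') (cell v u s x)))) :=
          by
  unfold symCell
  rw [app_cell, cell_tau_smash]
  congr 1
  funext c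
  exact Lab.alpha_src A _ _

theorem symCell_tgt : (Stage.tgt T).app (symCell A v u v' u' s s' x x') =
    (obs V T).map (O.compD (m * m') (n * n') (n' * n)) ((obs V T).pair
      ((obs V T).map (O.smashMap m n m' n') ((obs V T).pair (cell v u s x) (cell v' u' s' x')))
      ((obs V T).map (O.lowPt (𝟙_ (ICat V)) (PHom.tau n n')) (obs V T).star)) := by
  unfold symCell
  rw [app_cell, cell_smash_tau]
  congr 1
  funext c
  exact Lab.alpha_tgt A _ _

theorem symCell_inv : CompIs (symCell A v u v' u' s s' x x') (symInvCell A v u v' u' s s' x x')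
    ((Stage.idm T).app ((Stage.src T).app (symCell A v u v' u' s s' x x'))) := by
  unfold symCell
  rw [app_cell, app_cell]
  refine compIs_cell fun c => ?_
  have h := Lab.alpha_inv A (x' c.1) (x c.2)
  rw [← Lab.alpha_src A] at h
  exact h

theorem symInvCell_sym : CompIs (symInvCell A v u v' u' s s' x x')
    (symCell A v u v' u' s s' x x')
    ((Stage.idm T).app ((Stage.tgt T).app (symCell A v u v' u' s s' x x'))) := by
  unfold symCell
  rw [app_cell, app_cell]
  refine compIs_cell fun c => ?_
  have h := Lab.alpha_symm A (x c.2) (x' c.1)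
  rw [← Lab.alpha_tgt A] at h
  exact h

theorem symCell_pre (k : T' ⟶ T) : (preMor k).app (symCell A v u v' u' s s' x x') =
    symCell A v u v' u' s s' (fun b => (x b).ap (preOb k)) fun b => (x' b).ap (preOb k) := by
  unfold symCell
  rw [app_cell]
  congr 1
  funext c
  exact Lab.alpha_pre A k _ _
end

theorem symCell_nat (v : X ≃ Fin m) (u : Y ≃ Fin n) (v' : X' ≃ Fin m') (u' : Y' ≃ Fin n')
    (s : Span X Y) (s' : Span X' Y') (x : ∀ b, Lab O (mors V T) (s.K b))
    (x' : ∀ b, Lab O (mors V T) (s'.K b)) :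
    ∃ r, CompIs ((mors V T).map (O.compD (m * m') (m' * m) (n' * n)) ((mors V T).pair
        ((mors V T).map (O.lowPt (𝟙_ (ICat V)) (PHom.tau m m')) (mors V T).star)
        ((mors V T).map (O.smashMap m' n' m n)
          ((mors V T).pair (cell v' u' s' x') (cell v u s x)))))
        (symCell A v u v' u' s s' (fun b => (x b).tgt) fun b => (x' b).tgt) r ∧
      CompIs (symCell A v u v' u' s s' (fun b => (x b).src) fun b => (x' b).src)
        ((mors V T).map (O.compD (m * m') (n * n') (n' * n)) ((mors V T).pair
          ((mors V T).map (O.smashMap m n m' n')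
            ((mors V T).pair (cell v u s x) (cell v' u' s' x')))
          ((mors V T).map (O.lowPt (𝟙_ (ICat V)) (PHom.tau n n')) (mors V T).star))) r := by
  choose r h1 h2 using fun c : Y' × Y => Lab.alpha_nat A (x' c.1) (x c.2)
  rw [cell_tau_smash, cell_smash_tau]
  exact ⟨cell (lexNum v v') (lexNum u' u) (s.prodSwap s') r, compIs_cell h1, compIs_cell h2⟩

/-- The source of the symmetry constraint. -/
noncomputable abbrev tauSrc (O : Operad V) (m n m' n' : ℕ) :
    O.hom m n ⊗ O.hom m' n' ⟶ O.hom (m * m') (n' * n) :=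
  lift (toUnit _ ≫ O.lowPt (𝟙_ (ICat V)) (PHom.tau m m'))
    (sw (O.hom m n) (O.hom m' n') ≫ O.smashMap m' n' m n) ≫ O.compD (m * m') (m' * m) (n' * n)

/-- The target of the symmetry constraint. -/
noncomputable abbrev tauTgt (O : Operad V) (m n m' n' : ℕ) :
    O.hom m n ⊗ O.hom m' n' ⟶ O.hom (m * m') (n' * n) :=
  lift (O.smashMap m n m' n') (toUnit _ ≫ O.lowPt (𝟙_ (ICat V)) (PHom.tau n n')) ≫
    O.compD (m * m') (n * n') (n' * n)

theorem map_tauSrc (a : F.obj (O.hom m n)) (b : F.obj (O.hom m' n')) :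
    F.map (tauSrc O m n m' n') (F.pair a b) = F.map (O.compD (m * m') (m' * m) (n' * n)) (F.pair
        (F.map (O.lowPt (𝟙_ (ICat V)) (PHom.tau m m')) F.star)
        (F.map (O.smashMap m' n' m n) (F.pair b a))) := by
  rw [F.map_comp, map_lift, F.map_comp, F.map_comp, map_lift, F.map_fst, F.map_snd,
    F.star_eq (F.map (toUnit _) _)]

theorem map_tauTgt (a : F.obj (O.hom m n)) (b : F.obj (O.hom m' n')) :
    F.map (tauTgt O m n m' n') (F.pair a b) = F.map (O.compD (m * m') (n * n') (n' * n)) (F.pair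
        (F.map (O.smashMap m n m' n') (F.pair a b))
        (F.map (O.lowPt (𝟙_ (ICat V)) (PHom.tau n n')) F.star)) := by
  rw [F.map_comp, map_lift, F.map_comp, F.star_eq (F.map (toUnit _) _)]

section
variable (φ : FHom m n) (ψ : FHom m' n')

/-- The components of the symmetry constraint on a summand. -/
noncomputable def tauPt (z : (obs V T).obj (O.summand φ ⊗ O.summand ψ)) :
    (mors V T).obj (O.hom (m * m') (n' * n)) :=
  symCell A (Equiv.refl _) (Equiv.refl _) (Equiv.refl _) (Equiv.refl _) (Span.ofHom φ)
    (Span.ofHom ψ) (coord φ ((obs V T).map (fst _ _) z)) (coord ψ ((obs V T).map (snd _ _) z))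

/-- The components of the inverse of the symmetry constraint on a summand. -/
noncomputable def tauInvPt (z : (obs V T).obj (O.summand φ ⊗ O.summand ψ)) :
    (mors V T).obj (O.hom (m * m') (n' * n)) :=
  symInvCell A (Equiv.refl _) (Equiv.refl _) (Equiv.refl _) (Equiv.refl _) (Span.ofHom φ)
    (Span.ofHom ψ) (coord φ ((obs V T).map (fst _ _) z)) (coord ψ ((obs V T).map (snd _ _) z))

theorem ap_coord_map1 (h : F.Hom G) {C : ICat V} (φ : FHom m n) (f : C ⟶ O.summand φ)
    (z : F.obj C) : (fun b => (coord φ (F.map f z) b).ap h) = coord φ (G.map f (h.app z)) :=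
  funext fun b => (ap_coord h φ _ b).trans (by rw [h.nat])

theorem tauPt_pre (k : T' ⟶ T) (z : (obs V T).obj (O.summand φ ⊗ O.summand ψ)) :
    (preMor k).app (tauPt A φ ψ z) = tauPt A φ ψ ((preOb k).app z) := by
  refine (symCell_pre A _ _ _ _ _ _ _ _ k).trans ?_
  rw [ap_coord_map1, ap_coord_map1]
  rfl

theorem map_incl_tauSrc (z : F.obj (O.summand φ ⊗ O.summand ψ)) :
    F.map ((O.incl φ ⊗ₘ O.incl ψ) ≫ tauSrc O m n m' n') z =
      F.map (O.compD (m * m') (m' * m) (n' * n)) (F.pair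
        (F.map (O.lowPt (𝟙_ (ICat V)) (PHom.tau m m')) F.star)
        (F.map (O.smashMap m' n' m n) (F.pair
          (cell (Equiv.refl _) (Equiv.refl _) (Span.ofHom ψ) (coord ψ (F.map (snd _ _) z)))
          (cell (Equiv.refl _) (Equiv.refl _) (Span.ofHom φ) (coord φ (F.map (fst _ _) z)))))) := by
  rw [F.map_comp, ← pair_eta z, map_tensor, map_tauSrc, map_incl, map_incl, pair_eta]

theorem map_incl_tauTgt (z : F.obj (O.summand φ ⊗ O.summand ψ)) :
    F.map ((O.incl φ ⊗ₘ O.incl ψ) ≫ tauTgt O m n m' n') z =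
      F.map (O.compD (m * m') (n * n') (n' * n)) (F.pair
        (F.map (O.smashMap m n m' n') (F.pair
          (cell (Equiv.refl _) (Equiv.refl _) (Span.ofHom φ) (coord φ (F.map (fst _ _) z)))
          (cell (Equiv.refl _) (Equiv.refl _) (Span.ofHom ψ) (coord ψ (F.map (snd _ _) z)))))
        (F.map (O.lowPt (𝟙_ (ICat V)) (PHom.tau n n')) F.star)) := by
  rw [F.map_comp, ← pair_eta z, map_tensor, map_tauTgt, map_incl, map_incl, pair_eta]

theorem tauPt_nat (f : (mors V T).obj (O.summand φ ⊗ O.summand ψ)) :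
    ∃ r, CompIs ((mors V T).map ((O.incl φ ⊗ₘ O.incl ψ) ≫ tauSrc O m n m' n') f)
        (tauPt A φ ψ ((Stage.tgt T).app f)) r ∧
      CompIs (tauPt A φ ψ ((Stage.src T).app f))
        ((mors V T).map ((O.incl φ ⊗ₘ O.incl ψ) ≫ tauTgt O m n m' n') f) r := by
  obtain ⟨r, h1, h2⟩ := symCell_nat A (Equiv.refl _) (Equiv.refl _) (Equiv.refl _)
    (Equiv.refl _) (Span.ofHom φ) (Span.ofHom ψ) (coord φ ((mors V T).map (fst _ _) f))
    (coord ψ ((mors V T).map (snd _ _) f))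
  rw [ap_coord_map1, ap_coord_map1] at h1 h2
  exact ⟨r, CompIs.congr h1 (map_incl_tauSrc (F := mors V T) φ ψ f) rfl rfl,
    CompIs.congr h2 rfl (map_incl_tauTgt (F := mors V T) φ ψ f) rfl⟩

/-- The restriction of the symmetry constraint to a summand. -/
noncomputable def tauTrans : ITrans ((O.incl φ ⊗ₘ O.incl ψ) ≫ tauSrc O m n m' n')
    ((O.incl φ ⊗ₘ O.incl ψ) ≫ tauTgt O m n m' n') :=
  ITrans.ofPoints (fun {T} z => tauPt (T := T) A φ ψ z)
    (fun {T} z => (symCell_src A _ _ _ _ _ _ _ _).trans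
      (map_incl_tauSrc (F := obs V T) φ ψ z).symm)
    (fun {T} z => (symCell_tgt A _ _ _ _ _ _ _ _).trans
      (map_incl_tauTgt (F := obs V T) φ ψ z).symm)
    (fun {T _} k z => tauPt_pre (T := T) A φ ψ k z)
    (fun {T} f => tauPt_nat (T := T) A φ ψ f)

/-- The restriction of the symmetry constraint to a summand, with its inverse. -/
noncomputable def tauIso : IIso ((O.incl φ ⊗ₘ O.incl ψ) ≫ tauSrc O m n m' n')
    ((O.incl φ ⊗ₘ O.incl ψ) ≫ tauTgt O m n m' n') :=
  IIso.ofHom (tauTrans A φ ψ) (tauInvPt A φ ψ (𝟙 _))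
    (CompIs.congr (symCell_inv A _ _ _ _ _ _ _ _) rfl rfl
      (congrArg (Stage.idm _).app (tauTrans A φ ψ).src.symm))
    (CompIs.congr (symInvCell_sym A _ _ _ _ _ _ _ _) rfl rfl
      (congrArg (Stage.idm _).app (tauTrans A φ ψ).tgt.symm))

end

theorem isCoprod2 (O : Operad V) (m n m' n' : ℕ) :
    IsCoprod fun J : FHom m n × FHom m' n' => O.incl J.1 ⊗ₘ O.incl J.2 :=
  IsCoprod.tensor (a := fun φ : FHom m n => O.incl φ) (b := fun φ : FHom m' n' => O.incl φ)
    (O.isCoprod_hom m n) (O.isCoprod_hom m' n')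

/-- The symmetry given by the pseudo-commutative structure of the operad. -/
noncomputable def Operad.PseudoCommutative.symmetryData : A.smashData.SymmetryData where
  tau m p := O.lowPt (𝟙_ (ICat V)) (PHom.tau m p)
  tauHat m n m' n' := IIso.desc (F := tauSrc O m n m' n') (G := tauTgt O m n m' n')
    (isCoprod2 O m n m' n') fun J => tauIso A J.1 J.2

theorem tauHat_incl (φ : FHom m n) (ψ : FHom m' n')
    (a : (obs V T).obj (O.summand φ)) (b : (obs V T).obj (O.summand ψ)) :
    A.symmetryData.th ((obs V T).map (O.incl φ) a) ((obs V T).map (O.incl ψ) b) =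
      symCell A (Equiv.refl _) (Equiv.refl _) (Equiv.refl _) (Equiv.refl _) (Span.ofHom φ)
        (Span.ofHom ψ) (coord φ a) (coord ψ b) := by
  let z := (obs V T).pair a b
  have h1 : A.symmetryData.th ((obs V T).map (O.incl φ) a) ((obs V T).map (O.incl ψ) b) =
      ((obs V T).map (O.incl φ ⊗ₘ O.incl ψ) z : T ⟶ _) ≫
        (A.symmetryData.tauHat m n m' n').hom.app :=
    congrArg (fun t : T ⟶ (O.hom m n ⊗ O.hom m' n').Ob =>
      t ≫ (A.symmetryData.tauHat m n m' n').hom.app) (map_tensor (O.incl φ) (O.incl ψ) a b).symm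
  have h2 : ((obs V T).map (O.incl φ ⊗ₘ O.incl ψ) z : T ⟶ _) ≫
      (A.symmetryData.tauHat m n m' n').hom.app = (z : T ⟶ _) ≫ (tauTrans A φ ψ).app :=
    (Category.assoc _ _ _).trans (congrArg (fun t => (z : T ⟶ _) ≫ t)
      (ITrans.ob_desc (F := tauSrc O m n m' n') (G := tauTgt O m n m' n') (isCoprod2 O m n m' n')
        (fun J => (tauIso A J.1 J.2).hom) (φ, ψ)))
  have h3 : (z : T ⟶ _) ≫ (tauTrans A φ ψ).app = tauPt (T := T) A φ ψ z :=
    (tauPt_pre A φ ψ (z : T ⟶ _) (𝟙 _)).trans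
      (congrArg (fun z => tauPt (T := T) A φ ψ z) (Category.comp_id (z : T ⟶ _)))
  refine h1.trans (h2.trans (h3.trans ?_))
  unfold tauPt
  simp only [z, (obs V T).map_fst, (obs V T).map_snd]
  rfl

theorem tauHat_cell (v : X ≃ Fin m) (u : Y ≃ Fin n) (v' : X' ≃ Fin m') (u' : Y' ≃ Fin n')
    (s : Span X Y) (s' : Span X' Y') (x : ∀ b, Lab O (obs V T) (s.K b))
    (x' : ∀ b, Lab O (obs V T) (s'.K b)) :
    A.symmetryData.th (cell1 v u s x) (cell1 v' u' s' x') =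
      cell2 (lexNum v v') (lexNum u' u) (s.prodSwap s') fun b =>
        Lab.alpha A (x' b.1) (x b.2) := by
  refine (tauHat_incl A (s.hom v u) (s'.hom v' u') _ _).trans ?_
  refine cell_congr (Equiv.prodCongr v.symm v'.symm) (Equiv.prodCongr u'.symm u.symm)
    (fun a => congrArg finProdFinEquiv (Prod.ext (v.apply_symm_apply _) (v'.apply_symm_apply _)))
    (fun b => congrArg finProdFinEquiv (Prod.ext (u'.apply_symm_apply _) (u.apply_symm_apply _)))
    (fun c => Equiv.prodCongr (s.num v u c.2) (s'.num v' u' c.1)) (fun c k => ?_) fun c => ?_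
  · exact Prod.ext (num_leg v u s _ k.1).symm (num_leg v' u' s' _ k.2).symm
  · exact Lab.Eqv.alpha A (coord_eqv v' u' s' x' c.1) (coord_eqv v u s x c.2)

theorem t1_cell (v : X ≃ Fin m) (v' : X' ≃ Fin m') :
    A.symmetryData.t1 T m m' = cell1 (lexNum v v') (lexNum v' v)
      (Span.ofEquiv (Equiv.prodComm X X')) fun _ => Lab.unit := constCell_tau v v'

end TauHat
end ICat

/-! ### Strictness relative to `Π` -/

namespace ICat
open Stage

section Strict
variable {V : Type u} [Category.{v} V] [CartesianMonoidalCategory V] [MonoidalClosed V]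
  [HasLimits V] [HasColimits (ICat V)]
variable {O : Operad V} (A : O.PseudoCommutative) {T : V} {m n p q m' n' p' q' : ℕ}

theorem samePasting_singleton {C : ICat V} {x y : T ⟶ C.Mor} : SamePasting C [x] [y] ↔ x = y :=
  ⟨fun ⟨_, h, h'⟩ => Eq.trans (b := _) h (Eq.symm h'), fun h => ⟨y, h, rfl⟩⟩

theorem summand_iota (φ : PHom m n) (x : T ⟶ (𝟙_ (ICat V)).Ob) :
    ((x ≫ ob (el (𝟙_ (ICat V)) φ)) ≫ ob (O.catOp.ι.map m n) : Cell1 O.catOp.enr T m n) =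
      constCell O.catOp.enr T (O.lowPt (𝟙_ (ICat V)) φ) := by
  have h1 := (obs V T).map_comp (el (𝟙_ (ICat V)) φ) (O.iotaMap m n) x
  rw [O.el_iota] at h1
  exact h1.symm.trans (congrArg ((obs V T).map (O.lowPt (𝟙_ (ICat V)) φ)) ((obs V T).star_eq x))

theorem fromPi_id1 (n : ℕ) : O.catOp.FromPi (id1 O.catOp.enr T n) := by
  refine ⟨constCell (Pcat V) T ((Pcat V).id n), ?_⟩
  refine Eq.trans ?_ ((obs V T).map_comp ((Pcat V).id n) (O.catOp.ι.map n n) (toUnit T))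
  rw [O.catOp.ι.map_id]
  rfl

theorem isCoprod_cell (O : Operad V) (m n : ℕ) :
    IsCoprod (S := O.catOp.enr.Hom m n) fun φ : FHom m n => O.incl φ := O.isCoprod_hom m n

/-- The generalized 1-cells that come from `Π`. -/
noncomputable def piCell (x : T ⟶ (VS V (PHom m n)).Ob) : Cell1 O.catOp.enr T m n :=
  x ≫ ob (O.catOp.ι.map m n)

theorem pre_piCell {T' : V} (k : T' ⟶ T) (x : T ⟶ (VS V (PHom m n)).Ob) :
    (piCell (k ≫ x) : Cell1 O.catOp.enr T' m n) = k ≫ piCell x := Category.assoc _ _ _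

theorem thIsId_left (s : Span (Fin m) (Fin n)) (t : Span (Fin n) (Fin p))
    (s' : Span (Fin m') (Fin n')) (t' : Span (Fin n') (Fin p')) (x : ∀ b, Lab O (obs V T) (s.K b))
    (y : ∀ c, Lab O (obs V T) (t.K c)) (x' : ∀ b, Lab O (obs V T) (s'.K b))
    (y' : ∀ c, Lab O (obs V T) (t'.K c)) (hx : ∀ b, Lab.IsLow (x b)) :
    A.smashData.ThIsId (stdCell s x) (stdCell s' x') (stdCell t y) (stdCell t' y') := by
  unfold SmashData.ThIsId
  rw [th_cell, comp1_cell, comp1_cell, sm1_cell, one_cell]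
  congr 1
  funext c
  exact Lab.inter_low_left A _ _ _ fun k => hx _

theorem thIsId_right (s : Span (Fin m) (Fin n)) (t : Span (Fin n) (Fin p))
    (s' : Span (Fin m') (Fin n')) (t' : Span (Fin n') (Fin p')) (x : ∀ b, Lab O (obs V T) (s.K b))
    (y : ∀ c, Lab O (obs V T) (t.K c)) (x' : ∀ b, Lab O (obs V T) (s'.K b))
    (y' : ∀ c, Lab O (obs V T) (t'.K c)) (hy : ∀ b, Lab.IsLow (y' b)) :
    A.smashData.ThIsId (stdCell s x) (stdCell s' x') (stdCell t y) (stdCell t' y') := by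
  unfold SmashData.ThIsId
  rw [th_cell, comp1_cell, comp1_cell, sm1_cell, one_cell]
  congr 1
  funext c
  exact Lab.inter_low_right A _ _ _ (hy _)

/-- The constraint is the identity if the first morphism of the first variable is in `Π`. -/
theorem thIsId_of_fromPi_left {f₁ : Cell1 O.catOp.enr T m n} (h : O.catOp.FromPi f₁)
    (f₂ : Cell1 O.catOp.enr T m' n') (g₁ : Cell1 O.catOp.enr T n p)
    (g₂ : Cell1 O.catOp.enr T n' p') : A.smashData.ThIsId f₁ f₂ g₁ g₂ := by
  obtain ⟨x, rfl⟩ := h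
  refine samePasting_singleton.1 (IsCoprod.local4 (isCoprod_VS (PHom m n)) (isCoprod_cell O m' n')
    (isCoprod_cell O n p) (isCoprod_cell O n' p')
    (L := fun {T} (x : T ⟶ (VS V (PHom m n)).Ob) (f₂ : Cell1 O.catOp.enr T m' n')
      (g₁ : Cell1 O.catOp.enr T n p) (g₂ : Cell1 O.catOp.enr T n' p') =>
      [A.smashData.th (piCell x) f₂ g₁ g₂])
    (L' := fun {T} (x : T ⟶ (VS V (PHom m n)).Ob) (f₂ : Cell1 O.catOp.enr T m' n')
      (g₁ : Cell1 O.catOp.enr T n p) (g₂ : Cell1 O.catOp.enr T n' p') =>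
      [one (A.smashData.sm1 (comp1 _ (piCell x) g₁) (comp1 _ f₂ g₂))])
    (fun k x f₂ g₁ g₂ => ⟨?_, by simp⟩) (fun k x f₂ g₁ g₂ => ⟨?_, by simp⟩)
    (fun T φ ψ χ ω a b c d => ?_) x f₂ g₁ g₂)
  · rw [pre_piCell, pre_th]; rfl
  · rw [pre_piCell, pre_comp1, pre_comp1, pre_sm1, pre_one]; rfl
  · obtain ⟨e, he, h⟩ := constCell_lowPt (O := O) (T := T) φ
    have key := thIsId_left A _ _ _ _ e (coord (F := obs V T) χ c) (coord (F := obs V T) ψ b)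
      (coord (F := obs V T) ω d) he
    have h' := (summand_iota (O := O) φ a).trans h
    rw [← inclCell_eq, ← inclCell_eq, ← inclCell_eq] at key
    refine samePasting_singleton.2 ?_
    change A.smashData.ThIsId _ _ _ _
    rw [show piCell _ = _ from h']
    exact key

/-- The constraint is the identity if the second morphism of the second variable is in `Π`. -/
theorem thIsId_of_fromPi_right (f₁ : Cell1 O.catOp.enr T m n)
    (f₂ : Cell1 O.catOp.enr T m' n') (g₁ : Cell1 O.catOp.enr T n p)
    {g₂ : Cell1 O.catOp.enr T n' p'} (h : O.catOp.FromPi g₂) :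
    A.smashData.ThIsId f₁ f₂ g₁ g₂ := by
  obtain ⟨x, rfl⟩ := h
  refine samePasting_singleton.1 (IsCoprod.local4 (isCoprod_cell O m n) (isCoprod_cell O m' n')
    (isCoprod_cell O n p) (isCoprod_VS (PHom n' p'))
    (L := fun {T} (f₁ : Cell1 O.catOp.enr T m n) (f₂ : Cell1 O.catOp.enr T m' n')
      (g₁ : Cell1 O.catOp.enr T n p) (x : T ⟶ (VS V (PHom n' p')).Ob) =>
      [A.smashData.th f₁ f₂ g₁ (piCell x)])
    (L' := fun {T} (f₁ : Cell1 O.catOp.enr T m n) (f₂ : Cell1 O.catOp.enr T m' n')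
      (g₁ : Cell1 O.catOp.enr T n p) (x : T ⟶ (VS V (PHom n' p')).Ob) =>
      [one (A.smashData.sm1 (comp1 _ f₁ g₁) (comp1 _ f₂ (piCell x)))])
    (fun k f₁ f₂ g₁ x => ⟨?_, by simp⟩) (fun k f₁ f₂ g₁ x => ⟨?_, by simp⟩)
    (fun T φ ψ χ ω a b c d => ?_) f₁ f₂ g₁ x)
  · rw [pre_piCell, pre_th]; rfl
  · rw [pre_piCell, pre_comp1, pre_comp1, pre_sm1, pre_one]; rfl
  · obtain ⟨e, he, h⟩ := constCell_lowPt (O := O) (T := T) ω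
    have key := thIsId_right A _ _ _ _ (coord (F := obs V T) φ a) (coord (F := obs V T) χ c)
      (coord (F := obs V T) ψ b) e he
    have h' := (summand_iota (O := O) ω d).trans h
    rw [← inclCell_eq, ← inclCell_eq, ← inclCell_eq] at key
    refine samePasting_singleton.2 ?_
    change A.smashData.ThIsId _ _ _ _
    rw [show piCell _ = _ from h']
    exact key

/-- The symmetry constraint is the identity on `Π`. -/
theorem tauHat_of_fromPi {f : Cell1 O.catOp.enr T m n} {g : Cell1 O.catOp.enr T p q}
    (hf : O.catOp.FromPi f) (hg : O.catOp.FromPi g) : A.symmetryData.th f g =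
      one (comp1 O.catOp.enr (A.symmetryData.t1 T m p) (A.smashData.sm1 g f)) := by
  obtain ⟨x, rfl⟩ := hf
  obtain ⟨y, rfl⟩ := hg
  refine samePasting_singleton.1 (IsCoprod.local2 (isCoprod_VS (PHom m n)) (isCoprod_VS (PHom p q))
    (L := fun {T} (x : T ⟶ (VS V (PHom m n)).Ob) (y : T ⟶ (VS V (PHom p q)).Ob) =>
      [A.symmetryData.th (piCell x) (piCell y)])
    (L' := fun {T} (x : T ⟶ (VS V (PHom m n)).Ob) (y : T ⟶ (VS V (PHom p q)).Ob) =>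
      [one (comp1 O.catOp.enr (A.symmetryData.t1 T m p) (A.smashData.sm1
        (piCell y) (piCell x)))])
    (fun k x y => ⟨?_, by simp⟩) (fun k x y => ⟨?_, by simp⟩)
    (fun T φ ψ a b => ?_) x y)
  · rw [pre_piCell, pre_piCell, pre_tauHat]; rfl
  · rw [pre_piCell, pre_piCell, pre_t1 k, pre_sm1, pre_comp1, pre_one]; rfl
  · obtain ⟨e, he, h⟩ := constCell_lowPt (O := O) (T := T) φ
    obtain ⟨e', he', h'⟩ := constCell_lowPt (O := O) (T := T) ψ
    have h1 := (summand_iota (O := O) φ a).trans h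
    have h1' := (summand_iota (O := O) ψ b).trans h'
    refine samePasting_singleton.2 ?_
    rw [show piCell _ = _ from h1, show piCell _ = _ from h1', tauHat_cell, t1_cell A (Equiv.refl
        _) (Equiv.refl _), sm1_cell, comp1_cell,
      one_cell]
    refine cell_congr' (fun b => (Equiv.prodComm _ _).trans (Equiv.sigmaUnique _ _).symm)
      (fun _ _ => rfl) fun b => ?_
    rw [Lab.alpha_low_left A (he' _)]
    refine Lab.Eqv.ap _ ?_
    have h2 := (Lab.gam_unit (K := fun _ => Unit) (Lab.tens (e' b.1) (e b.2))).symm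
    refine Lab.Eqv.trans (e := Equiv.prodComm _ _) ?_ h2
    exact ((he _).tens (he' _)).eqv ((he' _).tens (he _)) _

end Strict
end ICat

/-! ### The product on basepoints, identities, units and `Π` -/

namespace ICat
open Stage

section Strictness
variable {V : Type u} [Category.{v} V] [CartesianMonoidalCategory V] [MonoidalClosed V]
  [HasLimits V] [HasColimits (ICat V)]
variable {O : Operad V} (A : O.PseudoCommutative) {T : V} {m n p q m' n' p' q' : ℕ}
  {F : Stage V} {X Y Z : Type}


/-- The basepoint of a morphism category. -/
noncomputable def basePt (O : Operad V) (m n : ℕ) : 𝟙_ (ICat V) ⟶ O.hom m n := O.catOp.based.pt m n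

theorem map_basePt (v : X ≃ Fin m) (u : Y ≃ Fin n) : ∃ c : ∀ b, Lab O F ((Span.zero X Y).K b),
    F.map (basePt O m n) F.star = cell v u (Span.zero X Y) c :=
  ⟨fun _ => Lab.mk (Equiv.equivOfIsEmpty (Fin 0) Empty) (F.map (O.reduced.from _) F.star),
    cell_zero v u _⟩

theorem cell_eq_basePt {v : X ≃ Fin m} {u : Y ≃ Fin n} {s : Span X Y} {c : ∀ b, Lab O F (s.K b)}
    (h : ∀ b, IsEmpty (s.K b)) : cell v u s c = F.map (basePt O m n) F.star := cell_eq_zero h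

theorem smash_basePt_left (φ : FHom p q) (d : ∀ j, F.obj (O.obj (φ.deg j))) :
    F.map (O.smashMap m n p q) (F.pair (F.map (basePt O m n) F.star) (ptF O F φ d)) =
      F.map (basePt O (m * p) (n * q)) F.star := by
  obtain ⟨c, hc⟩ := map_basePt (O := O) (F := F) (Equiv.refl (Fin m)) (Equiv.refl (Fin n))
  rw [ptF_eq, hc, cell_smash]
  exact cell_eq_basePt fun b => inferInstanceAs (IsEmpty (Empty × _))

theorem smash_basePt_right (φ : FHom p q) (d : ∀ j, F.obj (O.obj (φ.deg j))) :
    F.map (O.smashMap p q m n) (F.pair (ptF O F φ d) (F.map (basePt O m n) F.star)) =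
      F.map (basePt O (p * m) (q * n)) F.star := by
  obtain ⟨c, hc⟩ := map_basePt (O := O) (F := F) (Equiv.refl (Fin m)) (Equiv.refl (Fin n))
  rw [ptF_eq, hc, cell_smash]
  exact cell_eq_basePt fun b => inferInstanceAs (IsEmpty (_ × Empty))

theorem map_toUnit_comp {C D : ICat V} (f : 𝟙_ (ICat V) ⟶ D) (x : F.obj C) :
    F.map (toUnit C ≫ f) x = F.map f F.star := by rw [F.map_comp, F.star_eq (F.map _ x)]

/-- Equality of functors out of a morphism category may be checked on the generalized elements
`(φ; c)`. -/
theorem map_eq_of_ptF {C : ICat V} {f g : O.hom m n ⟶ C}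
    (h : ∀ (F : Stage V) (φ : FHom m n) (c : ∀ j, F.obj (O.obj (φ.deg j))),
      F.map f (ptF O F φ c) = F.map g (ptF O F φ c)) (x : F.obj (O.hom m n)) :
    F.map f x = F.map g x := by
  rw [O.hom_ext1 (f := f) (g := g) fun X φ c => h (funs V X) φ c]

theorem map_basePt_smash (a b : ℕ) (g : F.obj (O.hom p q)) :
    F.map (O.smashMap a b p q) (F.pair (F.map (basePt O a b) F.star) g) =
      F.map (basePt O (a * p) (b * q)) F.star := by
  have key := map_eq_of_ptF (F := F)
    (f := lift (toUnit _ ≫ basePt O a b) (𝟙 (O.hom p q)) ≫ O.smashMap a b p q)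
    (g := toUnit _ ≫ basePt O (a * p) (b * q)) (fun F φ c => by
      rw [Stage.map_comp, Stage.map_lift, map_toUnit_comp, map_toUnit_comp, Stage.map_id,
        smash_basePt_left]) g
  rwa [Stage.map_comp, Stage.map_lift, map_toUnit_comp, map_toUnit_comp, Stage.map_id] at key

theorem map_smash_basePt (a b : ℕ) (g : F.obj (O.hom p q)) :
    F.map (O.smashMap p q a b) (F.pair g (F.map (basePt O a b) F.star)) =
      F.map (basePt O (p * a) (q * b)) F.star := by
  have key := map_eq_of_ptF (F := F)
    (f := lift (𝟙 (O.hom p q)) (toUnit _ ≫ basePt O a b) ≫ O.smashMap p q a b)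
    (g := toUnit _ ≫ basePt O (p * a) (q * b)) (fun F φ c => by
      rw [Stage.map_comp, Stage.map_lift, map_toUnit_comp, map_toUnit_comp, Stage.map_id,
        smash_basePt_right]) g
  rwa [Stage.map_comp, Stage.map_lift, map_toUnit_comp, map_toUnit_comp, Stage.map_id] at key

theorem smashMap_basePt_left {X : ICat V} (a b : ℕ) (g : X ⟶ O.hom p q) :
    lift (toUnit X ≫ basePt O a b) g ≫ O.smashMap a b p q = toUnit X ≫ basePt O (a * p) (b * q) :=
  map_basePt_smash (F := funs V X) a b g

theorem smashMap_basePt_right {X : ICat V} (a b : ℕ) (g : X ⟶ O.hom p q) :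
    lift g (toUnit X ≫ basePt O a b) ≫ O.smashMap p q a b = toUnit X ≫ basePt O (p * a) (q * b) :=
  map_smash_basePt (F := funs V X) a b g

theorem map_smash_id (a c : ℕ) : F.map (O.smashMap a a c c)
    (F.pair (F.map (O.idD a) F.star) (F.map (O.idD c) F.star)) =
      F.map (O.idD (a * c)) F.star := by
  rw [cell_id (Equiv.refl _), cell_id (Equiv.refl _), cell_smash]
  refine Eq.trans ?_ (cell_id (lexNum (Equiv.refl _) (Equiv.refl _))).symm
  exact cell_congr' (fun _ => Equiv.prodUnique Unit Unit) (fun _ _ => rfl) fun b => Lab.tens_unit _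

theorem smashMap_id (a c : ℕ) : lift (O.idD a) (O.idD c) ≫ O.smashMap a a c c = O.idD (a * c) := by
  have key := map_smash_id (O := O) (F := funs V (𝟙_ (ICat V))) a c
  have h (n : ℕ) : (funs V (𝟙_ (ICat V))).map (O.idD n) (funs V (𝟙_ (ICat V))).star = O.idD n :=
    (congrArg (fun t => t ≫ O.idD n) (toUnit_unique (toUnit _) (𝟙 _))).trans (Category.id_comp _)
  rw [h, h, h] at key
  exact key

theorem lexNum_assoc {a b c : ℕ} (v : X ≃ Fin a) (u : Y ≃ Fin b) (w : Z ≃ Fin c)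
    (i : (X × Y) × Z) : lexNum v (lexNum u w) (Equiv.prodAssoc X Y Z i) =
      finCongr (mul_assoc a b c) (lexNum (lexNum v u) w i) := by
  ext
  simp [lexNum, finProdFinEquiv]
  ring

theorem Lab.tens_assoc {S R Q : Type} [Finite S] [Finite R] [Finite Q] (x : Lab O F S)
    (y : Lab O F R) (z : Lab O F Q) : Lab.Eqv (Equiv.prodAssoc S R Q)
      (Lab.tens (Lab.tens x y) z) (Lab.tens x (Lab.tens y z)) := by
  have h1 := Lab.Eqv.gam (K := fun _ : S × R => Q) (K' := fun _ : Σ _ : S, R => Q)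
    (τ := fun _ => Equiv.refl _) (y := fun _ => z) (y' := fun _ => z) (Lab.tens_eqv x y)
    fun _ => Lab.Eqv.refl z
  have h2 := Lab.gam_assoc (L := fun _ : Σ _ : S, R => Q) x (fun _ => y) fun _ => z
  have h3 := Lab.Eqv.gam_right x fun _ => (Lab.tens_eqv y z).symm
  exact (((((Lab.tens_eqv _ _).trans h1).trans h2).trans h3).trans
    (Lab.tens_eqv _ _).symm).of_eq fun _ => rfl

theorem map_smash_assoc {a b c d e k : ℕ} (φ : FHom a b) (x : ∀ j, F.obj (O.obj (φ.deg j)))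
    (ψ : FHom c d) (y : ∀ j, F.obj (O.obj (ψ.deg j))) (χ : FHom e k)
    (z : ∀ j, F.obj (O.obj (χ.deg j))) :
    F.map (homCast O.opCat (mul_assoc a c e) (mul_assoc b d k))
      (F.map (O.smashMap (a * c) (b * d) e k) (F.pair
        (F.map (O.smashMap a b c d) (F.pair (ptF O F φ x) (ptF O F ψ y))) (ptF O F χ z))) =
      F.map (O.smashMap a b (c * e) (d * k)) (F.pair (ptF O F φ x)
        (F.map (O.smashMap c d e k) (F.pair (ptF O F ψ y) (ptF O F χ z)))) := by
  rw [ptF_eq, ptF_eq, ptF_eq, cell_smash, cell_smash, cell_smash, cell_smash, cell_cast]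
  exact cell_congr (Equiv.prodAssoc _ _ _) (Equiv.prodAssoc _ _ _) (lexNum_assoc _ _ _)
    (lexNum_assoc _ _ _) (fun _ => Equiv.prodAssoc _ _ _) (fun _ _ => rfl)
    fun _ => Lab.tens_assoc _ _ _

theorem map_assoc_smash {a b c d e k : ℕ} (f : F.obj (O.hom a b)) (g : F.obj (O.hom c d))
    (h : F.obj (O.hom e k)) :
    F.map (homCast O.opCat (mul_assoc a c e) (mul_assoc b d k))
      (F.map (O.smashMap (a * c) (b * d) e k) (F.pair
        (F.map (O.smashMap a b c d) (F.pair f g)) h)) =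
      F.map (O.smashMap a b (c * e) (d * k)) (F.pair f
        (F.map (O.smashMap c d e k) (F.pair g h))) := by
  have gen (F : Stage V) (f : F.obj (O.hom a b)) (g : F.obj (O.hom c d)) (h : F.obj (O.hom e k)) :
      F.map (lift (lift (fst _ _) (snd _ _ ≫ fst _ _) ≫ O.smashMap a b c d)
        (snd _ _ ≫ snd _ _) ≫ O.smashMap (a * c) (b * d) e k ≫
          homCast O.opCat (mul_assoc a c e) (mul_assoc b d k)) (F.pair f (F.pair g h)) =
      F.map (homCast O.opCat (mul_assoc a c e) (mul_assoc b d k))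
        (F.map (O.smashMap (a * c) (b * d) e k) (F.pair
          (F.map (O.smashMap a b c d) (F.pair f g)) h)) := by
    simp only [Stage.map_comp, Stage.map_lift, Stage.map_fst, Stage.map_snd]
  have gen' (F : Stage V) (f : F.obj (O.hom a b)) (g : F.obj (O.hom c d))
      (h : F.obj (O.hom e k)) :
      F.map (lift (fst _ _) (lift (snd _ _ ≫ fst _ _) (snd _ _ ≫ snd _ _) ≫
        O.smashMap c d e k) ≫ O.smashMap a b (c * e) (d * k)) (F.pair f (F.pair g h)) =
      F.map (O.smashMap a b (c * e) (d * k)) (F.pair f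
        (F.map (O.smashMap c d e k) (F.pair g h))) := by
    simp only [Stage.map_comp, Stage.map_lift, Stage.map_fst, Stage.map_snd]
  rw [← gen, ← gen']
  congr 1
  refine O.hom_ext3 fun X φ x ψ y χ z => ?_
  exact (gen (funs V X) _ _ _).trans ((map_smash_assoc (F := funs V X) φ x ψ y χ z).trans
    (gen' (funs V X) _ _ _).symm)

theorem smashMap_assoc {X : ICat V} {a b c d e k : ℕ} (f : X ⟶ O.hom a b) (g : X ⟶ O.hom c d)
    (h : X ⟶ O.hom e k) :
    lift (lift f g ≫ O.smashMap a b c d) h ≫ O.smashMap (a * c) (b * d) e k ≫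
        homCast O.opCat (mul_assoc a c e) (mul_assoc b d k) =
      lift f (lift g h ≫ O.smashMap c d e k) ≫ O.smashMap a b (c * e) (d * k) :=
  (Category.assoc _ _ _).symm.trans (map_assoc_smash (F := funs V X) f g h)

theorem map_one_smash {a b : ℕ} (φ : FHom a b) (x : ∀ j, F.obj (O.obj (φ.deg j))) :
    F.map (homCast O.opCat (one_mul a) (one_mul b)) (F.map (O.smashMap 1 1 a b)
      (F.pair (F.map (O.idD 1) F.star) (ptF O F φ x))) = ptF O F φ x := by
  rw [ptF_eq, cell_id (Equiv.refl _), cell_smash, cell_cast]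
  exact cell_congr (Equiv.uniqueProd _ _) (Equiv.uniqueProd _ _)
    (fun i => Fin.ext (by simp [finProdFinEquiv]))
    (fun i => Fin.ext (by simp [finProdFinEquiv]))
    (fun _ => Equiv.uniqueProd _ Unit) (fun _ _ => rfl) fun _ => Lab.unit_tens _

theorem map_smash_one {a b : ℕ} (φ : FHom a b) (x : ∀ j, F.obj (O.obj (φ.deg j))) :
    F.map (homCast O.opCat (mul_one a) (mul_one b)) (F.map (O.smashMap a b 1 1)
      (F.pair (ptF O F φ x) (F.map (O.idD 1) F.star))) = ptF O F φ x := by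
  rw [ptF_eq, cell_id (Equiv.refl _), cell_smash, cell_cast]
  exact cell_congr (Equiv.prodUnique _ _) (Equiv.prodUnique _ _)
    (fun i => Fin.ext (by simp [finProdFinEquiv]))
    (fun i => Fin.ext (by simp [finProdFinEquiv]))
    (fun _ => Equiv.prodUnique _ Unit) (fun _ _ => rfl) fun _ => Lab.tens_unit _

theorem map_one_smash' {a b : ℕ} (f : F.obj (O.hom a b)) :
    F.map (homCast O.opCat (one_mul a) (one_mul b)) (F.map (O.smashMap 1 1 a b)
      (F.pair (F.map (O.idD 1) F.star) f)) = f := by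
  have key := map_eq_of_ptF (F := F) (f := lift (toUnit _ ≫ O.idD 1) (𝟙 (O.hom a b)) ≫
    O.smashMap 1 1 a b ≫ homCast O.opCat (one_mul a) (one_mul b)) (g := 𝟙 (O.hom a b))
    (fun F φ c => by
      rw [Stage.map_comp, Stage.map_comp, Stage.map_lift, map_toUnit_comp, Stage.map_id]
      exact map_one_smash φ c) f
  rw [Stage.map_comp, Stage.map_comp, Stage.map_lift, map_toUnit_comp, Stage.map_id] at key
  exact key

theorem map_smash_one' {a b : ℕ} (f : F.obj (O.hom a b)) :
    F.map (homCast O.opCat (mul_one a) (mul_one b)) (F.map (O.smashMap a b 1 1)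
      (F.pair f (F.map (O.idD 1) F.star))) = f := by
  have key := map_eq_of_ptF (F := F) (f := lift (𝟙 (O.hom a b)) (toUnit _ ≫ O.idD 1) ≫
    O.smashMap a b 1 1 ≫ homCast O.opCat (mul_one a) (mul_one b)) (g := 𝟙 (O.hom a b))
    (fun F φ c => by
      rw [Stage.map_comp, Stage.map_comp, Stage.map_lift, map_toUnit_comp, Stage.map_id]
      exact map_smash_one φ c) f
  rw [Stage.map_comp, Stage.map_comp, Stage.map_lift, map_toUnit_comp, Stage.map_id] at key
  exact key

theorem one_smashMap {X : ICat V} {a b : ℕ} (f : X ⟶ O.hom a b) :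
    lift (toUnit X ≫ O.idD 1) f ≫ O.smashMap 1 1 a b ≫
      homCast O.opCat (one_mul a) (one_mul b) = f :=
  (Category.assoc _ _ _).symm.trans (map_one_smash' (F := funs V X) f)

theorem smashMap_one {X : ICat V} {a b : ℕ} (f : X ⟶ O.hom a b) :
    lift f (toUnit X ≫ O.idD 1) ≫ O.smashMap a b 1 1 ≫
      homCast O.opCat (mul_one a) (mul_one b) = f :=
  (Category.assoc _ _ _).symm.trans (map_smash_one' (F := funs V X) f)

theorem iota_smash (m n p q : ℕ) : (O.iotaMap m n ⊗ₘ O.iotaMap p q) ≫ O.smashMap m n p q =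
    vmap2 V PHom.smash ≫ O.iotaMap (m * p) (n * q) := VS_ext2 fun X φ ψ => by
  rw [← Category.assoc, lift_map, O.el_iota, O.el_iota, ← Category.assoc, el_vmap2, O.el_iota]
  unfold Operad.lowPt
  rw [lift_pt_smashMap]
  unfold Operad.PseudoCommutative.smashPt
  refine congrArg (O.pt _) (funext fun l => Operad.IsLow.ext ?_ (O.isLow_low _ _ _))
  have e : φ.1.deg (finProdFinEquiv.symm l).1 * ψ.1.deg (finProdFinEquiv.symm l).2 =
      ∑ _ : Fin (φ.1.deg (finProdFinEquiv.symm l).1), ψ.1.deg (finProdFinEquiv.symm l).2 := by simp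
  have h := (((O.isLow_low X _ (φ.2 (finProdFinEquiv.symm l).1)).gam fun _ =>
    O.isLow_low X _ (ψ.2 (finProdFinEquiv.symm l).2)).act (finCongr e)).act
      (finCongr (FHom.deg_smash φ.1 ψ.1 l))
  unfold Operad.pairing
  convert! h using 1
  rw [Category.assoc, Category.assoc, ← Category.assoc, Operad.comp_gam, lift_fst]
  simp only [lift_snd]

theorem smash_xi (m n p q : ℕ) : O.smashMap m n p q ≫ O.xiMap (m * p) (n * q) =
    (O.xiMap m n ⊗ₘ O.xiMap p q) ≫ vmap2 V FHom.smash := O.hom_ext2' fun X φ c ψ d => by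
  rw [← Category.assoc, lift_pt_smashMap, ← Category.assoc, lift_map, O.pt_xi, O.pt_xi, el_vmap2]
  unfold Operad.PseudoCommutative.smashPt
  rw [O.pt_xi]

end Strictness
end ICat

/-! ### Basepoints and the permutations `τ` -/

namespace ICat
open Stage

section Basepoint
variable {V : Type u} [Category.{v} V] [CartesianMonoidalCategory V] [MonoidalClosed V]
  [HasLimits V] [HasColimits (ICat V)]
variable {O : Operad V} (A : O.PseudoCommutative) {T : V} {m n p q m' n' p' q' : ℕ}
  {F : Stage V} {X Y Z : Type}

/-- The basepoint of the generalized 1-cells. -/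
noncomputable def pt1 (O : Operad V) (T : V) (m n : ℕ) : Cell1 O.catOp.enr T m n :=
  constCell O.catOp.enr T (O.catOp.based.pt m n)

theorem pre_pt1 {T' : V} (k : T' ⟶ T) : pt1 O T' m n = k ≫ pt1 O T m n := pre_constCell k _

theorem pt1_cell (O : Operad V) (T : V) (m n : ℕ) :
    ∃ c, pt1 O T m n = stdCell (Span.zero (Fin m) (Fin n)) c := constCell_pt _ _

theorem th_pt_f₁ (f₂ : Cell1 O.catOp.enr T m' n') (g₁ : Cell1 O.catOp.enr T n p)
    (g₂ : Cell1 O.catOp.enr T n' p') :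
    A.smashData.th (pt1 O T m n) f₂ g₁ g₂ = one (pt1 O T (m * m') (p * p')) :=
  samePasting_singleton.1 (same_cells3
    (L := fun {T} f₂ g₁ g₂ => [A.smashData.th (pt1 O T m n) f₂ g₁ g₂])
    (L' := fun {T} _ _ _ => [one (pt1 O T (m * m') (p * p'))])
    (fun k _ _ _ => ⟨by rw [pre_pt1 k, pre_th]; rfl, by simp⟩)
    (fun k _ _ _ => ⟨by rw [pre_pt1 k, pre_one]; rfl, by simp⟩)
    (fun T s₁ s₂ s₃ x y z => by
      obtain ⟨c, hc⟩ := pt1_cell O T m n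
      rw [samePasting_singleton, hc, th_cell]
      exact cell2_eq_zero _ _ _ fun b => ⟨fun k => k.1.2.elim⟩) f₂ g₁ g₂)

theorem th_pt_f₂ (f₁ : Cell1 O.catOp.enr T m n) (g₁ : Cell1 O.catOp.enr T n p)
    (g₂ : Cell1 O.catOp.enr T n' p') :
    A.smashData.th f₁ (pt1 O T m' n') g₁ g₂ = one (pt1 O T (m * m') (p * p')) :=
  samePasting_singleton.1 (same_cells3
    (L := fun {T} f₁ g₁ g₂ => [A.smashData.th f₁ (pt1 O T m' n') g₁ g₂])
    (L' := fun {T} _ _ _ => [one (pt1 O T (m * m') (p * p'))])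
    (fun k _ _ _ => ⟨by rw [pre_pt1 k, pre_th]; rfl, by simp⟩)
    (fun k _ _ _ => ⟨by rw [pre_pt1 k, pre_one]; rfl, by simp⟩)
    (fun T s₁ s₂ s₃ x y z => by
      obtain ⟨c, hc⟩ := pt1_cell O T m' n'
      rw [samePasting_singleton, hc, th_cell]
      exact cell2_eq_zero _ _ _ fun b => ⟨fun k => k.2.2.elim⟩) f₁ g₁ g₂)

theorem th_pt_g₁ (f₁ : Cell1 O.catOp.enr T m n) (f₂ : Cell1 O.catOp.enr T m' n')
    (g₂ : Cell1 O.catOp.enr T n' p') :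
    A.smashData.th f₁ f₂ (pt1 O T n p) g₂ = one (pt1 O T (m * m') (p * p')) :=
  samePasting_singleton.1 (same_cells3
    (L := fun {T} f₁ f₂ g₂ => [A.smashData.th f₁ f₂ (pt1 O T n p) g₂])
    (L' := fun {T} _ _ _ => [one (pt1 O T (m * m') (p * p'))])
    (fun k _ _ _ => ⟨by rw [pre_pt1 k, pre_th]; rfl, by simp⟩)
    (fun k _ _ _ => ⟨by rw [pre_pt1 k, pre_one]; rfl, by simp⟩)
    (fun T s₁ s₂ s₃ x y z => by
      obtain ⟨c, hc⟩ := pt1_cell O T n p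
      rw [samePasting_singleton, hc, th_cell]
      exact cell2_eq_zero _ _ _ fun b => ⟨fun k => k.1.1.elim⟩) f₁ f₂ g₂)

theorem th_pt_g₂ (f₁ : Cell1 O.catOp.enr T m n) (f₂ : Cell1 O.catOp.enr T m' n')
    (g₁ : Cell1 O.catOp.enr T n p) :
    A.smashData.th f₁ f₂ g₁ (pt1 O T n' p') = one (pt1 O T (m * m') (p * p')) :=
  samePasting_singleton.1 (same_cells3
    (L := fun {T} f₁ f₂ g₁ => [A.smashData.th f₁ f₂ g₁ (pt1 O T n' p')])
    (L' := fun {T} _ _ _ => [one (pt1 O T (m * m') (p * p'))])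
    (fun k _ _ _ => ⟨by rw [pre_pt1 k, pre_th]; rfl, by simp⟩)
    (fun k _ _ _ => ⟨by rw [pre_pt1 k, pre_one]; rfl, by simp⟩)
    (fun T s₁ s₂ s₃ x y z => by
      obtain ⟨c, hc⟩ := pt1_cell O T n' p'
      rw [samePasting_singleton, hc, th_cell]
      exact cell2_eq_zero _ _ _ fun b => ⟨fun k => k.2.1.elim⟩) f₁ f₂ g₁)

theorem tauHat_pt_left (g : Cell1 O.catOp.enr T p q) :
    A.symmetryData.th (pt1 O T m n) g = one (pt1 O T (m * p) (q * n)) :=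
  samePasting_singleton.1 (same_cells1
    (L := fun {T} g => [A.symmetryData.th (pt1 O T m n) g])
    (L' := fun {T} _ => [one (pt1 O T (m * p) (q * n))])
    (fun k _ => ⟨by rw [pre_pt1 k, pre_tauHat]; rfl, by simp⟩)
    (fun k _ => ⟨by rw [pre_pt1 k, pre_one]; rfl, by simp⟩)
    (fun T s₁ x => by
      obtain ⟨c, hc⟩ := pt1_cell O T m n
      rw [samePasting_singleton, hc, tauHat_cell]
      exact cell2_eq_zero _ _ _ fun b => ⟨fun k => k.1.elim⟩) g)

theorem tauHat_pt_right (f : Cell1 O.catOp.enr T m n) :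
    A.symmetryData.th f (pt1 O T p q) = one (pt1 O T (m * p) (q * n)) :=
  samePasting_singleton.1 (same_cells1
    (L := fun {T} f => [A.symmetryData.th f (pt1 O T p q)])
    (L' := fun {T} _ => [one (pt1 O T (m * p) (q * n))])
    (fun k _ => ⟨by rw [pre_pt1 k, pre_tauHat]; rfl, by simp⟩)
    (fun k _ => ⟨by rw [pre_pt1 k, pre_one]; rfl, by simp⟩)
    (fun T s₁ x => by
      obtain ⟨c, hc⟩ := pt1_cell O T p q
      rw [samePasting_singleton, hc, tauHat_cell]
      exact cell2_eq_zero _ _ _ fun b => ⟨fun k => k.2.elim⟩) f)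

theorem tauHat_id (T : V) (a c : ℕ) :
    A.symmetryData.th (id1 O.catOp.enr T a) (id1 O.catOp.enr T c) =
      one (A.symmetryData.t1 T a c) := by
  rw [id1_cell (Equiv.refl _), id1_cell (Equiv.refl _), tauHat_cell,
    t1_cell A (Equiv.refl _) (Equiv.refl _), one_cell]
  refine cell_congr' (fun b => Equiv.prodUnique Unit Unit) (fun b k => rfl) fun b => ?_
  rw [Lab.alpha_low_left A Lab.isLow_unit]
  exact (Lab.tens_unit _).ap _

theorem tau_comp_tau (a b : ℕ) : lift (O.lowPt (𝟙_ (ICat V)) (PHom.tau a b))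
    (O.lowPt (𝟙_ (ICat V)) (PHom.tau b a)) ≫ O.compD (a * b) (b * a) (a * b) = O.idD (a * b) := by
  have gen (F : Stage V) : F.map (O.compD (a * b) (b * a) (a * b)) (F.pair
      (F.map (O.lowPt (𝟙_ (ICat V)) (PHom.tau a b)) F.star)
      (F.map (O.lowPt (𝟙_ (ICat V)) (PHom.tau b a)) F.star)) = F.map (O.idD (a * b)) F.star := by
    rw [cell_tau (Equiv.refl _) (Equiv.refl _), cell_tau (Equiv.refl _) (Equiv.refl _), cell_comp]
    refine Eq.trans ?_ (cell_id (lexNum (Equiv.refl _) (Equiv.refl _))).symm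
    exact cell_congr' (fun _ => Equiv.sigmaUnique Unit fun _ => Unit) (fun _ _ => rfl)
      fun _ => Lab.gam_unit _
  have h {C : ICat V} (x : 𝟙_ (ICat V) ⟶ C) :
      (funs V (𝟙_ (ICat V))).map x (funs V (𝟙_ (ICat V))).star = x :=
    (congrArg (fun t => t ≫ x) (toUnit_unique (toUnit _) (𝟙 _))).trans (Category.id_comp _)
  have key := gen (funs V (𝟙_ (ICat V)))
  rw [h, h, h] at key
  exact key


/-- Change of the first index set of a span along a bijection. -/
abbrev Span.relabel (σ : X ≃ Y) (s : Span Y Z) : Span X Z where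
  K b := s.K b
  fin _ := inferInstance
  leg b k := σ.symm (s.leg b k)
  inj := σ.symm.injective.comp s.inj

theorem cell_relabel (σ : X ≃ Y) {v : X ≃ Fin m} {v' : Y ≃ Fin m} (u : Z ≃ Fin n) (s : Span Y Z)
    (c : ∀ b, Lab O F (s.K b)) (h : ∀ a, v' (σ a) = v a) :
    cell v' u s c = cell v u (s.relabel σ) c :=
  (cell_congr σ (Equiv.refl Z) h (fun _ => rfl) (fun _ => Equiv.refl _)
    (fun _ _ => (σ.apply_symm_apply _).symm) fun _ => Lab.Eqv.refl _).symm

/-- Composition of cells for two numberings that agree along a bijection. -/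
theorem comp1_relabel {W : Type} (σ : Y ≃ W) (v : X ≃ Fin m) {u : Y ≃ Fin n} {u' : W ≃ Fin n}
    (w : Z ≃ Fin p) (h : ∀ a, u' (σ a) = u a) (s : Span X Y) (t : Span W Z)
    (x : ∀ b, Lab O (obs V T) (s.K b)) (y : ∀ c, Lab O (obs V T) (t.K c)) :
    comp1 O.catOp.enr (cell1 v u s x) (cell1 u' w t y) =
      cell1 v w (s.comp (t.relabel σ)) fun c => Lab.gam (y c) fun k => x (σ.symm (t.leg c k)) :=
  (congrArg (comp1 O.catOp.enr _) (cell_relabel σ w t y h)).trans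
    (comp1_cell v u w s (t.relabel σ) x y)

theorem lexNum_assoc' {a b c : ℕ} (v : X ≃ Fin a) (u : Y ≃ Fin b) (w : Z ≃ Fin c)
    (i : (X × Y) × Z) : ((lexNum v (lexNum u w)).trans (finCongr (mul_assoc a b c).symm))
      (Equiv.prodAssoc X Y Z i) = lexNum (lexNum v u) w i :=
  (congrArg (finCongr (mul_assoc a b c).symm) (lexNum_assoc v u w i)).trans (by simp)

theorem tau_mul (T : V) (a b c : ℕ) :
    cast1 O.catOp.enr (mul_assoc a b c).symm rfl (A.symmetryData.t1 T a (b * c)) =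
      comp1 O.catOp.enr (A.smashData.sm1 (A.symmetryData.t1 T a b) (id1 O.catOp.enr T c))
        (cast1 O.catOp.enr (mul_assoc b a c).symm (mul_assoc b c a).symm
          (A.smashData.sm1 (id1 O.catOp.enr T b) (A.symmetryData.t1 T a c))) := by
  rw [t1_cell A (Equiv.refl _) (lexNum (Equiv.refl _) (Equiv.refl _)), cast1_cell,
    t1_cell A (Equiv.refl _) (Equiv.refl _), t1_cell A (Equiv.refl _) (Equiv.refl _),
    id1_cell (Equiv.refl _), id1_cell (Equiv.refl _), sm1_cell, sm1_cell, cast1_cell]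
  rw [comp1_relabel (Equiv.prodAssoc (Fin b) (Fin a) (Fin c)) _ _
    (lexNum_assoc' (Equiv.refl _) (Equiv.refl _) (Equiv.refl _))]
  refine cell_congr (Equiv.prodAssoc _ _ _).symm (Equiv.prodAssoc _ _ _)
    (fun i => (lexNum_assoc' (Equiv.refl _) (Equiv.refl _) (Equiv.refl _)
      ((Equiv.prodAssoc _ _ _).symm i)).symm)
    (fun i => lexNum_assoc' (Equiv.refl _) (Equiv.refl _) (Equiv.refl _) i)
    (fun _ => ⟨fun _ => ⟨((), ()), ((), ())⟩, fun _ => (), fun _ => rfl, fun _ => rfl⟩) (fun _ _ =>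
        rfl) fun _ => ?_
  exact Lab.isLow_unit.eqv ((Lab.isLow_unit.tens Lab.isLow_unit).gam fun _ =>
    Lab.isLow_unit.tens Lab.isLow_unit) _

end Basepoint
end ICat

/-! ### The symmetry axiom and compatibility of the symmetry with composition -/

namespace ICat
open Stage

namespace Lab
section SymmComp
variable {V : Type u} [Category.{v} V] [CartesianMonoidalCategory V] [HasLimits V]
variable {O : Operad V} (A : O.PseudoCommutative) {F G : Stage V} {T : V}
  {S P : Type} [Finite S] [Finite P]
  {R : S → Type} {Q : P → Type} [∀ s, Finite (R s)] [∀ p, Finite (Q p)]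

/-- The bijection `((s, r), (p, q)) ↦ ((p, s), (r, q))`. -/
def swapMid' (R : S → Type) (Q : P → Type) :
    (Σ s, R s) × (Σ p, Q p) ≃ Σ k : P × S, R k.2 × Q k.1 where
  toFun a := ⟨(a.2.1, a.1.1), (a.1.2, a.2.2)⟩
  invFun a := (⟨a.1.2, a.2.1⟩, ⟨a.1.1, a.2.2⟩)
  left_inv _ := rfl
  right_inv _ := rfl

theorem one_tens {S R : Type} [Finite S] [Finite R] (x : Lab O (obs V T) S)
    (y : Lab O (obs V T) R) : (tens x y).one = tens x.one y.one := ap_tens _ _ _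

theorem one_gam (x : Lab O (obs V T) S) (y : ∀ s, Lab O (obs V T) (R s)) :
    (gam x y).one = gam x.one fun s => (y s).one := ap_gam _ _ _

theorem one_re {S' : Type} [Finite S'] (x : Lab O (obs V T) S) (e : S' ≃ S) :
    (x.re e).one = x.one.re e := ap_re _ _ _

/-- The bijection `((s, r), p) ↦ ((s, p), r)`. -/
def distL' (R : S → Type) (P : Type) : (Σ s, R s) × P ≃ Σ k : S × P, R k.1 where
  toFun a := ⟨(a.1.1, a.2), a.1.2⟩
  invFun a := (⟨a.1.1, a.2⟩, a.1.2)
  left_inv _ := rfl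
  right_inv _ := rfl

/-- The bijection `((s, r), p) ↦ (s, (r, p))`. -/
def dist' (R : S → Type) (P : Type) : (Σ s, R s) × P ≃ Σ s, R s × P where
  toFun a := ⟨a.1.1, a.1.2, a.2⟩
  invFun a := (⟨a.1, a.2.1⟩, a.2.2)
  left_inv _ := rfl
  right_inv _ := rfl

/-- Associativity of the composition, with the labels of the first composite renamed. -/
theorem gam_re_gam {U : Type} [Finite U] {L : U → Type} [∀ u, Finite (L u)] (x : Lab O F S)
    (y : ∀ s, Lab O F (R s)) (e : U ≃ Σ s, R s) (z : ∀ u, Lab O F (L u)) :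
    Eqv ((Equiv.sigmaCongrLeft' e).trans (sigAssoc fun k => L (e.symm k)))
      (gam ((gam x y).re e) z) (gam x fun s => gam (y s) fun r => z (e.symm ⟨s, r⟩)) := by
  have h := Eqv.gam (K := fun k => L (e.symm k)) (K' := L) (τ := fun _ => Equiv.refl _)
    (y := fun k => z (e.symm k)) (y' := z) (Eqv.of_re (gam x y) e).symm fun k => Eqv.refl _
  refine (h.symm.trans (gam_assoc x y fun k => z (e.symm k))).of_eq_symm fun _ => rfl

/-- Compatibility of the symmetry with composition. The decompositions of `α` at the two
composites express `α_{γ(w; z), γ(x; y)}` by `α_{z, x}`, `α_{z, y}`, `α_{w, x}` and `α_{w, y}`, and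
the first of these is cancelled by `α_{x, z}`. -/
theorem alpha_gam_gam (x : Lab O (obs V T) S) (w : Lab O (obs V T) P)
    (y : ∀ s, Lab O (obs V T) (R s)) (z : ∀ p, Lab O (obs V T) (Q p)) :
    ∃ q r, Cmp ((gam (alpha A w x) fun k => (tens (y k.1) (z k.2)).one).re (swapMid R Q).symm)
        (inter A x w y z) q ∧
      Cmp ((gam (tens w x).one fun k => alpha A (z k.1) (y k.2)).re (swapMid' R Q)) q r ∧
      Cmp ((inter A w x z y).re (Equiv.prodComm _ _)) (alpha A (gam w z) (gam x y)) r := by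
  -- decompose first in the variable `γ(w; z)`, then each factor in the variable `γ(x; y)`
  have h := alpha_gam A w z (gam x y)
  have h1 (p : P) := alpha_gam' A x y (z p)
  have h2 := alpha_gam' A x y w
  have h3 := ((Cmp.one w).gam h1).re (dist Q (Σ s, R s))
  have h4 := (h2.gam (K := fun k : (Σ s, R s) × P => Q k.2) fun k => Cmp.one (z k.2)).re
    (distL Q (Σ s, R s))
  have e1 : (gam w.one fun p => (gam x.one fun s => alpha A (z p) (y s)).re (dist' R (Q p))).re
        (dist Q (Σ s, R s)) =
      (gam (tens w x).one fun k => alpha A (z k.1) (y k.2)).re (swapMid' R Q) := by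
    have k1 := Eqv.gam_right w.one fun p =>
      Eqv.of_re (gam x.one fun s => alpha A (z p) (y s)) (dist' R (Q p))
    have k2 := gam_assoc (L := fun k : Σ _ : P, S => R k.2 × Q k.1) w.one (fun _ => x.one)
      fun k => alpha A (z k.1) (y k.2)
    have k3 := Eqv.gam (K := fun k : P × S => R k.2 × Q k.1)
      (K' := fun k : Σ _ : P, S => R k.2 × Q k.1) (τ := fun _ => Equiv.refl _)
      (y := fun k => alpha A (z k.1) (y k.2)) (y' := fun k => alpha A (z k.1) (y k.2))
      (tens_eqv w.one x.one) fun k => Eqv.refl _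
    rw [one_tens]
    exact ((((Eqv.of_re _ (dist Q (Σ s, R s))).trans k1).trans k2.symm).trans k3.symm).of_eq
      (e' := swapMid' R Q) fun _ => rfl
  have e2 : (gam ((gam (alpha A w x) fun k => (y k.1).one).re (distL' R P)) fun k =>
        (z k.2).one).re (distL Q (Σ s, R s)) =
      (gam (alpha A w x) fun k => (tens (y k.1) (z k.2)).one).re (swapMid R Q).symm := by
    have k1 := gam_re_gam (alpha A w x) (fun k => (y k.1).one) (distL' R P) fun k => (z k.2).one
    have k2 := Eqv.gam_right (alpha A w x) fun k =>
      ((tens_eqv (y k.1) (z k.2)).ap (Stage.idm T)).trans_eq (one_gam _ _)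
    exact (((Eqv.of_re _ (distL Q (Σ s, R s))).trans k1).trans k2.symm).of_eq
      (e' := (swapMid R Q).symm) fun _ => rfl
  have e3 : (gam ((gam x.one fun s => alpha A w (y s)).re (dist' R P)) fun k =>
        (z k.2).one).re (distL Q (Σ s, R s)) = inter A x w y z := by
    have k1 := gam_re_gam x.one (fun s => alpha A w (y s)) (dist' R P) fun k => (z k.2).one
    exact ((Eqv.of_re _ (distL Q (Σ s, R s))).trans k1).of_eq (e' := mid R Q) fun _ => rfl
  -- the terms `α_{x, z_p}` of the interchange for `(w, x, z, y)` cancel the terms `α_{z_p, x}`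
  have e4 : ∃ a : Lab O (obs V T) ((Σ s, R s) × (Σ p, Q p)),
      Cmp ((inter A w x z y).re (Equiv.prodComm _ _))
        ((gam w.one fun p => (gam (alpha A (z p) x) fun k => (y k.1).one).re
          (distL' R (Q p))).re (dist Q (Σ s, R s))) a.one := by
    let e : (Σ s, R s) × (Σ p, Q p) ≃ Σ p, Σ k : Q p × S, R k.2 :=
      (Equiv.prodComm _ _).trans (mid Q R)
    refine ⟨(gam w fun p => gam ((tens x (z p)).re (Equiv.prodComm _ _)) fun k => y k.2).re e, ?_⟩
    refine Cmp.of_eqv (e := e) ((Cmp.one w).gam fun p => (alpha_inv A x (z p)).gam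
      (K := fun k : Q p × S => R k.2) fun k => Cmp.one (y k.2)) ?_ ?_ ?_
    · exact (Eqv.of_re _ _).trans (Eqv.of_re _ _)
    · have k1 (p : P) := Eqv.gam (K := fun k : Q p × S => R k.2) (K' := fun k : S × Q p => R k.1)
        (τ := fun _ => Equiv.refl _) (y := fun k => (y k.2).one) (y' := fun k => (y k.1).one)
        (Eqv.of_re (alpha A (z p) x) (Equiv.prodComm (Q p) S)) fun k => Eqv.refl _
      have k2 := Eqv.gam_right w.one fun p => (Eqv.of_re _ (distL' R (Q p))).trans (k1 p).symm
      exact ((Eqv.of_re _ (dist Q (Σ s, R s))).trans k2).of_eq fun _ => rfl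
    · refine ((Eqv.of_re _ e).ap _).trans_eq ((one_gam _ _).trans ?_)
      congr 1
      funext p
      exact one_gam _ _
  obtain ⟨a, e4⟩ := e4
  have g1 := e1 ▸ h3
  have g2 := e2 ▸ e3 ▸ h4
  have g3 := e4.assoc (Cmp.id_left (g1.mid.symm.trans (e4.tgt.symm.trans (tgt_one a)))) g1
  obtain ⟨r, hr⟩ := Cmp.exists (g1.tgt.symm.trans h.mid)
  exact ⟨_, r, g2, hr, g3.assoc hr h⟩

end SymmComp
end Lab

section Symmetry
variable {V : Type u} [Category.{v} V] [CartesianMonoidalCategory V] [MonoidalClosed V]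
  [HasLimits V] [HasColimits (ICat V)]
variable {O : Operad V} (A : O.PseudoCommutative) {T : V} {m n p q m' n' p' q' : ℕ}
  {X Y Z : Type}

/-- A 2-cell with its labels renamed. -/
theorem cell2_re {v : X ≃ Fin m} {u : Y ≃ Fin n} {s : Span X Y} {s' : Span X Y}
    (c : ∀ b, Lab O (mors V T) (s.K b)) (e : ∀ b, s'.K b ≃ s.K b)
    (he : ∀ b k, s.leg b (e b k) = s'.leg b k) :
    cell2 v u s c = cell2 v u s' fun b => (c b).re (e b) :=
  (cell_congr' e he fun b => Lab.Eqv.of_re (c b) (e b)).symm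

/-- Change of the second index set of a span along a bijection. -/
abbrev Span.retarget (ρ : Y ≃ Z) (s : Span X Y) : Span X Z where
  K b := s.K (ρ.symm b)
  fin _ := inferInstance
  leg b k := s.leg (ρ.symm b) k
  inj := by
    rintro ⟨b, k⟩ ⟨b', k'⟩ h
    have h1 := s.inj (a₁ := ⟨_, k⟩) (a₂ := ⟨_, k'⟩) h
    simp only [Sigma.mk.injEq] at h1
    obtain ⟨h1, h2⟩ := h1
    obtain rfl := ρ.symm.injective h1
    obtain rfl := eq_of_heq h2
    rfl

theorem compIs_cell2 {v : X ≃ Fin m} {u : Y ≃ Fin n} {s : Span X Y}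
    {x y z : ∀ b, Lab O (mors V T) (s.K b)} (h : ∀ b, Lab.Cmp (x b) (y b) (z b)) :
    CompIs (V := V) (cell2 v u s x) (cell2 v u s y) (cell2 v u s z) := compIs_cell h

theorem one_t1 (v : X ≃ Fin m) (u : Y ≃ Fin n) : one (A.symmetryData.t1 T m n) =
    cell2 (lexNum v u) (lexNum u v) (Span.ofEquiv (Equiv.prodComm X Y)) fun _ => Lab.unit :=
  (congrArg one (t1_cell A v u)).trans ((one_cell _ _ _ _).trans
    (congrArg (cell2 _ _ _) (funext fun _ => Lab.ap_unit _)))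

theorem comp2_ofEquiv_left (e : X ≃ Y) (v : X ≃ Fin m) (u : Y ≃ Fin n) (w : Z ≃ Fin p)
    (s : Span Y Z) (c : ∀ b, Lab O (mors V T) (s.K b)) :
    comp2 O.catOp.enr (cell2 v u (Span.ofEquiv e) fun _ => Lab.unit) (cell2 u w s c) =
      cell2 v w (s.relabel e) c := by
  rw [comp2_cell]
  refine cell_congr' (fun b => Equiv.sigmaUnique _ fun _ => Unit) (fun _ _ => rfl) fun b => ?_
  exact Lab.gam_unit (K := fun _ => Unit) (c b)

theorem comp2_ofEquiv_right (e : X ≃ Y) (v : Z ≃ Fin m) (u : X ≃ Fin n) (w : Y ≃ Fin p)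
    (s : Span Z X) (c : ∀ b, Lab O (mors V T) (s.K b)) :
    comp2 O.catOp.enr (cell2 v u s c) (cell2 u w (Span.ofEquiv e) fun _ => Lab.unit) =
      cell2 v w (s.retarget e) fun b => c (e.symm b) := by
  rw [comp2_cell]
  refine cell_congr' (fun b => Equiv.uniqueSigma fun _ : Unit => s.K _) (fun _ _ => rfl)
    fun b => ?_
  exact Lab.unit_gam (S := Unit) (K := fun _ => s.K (e.symm b)) fun _ => c (e.symm b)

theorem comp2_t1_left (v : X ≃ Fin m) (u : Y ≃ Fin n) (w : Z ≃ Fin p) (s : Span (Y × X) Z)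
    (c : ∀ b, Lab O (mors V T) (s.K b)) :
    comp2 O.catOp.enr (one (A.symmetryData.t1 T m n)) (cell2 (lexNum u v) w s c) =
      cell2 (lexNum v u) w (s.relabel (Equiv.prodComm X Y)) c := by
  rw [one_t1 A v u, comp2_ofEquiv_left]

theorem comp2_t1_right (v : X ≃ Fin m) (u : Y ≃ Fin n) (w : Z ≃ Fin p) (s : Span Z (X × Y))
    (c : ∀ b, Lab O (mors V T) (s.K b)) :
    comp2 O.catOp.enr (cell2 w (lexNum v u) s c) (one (A.symmetryData.t1 T m n)) =
      cell2 w (lexNum u v) (s.retarget (Equiv.prodComm X Y)) fun b => c b.swap := by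
  rw [one_t1 A v u, comp2_ofEquiv_right]
  rfl

/-- The symmetry axiom, from that of `α`. -/
theorem tauHat_tauHat {a b c d : ℕ} (f : Cell1 O.catOp.enr T a b) (g : Cell1 O.catOp.enr T c d) :
    IsPasting _ [comp2 O.catOp.enr (one (A.symmetryData.t1 T a c)) (A.symmetryData.th g f),
      comp2 O.catOp.enr (A.symmetryData.th f g) (one (A.symmetryData.t1 T d b))]
      (one (A.smashData.sm1 f g)) := by
  obtain ⟨m, h1, h2⟩ := same_cells2
    (L := fun {T} f g => [comp2 O.catOp.enr (one (A.symmetryData.t1 T a c))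
      (A.symmetryData.th g f), comp2 O.catOp.enr (A.symmetryData.th f g)
        (one (A.symmetryData.t1 T d b))])
    (L' := fun {T} f g => [one (A.smashData.sm1 f g)])
    (fun k f g => ⟨by
      rw [pre_t1 k, pre_t1 k, pre_one, pre_one, pre_tauHat, pre_tauHat, pre_comp2, pre_comp2]; rfl,
      by simp⟩)
    (fun k f g => ⟨by rw [pre_sm1, pre_one]; rfl, by simp⟩)
    (fun T s s' x x' => by
      rw [tauHat_cell, tauHat_cell, comp2_t1_left, comp2_t1_right, sm1_cell, one_cell]
      refine ⟨_, isPasting_two.2 ?_, rfl⟩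
      refine ICat.CompIs.congr (compIs_cell2 fun b => Lab.alpha_symm A (x b.1) (x' b.2))
        ?_ ?_ rfl
      · exact cell2_re (s := (s'.prodSwap s).relabel (Equiv.prodComm _ _)) (s' := s.prod s') _
          (fun b => Equiv.prodComm _ _) fun _ _ => rfl
      · rfl) f g
  exact (show _ = m from h2) ▸ h1

end Symmetry
end ICat

namespace ICat
open Stage

section SymmetryComp
variable {V : Type u} [Category.{v} V] [CartesianMonoidalCategory V] [MonoidalClosed V]
  [HasLimits V] [HasColimits (ICat V)]
variable {O : Operad V} (A : O.PseudoCommutative) {T : V} {m n p q m' n' p' q' : ℕ}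
  {X Y Z : Type}

theorem samePasting_three_two {C : ICat V} {a b c d e r s : T ⟶ C.Mor}
    (h₁ : CompIs (V := V) b c s) (h₂ : CompIs (V := V) a s r) (h₃ : CompIs (V := V) d e r) :
    SamePasting C [a, b, c] [d, e] :=
  ⟨r, isPasting_cons.2 ⟨s, isPasting_two.2 h₁, h₂⟩, isPasting_two.2 h₃⟩

/-- Compatibility of the symmetry with composition, coordinate by coordinate given by
`Lab.alpha_gam_gam`. -/
theorem tauHat_comp_cells {a a' a'' c c' c'' : ℕ} (s : Span (Fin a) (Fin a'))
    (t : Span (Fin c) (Fin c')) (s' : Span (Fin a') (Fin a'')) (t' : Span (Fin c') (Fin c''))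
    (x : ∀ b, Lab O (obs V T) (s.K b)) (y : ∀ b, Lab O (obs V T) (t.K b))
    (x' : ∀ b, Lab O (obs V T) (s'.K b)) (y' : ∀ b, Lab O (obs V T) (t'.K b)) :
    SamePasting _
      [comp2 O.catOp.enr (A.symmetryData.th (stdCell s x) (stdCell t y))
          (one (A.smashData.sm1 (stdCell t' y') (stdCell s' x'))),
        comp2 O.catOp.enr (one (A.smashData.sm1 (stdCell s x) (stdCell t y)))
          (A.symmetryData.th (stdCell s' x') (stdCell t' y')),
        comp2 O.catOp.enr (A.smashData.th (stdCell s x) (stdCell t y) (stdCell s' x')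
          (stdCell t' y')) (one (A.symmetryData.t1 T a'' c''))]
      [comp2 O.catOp.enr (one (A.symmetryData.t1 T a c)) (A.smashData.th (stdCell t y)
          (stdCell s x) (stdCell t' y') (stdCell s' x')),
        A.symmetryData.th (comp1 O.catOp.enr (stdCell s x) (stdCell s' x'))
          (comp1 O.catOp.enr (stdCell t y) (stdCell t' y'))] := by
  choose q r h1 h2 h3 using fun b : Fin c'' × Fin a'' => Lab.alpha_gam_gam A (x' b.2) (y' b.1)
    (fun k => x (s'.leg b.2 k)) fun k => y (t'.leg b.1 k)
  rw [tauHat_cell, tauHat_cell, sm1_cell, sm1_cell, one_cell, one_cell, comp2_cell, comp2_cell,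
    th_cell, th_cell, comp2_t1_left, comp2_t1_right, comp1_cell, comp1_cell, tauHat_cell,
    cell2_re (s := (s.prodSwap t).comp (t'.prod s'))
      (s' := (s.comp s').prodSwap (t.comp t')) _
      (fun b => Lab.swapMid' (fun k => s.K (s'.leg b.2 k)) fun k => t.K (t'.leg b.1 k))
      fun _ _ => rfl,
    cell2_re (s := (s.prod t).comp (s'.prodSwap t'))
      (s' := (s.comp s').prodSwap (t.comp t')) _
      (fun b => (Lab.swapMid (fun k => s.K (s'.leg b.2 k)) fun k => t.K (t'.leg b.1 k)).symm)
      fun _ _ => rfl,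
    cell2_re (s := ((t.comp t').prod (s.comp s')).relabel (Equiv.prodComm _ _))
      (s' := (s.comp s').prodSwap (t.comp t')) _ (fun b => Equiv.prodComm _ _) fun _ _ => rfl]
  exact samePasting_three_two (compIs_cell2 h1) (compIs_cell2 h2) (compIs_cell2 h3)

theorem tauHat_comp {a a' a'' c c' c'' : ℕ} (f₁ : Cell1 O.catOp.enr T a a')
    (f₂ : Cell1 O.catOp.enr T c c') (g₁ : Cell1 O.catOp.enr T a' a'')
    (g₂ : Cell1 O.catOp.enr T c' c'') :
    SamePasting _
      [comp2 O.catOp.enr (A.symmetryData.th f₁ f₂) (one (A.smashData.sm1 g₂ g₁)),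
        comp2 O.catOp.enr (one (A.smashData.sm1 f₁ f₂)) (A.symmetryData.th g₁ g₂),
        comp2 O.catOp.enr (A.smashData.th f₁ f₂ g₁ g₂) (one (A.symmetryData.t1 T a'' c''))]
      [comp2 O.catOp.enr (one (A.symmetryData.t1 T a c)) (A.smashData.th f₂ f₁ g₂ g₁),
        A.symmetryData.th (comp1 O.catOp.enr f₁ g₁) (comp1 O.catOp.enr f₂ g₂)] :=
  same_cells4
    (L := fun {T} f₁ f₂ g₁ g₂ =>
      [comp2 O.catOp.enr (A.symmetryData.th f₁ f₂) (one (A.smashData.sm1 g₂ g₁)),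
        comp2 O.catOp.enr (one (A.smashData.sm1 f₁ f₂)) (A.symmetryData.th g₁ g₂),
        comp2 O.catOp.enr (A.smashData.th f₁ f₂ g₁ g₂) (one (A.symmetryData.t1 T a'' c''))])
    (L' := fun {T} f₁ f₂ g₁ g₂ =>
      [comp2 O.catOp.enr (one (A.symmetryData.t1 T a c)) (A.smashData.th f₂ f₁ g₂ g₁),
        A.symmetryData.th (comp1 O.catOp.enr f₁ g₁) (comp1 O.catOp.enr f₂ g₂)])
    (fun k f₁ f₂ g₁ g₂ => ⟨by
      rw [pre_t1 k, pre_tauHat, pre_tauHat, pre_sm1, pre_sm1, pre_th, pre_one, pre_one, pre_one,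
        pre_comp2, pre_comp2, pre_comp2]; rfl, by simp⟩)
    (fun k f₁ f₂ g₁ g₂ => ⟨by
      rw [pre_t1 k, pre_one, pre_th, pre_comp2, pre_comp1, pre_comp1, pre_tauHat]; rfl, by simp⟩)
    (fun T s t s' t' x y x' y' => tauHat_comp_cells A s t s' t' x y x' y') f₁ f₂ g₁ g₂

theorem fromPi_t1 (T : V) (a b : ℕ) : O.catOp.FromPi (A.symmetryData.t1 T a b) :=
  ⟨_, (summand_iota (PHom.tau a b) (toUnit T)).symm⟩

section Generic
variable {K : Type w} {E : EnrichedCategory (ICat V) K} {a b c d : K}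

theorem app_comp2 (h : (mors V T).Hom (obs V T)) (x : Cell2 E T a b) (y : Cell2 E T b c) :
    h.app (comp2 E x y) = comp1 E (h.app x) (h.app y) :=
  (h.nat (E.comp a b c) ((mors V T).pair x y)).trans
    (congrArg ((obs V T).map (E.comp a b c)) (h.pair _ _))

theorem app_cast2 (h : (mors V T).Hom (obs V T)) {a' b' : K} (ha : a = a') (hb : b = b')
    (x : Cell2 E T a b) : h.app (cast2 E ha hb x) = cast1 E ha hb (h.app x) := h.nat _ _

theorem app_sm2 [Mul K] {S : SmashData E} (h : (mors V T).Hom (obs V T)) (x : Cell2 E T a b)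
    (y : Cell2 E T c d) : h.app (S.sm2 x y) = S.sm1 (h.app x) (h.app y) :=
  (h.nat (S.map a b c d) ((mors V T).pair x y)).trans
    (congrArg ((obs V T).map (S.map a b c d)) (h.pair _ _))

theorem comp2_one (f : Cell1 E T a b) (g : Cell1 E T b c) :
    comp2 E (one f) (one g) = one (comp1 E f g) :=
  ((congrArg ((mors V T).map (E.comp a b c)) ((Stage.idm T).pair f g)).symm.trans
    ((Stage.idm T).nat (E.comp a b c) ((obs V T).pair f g)).symm)

theorem cast2_one {a' b' : K} (ha : a = a') (hb : b = b') (f : Cell1 E T a b) :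
    cast2 E ha hb (one f) = one (cast1 E ha hb f) := ((Stage.idm T).nat _ f).symm

theorem src_one (f : Cell1 E T a b) : (Stage.src T).app (one f) = f := src_idm
theorem tgt_one (f : Cell1 E T a b) : (Stage.tgt T).app (one f) = f := tgt_idm

theorem map_comp_id {F : Stage V} (x : F.obj (E.Hom a b)) :
    F.map (E.comp a b b) (F.pair x (F.map (E.id b) F.star)) = x := by
  have h := congrArg (fun t => F.map t x) (cmpX_id E (𝟙 (E.Hom a b)))
  rw [F.map_id] at h
  refine Eq.trans ?_ h
  change _ = F.map (lift _ _ ≫ _) x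
  rw [F.map_comp, map_lift, F.map_id, F.map_comp, F.star_eq (F.map (toUnit _) x)]

theorem map_id_comp {F : Stage V} (x : F.obj (E.Hom a b)) :
    F.map (E.comp a a b) (F.pair (F.map (E.id a) F.star) x) = x := by
  have h := congrArg (fun t => F.map t x) (id_cmpX E (𝟙 (E.Hom a b)))
  rw [F.map_id] at h
  refine Eq.trans ?_ h
  change _ = F.map (lift _ _ ≫ _) x
  rw [F.map_comp, map_lift, F.map_id, F.map_comp, F.star_eq (F.map (toUnit _) x)]

theorem comp1_id1 (f : Cell1 E T a b) : comp1 E f (id1 E T b) = f :=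
  map_comp_id (F := obs V T) f

theorem id1_comp1 (f : Cell1 E T a b) : comp1 E (id1 E T a) f = f :=
  map_id_comp (F := obs V T) f

end Generic

theorem src_tauHat (f : Cell1 O.catOp.enr T m n) (g : Cell1 O.catOp.enr T p q) :
    (Stage.src T).app (A.symmetryData.th f g) =
      comp1 O.catOp.enr (A.symmetryData.t1 T m p) (A.smashData.sm1 g f) :=
  (Category.assoc _ _ _).trans ((congrArg (fun t => obPair f g ≫ t)
    (A.symmetryData.tauHat m n p q).hom.src).trans (map_tauSrc (F := obs V T) f g))

theorem tgt_tauHat (f : Cell1 O.catOp.enr T m n) (g : Cell1 O.catOp.enr T p q) :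
    (Stage.tgt T).app (A.symmetryData.th f g) =
      comp1 O.catOp.enr (A.smashData.sm1 f g) (A.symmetryData.t1 T n q) :=
  (Category.assoc _ _ _).trans ((congrArg (fun t => obPair f g ≫ t)
    (A.symmetryData.tauHat m n p q).hom.tgt).trans (map_tauTgt (F := obs V T) f g))

end SymmetryComp
end ICat

/-! ### The hexagon axiom -/

namespace ICat
open Stage

namespace Lab
section Hexagon
variable {V : Type u} [Category.{v} V] [CartesianMonoidalCategory V] [HasLimits V]
variable {O : Operad V} (A : O.PseudoCommutative) {T : V} {X Y Z : Type} [Finite X] [Finite Y]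
  [Finite Z]

/-- The bijection `(a, (b, c)) ↦ (b, (a, c))`. -/
def leftSwap (X Y Z : Type) : X × (Y × Z) ≃ Y × (X × Z) where
  toFun a := (a.2.1, (a.1, a.2.2))
  invFun a := (a.2.1, (a.1, a.2.2))
  left_inv _ := rfl
  right_inv _ := rfl

/-- The bijection `((a, b), c) ↦ ((a, c), b)`. -/
def rightSwap (X Y Z : Type) : (X × Y) × Z ≃ (X × Z) × Y where
  toFun a := ((a.1.1, a.2), a.1.2)
  invFun a := ((a.1.1, a.2), a.1.2)
  left_inv _ := rfl
  right_inv _ := rfl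

/-- The decomposition of `α_{γ(y; z), x}` for a constant family `z`. -/
theorem alpha_tens (x : Lab O (obs V T) X) (y : Lab O (obs V T) Y) (z : Lab O (obs V T) Z) :
    Cmp ((tens y.one (alpha A z x)).re (leftSwap X Y Z))
      ((tens (alpha A y x) z.one).re (Equiv.prodAssoc X Y Z).symm) (alpha A (tens y z) x) := by
  refine Cmp.of_eqv
    (e := Equiv.prodCongr (Equiv.refl X) (Equiv.sigmaEquivProd Y Z).symm)
    (alpha_gam A y (fun _ => z) x) ?_ ?_ ?_
  · have h := (Eqv.of_re _ (leftSwap X Y Z)).trans (tens_eqv y.one (alpha A z x))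
    exact (h.trans (Eqv.of_re _ (dist (fun _ : Y => Z) X)).symm).of_eq fun _ => rfl
  · have h := (Eqv.of_re _ (Equiv.prodAssoc X Y Z).symm).trans (tens_eqv (alpha A y x) z.one)
    exact (h.trans (Eqv.of_re _ (distL (fun _ : Y => Z) X)).symm).of_eq fun _ => rfl
  · exact Eqv.alpha A (tens_eqv y z) (Eqv.refl x)

end Hexagon
end Lab

section Hexagon
variable {V : Type u} [Category.{v} V] [CartesianMonoidalCategory V] [MonoidalClosed V]
  [HasLimits V] [HasColimits (ICat V)]
variable {O : Operad V} (A : O.PseudoCommutative) {T : V} {X Y Z : Type}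

theorem sm1_t1_id1 {a b c : ℕ} (v : X ≃ Fin a) (u : Y ≃ Fin b) (w : Z ≃ Fin c) :
    A.smashData.sm1 (A.symmetryData.t1 T a b) (id1 O.catOp.enr T c) =
      cell1 ((lexNum v (lexNum u w)).trans (finCongr (mul_assoc a b c).symm))
        ((lexNum u (lexNum v w)).trans (finCongr (mul_assoc b a c).symm))
        (Span.ofEquiv (Lab.leftSwap X Y Z)) fun _ => Lab.unit := by
  rw [t1_cell A v u, id1_cell w, sm1_cell]
  refine cell_congr (Equiv.prodAssoc _ _ _) (Equiv.prodAssoc _ _ _) (lexNum_assoc' v u w)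
    (lexNum_assoc' u v w) (fun _ => Equiv.prodPUnit _) (fun _ _ => rfl) fun _ => ?_
  exact (Lab.isLow_unit.tens Lab.isLow_unit).eqv Lab.isLow_unit _

theorem sm1_id1_t1 {a b c : ℕ} (v : X ≃ Fin a) (u : Y ≃ Fin b) (w : Z ≃ Fin c) :
    cast1 O.catOp.enr (mul_assoc a b c).symm (mul_assoc a c b).symm
      (A.smashData.sm1 (id1 O.catOp.enr T a) (A.symmetryData.t1 T b c)) =
      cell1 (lexNum (lexNum v u) w) (lexNum (lexNum v w) u)
        (Span.ofEquiv (Lab.rightSwap X Y Z)) fun _ => Lab.unit := by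
  rw [t1_cell A u w, id1_cell v, sm1_cell, cast1_cell]
  refine (cell_congr (Equiv.prodAssoc _ _ _) (Equiv.prodAssoc _ _ _) (lexNum_assoc' v u w)
    (lexNum_assoc' v w u) (fun _ => (Equiv.prodPUnit _).symm) (fun _ _ => rfl) fun _ => ?_).symm
  exact Lab.isLow_unit.eqv (Lab.isLow_unit.tens Lab.isLow_unit) _

theorem one_cell_unit {m n : ℕ} (e : X ≃ Y) (v : X ≃ Fin m) (u : Y ≃ Fin n) :
    one (cell1 v u (Span.ofEquiv e) fun _ => (Lab.unit : Lab O (obs V T) Unit)) =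
      cell2 v u (Span.ofEquiv e) fun _ => Lab.unit := by
  rw [one_cell]
  exact congrArg (cell2 v u _) (funext fun _ => Lab.ap_unit _)

/-- The hexagon, without the constraints of the product, which are identities. It is the
decomposition of `α_{y ⊗ z, x}`. -/
theorem tauHat_mul_cells {a a' b b' c c' : ℕ} (s : Span (Fin a) (Fin a'))
    (t : Span (Fin b) (Fin b')) (w : Span (Fin c) (Fin c'))
    (x : ∀ i, Lab O (obs V T) (s.K i)) (y : ∀ i, Lab O (obs V T) (t.K i))
    (z : ∀ i, Lab O (obs V T) (w.K i)) :
    SamePasting _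
      [cast2 O.catOp.enr (mul_assoc a b c).symm rfl
        (A.symmetryData.th (stdCell s x) (A.smashData.sm1 (stdCell t y) (stdCell w z)))]
      [comp2 O.catOp.enr (one (A.smashData.sm1 (A.symmetryData.t1 T a b) (id1 O.catOp.enr T c)))
          (cast2 O.catOp.enr (mul_assoc b a c).symm (mul_assoc b' c' a').symm
            (A.smashData.sm2 (one (stdCell t y)) (A.symmetryData.th (stdCell s x) (stdCell w z)))),
        comp2 O.catOp.enr (A.smashData.sm2 (A.symmetryData.th (stdCell s x) (stdCell t y))
            (one (stdCell w z)))
          (cast2 O.catOp.enr (mul_assoc b' a' c').symm (mul_assoc b' c' a').symm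
            (one (A.smashData.sm1 (id1 O.catOp.enr T b') (A.symmetryData.t1 T a' c'))))] := by
  rw [cast2_one, sm1_id1_t1 A (Equiv.refl _) (Equiv.refl _) (Equiv.refl _),
    sm1_t1_id1 A (Equiv.refl _) (Equiv.refl _) (Equiv.refl _), tauHat_cell, tauHat_cell, sm1_cell,
    tauHat_cell, one_cell_unit, one_cell_unit, one_cell, one_cell, sm2_cell, sm2_cell, cast2_cell,
    cast2_cell, comp2_ofEquiv_left, comp2_ofEquiv_right]
  refine ⟨_, rfl, isPasting_two.2 (ICat.CompIs.congr (compIs_cell2 fun i =>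
    Lab.alpha_tens A (x i.2) (y i.1.1) (z i.1.2)) ?_ ?_ rfl)⟩
  · exact Eq.symm <| cell_congr (Equiv.refl _) (Equiv.prodAssoc _ _ _) (fun _ => rfl)
      (fun i => lexNum_assoc' (Equiv.refl _) (Equiv.refl _) (Equiv.refl _) i)
      (fun i => Lab.leftSwap _ _ _) (fun _ _ => rfl) fun i => Lab.Eqv.of_re _ _
  · exact cell_congr (Equiv.prodAssoc _ _ _) (Equiv.refl _)
      (fun i => lexNum_assoc' (Equiv.refl _) (Equiv.refl _) (Equiv.refl _) i) (fun _ => rfl)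
      (fun i => Equiv.prodAssoc _ _ _) (fun _ _ => rfl) fun i => (Lab.Eqv.of_re _ _).symm

/-- The hexagon for arbitrary 1-cells, without the constraints of the product. -/
theorem tauHat_mul' {a a' b b' c c' : ℕ} (f : Cell1 O.catOp.enr T a a')
    (g : Cell1 O.catOp.enr T b b') (h : Cell1 O.catOp.enr T c c') :
    SamePasting _
      [cast2 O.catOp.enr (mul_assoc a b c).symm rfl
        (A.symmetryData.th f (A.smashData.sm1 g h))]
      [comp2 O.catOp.enr (one (A.smashData.sm1 (A.symmetryData.t1 T a b) (id1 O.catOp.enr T c)))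
          (cast2 O.catOp.enr (mul_assoc b a c).symm (mul_assoc b' c' a').symm
            (A.smashData.sm2 (one g) (A.symmetryData.th f h))),
        comp2 O.catOp.enr (A.smashData.sm2 (A.symmetryData.th f g) (one h))
          (cast2 O.catOp.enr (mul_assoc b' a' c').symm (mul_assoc b' c' a').symm
            (one (A.smashData.sm1 (id1 O.catOp.enr T b') (A.symmetryData.t1 T a' c'))))] :=
  same_cells3
    (L := fun {T} f g h => [cast2 O.catOp.enr (mul_assoc a b c).symm rfl
        (A.symmetryData.th f (A.smashData.sm1 g h))])
    (L' := fun {T} f g h =>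
      [comp2 O.catOp.enr (one (A.smashData.sm1 (A.symmetryData.t1 T a b) (id1 O.catOp.enr T c)))
          (cast2 O.catOp.enr (mul_assoc b a c).symm (mul_assoc b' c' a').symm
            (A.smashData.sm2 (one g) (A.symmetryData.th f h))),
        comp2 O.catOp.enr (A.smashData.sm2 (A.symmetryData.th f g) (one h))
          (cast2 O.catOp.enr (mul_assoc b' a' c').symm (mul_assoc b' c' a').symm
            (one (A.smashData.sm1 (id1 O.catOp.enr T b') (A.symmetryData.t1 T a' c'))))])
    (fun k f g h => ⟨by rw [pre_sm1, pre_tauHat, pre_cast2]; rfl, by simp⟩)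
    (fun k f g h => ⟨by
      rw [pre_t1 k, pre_t1 k, pre_id1 k, pre_id1 k, pre_sm1, pre_sm1, pre_one, pre_one, pre_one,
        pre_one, pre_cast2, pre_tauHat, pre_tauHat, pre_sm2, pre_sm2, pre_cast2, pre_comp2,
        pre_comp2]; rfl, by simp⟩)
    (fun T s t w x y z => tauHat_mul_cells A s t w x y z) f g h

/-- Identities may be inserted around the two factors of a pasting. -/
theorem samePasting_insert {C : ICat V} {x e₁ y e₂ e₃ z e₄ : T ⟶ C.Mor}
    (h : SamePasting C [x] [y, z])
    (h₁ : e₁ = (Stage.idm T).app ((Stage.src T).app (y : (mors V T).obj C)))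
    (h₂ : e₂ = (Stage.idm T).app ((Stage.tgt T).app (y : (mors V T).obj C)))
    (h₃ : e₃ = (Stage.idm T).app ((Stage.src T).app (z : (mors V T).obj C)))
    (h₄ : e₄ = (Stage.idm T).app ((Stage.tgt T).app (z : (mors V T).obj C))) :
    SamePasting C [x] [e₁, y, e₂, e₃, z, e₄] := by
  subst h₁ h₂ h₃ h₄
  obtain ⟨r, hx, hyz⟩ := h
  have c : CompIs (V := V) y z r := isPasting_two.1 hyz
  exact ⟨r, hx, isPasting_cons.2 ⟨r, isPasting_cons.2 ⟨z, isPasting_cons.2 ⟨z,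
    isPasting_cons.2 ⟨z, isPasting_two.2 (CompIs.id_right rfl), CompIs.id_left rfl⟩,
    CompIs.id_left c.mid.symm⟩, c⟩, CompIs.id_left c.src⟩⟩

theorem tauHat_mul {a a' b b' c c' : ℕ} (f : Cell1 O.catOp.enr T a a')
    (g : Cell1 O.catOp.enr T b b') (h : Cell1 O.catOp.enr T c c') :
    SamePasting _
      [cast2 O.catOp.enr (mul_assoc a b c).symm rfl
        (A.symmetryData.th f (A.smashData.sm1 g h))]
      ([A.smashData.th (id1 O.catOp.enr T b) (A.symmetryData.t1 T a c) g (A.smashData.sm1 h f),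
          A.smashData.sm2 (one g) (A.symmetryData.th f h),
          A.smashData.thInv g (A.smashData.sm1 f h) (id1 O.catOp.enr T b')
            (A.symmetryData.t1 T a' c')].map (fun x =>
        comp2 O.catOp.enr
          (one (A.smashData.sm1 (A.symmetryData.t1 T a b) (id1 O.catOp.enr T c)))
          (cast2 O.catOp.enr (mul_assoc b a c).symm (mul_assoc b' c' a').symm x)) ++
      [A.smashData.th (A.symmetryData.t1 T a b) (id1 O.catOp.enr T c) (A.smashData.sm1 g f) h,
          A.smashData.sm2 (A.symmetryData.th f g) (one h),
          A.smashData.thInv (A.smashData.sm1 f g) h (A.symmetryData.t1 T a' b')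
            (id1 O.catOp.enr T c')].map (fun x =>
        comp2 O.catOp.enr x (cast2 O.catOp.enr (mul_assoc b' a' c').symm (mul_assoc b' c' a').symm
          (one (A.smashData.sm1 (id1 O.catOp.enr T b') (A.symmetryData.t1 T a' c')))))) := by
  -- each constraint of the product has an identity or a permutation in the first variable before
  -- the other morphisms, or in the second variable after them, and so is an identity
  rw [thInv_eq A _ _ _ _ (thIsId_of_fromPi_right A g (A.smashData.sm1 f h)
      (id1 O.catOp.enr T b') (fromPi_t1 A T a' c')),
    thInv_eq A _ _ _ _ (thIsId_of_fromPi_right A (A.smashData.sm1 f g) h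
      (A.symmetryData.t1 T a' b') (fromPi_id1 c')),
    show A.smashData.th (id1 O.catOp.enr T b) (A.symmetryData.t1 T a c) g (A.smashData.sm1 h f) = _
      from thIsId_of_fromPi_left A (fromPi_id1 b) _ _ _,
    show A.smashData.th (A.symmetryData.t1 T a b) (id1 O.catOp.enr T c) (A.smashData.sm1 g f) h = _
      from thIsId_of_fromPi_left A (fromPi_t1 A T a b) _ _ _,
    id1_comp1, id1_comp1, comp1_id1, comp1_id1]
  simp only [List.map_cons, List.map_nil, List.cons_append, List.nil_append, cast2_one, comp2_one]
  have key := tauHat_mul' A f g h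
  simp only [cast2_one] at key
  refine samePasting_insert key ?_ ?_ ?_ ?_
  · refine congrArg one (Eq.symm ?_)
    refine (app_comp2 _ _ _).trans (congrArg₂ (comp1 _) (src_one _) ?_)
    refine (app_cast2 _ _ _ _).trans (congrArg (cast1 _ _ _) ?_)
    exact (app_sm2 _ _ _).trans (congrArg₂ _ (src_one _) (src_tauHat A _ _))
  · refine congrArg one (Eq.symm ?_)
    refine (app_comp2 _ _ _).trans (congrArg₂ (comp1 _) (tgt_one _) ?_)
    refine (app_cast2 _ _ _ _).trans (congrArg (cast1 _ _ _) ?_)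
    exact (app_sm2 _ _ _).trans (congrArg₂ _ (tgt_one _) (tgt_tauHat A _ _))
  · refine congrArg one (Eq.symm ?_)
    refine (app_comp2 _ _ _).trans (congrArg₂ (comp1 _) ?_ (src_one _))
    exact (app_sm2 _ _ _).trans (congrArg₂ _ (src_tauHat A _ _) (src_one _))
  · refine congrArg one (Eq.symm ?_)
    refine (app_comp2 _ _ _).trans (congrArg₂ (comp1 _) ?_ (tgt_one _))
    exact (app_sm2 _ _ _).trans (congrArg₂ _ (tgt_tauHat A _ _) (tgt_one _))

end Hexagon
end ICat

/-! ### Compatibility of the product with triple composition -/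

namespace ICat
open Stage

namespace Lab
section TripleComp
variable {V : Type u} [Category.{v} V] [CartesianMonoidalCategory V] [HasLimits V]
variable {O : Operad V} (A : O.PseudoCommutative) {T : V} {S P : Type} [Finite S] [Finite P]
  {R : S → Type} {Q : P → Type} [∀ s, Finite (R s)] [∀ p, Finite (Q p)]
  {E : ∀ s, R s → Type} {G : ∀ p, Q p → Type} [∀ s r, Finite (E s r)] [∀ p q, Finite (G p q)]

theorem Eqv.re_eq_re {S' S'' : Type} [Finite S'] [Finite S''] {F : Stage V} {x : Lab O F S}
    {y : Lab O F S'} {e : S ≃ S'} (h : Eqv e x y) (f : S'' ≃ S) (g : S'' ≃ S')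
    (hg : ∀ a, e (f a) = g a) : x.re f = y.re g :=
  ((Eqv.of_re x f).trans h).of_eq hg

/-- The bijection `((s, r), l) ↦ (s, (r, l))`. -/
def prodSigma {R : Type} (L : S × R → Type) : (Σ k, L k) ≃ Σ s, Σ r, L (s, r) where
  toFun a := ⟨a.1.1, a.1.2, a.2⟩
  invFun a := ⟨(a.1, a.2.1), a.2.2⟩
  left_inv _ := rfl
  right_inv _ := rfl

theorem gam_tens {R : Type} [Finite R] {F : Stage V} {L : S × R → Type} [∀ k, Finite (L k)]
    (x : Lab O F S) (y : Lab O F R) (z : ∀ k, Lab O F (L k)) :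
    Eqv (prodSigma L) (gam (tens x y) z) (gam x fun s => gam y fun r => z (s, r)) := by
  have h1 := Eqv.gam (K := L) (K' := fun k : Σ _ : S, R => L (k.1, k.2))
    (τ := fun _ => Equiv.refl _) (y := z) (y' := fun k => z (k.1, k.2)) (tens_eqv x y)
    fun _ => Eqv.refl _
  exact (h1.trans (gam_assoc (L := fun k : Σ _ : S, R => L (k.1, k.2)) x (fun _ => y)
    fun k => z (k.1, k.2))).of_eq fun _ => rfl

/-- The bijection `((r, s), l) ↦ (s, (r, l))`. -/
def prodSigmaSwap {R : Type} (L : R × S → Type) : (Σ k, L k) ≃ Σ s, Σ r, L (r, s) where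
  toFun a := ⟨a.1.2, a.1.1, a.2⟩
  invFun a := ⟨(a.2.1, a.1), a.2.2⟩
  left_inv _ := rfl
  right_inv _ := rfl

theorem gam_tens_comm {R : Type} [Finite R] {F : Stage V} {L : R × S → Type} [∀ k, Finite (L k)]
    (x : Lab O F S) (y : Lab O F R) (z : ∀ k, Lab O F (L k)) :
    Eqv (prodSigmaSwap L) (gam ((tens x y).re (Equiv.prodComm R S)) z)
      (gam x fun s => gam y fun r => z (r, s)) := by
  have h1 := Eqv.gam (K := L) (K' := fun k : S × R => L (k.2, k.1))
    (τ := fun _ => Equiv.refl _) (y := z) (y' := fun k => z (k.2, k.1))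
    (Eqv.of_re (tens x y) (Equiv.prodComm R S)) fun _ => Eqv.refl _
  exact (h1.trans (gam_tens x y fun k => z (k.2, k.1))).of_eq fun _ => rfl

/-- The bijection `((s, r, e), (p, q, g)) ↦ (s, (r, p), (e, q), g)`. -/
def compNest (R : S → Type) (E : ∀ s, R s → Type) (Q : P → Type) (G : ∀ p, Q p → Type) :
    (Σ s, Σ r, E s r) × (Σ p, Σ q, G p q) ≃ Σ s, Σ rp : R s × P, Σ k : E s rp.1 × Q rp.2, G rp.2
        k.2 where
  toFun a := ⟨a.1.1, (a.1.2.1, a.2.1), (a.1.2.2, a.2.2.1), a.2.2.2⟩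
  invFun a := (⟨a.1, a.2.1.1, a.2.2.1.1⟩, ⟨a.2.1.2, a.2.2.1.2, a.2.2.2⟩)
  left_inv _ := rfl
  right_inv _ := rfl

/-- The bijection `((s, r, e), (p, q, g)) ↦ (s, r, (e, p), q, g)`. -/
def compNest' (R : S → Type) (E : ∀ s, R s → Type) (Q : P → Type) (G : ∀ p, Q p → Type) :
    (Σ s, Σ r, E s r) × (Σ p, Σ q, G p q) ≃ Σ s, Σ r, Σ k : E s r × P, Σ q, G k.2 q where
  toFun a := ⟨a.1.1, a.1.2.1, (a.1.2.2, a.2.1), a.2.2⟩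
  invFun a := (⟨a.1, a.2.1, a.2.2.1.1⟩, ⟨a.2.2.1.2, a.2.2.2⟩)
  left_inv _ := rfl
  right_inv _ := rfl

/-- The bijection `((s, r, e), (p, q, g)) ↦ (((s, r), (p, q)), (e, g))`. -/
def nestUpper (R : S → Type) (E : ∀ s, R s → Type) (Q : P → Type) (G : ∀ p, Q p → Type) :
    (Σ s, Σ r, E s r) × (Σ p, Σ q, G p q) ≃
      Σ k : (Σ s, R s) × (Σ p, Q p), E k.1.1 k.1.2 × G k.2.1 k.2.2 where
  toFun a := ⟨(⟨a.1.1, a.1.2.1⟩, ⟨a.2.1, a.2.2.1⟩), (a.1.2.2, a.2.2.2)⟩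
  invFun a := (⟨a.1.1.1, a.1.1.2, a.2.1⟩, ⟨a.1.2.1, a.1.2.2, a.2.2⟩)
  left_inv _ := rfl
  right_inv _ := rfl

/-- The bijection `((s, r, e), (p, q, g)) ↦ (((s, r), e), ((p, q), g))`. -/
def nestLower (R : S → Type) (E : ∀ s, R s → Type) (Q : P → Type) (G : ∀ p, Q p → Type) :
    (Σ s, Σ r, E s r) × (Σ p, Σ q, G p q) ≃
      (Σ k : Σ s, R s, E k.1 k.2) × (Σ k : Σ p, Q p, G k.1 k.2) where
  toFun a := (⟨⟨a.1.1, a.1.2.1⟩, a.1.2.2⟩, ⟨⟨a.2.1, a.2.2.1⟩, a.2.2.2⟩)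
  invFun a := (⟨a.1.1.1, a.1.1.2, a.1.2⟩, ⟨a.2.1.1, a.2.1.2, a.2.2⟩)
  left_inv _ := rfl
  right_inv _ := rfl

/-- The bijection `((s, r, e), (p, q, g)) ↦ ((s, p), ((r, e), (q, g)))`. -/
def nestPaired (R : S → Type) (E : ∀ s, R s → Type) (Q : P → Type) (G : ∀ p, Q p → Type) :
    (Σ s, Σ r, E s r) × (Σ p, Σ q, G p q) ≃
      Σ k : S × P, (Σ r, E k.1 r) × (Σ q, G k.2 q) where
  toFun a := ⟨(a.1.1, a.2.1), (a.1.2, a.2.2)⟩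
  invFun a := (⟨a.1.1, a.2.1⟩, ⟨a.1.2, a.2.2⟩)
  left_inv _ := rfl
  right_inv _ := rfl

variable (u : Lab O (obs V T) S) (v : Lab O (obs V T) P) (b : ∀ s, Lab O (obs V T) (R s))
  (d : ∀ p, Lab O (obs V T) (Q p)) (e : ∀ s r, Lab O (obs V T) (E s r))
  (f : ∀ p q, Lab O (obs V T) (G p q))

/-- The interchange at the two outer levels, written in terms of `α_{v, b_s}`. -/
theorem gam_inter_tens :
    (gam (inter A u v b d) fun k : (Σ s, R s) × (Σ p, Q p) =>
        (tens (e k.1.1 k.1.2) (f k.2.1 k.2.2)).one).re (nestUpper R E Q G) =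
      (gam u.one fun s => gam (alpha A v (b s)) fun rp : R s × P =>
        (gam ((tens (d rp.2) (e s rp.1)).re (Equiv.prodComm _ _)) fun k : E s rp.1 × Q rp.2 =>
          f rp.2 k.2).one).re (compNest R E Q G) := by
  have k1 := gam_re_gam (L := fun k : (Σ s, R s) × (Σ p, Q p) => E k.1.1 k.1.2 × G k.2.1 k.2.2)
    u.one (fun s => gam (alpha A v (b s)) fun rp : R s × P => (d rp.2).one) (mid R Q)
    fun k => (tens (e k.1.1 k.1.2) (f k.2.1 k.2.2)).one
  have k2 := Eqv.gam_right u.one fun s => gam_assoc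
    (L := fun k : Σ rp : R s × P, Q rp.2 => E s k.1.1 × G k.1.2 k.2) (alpha A v (b s))
    (fun rp : R s × P => (d rp.2).one) fun k => (tens (e s k.1.1) (f k.1.2 k.2)).one
  have k3 := Eqv.gam_right u.one fun s => Eqv.gam_right (alpha A v (b s)) fun rp : R s × P =>
    ((gam_tens_right (d rp.2) (e s rp.1) (f rp.2)).ap (Stage.idm T)).eq_trans
      (one_gam (d rp.2) fun q => tens (e s rp.1) (f rp.2 q)).symm
  exact ((k1.trans k2).trans k3).re_eq_re _ _ fun _ => rfl

/-- The interchange at the two inner levels, written in terms of `α_{d_p, e_{s, r}}`. -/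
theorem gam_tens_inter :
    (gam (tens u v).one fun k : S × P => inter A (b k.1) (d k.2) (e k.1) (f k.2)).re
        (nestPaired R E Q G) =
      (gam u.one fun s => gam ((tens v (b s)).re (Equiv.prodComm _ _)).one fun rp : R s × P =>
        gam (alpha A (d rp.2) (e s rp.1)) fun k : E s rp.1 × Q rp.2 =>
          (f rp.2 k.2).one).re (compNest R E Q G) := by
  simp only [one_tens, one_re]
  have k1 := gam_tens (L := fun k : S × P => (Σ r, E k.1 r) × (Σ q, G k.2 q)) u.one v.one
    fun k => inter A (b k.1) (d k.2) (e k.1) (f k.2)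
  have k2 := Eqv.gam_right u.one fun s => Eqv.gam_right v.one fun p =>
    Eqv.of_re (gam (b s).one fun r => gam (alpha A (d p) (e s r)) fun k : E s r × Q p =>
      (f p k.2).one) (mid (E s) (G p))
  have k3 := Eqv.gam_right u.one fun s => gam_tens_comm
    (L := fun rp : R s × P => Σ k : E s rp.1 × Q rp.2, G rp.2 k.2) v.one (b s).one fun rp =>
      gam (alpha A (d rp.2) (e s rp.1)) fun k : E s rp.1 × Q rp.2 => (f rp.2 k.2).one
  exact ((k1.trans k2).trans k3.symm).re_eq_re _ _ fun _ => rfl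

/-- The interchange for composites at the outer levels, by the decomposition of
`α_{γ(v; d), e_{s, r}}`. -/
theorem inter_gam_left_cmp :
    Cmp ((gam u.one fun s => gam (tens (b s) v).one fun rp : R s × P =>
        gam (alpha A (d rp.2) (e s rp.1)) fun k : E s rp.1 × Q rp.2 =>
          (f rp.2 k.2).one).re (compNest R E Q G))
      ((gam u.one fun s => gam (b s).one fun r => gam (alpha A v (e s r)) fun k : E s r × P =>
        (gam (d k.2) (f k.2)).one).re (compNest' R E Q G))
      ((inter A (gam u b) (gam v d) (fun k => e k.1 k.2) fun k => f k.1 k.2).re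
        (nestLower R E Q G)) := by
  have h := (((Cmp.one (gam u b)).gam fun k => (alpha_gam A v d (e k.1 k.2)).gam
    (K := fun j : E k.1 k.2 × (Σ p, Q p) => G j.2.1 j.2.2) fun j => Cmp.one (f j.2.1 j.2.2)).re
      (mid (fun k : Σ s, R s => E k.1 k.2) fun k : Σ p, Q p => G k.1 k.2)).re (nestLower R E Q G)
  simp only [one_gam, one_tens]
  have k1 := gam_assoc (L := fun k : Σ s, R s => Σ j : E k.1 k.2 × (Σ p, Q p), G j.2.1 j.2.2)
    u.one (fun s => (b s).one) fun k => gam ((gam v.one fun p => alpha A (d p) (e k.1 k.2)).re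
      (dist Q (E k.1 k.2))) fun j => (f j.2.1 j.2.2).one
  have k2 := Eqv.gam_right u.one fun s => Eqv.gam_right (b s).one fun r =>
    gam_re_gam (L := fun j : E s r × (Σ p, Q p) => G j.2.1 j.2.2) v.one
      (fun p => alpha A (d p) (e s r)) (dist Q (E s r)) fun j => (f j.2.1 j.2.2).one
  have k3 := Eqv.gam_right u.one fun s => gam_tens
    (L := fun rp : R s × P => Σ k : E s rp.1 × Q rp.2, G rp.2 k.2) (b s).one v.one fun rp =>
      gam (alpha A (d rp.2) (e s rp.1)) fun k : E s rp.1 × Q rp.2 => (f rp.2 k.2).one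
  have l1 := gam_assoc (L := fun k : Σ s, R s => Σ j : E k.1 k.2 × (Σ p, Q p), G j.2.1 j.2.2)
    u.one (fun s => (b s).one) fun k => gam ((gam (alpha A v (e k.1 k.2)) fun p => (d p.2).one).re
      (distL Q (E k.1 k.2))) fun j => (f j.2.1 j.2.2).one
  have l2 := Eqv.gam_right u.one fun s => Eqv.gam_right (b s).one fun r =>
    gam_re_gam (L := fun j : E s r × (Σ p, Q p) => G j.2.1 j.2.2) (alpha A v (e s r))
      (fun p => (d p.2).one) (distL Q (E s r)) fun j => (f j.2.1 j.2.2).one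
  have m1 (x : ∀ k : Σ s, R s, Lab O (mors V T) (Σ j : E k.1 k.2 × (Σ p, Q p), G j.2.1 j.2.2)) :=
    (re_re (gam (gam u b).one x) (mid (fun k : Σ s, R s => E k.1 k.2) fun k : Σ p, Q p => G k.1 k.2)
      (nestLower R E Q G)).trans (congrArg (fun t : Lab O (mors V T) (Σ s, R s) => (gam t x).re
        ((nestLower R E Q G).trans (mid (fun k : Σ s, R s => E k.1 k.2) fun k : Σ p, Q p => G k.1
            k.2)))
        (one_gam u b))
  exact (congrArg₂ (fun x y => Cmp x y _)
    ((m1 _).trans (((k1.trans k2).trans k3.symm).re_eq_re _ (compNest R E Q G) fun _ => rfl))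
    ((m1 _).trans ((l1.trans l2).re_eq_re _ (compNest' R E Q G) fun _ => rfl))).mp h

/-- The interchange for composites at the inner levels, by the decomposition of
`α_{v, γ(b_s; e_s)}`. -/
theorem inter_gam_right_cmp :
    Cmp ((gam u.one fun s => gam (alpha A v (b s)) fun rp : R s × P =>
        (gam (tens (e s rp.1) (d rp.2)) fun k : E s rp.1 × Q rp.2 =>
          f rp.2 k.2).one).re (compNest R E Q G))
      ((gam u.one fun s => gam (b s).one fun r => gam (alpha A v (e s r)) fun k : E s r × P =>
        (gam (d k.2) (f k.2)).one).re (compNest' R E Q G))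
      (inter A u v (fun s => gam (b s) (e s)) fun p => gam (d p) (f p)) := by
  have h := ((Cmp.one u).gam fun s => (alpha_gam' A (b s) (e s) v).gam
    (K := fun j : (Σ r, E s r) × P => Σ q, G j.2 q) fun j => Cmp.one (gam (d j.2) (f j.2))).re
      (mid (fun s => Σ r, E s r) fun p => Σ q, G p q)
  have k1 := Eqv.gam_right u.one fun s => gam_re_gam (L := fun j : (Σ r, E s r) × P => Σ q, G j.2 q)
    (alpha A v (b s)) (fun p => (e s p.1).one) (distL' (E s) P) fun j => (gam (d j.2) (f j.2)).one
  have k2 := Eqv.gam_right u.one fun s => Eqv.gam_right (alpha A v (b s)) fun rp : R s × P =>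
    (((gam_tens (L := fun k : E s rp.1 × Q rp.2 => G rp.2 k.2) (e s rp.1) (d rp.2) fun k =>
      f rp.2 k.2).ap (Stage.idm T)).trans_eq (one_gam _ _)).symm
  have l1 := Eqv.gam_right u.one fun s => gam_re_gam (L := fun j : (Σ r, E s r) × P => Σ q, G j.2 q)
    (b s).one (fun r => alpha A v (e s r)) (dist' (E s) P) fun j => (gam (d j.2) (f j.2)).one
  exact (congrArg₂ (fun x y => Cmp x y _) ((k1.trans k2).re_eq_re _ (compNest R E Q G) fun _ => rfl)
    (l1.re_eq_re _ (compNest' R E Q G) fun _ => rfl)).mp h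

/-- The interchange is compatible with triple composition. Both composites end with the terms
`α_{v, e_{s, r}}`; before these come `α_{v, b_s}` and `α_{d_p, e_{s, r}}`, which are at different
levels of a nested composition, and hence commute. -/
theorem inter_comp :
    ∃ z, Cmp ((gam (inter A u v b d) fun k : (Σ s, R s) × (Σ p, Q p) =>
          (tens (e k.1.1 k.1.2) (f k.2.1 k.2.2)).one).re (nestUpper R E Q G))
        ((inter A (gam u b) (gam v d) (fun k => e k.1 k.2) fun k => f k.1 k.2).re
          (nestLower R E Q G)) z ∧
      Cmp ((gam (tens u v).one fun k : S × P => inter A (b k.1) (d k.2) (e k.1) (f k.2)).re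
          (nestPaired R E Q G))
        (inter A u v (fun s => gam (b s) (e s)) fun p => gam (d p) (f p)) z := by
  have β (s : S) (rp : R s × P) := Cmp.gam (K := fun k : E s rp.1 × Q rp.2 => G rp.2 k.2)
    (Cmp.id_left (alpha_src A (d rp.2) (e s rp.1))) fun k => Cmp.one (f rp.2 k.2)
  have β' (s : S) (rp : R s × P) := Cmp.gam (K := fun k : E s rp.1 × Q rp.2 => G rp.2 k.2)
    (Cmp.id_right (alpha_tgt A (d rp.2) (e s rp.1))) fun k => Cmp.one (f rp.2 k.2)
  -- the terms at the two levels may be composed in either order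
  have n1 := ((Cmp.one u).gam fun s => (Cmp.id_right (alpha_tgt A v (b s))).gam fun rp =>
    β s rp).re (compNest R E Q G)
  have n3 := ((Cmp.one u).gam fun s => (Cmp.id_left (alpha_src A v (b s))).gam fun rp =>
    β' s rp).re (compNest R E Q G)
  rw [gam_inter_tens, gam_tens_inter]
  simp only [one_gam]
  have h2 := inter_gam_left_cmp A u v b d e f
  have h4 := inter_gam_right_cmp A u v b d e f
  simp only [one_gam] at h2 h4
  obtain ⟨z, hz⟩ := Cmp.exists (n1.tgt.trans h2.mid)
  exact ⟨z, n1.assoc hz h2, n3.assoc hz h4⟩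

end TripleComp
end Lab
end ICat

namespace ICat
open Stage

section TripleComp
variable {V : Type u} [Category.{v} V] [CartesianMonoidalCategory V] [MonoidalClosed V]
  [HasLimits V] [HasColimits (ICat V)]
variable {O : Operad V} (A : O.PseudoCommutative) {T : V}
  {a₀ a₁ a₂ a₃ c₀ c₁ c₂ c₃ : ℕ}

theorem samePasting_two_two {C : ICat V} {a b d e r : T ⟶ C.Mor}
    (h₁ : CompIs (V := V) a b r) (h₂ : CompIs (V := V) d e r) : SamePasting C [a, b] [d, e] :=
  ⟨r, isPasting_two.2 h₁, isPasting_two.2 h₂⟩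

/-- Compatibility with triple composition, coordinate by coordinate given by `Lab.inter_comp`. -/
theorem th_comp_cells (s : Span (Fin a₀) (Fin a₁)) (s' : Span (Fin c₀) (Fin c₁))
    (t : Span (Fin a₁) (Fin a₂)) (t' : Span (Fin c₁) (Fin c₂)) (w : Span (Fin a₂) (Fin a₃))
    (w' : Span (Fin c₂) (Fin c₃)) (x : ∀ i, Lab O (obs V T) (s.K i))
    (x' : ∀ i, Lab O (obs V T) (s'.K i)) (y : ∀ i, Lab O (obs V T) (t.K i))
    (y' : ∀ i, Lab O (obs V T) (t'.K i)) (z : ∀ i, Lab O (obs V T) (w.K i))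
    (z' : ∀ i, Lab O (obs V T) (w'.K i)) :
    SamePasting _
      [comp2 O.catOp.enr (one (A.smashData.sm1 (stdCell s x) (stdCell s' x')))
          (A.smashData.th (stdCell t y) (stdCell t' y') (stdCell w z) (stdCell w' z')),
        A.smashData.th (stdCell s x) (stdCell s' x')
          (comp1 O.catOp.enr (stdCell t y) (stdCell w z))
          (comp1 O.catOp.enr (stdCell t' y') (stdCell w' z'))]
      [comp2 O.catOp.enr (A.smashData.th (stdCell s x) (stdCell s' x') (stdCell t y)
          (stdCell t' y')) (one (A.smashData.sm1 (stdCell w z) (stdCell w' z'))),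
        A.smashData.th (comp1 O.catOp.enr (stdCell s x) (stdCell t y))
          (comp1 O.catOp.enr (stdCell s' x') (stdCell t' y')) (stdCell w z) (stdCell w' z')] := by
  choose r h1 h2 using fun i : Fin a₃ × Fin c₃ => Lab.inter_comp A (z i.1) (z' i.2)
    (fun k => y (w.leg i.1 k)) (fun k => y' (w'.leg i.2 k))
    (fun k l => x (t.leg (w.leg i.1 k) l)) (fun k l => x' (t'.leg (w'.leg i.2 k) l))
  rw [th_cell, th_cell, sm1_cell, sm1_cell, one_cell, one_cell, comp2_cell, comp2_cell,
    comp1_cell, comp1_cell, comp1_cell, comp1_cell, th_cell, th_cell,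
    cell2_re (s := (s.prod s').comp ((t.comp w).prod (t'.comp w')))
      (s' := ((s.comp t).comp w).prod ((s'.comp t').comp w')) _
      (fun i => Lab.nestUpper (fun k => t.K (w.leg i.1 k)) (fun k l => s.K (t.leg (w.leg i.1 k) l))
        (fun k => t'.K (w'.leg i.2 k)) fun k l => s'.K (t'.leg (w'.leg i.2 k) l))
      fun _ _ => rfl,
    cell2_re (s := (s.comp (t.comp w)).prod (s'.comp (t'.comp w')))
      (s' := ((s.comp t).comp w).prod ((s'.comp t').comp w')) _
      (fun i => Lab.nestLower (fun k => t.K (w.leg i.1 k)) (fun k l => s.K (t.leg (w.leg i.1 k) l))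
        (fun k => t'.K (w'.leg i.2 k)) fun k l => s'.K (t'.leg (w'.leg i.2 k) l))
      fun _ _ => rfl,
    cell2_re (s := ((s.comp t).prod (s'.comp t')).comp (w.prod w'))
      (s' := ((s.comp t).comp w).prod ((s'.comp t').comp w')) _
      (fun i => Lab.nestPaired (fun k => t.K (w.leg i.1 k)) (fun k l => s.K (t.leg (w.leg i.1 k) l))
        (fun k => t'.K (w'.leg i.2 k)) fun k l => s'.K (t'.leg (w'.leg i.2 k) l))
      fun _ _ => rfl]
  exact samePasting_two_two (compIs_cell2 h1) (compIs_cell2 h2)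

theorem th_comp (f₁ : Cell1 O.catOp.enr T a₀ a₁) (f₂ : Cell1 O.catOp.enr T c₀ c₁)
    (g₁ : Cell1 O.catOp.enr T a₁ a₂) (g₂ : Cell1 O.catOp.enr T c₁ c₂)
    (h₁ : Cell1 O.catOp.enr T a₂ a₃) (h₂ : Cell1 O.catOp.enr T c₂ c₃) :
    SamePasting _
      [comp2 O.catOp.enr (one (A.smashData.sm1 f₁ f₂)) (A.smashData.th g₁ g₂ h₁ h₂),
        A.smashData.th f₁ f₂ (comp1 O.catOp.enr g₁ h₁) (comp1 O.catOp.enr g₂ h₂)]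
      [comp2 O.catOp.enr (A.smashData.th f₁ f₂ g₁ g₂) (one (A.smashData.sm1 h₁ h₂)),
        A.smashData.th (comp1 O.catOp.enr f₁ g₁) (comp1 O.catOp.enr f₂ g₂) h₁ h₂] :=
  same_cells6
    (L := fun {T} f₁ f₂ g₁ g₂ h₁ h₂ =>
      [comp2 O.catOp.enr (one (A.smashData.sm1 f₁ f₂)) (A.smashData.th g₁ g₂ h₁ h₂),
        A.smashData.th f₁ f₂ (comp1 O.catOp.enr g₁ h₁) (comp1 O.catOp.enr g₂ h₂)])
    (L' := fun {T} f₁ f₂ g₁ g₂ h₁ h₂ =>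
      [comp2 O.catOp.enr (A.smashData.th f₁ f₂ g₁ g₂) (one (A.smashData.sm1 h₁ h₂)),
        A.smashData.th (comp1 O.catOp.enr f₁ g₁) (comp1 O.catOp.enr f₂ g₂) h₁ h₂])
    (fun k f₁ f₂ g₁ g₂ h₁ h₂ => ⟨by
      rw [pre_sm1, pre_one, pre_th, pre_comp2, pre_comp1, pre_comp1, pre_th]; rfl, by simp⟩)
    (fun k f₁ f₂ g₁ g₂ h₁ h₂ => ⟨by
      rw [pre_sm1, pre_one, pre_th, pre_comp2, pre_comp1, pre_comp1, pre_th]; rfl, by simp⟩)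
    (fun T s s' t t' w w' x x' y y' z z' => th_comp_cells A s s' t t' w w' x x' y y' z z')
    f₁ f₂ g₁ g₂ h₁ h₂

end TripleComp
end ICat

/-! ### Strict associativity of the constraint -/

namespace ICat
open Stage

namespace Lab
section Assoc
variable {V : Type u} [Category.{v} V] [CartesianMonoidalCategory V] [HasLimits V]
variable {O : Operad V} (A : O.PseudoCommutative) {T : V} {S P M : Type} [Finite S] [Finite P]
  [Finite M] {R : S → Type} {Q : P → Type} {N : M → Type} [∀ s, Finite (R s)]
  [∀ p, Finite (Q p)] [∀ m, Finite (N m)]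

section
variable {X Y Z : Type} [Finite X] [Finite Y] [Finite Z]

/-- The decomposition of `α_{y ⊗ z, x}`, with the terms written as operadic compositions. -/
theorem alpha_tens_left (x : Lab O (obs V T) X) (y : Lab O (obs V T) Y) (z : Lab O (obs V T) Z) :
    Cmp ((gam y.one fun _ => alpha A z x).re
        ⟨fun a => ⟨a.2.1, a.1, a.2.2⟩, fun a => (a.2.1, a.1, a.2.2), fun _ => rfl, fun _ => rfl⟩)
      ((gam (alpha A y x) fun _ => z.one).re
        ⟨fun a => ⟨(a.1, a.2.1), a.2.2⟩, fun a => (a.1.1, a.1.2, a.2), fun _ => rfl, fun _ => rfl⟩)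
      (alpha A (tens y z) x) :=
  Cmp.of_eqv (e := Equiv.prodCongr (Equiv.refl X) (Equiv.sigmaEquivProd Y Z).symm)
    (alpha_gam A y (fun _ => z) x)
    (((Eqv.of_re _ _).trans (Eqv.of_re _ (dist (fun _ : Y => Z) X)).symm).of_eq fun _ => rfl)
    (((Eqv.of_re _ _).trans (Eqv.of_re _ (distL (fun _ : Y => Z) X)).symm).of_eq fun _ => rfl)
    (Eqv.alpha A (tens_eqv y z) (Eqv.refl x))

/-- The decomposition of `α_{z, x ⊗ y}`, with the terms written as operadic compositions. -/
theorem alpha_tens_right (x : Lab O (obs V T) X) (y : Lab O (obs V T) Y) (z : Lab O (obs V T) Z) :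
    Cmp ((gam (alpha A z x) fun _ => y.one).re
        ⟨fun a => ⟨(a.1.1, a.2), a.1.2⟩, fun a => ((a.1.1, a.2), a.1.2), fun _ => rfl, fun _ =>
            rfl⟩)
      ((gam x.one fun _ => alpha A z y).re
        ⟨fun a => ⟨a.1.1, a.1.2, a.2⟩, fun a => ((a.1, a.2.1), a.2.2), fun _ => rfl, fun _ => rfl⟩)
      (alpha A z (tens x y)) :=
  Cmp.of_eqv (e := Equiv.prodCongr (Equiv.sigmaEquivProd X Y).symm (Equiv.refl Z))
    (alpha_gam' A x (fun _ => y) z)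
    (((Eqv.of_re _ _).trans (Eqv.of_re _ (distL' (fun _ : X => Y) Z)).symm).of_eq fun _ => rfl)
    (((Eqv.of_re _ _).trans (Eqv.of_re _ (dist' (fun _ : X => Y) Z)).symm).of_eq fun _ => rfl)
    (Eqv.alpha A (Eqv.refl z) (tens_eqv x y))

end

/-- The bijection `((s, r), ((p, q), (m, n))) ↦ (s, (r, p), (q, m), n)`. -/
def assocNest (R : S → Type) (Q : P → Type) (N : M → Type) :
    (Σ s, R s) × ((Σ p, Q p) × (Σ m, N m)) ≃ Σ s, Σ rp : R s × P, Σ k : Q rp.2 × M, N k.2 where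
  toFun a := ⟨a.1.1, (a.1.2, a.2.1.1), (a.2.1.2, a.2.2.1), a.2.2.2⟩
  invFun a := (⟨a.1, a.2.1.1⟩, ⟨a.2.1.2, a.2.2.1.1⟩, ⟨a.2.2.1.2, a.2.2.2⟩)
  left_inv _ := rfl
  right_inv _ := rfl

/-- The bijection `((s, r), ((p, q), (m, n))) ↦ (s, p, (r, m), q, n)`. -/
def assocNest' (R : S → Type) (Q : P → Type) (N : M → Type) :
    (Σ s, R s) × ((Σ p, Q p) × (Σ m, N m)) ≃ Σ s, Σ p, Σ k : R s × M, Σ _ : Q p, N k.2 where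
  toFun a := ⟨a.1.1, a.2.1.1, (a.1.2, a.2.2.1), a.2.1.2, a.2.2.2⟩
  invFun a := (⟨a.1, a.2.2.1.1⟩, ⟨a.2.1, a.2.2.2.1⟩, ⟨a.2.2.1.2, a.2.2.2.2⟩)
  left_inv _ := rfl
  right_inv _ := rfl

/-- The bijection `((s, r), ((p, q), (m, n))) ↦ (((s, p), (r, q)), (m, n))`. -/
def assocLeft (R : S → Type) (Q : P → Type) (N : M → Type) :
    (Σ s, R s) × ((Σ p, Q p) × (Σ m, N m)) ≃ (Σ k : S × P, R k.1 × Q k.2) × (Σ m, N m) where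
  toFun a := (⟨(a.1.1, a.2.1.1), (a.1.2, a.2.1.2)⟩, a.2.2)
  invFun a := (⟨a.1.1.1, a.1.2.1⟩, ⟨a.1.1.2, a.1.2.2⟩, a.2)
  left_inv _ := rfl
  right_inv _ := rfl

/-- The bijection `((s, r), ((p, q), (m, n))) ↦ ((s, r), ((p, m), (q, n)))`. -/
def assocRight (R : S → Type) (Q : P → Type) (N : M → Type) :
    (Σ s, R s) × ((Σ p, Q p) × (Σ m, N m)) ≃ (Σ s, R s) × (Σ k : P × M, Q k.1 × N k.2) where
  toFun a := (a.1, ⟨(a.2.1.1, a.2.2.1), (a.2.1.2, a.2.2.2)⟩)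
  invFun a := (a.1, ⟨a.2.1.1, a.2.2.1⟩, ⟨a.2.1.2, a.2.2.2⟩)
  left_inv _ := rfl
  right_inv _ := rfl

variable (u : Lab O (obs V T) S) (v : Lab O (obs V T) P) (w : Lab O (obs V T) M)
  (x : ∀ s, Lab O (obs V T) (R s)) (y : ∀ p, Lab O (obs V T) (Q p))
  (z : ∀ m, Lab O (obs V T) (N m))

/-- The interchange for `(u ⊗ v, w)`, by the decomposition of `α_{w, x_s ⊗ y_p}`. -/
theorem inter_tens_left_cmp :
    Cmp ((gam u.one fun s => gam v.one fun p => gam (alpha A w (x s)) fun k : R s × M =>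
        gam (y p).one fun _ => (z k.2).one).re (assocNest' R Q N))
      ((gam u.one fun s => gam ((tens v (x s)).re (Equiv.prodComm _ _)).one fun rp : R s × P =>
        gam (alpha A w (y rp.2)) fun k : Q rp.2 × M => (z k.2).one).re (assocNest R Q N))
      ((inter A (tens u v) w (fun k : S × P => tens (x k.1) (y k.2)) z).re (assocLeft R Q N)) := by
  have h := (((Cmp.one (tens u v)).gam fun k => (alpha_tens_right A (x k.1) (y k.2) w).gam
    (K := fun j : (R k.1 × Q k.2) × M => N j.2) fun j => Cmp.one (z j.2)).re
      (mid (fun k : S × P => R k.1 × Q k.2) N)).re (assocLeft R Q N)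
  simp only [one_re, one_tens]
  have m1 (t : ∀ k : S × P, Lab O (mors V T) (Σ j : (R k.1 × Q k.2) × M, N j.2)) :=
    (re_re (gam (tens u v).one t) (mid (fun k : S × P => R k.1 × Q k.2) N)
      (assocLeft R Q N)).trans (congrArg (fun l : Lab O (mors V T) (S × P) =>
        (gam l t).re ((assocLeft R Q N).trans (mid (fun k : S × P => R k.1 × Q k.2) N)))
        (one_tens u v))
  have k1 := gam_tens (L := fun k : S × P => Σ j : (R k.1 × Q k.2) × M, N j.2) u.one v.one fun k =>
    gam ((gam (alpha A w (x k.1)) fun _ => (y k.2).one).re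
      ⟨fun a => ⟨(a.1.1, a.2), a.1.2⟩, fun a => ((a.1.1, a.2), a.1.2), fun _ => rfl, fun _ => rfl⟩)
      fun j : (R k.1 × Q k.2) × M => (z j.2).one
  have k2 := Eqv.gam_right u.one fun s => Eqv.gam_right v.one fun p =>
    gam_re_gam (L := fun j : (R s × Q p) × M => N j.2) (alpha A w (x s)) (fun _ => (y p).one)
      ⟨fun a => ⟨(a.1.1, a.2), a.1.2⟩, fun a => ((a.1.1, a.2), a.1.2), fun _ => rfl, fun _ => rfl⟩
      fun j => (z j.2).one
  have l1 := gam_tens (L := fun k : S × P => Σ j : (R k.1 × Q k.2) × M, N j.2) u.one v.one fun k =>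
    gam ((gam (x k.1).one fun _ => alpha A w (y k.2)).re
      ⟨fun a => ⟨a.1.1, a.1.2, a.2⟩, fun a => ((a.1, a.2.1), a.2.2), fun _ => rfl, fun _ => rfl⟩)
      fun j : (R k.1 × Q k.2) × M => (z j.2).one
  have l2 := Eqv.gam_right u.one fun s => Eqv.gam_right v.one fun p =>
    gam_re_gam (L := fun j : (R s × Q p) × M => N j.2) (x s).one (fun _ => alpha A w (y p))
      ⟨fun a => ⟨a.1.1, a.1.2, a.2⟩, fun a => ((a.1, a.2.1), a.2.2), fun _ => rfl, fun _ => rfl⟩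
      fun j => (z j.2).one
  have l3 := Eqv.gam_right u.one fun s => gam_tens_comm
    (L := fun rp : R s × P => Σ k : Q rp.2 × M, N k.2) v.one (x s).one fun rp =>
      gam (alpha A w (y rp.2)) fun k : Q rp.2 × M => (z k.2).one
  exact (congrArg₂ (fun x y => Cmp x y _)
    ((m1 _).trans ((k1.trans k2).re_eq_re _ (assocNest' R Q N) fun _ => rfl))
    ((m1 _).trans (((l1.trans l2).trans l3.symm).re_eq_re _ (assocNest R Q N) fun _ => rfl))).mp h

/-- The interchange for `(u, v ⊗ w)`, by the decomposition of `α_{v ⊗ w, x_s}`. -/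
theorem inter_tens_right_cmp :
    Cmp ((gam u.one fun s => gam v.one fun p => gam (alpha A w (x s)) fun k : R s × M =>
        gam (y p).one fun _ => (z k.2).one).re (assocNest' R Q N))
      ((gam u.one fun s => gam (alpha A v (x s)) fun rp : R s × P =>
        (gam ((tens w (y rp.2)).re (Equiv.prodComm _ _)) fun k : Q rp.2 × M => z k.2).one).re
          (assocNest R Q N))
      ((inter A u (tens v w) x fun k : P × M => tens (y k.1) (z k.2)).re (assocRight R Q N)) := by
  have h := (((Cmp.one u).gam fun s => (alpha_tens_left A (x s) v w).gam
    (K := fun j : R s × (P × M) => Q j.2.1 × N j.2.2) fun j =>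
      Cmp.one (tens (y j.2.1) (z j.2.2))).re
      (mid R fun k : P × M => Q k.1 × N k.2)).re (assocRight R Q N)
  have m1 (t : ∀ s, Lab O (mors V T) (Σ j : R s × (P × M), Q j.2.1 × N j.2.2)) :=
    re_re (gam u.one t) (mid R fun k : P × M => Q k.1 × N k.2) (assocRight R Q N)
  have k1 := Eqv.gam_right u.one fun s =>
    gam_re_gam (L := fun j : R s × (P × M) => Q j.2.1 × N j.2.2) v.one (fun _ => alpha A w (x s))
      ⟨fun a => ⟨a.2.1, a.1, a.2.2⟩, fun a => (a.2.1, a.1, a.2.2), fun _ => rfl, fun _ => rfl⟩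
      fun j => (tens (y j.2.1) (z j.2.2)).one
  have k2 := Eqv.gam_right u.one fun s => Eqv.gam_right v.one fun p =>
    Eqv.gam_right (alpha A w (x s)) fun k : R s × M =>
      ((tens_eqv (y p) (z k.2)).ap (Stage.idm T)).trans_eq (one_gam _ _)
  have l1 := Eqv.gam_right u.one fun s =>
    gam_re_gam (L := fun j : R s × (P × M) => Q j.2.1 × N j.2.2) (alpha A v (x s))
      (fun _ => w.one)
      ⟨fun a => ⟨(a.1, a.2.1), a.2.2⟩, fun a => (a.1.1, a.1.2, a.2), fun _ => rfl, fun _ => rfl⟩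
      fun j => (tens (y j.2.1) (z j.2.2)).one
  have l2 := Eqv.gam_right u.one fun s => Eqv.gam_right (alpha A v (x s)) fun rp : R s × P =>
    ((gam_tens_right w (y rp.2) z).ap (Stage.idm T)).eq_trans
      (one_gam w fun m => tens (y rp.2) (z m)).symm
  exact (congrArg₂ (fun x y => Cmp x y _)
    ((m1 _).trans ((k1.trans k2).re_eq_re _ (assocNest' R Q N) fun _ => rfl))
    ((m1 _).trans ((l1.trans l2).re_eq_re _ (assocNest R Q N) fun _ => rfl))).mp h

theorem tens_inter_left :
    (tens (inter A u v x y) (gam w z).one).re (Equiv.prodAssoc _ _ _).symm =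
      (gam u.one fun s => gam (alpha A v (x s)) fun rp : R s × P =>
        (gam (tens (y rp.2) w) fun k : Q rp.2 × M => z k.2).one).re (assocNest R Q N) := by
  have k1 := tens_eqv (inter A u v x y) (gam w z).one
  have k2 := gam_re_gam (L := fun _ => Σ m, N m) u.one
    (fun s => gam (alpha A v (x s)) fun rp : R s × P => (y rp.2).one) (mid R Q)
    fun _ => (gam w z).one
  have k3 := Eqv.gam_right u.one fun s => gam_assoc (L := fun _ => Σ m, N m) (alpha A v (x s))
    (fun rp : R s × P => (y rp.2).one) fun _ => (gam w z).one
  have k4 := Eqv.gam_right u.one fun s => Eqv.gam_right (alpha A v (x s)) fun rp : R s × P =>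
    (((gam_tens (L := fun k : Q rp.2 × M => N k.2) (y rp.2) w fun k => z k.2).ap
      (Stage.idm T)).trans_eq (one_gam _ _)).symm
  exact (((k1.trans k2).trans k3).trans k4).re_eq_re _ _ fun _ => rfl

theorem tens_inter_right :
    tens (gam u x).one (inter A v w y z) =
      (gam u.one fun s => gam (tens (x s) v).one fun rp : R s × P =>
        gam (alpha A w (y rp.2)) fun k : Q rp.2 × M => (z k.2).one).re (assocNest R Q N) := by
  rw [one_gam]
  simp only [one_tens]
  have k1 := tens_eqv (gam u.one fun s => (x s).one) (inter A v w y z)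
  have k2 := gam_assoc (L := fun _ => (Σ p, Q p) × (Σ m, N m)) u.one (fun s => (x s).one)
    fun _ => inter A v w y z
  have k3 := Eqv.gam_right u.one fun s => Eqv.gam_right (x s).one fun r => Eqv.of_re
    (gam v.one fun p => gam (alpha A w (y p)) fun k : Q p × M => (z k.2).one) (mid Q N)
  have k4 := Eqv.gam_right u.one fun s => gam_tens
    (L := fun rp : R s × P => Σ k : Q rp.2 × M, N k.2) (x s).one v.one fun rp =>
      gam (alpha A w (y rp.2)) fun k : Q rp.2 × M => (z k.2).one
  exact (((k1.trans k2).trans k3).trans k4.symm).of_eq (e' := assocNest R Q N) fun _ => rfl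

/-- The interchange is associative. Both composites begin with the terms `α_{w, x_s}`; after these
come `α_{v, x_s}` and `α_{w, y_p}`, which are at different levels of a nested composition, and
hence commute. -/
theorem inter_assoc :
    ∃ r, Cmp ((inter A (tens u v) w (fun k : S × P => tens (x k.1) (y k.2)) z).re
          (assocLeft R Q N))
        ((tens (inter A u v x y) (gam w z).one).re (Equiv.prodAssoc _ _ _).symm) r ∧
      Cmp ((inter A u (tens v w) x fun k : P × M => tens (y k.1) (z k.2)).re (assocRight R Q N))
        (tens (gam u x).one (inter A v w y z)) r := by
  have β (s : S) (rp : R s × P) := Cmp.gam (K := fun k : Q rp.2 × M => N k.2)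
    (Cmp.id_left (alpha_src A w (y rp.2))) fun k => Cmp.one (z k.2)
  have β' (s : S) (rp : R s × P) := Cmp.gam (K := fun k : Q rp.2 × M => N k.2)
    (Cmp.id_right (alpha_tgt A w (y rp.2))) fun k => Cmp.one (z k.2)
  -- the terms at the two levels may be composed in either order
  have n1 := ((Cmp.one u).gam fun s => (Cmp.id_left (alpha_src A v (x s))).gam fun rp =>
    β' s rp).re (assocNest R Q N)
  have n3 := ((Cmp.one u).gam fun s => (Cmp.id_right (alpha_tgt A v (x s))).gam fun rp =>
    β s rp).re (assocNest R Q N)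
  have h1 := inter_tens_left_cmp A u v w x y z
  have h3 := inter_tens_right_cmp A u v w x y z
  rw [tens_inter_left, tens_inter_right]
  simp only [one_gam] at h1 h3 ⊢
  obtain ⟨r, hr⟩ := Cmp.exists (h1.mid.trans n1.src.symm)
  exact ⟨r, h1.assoc' hr n1, h3.assoc' hr n3⟩

end Assoc
end Lab
end ICat

namespace ICat
open Stage

section Assoc
variable {V : Type u} [Category.{v} V] [CartesianMonoidalCategory V] [MonoidalClosed V]
  [HasLimits V] [HasColimits (ICat V)]
variable {O : Operad V} (A : O.PseudoCommutative) {T : V}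
  {a₀ a₁ a₂ b₀ b₁ b₂ c₀ c₁ c₂ : ℕ}

/-- Associativity of the constraint, coordinate by coordinate given by `Lab.inter_assoc`. -/
theorem th_assoc_cells (s : Span (Fin a₀) (Fin a₁)) (s' : Span (Fin b₀) (Fin b₁))
    (s'' : Span (Fin c₀) (Fin c₁)) (t : Span (Fin a₁) (Fin a₂)) (t' : Span (Fin b₁) (Fin b₂))
    (t'' : Span (Fin c₁) (Fin c₂)) (x : ∀ i, Lab O (obs V T) (s.K i))
    (x' : ∀ i, Lab O (obs V T) (s'.K i)) (x'' : ∀ i, Lab O (obs V T) (s''.K i))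
    (y : ∀ i, Lab O (obs V T) (t.K i)) (y' : ∀ i, Lab O (obs V T) (t'.K i))
    (y'' : ∀ i, Lab O (obs V T) (t''.K i)) :
    SamePasting _
      [cast2 O.catOp.enr (mul_assoc _ _ _) (mul_assoc _ _ _)
          (A.smashData.th (A.smashData.sm1 (stdCell s x) (stdCell s' x')) (stdCell s'' x'')
            (A.smashData.sm1 (stdCell t y) (stdCell t' y')) (stdCell t'' y'')),
        cast2 O.catOp.enr (mul_assoc _ _ _) (mul_assoc _ _ _)
          (A.smashData.sm2 (A.smashData.th (stdCell s x) (stdCell s' x') (stdCell t y)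
            (stdCell t' y')) (one (comp1 O.catOp.enr (stdCell s'' x'') (stdCell t'' y''))))]
      [A.smashData.th (stdCell s x) (A.smashData.sm1 (stdCell s' x') (stdCell s'' x''))
          (stdCell t y) (A.smashData.sm1 (stdCell t' y') (stdCell t'' y'')),
        A.smashData.sm2 (one (comp1 O.catOp.enr (stdCell s x) (stdCell t y)))
          (A.smashData.th (stdCell s' x') (stdCell s'' x'') (stdCell t' y') (stdCell t'' y''))] :=
              by
  choose r h1 h2 using fun i : Fin a₂ × (Fin b₂ × Fin c₂) => Lab.inter_assoc A (y i.1) (y' i.2.1)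
    (y'' i.2.2) (fun k => x (t.leg i.1 k)) (fun k => x' (t'.leg i.2.1 k))
    fun k => x'' (t''.leg i.2.2 k)
  rw [sm1_cell, sm1_cell, sm1_cell, sm1_cell, th_cell, th_cell, th_cell, th_cell, comp1_cell,
    comp1_cell, one_cell, one_cell, sm2_cell, sm2_cell, cast2_cell, cast2_cell,
    cell2_re (s := (s.comp t).prod ((s'.prod s'').comp (t'.prod t'')))
      (s' := (s.comp t).prod ((s'.comp t').prod (s''.comp t''))) _
      (fun i => Lab.assocRight (fun k => s.K (t.leg i.1 k)) (fun k => s'.K (t'.leg i.2.1 k))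
        fun k => s''.K (t''.leg i.2.2 k)) fun _ _ => rfl]
  refine samePasting_two_two (ICat.CompIs.congr (compIs_cell2 h1) ?_ ?_ rfl) (compIs_cell2 h2)
  · exact cell_congr (Equiv.prodAssoc _ _ _) (Equiv.prodAssoc _ _ _)
      (fun i => lexNum_assoc (Equiv.refl _) (Equiv.refl _) (Equiv.refl _) i)
      (fun i => lexNum_assoc (Equiv.refl _) (Equiv.refl _) (Equiv.refl _) i)
      (fun i => (Lab.assocLeft (fun k => s.K (t.leg i.1.1 k)) (fun k => s'.K (t'.leg i.1.2 k))
          fun k => s''.K (t''.leg i.2 k)).symm)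
      (fun _ _ => rfl) fun i => (Lab.Eqv.of_re _ (Lab.assocLeft (fun k => s.K (t.leg i.1.1 k)) (fun
          k => s'.K (t'.leg i.1.2 k))
          fun k => s''.K (t''.leg i.2 k))).symm
  · exact cell_congr (Equiv.prodAssoc _ _ _) (Equiv.prodAssoc _ _ _)
      (fun i => lexNum_assoc (Equiv.refl _) (Equiv.refl _) (Equiv.refl _) i)
      (fun i => lexNum_assoc (Equiv.refl _) (Equiv.refl _) (Equiv.refl _) i)
      (fun i => Equiv.prodAssoc _ _ _) (fun _ _ => rfl) fun i => (Lab.Eqv.of_re _ _).symm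

theorem th_assoc (f₁ : Cell1 O.catOp.enr T a₀ a₁) (f₂ : Cell1 O.catOp.enr T b₀ b₁)
    (f₃ : Cell1 O.catOp.enr T c₀ c₁) (g₁ : Cell1 O.catOp.enr T a₁ a₂)
    (g₂ : Cell1 O.catOp.enr T b₁ b₂) (g₃ : Cell1 O.catOp.enr T c₁ c₂) :
    SamePasting _
      [cast2 O.catOp.enr (mul_assoc _ _ _) (mul_assoc _ _ _)
          (A.smashData.th (A.smashData.sm1 f₁ f₂) f₃ (A.smashData.sm1 g₁ g₂) g₃),
        cast2 O.catOp.enr (mul_assoc _ _ _) (mul_assoc _ _ _)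
          (A.smashData.sm2 (A.smashData.th f₁ f₂ g₁ g₂) (one (comp1 O.catOp.enr f₃ g₃)))]
      [A.smashData.th f₁ (A.smashData.sm1 f₂ f₃) g₁ (A.smashData.sm1 g₂ g₃),
        A.smashData.sm2 (one (comp1 O.catOp.enr f₁ g₁)) (A.smashData.th f₂ f₃ g₂ g₃)] :=
  same_cells6
    (L := fun {T} f₁ f₂ f₃ g₁ g₂ g₃ =>
      [cast2 O.catOp.enr (mul_assoc _ _ _) (mul_assoc _ _ _)
          (A.smashData.th (A.smashData.sm1 f₁ f₂) f₃ (A.smashData.sm1 g₁ g₂) g₃),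
        cast2 O.catOp.enr (mul_assoc _ _ _) (mul_assoc _ _ _)
          (A.smashData.sm2 (A.smashData.th f₁ f₂ g₁ g₂) (one (comp1 O.catOp.enr f₃ g₃)))])
    (L' := fun {T} f₁ f₂ f₃ g₁ g₂ g₃ =>
      [A.smashData.th f₁ (A.smashData.sm1 f₂ f₃) g₁ (A.smashData.sm1 g₂ g₃),
        A.smashData.sm2 (one (comp1 O.catOp.enr f₁ g₁)) (A.smashData.th f₂ f₃ g₂ g₃)])
    (fun k f₁ f₂ f₃ g₁ g₂ g₃ => ⟨by
      rw [pre_sm1, pre_sm1, pre_th, pre_th, pre_comp1, pre_one, pre_sm2, pre_cast2, pre_cast2]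
      rfl, by simp⟩)
    (fun k f₁ f₂ f₃ g₁ g₂ g₃ => ⟨by
      rw [pre_sm1, pre_sm1, pre_th, pre_th, pre_comp1, pre_one, pre_sm2]
      rfl, by simp⟩)
    (fun T s s' s'' t t' t'' x x' x'' y y' y'' =>
      th_assoc_cells A s s' s'' t t' t'' x x' x'' y y' y'')
    f₁ f₂ f₃ g₁ g₂ g₃

end Assoc
end ICat

/-! ### The pseudo-commutative structure -/

namespace ICat
open Stage

section PseudoCommutative
variable {V : Type u} [Category.{v} V] [CartesianMonoidalCategory V] [MonoidalClosed V]
  [HasLimits V] [HasColimits (ICat V)]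
variable {O : Operad V} (A : O.PseudoCommutative) {T : V} {m n p q : ℕ}

theorem alpha_coord_at (φ : FHom m n) (c : ∀ j, (obs V T).obj (O.obj (φ.deg j))) (ψ : FHom p q)
    (d : ∀ k, (obs V T).obj (O.obj (ψ.deg k))) (k : Fin q) (j : Fin n) {N : ℕ}
    (h : N = φ.deg j * ψ.deg k) :
    (Lab.alpha A (coord ψ ((obs V T).tuple d) k) (coord φ ((obs V T).tuple c) j)).at'
        ((finCongr h).trans finProdFinEquiv.symm) =
      O.actF _ (finCongr h) (Lab.alphaF A (d k) (c j)) := by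
  rw [coord_tuple, coord_tuple]
  refine Eq.trans (Lab.actF_at _ (Lab.prodNum (Equiv.refl _) (Equiv.refl _)) _).symm ?_
  rw [Lab.alpha_at, Lab.mk_at_self, Lab.mk_at_self]

/-- The components of the symmetry constraint are those of `α`. -/
theorem tauHat_ptOb (φ : FHom m n) (c : ∀ j, T ⟶ (O.obj (φ.deg j)).Ob) (ψ : FHom p q)
    (d : ∀ k, T ⟶ (O.obj (ψ.deg k)).Ob) :
    A.symmetryData.th (Operad.PseudoCommutative.ptOb O φ c)
      (Operad.PseudoCommutative.ptOb O ψ d) = A.symPt φ c ψ d := by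
  refine (tauHat_incl A φ ψ ((obs V T).tuple c) ((obs V T).tuple d)).trans ?_
  refine Eq.symm (ptF_eq_cell (F := mors V T) ((FHom.tau m p).comp (ψ.smash φ)) _
    (fun l => finProdFinEquiv.symm l) (fun l => finProdFinEquiv.apply_symm_apply l)
    (fun l => (finCongr (FHom.deg_tau_smash φ ψ l)).trans finProdFinEquiv.symm)
    (fun l a => (FHom.fib_tau_smash φ ψ l a).symm) fun l => ?_)
  exact (alpha_coord_at A φ c ψ d _ _ _).symm

/-- The product is a strictly associative and strictly unital based pseudofunctor. -/
theorem isMonoidal_smashData : A.smashData.IsMonoidal O.catOp.based where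
  pt_map a b _ _ g := smashMap_basePt_left a b g
  map_pt c d f := smashMap_basePt_right c d f
  th_pt f₁ f₂ g₁ g₂ h := by
    rcases h with rfl | rfl | rfl | rfl
    · exact th_pt_f₁ A f₂ g₁ g₂
    · exact th_pt_f₂ A f₁ g₁ g₂
    · exact th_pt_g₁ A f₁ f₂ g₂
    · exact th_pt_g₂ A f₁ f₂ g₁
  map_id a c := smashMap_id a c
  th_id_left g₁ g₂ := thIsId_of_fromPi_left A (fromPi_id1 _) _ g₁ g₂
  th_id_right f₁ f₂ := thIsId_of_fromPi_right A f₁ f₂ _ (fromPi_id1 _)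
  th_comp f₁ f₂ g₁ g₂ h₁ h₂ := th_comp A f₁ f₂ g₁ g₂ h₁ h₂
  map_assoc f g h := smashMap_assoc f g h
  th_assoc f₁ f₂ f₃ g₁ g₂ g₃ := th_assoc A f₁ f₂ f₃ g₁ g₂ g₃
  one_map f := one_smashMap f
  map_one f := smashMap_one f
  th_one_left f g := thIsId_of_fromPi_left A (fromPi_id1 1) f _ g
  th_one_right f g := thIsId_of_fromPi_right A f _ g (fromPi_id1 1)

/-- The symmetry is a based pseudotransformation that satisfies the symmetry and hexagon axioms. -/
theorem isSymmetry_symmetryData : A.symmetryData.IsSymmetry O.catOp.based where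
  th_pt f g h := by
    rcases h with rfl | rfl
    · exact tauHat_pt_left A g
    · exact tauHat_pt_right A f
  th_id T a c := tauHat_id A T a c
  th_comp f₁ f₂ g₁ g₂ := tauHat_comp A f₁ f₂ g₁ g₂
  tau_tau a b := tau_comp_tau a b
  th_th f g := tauHat_tauHat A f g
  tau_mul T a b c := tau_mul A T a b c
  th_mul f g h := tauHat_mul A f g h

/-- The pseudo-commutative structure of the category of operators of a pseudo-commutative
operad. -/
noncomputable def Operad.PseudoCommutative.catOp : O.catOp.PseudoCommutative where
  smash := A.smashData
  isMonoidal := isMonoidal_smashData A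
  symm := A.symmetryData
  isSymmetry := isSymmetry_symmetryData A
  ι_map m n p q := iota_smash m n p q
  map_ξ m n p q := smash_xi m n p q
  strict f₁ f₂ g₁ g₂ h := by
    rcases h with h | h | h | h
    · exact thIsId_of_fromPi_left A h.1 f₂ g₁ g₂
    · exact thIsId_of_fromPi_right A f₁ f₂ g₁ h.2
    · exact thIsId_of_fromPi_right A f₁ f₂ g₁ h.2
    · exact thIsId_of_fromPi_left A h.1 f₂ g₁ g₂
  tau_eq m p := (O.el_iota _ (PHom.tau m p)).symm
  tauHat_eq _ _ hf hg := tauHat_of_fromPi A hf hg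

end PseudoCommutative
end ICat

/-- The category of operators of a pseudo-commutative operad is pseudo-commutative. -/
theorem mainTheorem4 {V : Type u} [Category.{v} V] [CartesianMonoidalCategory V]
    [MonoidalClosed V] [HasLimits V] [HasColimits V] [HasColimits (ICat V)]
    (O : ICat.Operad V) (A : O.PseudoCommutative) :
    ∃ P : O.catOp.PseudoCommutative,
      (∀ {X : ICat V} {m n p q : ℕ} (φ : FHom m n) (c : ∀ j, X ⟶ O.obj (φ.deg j))
        (ψ : FHom p q) (d : ∀ k, X ⟶ O.obj (ψ.deg k)),
        lift (O.pt φ c) (O.pt ψ d) ≫ P.smash.map m n p q =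
          ICat.Operad.PseudoCommutative.smashPt O φ c ψ d) ∧
      (∀ {T : V} {m n p q : ℕ} (φ : FHom m n) (c : ∀ j, T ⟶ (O.obj (φ.deg j)).Ob)
        (ψ : FHom p q) (d : ∀ k, T ⟶ (O.obj (ψ.deg k)).Ob),
        P.symm.th (ICat.Operad.PseudoCommutative.ptOb O φ c)
            (ICat.Operad.PseudoCommutative.ptOb O ψ d) = A.symPt φ c ψ d) :=
  ⟨A.catOp, fun φ c ψ d => ICat.lift_pt_smashMap φ c ψ d,
    fun φ c ψ d => ICat.tauHat_ptOb A φ c ψ d⟩
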